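/- Let $F_3,F_6\in\mathbb{C}[X_1,X_2]$ be homogeneous of degrees $3$ and $6$ such that $F_3F_6$ has no multiple roots (that is, $F_3F_6$ is squarefree), and put $F=X_0^3F_3(X_1,X_2)+F_6(X_1,X_2)$, $p=[1:0:0]\in\mathbb{P}^2$. Let $Q=\mathrm{Bl}_p\mathbb{P}^2$ with exceptional divisor $E_p$, let $K\subset Q$ be the strict transform of the sextic curve $Z(F)\subset\mathbb{P}^2$, let $R=\mathrm{Bl}_{K\cap E_p}Q$, and let $\widehat K,\widehat E_p\subset R$ be the strict transforms of $K$ and $E_p$. Let $W_F$ be the normalization of $R$ in the function field $\mathbb{C}(\mathbb{P}^2)\bigl(\sqrt{F/X_0^6}\bigr)$ of the double plane $S^2=F(X_0,X_1,X_2)$. Then: 1. $W_F\to R$ is a double cover with branch locus $\widehat K\cup\widehat E_p$. 2. There is exactly one morphism $\pi_F\colon W_F\to P=\mathbb{P}^1$ that extends the composition of $W_F\to R\to Q\to\mathbb{P}^2$ with the rational map $\mathbb{P}^2\dashrightarrow P$, $[X_0:X_1:X_2]\mapsto[X_1:X_2]$. 3. $\pi_F$ is an elliptic fibration: $W_F$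 is an integral proper smooth surface over $\mathbb{C}$, $\pi_F$ is surjective, and its fibers over the closed points of some nonempty open subset of $P$ are elliptic curves. Every smooth fiber over a closed point is an elliptic curve with $j$-invariant $0$; in particular $\pi_F$ is isotrivial, i.e. any two smooth fibers over closed points are isomorphic. 4. The discriminant set of $\pi_F$, i.e. the set of points of $P$ over which the scheme-theoretic fiber is not smooth, is $Z(F_3F_6)\subset P$. 5. The fibers over the points of $Z(F_3)$ are of Kodaira type IV: as schemes they are unions of three smooth rational curves meeting at one point, isomorphic to the three concurrent lines $XY(X+Y)=0$ in $\mathbb{P}^2$. The fibers over the points of $Z(F_6)$ are of Kodaira type II: as schemes they are isomorphic to the cuspidal plane cubic $Y^2Z=X^3$. -/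

import Mathlib

open AlgebraicGeometry CategoryTheory Limits TopologicalSpace

namespace PlaneSextic

noncomputable section

section Blowup

open Polynomial HomogeneousLocalization Scheme.AffineZariskiSite

/-- The degree-`n` part `Iⁿ tⁿ` of the Rees algebra `⨁ₙ Iⁿ tⁿ ⊆ A[t]` of an ideal `I`. -/
def reesGrading {A : Type} [CommRing A] (I : Ideal A) (n : ℕ) : Submodule A (reesAlgebra I) :=
  (LinearMap.range (monomial n : A →ₗ[A] A[X])).comap (reesAlgebra I).val.toLinearMap

namespace reesGrading

variable {A : Type} [CommRing A] (I : Ideal A)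

/-- The element `a tⁿ` of the Rees algebra. -/
def elt (n : ℕ) (a : A) (ha : a ∈ I ^ n) : reesAlgebra I :=
  ⟨monomial n a, reesAlgebra.monomial_mem.mpr ha⟩

lemma elt_mem (n : ℕ) (a : A) (ha : a ∈ I ^ n) : elt I n a ha ∈ reesGrading I n := ⟨a, rfl⟩

variable {I} in
lemma exists_elt {n : ℕ} {s : reesAlgebra I} (hs : s ∈ reesGrading I n) :
    ∃ a ha, s = elt I n a ha := by
  obtain ⟨a, ha⟩ := hs
  change monomial n a = (s : A[X]) at ha
  have : a ∈ I ^ n := by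
    have := s.2 n
    rwa [← ha, coeff_monomial_same] at this
  exact ⟨a, this, Subtype.ext ha.symm⟩

/-- The projection to the degree-`n` part. -/
def comp (n : ℕ) : reesAlgebra I →ₗ[A] reesGrading I n where
  toFun s := ⟨elt I n (s.1.coeff n) (s.2 n), elt_mem ..⟩
  map_add' x y := by
    apply Subtype.ext; apply Subtype.ext
    simp [elt]
  map_smul' x y := by
    apply Subtype.ext; apply Subtype.ext
    simp [elt, smul_monomial]

lemma comp_of_mem {n m : ℕ} (s : reesGrading I n) :
    comp I m s = if h : n = m then h ▸ s else 0 := by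
  obtain ⟨s, hs⟩ := s
  obtain ⟨a, ha, rfl⟩ := exists_elt hs
  split_ifs with h
  · subst h
    apply Subtype.ext; apply Subtype.ext
    simp [comp, elt]
  · apply Subtype.ext; apply Subtype.ext
    simp [comp, elt, coeff_monomial, h]

instance : SetLike.GradedMonoid (reesGrading I) where
  one_mem := ⟨1, by simp⟩
  mul_mem := by
    rintro i j x y hx hy
    obtain ⟨a, ha, rfl⟩ := exists_elt hx
    obtain ⟨b, hb, rfl⟩ := exists_elt hy
    exact ⟨a * b, (monomial_mul_monomial i j a b).symm⟩

/-- The decomposition into homogeneous components. -/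
def decomposeAux (s : reesAlgebra I) : DirectSum ℕ fun i ↦ reesGrading I i :=
  DirectSum.mk (fun i ↦ reesGrading I i) s.1.support fun i ↦ comp I i s

lemma decomposeAux_apply (s : reesAlgebra I) (i : ℕ) : decomposeAux I s i = comp I i s := by
  by_cases h : i ∈ s.1.support
  · exact DirectSum.mk_apply_of_mem h
  · rw [decomposeAux, DirectSum.mk_apply_of_notMem h]
    apply Subtype.ext; apply Subtype.ext
    simp [comp, elt, notMem_support_iff.mp h]

instance : DirectSum.Decomposition (reesGrading I) where
  decompose' := decomposeAux I
  left_inv s := by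
    classical
    apply Subtype.ext
    rw [DirectSum.coeAddMonoidHom_eq_dfinsuppSum]
    have : (decomposeAux I s).support ⊆ s.1.support := by
      intro i hi
      rw [DFinsupp.mem_support_iff, decomposeAux_apply] at hi
      rw [mem_support_iff]
      contrapose! hi
      apply Subtype.ext; apply Subtype.ext
      simp [comp, elt, hi]
    rw [DFinsupp.sum, Finset.sum_subset this (by
      intro i _ hi
      simpa using hi)]
    have h2 := s.1.sum_monomial_eq
    rw [Polynomial.sum] at h2
    conv_rhs => rw [← h2]
    rw [← Subalgebra.coe_val, map_sum]
    refine Finset.sum_congr rfl fun i _ ↦ ?_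
    rw [decomposeAux_apply]
    rfl
  right_inv x := by
    induction x using DirectSum.induction_on with
    | zero =>
      ext i : 1
      rw [decomposeAux_apply]; simp
    | of i x =>
      ext j : 1
      rw [decomposeAux_apply, DirectSum.coeAddMonoidHom_of, comp_of_mem]
      split_ifs with h
      · subst h; simp
      · rw [DirectSum.of_eq_of_ne _ _ _ (Ne.symm h)]
    | add x y hx hy =>
      ext j : 1
      rw [decomposeAux_apply, map_add, map_add, ← decomposeAux_apply, ← decomposeAux_apply, hx, hy]
      rfl

instance : GradedAlgebra (reesGrading I) where

end reesGrading

open reesGrading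

variable {A B C : Type} [CommRing A] [CommRing B] [CommRing C]

/-- The graded ring homomorphism of Rees algebras induced by `φ : A → B` with `I B ⊆ J`. -/
def reesMap (φ : A →+* B) (I : Ideal A) (J : Ideal B) (h : I.map φ ≤ J) :
    reesGrading I →+*ᵍ reesGrading J where
  __ := ((mapRingHom φ).comp (reesAlgebra I).val.toRingHom).codRestrict (reesAlgebra J) (by
    intro x i
    have := Ideal.mem_map_of_mem φ (x.2 i)
    rw [Ideal.map_pow] at this
    simpa using Ideal.pow_right_mono h i this)
  map_mem := by
    intro i x hx
    obtain ⟨a, ha, rfl⟩ := exists_elt hx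
    exact ⟨φ a, (map_monomial φ).symm⟩

lemma coe_reesMap (φ : A →+* B) (I : Ideal A) (J : Ideal B) (h : I.map φ ≤ J) (x) :
    (reesMap φ I J h x : B[X]) = (x : A[X]).map φ := rfl

lemma reesMap_irrelevant (φ : A →+* B) (I : Ideal A) (J : Ideal B) (h : I.map φ = J) :
    HomogeneousIdeal.irrelevant (reesGrading J) ≤
      (HomogeneousIdeal.irrelevant (reesGrading I)).map (reesMap φ I J h.le) := by
  subst h
  suffices H : (HomogeneousIdeal.irrelevant (reesGrading (I.map φ))).toIdeal ≤
      Ideal.map (reesMap φ I _ le_rfl) (HomogeneousIdeal.irrelevant (reesGrading I)).toIdeal from H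
  rw [HomogeneousIdeal.toIdeal_irrelevant_le]
  intro i hi x hx
  obtain ⟨b, hb, rfl⟩ := exists_elt hx
  have key : ∀ b (hb' : b ∈ Ideal.map φ (I ^ i)) (hb : b ∈ (I.map φ) ^ i),
      elt (I.map φ) i b hb ∈
        Ideal.map (reesMap φ I _ le_rfl) (HomogeneousIdeal.irrelevant (reesGrading I)).toIdeal := by
    intro b hb'
    induction hb' using Submodule.span_induction with
    | mem x hx =>
      obtain ⟨a, ha, rfl⟩ := hx
      intro hb
      have : elt (I.map φ) i (φ a) hb = reesMap φ I _ le_rfl (elt I i a ha) :=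
        Subtype.ext (map_monomial φ).symm
      rw [this]
      exact Ideal.mem_map_of_mem _ (HomogeneousIdeal.mem_irrelevant_of_mem _ hi (elt_mem ..))
    | zero =>
      intro hb
      have : elt (I.map φ) i 0 hb = 0 := Subtype.ext (by simp [elt])
      rw [this]; exact zero_mem _
    | add x y hx hy h1 h2 =>
      intro hb
      have : elt (I.map φ) i (x + y) hb = elt _ i x (by rw [← Ideal.map_pow]; exact hx) +
        elt _ i y (by rw [← Ideal.map_pow]; exact hy) := Subtype.ext (by simp [elt])
      rw [this]; exact add_mem (h1 _) (h2 _)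
    | smul c x hx h1 =>
      intro hb
      have : elt (I.map φ) i (c • x) hb = algebraMap B (reesAlgebra (I.map φ)) c *
        elt _ i x (by rw [← Ideal.map_pow]; exact hx) := Subtype.ext (by
          simp [elt, C_mul_monomial])
      rw [this]; exact Ideal.mul_mem_left _ _ (h1 _)
  exact key b (by rwa [Ideal.map_pow]) hb

/-- The blow-up of `Spec A` along `I`: the structure morphism `Proj (⨁ₙ Iⁿ) ⟶ Spec A`. -/
def reesProjToSpec (I : Ideal A) : Proj (reesGrading I) ⟶ Spec (.of A) :=
  Proj.toSpecZero (reesGrading I) ≫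
    Spec.map (CommRingCat.ofHom (algebraMap A (reesGrading I 0)))

/-- The structure homomorphism of a chart of `Proj` of the Rees algebra. -/
def chartHom (I : Ideal A) (s : reesAlgebra I) : A →+* Away (reesGrading I) s :=
  (fromZeroRingHom (reesGrading I) (.powers s)).comp (algebraMap A (reesGrading I 0))

lemma val_chartHom (I : Ideal A) (s : reesAlgebra I) (a : A) :
    (chartHom I s a).val = Localization.mk (algebraMap A (reesAlgebra I) a) 1 := rfl

lemma awayMap_chartHom (φ : A →+* B) (I : Ideal A) (J : Ideal B) (h : I.map φ ≤ J)
    (s : reesAlgebra I) (a : A) :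
    Away.map (reesMap φ I J h) s (chartHom I s a) = chartHom J (reesMap φ I J h s) (φ a) := by
  ext
  rw [val_chartHom]
  change Localization.mk (reesMap φ I J h (algebraMap A (reesAlgebra I) a))
    (⟨reesMap φ I J h 1, _⟩ : Submonoid.powers (reesMap φ I J h s)) = _
  congr 1
  · apply Subtype.ext
    change Polynomial.map φ (algebraMap A A[X] a) = algebraMap B B[X] (φ a)
    simp
  · apply Subtype.ext
    exact map_one (reesMap φ I J h)

lemma chartHom_mul_mk (I : Ideal A) {i : ℕ} {s : reesAlgebra I} (hs : s ∈ reesGrading I i)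
    (a : A) (n : ℕ) (x hx) :
    chartHom I s a * Away.mk (reesGrading I) hs n x hx =
    Away.mk (reesGrading I) hs n (a • x) (Submodule.smul_mem _ _ hx) := by
  ext
  rw [val_mul, val_chartHom, Away.val_mk, Away.val_mk, Localization.mk_mul, one_mul,
    Algebra.smul_def]

lemma isLocalization_away_of {R S : Type} [CommRing R] [CommRing S] (g : R →+* S) (t : R)
    (h1 : IsUnit (g t)) (h2 : ∀ z, ∃ (n : ℕ) (x : R), g (t ^ n) * z = g x)
    (h3 : ∀ x, g x = 0 → ∃ n : ℕ, t ^ n * x = 0) :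
    let := g.toAlgebra; IsLocalization.Away t S := by
  let := g.toAlgebra
  refine (isLocalization_iff (.powers t) _).mpr ⟨?_, ?_, ?_⟩
  · rintro ⟨_, n, rfl⟩
    change IsUnit (g (t ^ n))
    rw [map_pow]
    exact h1.pow n
  · intro z
    obtain ⟨n, x, h⟩ := h2 z
    exact ⟨⟨x, ⟨t ^ n, n, rfl⟩⟩, (mul_comm _ _).trans h⟩
  · intro x y hxy
    obtain ⟨n, hn⟩ := h3 (x - y) (by rw [map_sub, sub_eq_zero]; exact hxy)
    exact ⟨⟨t ^ n, n, rfl⟩, by rwa [mul_sub, sub_eq_zero] at hn⟩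

lemma isLocalization_away_rees (f : A) [Algebra A B] [IsLocalization.Away f B]
    (I : Ideal A) (J : Ideal B) (h : I.map (algebraMap A B) = J)
    {i : ℕ} (s : reesAlgebra I) (hs : s ∈ reesGrading I i) :
    let := (Away.map (reesMap (algebraMap A B) I J h.le) s).toAlgebra
    IsLocalization.Away (chartHom I s f)
      (Away (reesGrading J) (reesMap (algebraMap A B) I J h.le s)) := by
  subst h
  set ψ := reesMap (algebraMap A B) I _ le_rfl with hψ
  have hψs : ψ s ∈ reesGrading (I.map (algebraMap A B)) i := ψ.2 hs
  have hch : ∀ a, Away.map ψ s (chartHom I s a) = chartHom _ (ψ s) (algebraMap A B a) :=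
    awayMap_chartHom _ _ _ _ s
  have htp : ∀ n : ℕ, chartHom I s f ^ n = chartHom I s (f ^ n) := fun n ↦
    ((chartHom I s).map_pow f n).symm
  refine isLocalization_away_of _ _ ?_ ?_ ?_
  · rw [hch]
    exact (IsLocalization.Away.algebraMap_isUnit f).map _
  · intro z
    obtain ⟨n, x, hx, rfl⟩ := Away.mk_surjective _ hψs z
    obtain ⟨b, hb, rfl⟩ := exists_elt hx
    have hb' := hb
    rw [← Ideal.map_pow, IsLocalization.mem_map_algebraMap_iff (.powers f)] at hb'
    obtain ⟨⟨⟨a, ha⟩, ⟨_, m, rfl⟩⟩, hab⟩ := hb'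
    refine ⟨m, Away.mk _ hs n (elt I _ a ha) (elt_mem ..), ?_⟩
    rw [htp, hch, chartHom_mul_mk, Away.map_mk]
    congr 1
    apply Subtype.ext
    change algebraMap A B (f ^ m) • monomial (n • i) b =
      Polynomial.map (algebraMap A B) (monomial (n • i) a)
    have hab' : algebraMap A B (f ^ m) • b = algebraMap A B a := (mul_comm _ _).trans hab
    rw [map_monomial, smul_monomial, hab']
  · intro x hx
    obtain ⟨n, x, hx', rfl⟩ := Away.mk_surjective _ hs x
    rw [Away.map_mk, HomogeneousLocalization.ext_iff_val, Away.val_mk, val_zero,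
      Localization.mk_eq_mk', IsLocalization.mk'_eq_zero_iff] at hx
    obtain ⟨⟨_, m, rfl⟩, hm⟩ := hx
    have hmem : s ^ m * x ∈ reesGrading I (m • i + n • i) :=
      SetLike.mul_mem_graded (SetLike.pow_mem_graded _ hs) hx'
    obtain ⟨c, hc, hcx⟩ := exists_elt hmem
    change ψ s ^ m * ψ x = 0 at hm
    rw [← map_pow, ← map_mul, hcx] at hm
    have hc0 : algebraMap A B c = algebraMap A B 0 := by
      have := congrArg Subtype.val hm
      change Polynomial.map (algebraMap A B) (monomial _ c) = 0 at this
      rwa [map_monomial, monomial_eq_zero_iff, ← map_zero (algebraMap A B)] at this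
    rw [IsLocalization.eq_iff_exists (.powers f)] at hc0
    obtain ⟨⟨_, k, rfl⟩, hk⟩ := hc0
    refine ⟨k, ?_⟩
    rw [htp, chartHom_mul_mk, HomogeneousLocalization.ext_iff_val, Away.val_mk, val_zero,
      Localization.mk_eq_mk', IsLocalization.mk'_eq_zero_iff]
    refine ⟨⟨s ^ m, m, rfl⟩, ?_⟩
    change s ^ m * _ = 0
    rw [mul_smul_comm, hcx]
    apply Subtype.ext
    change f ^ k • monomial _ c = 0
    have hk' : f ^ k • c = 0 := by simpa using hk
    rw [smul_monomial, hk', map_zero]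

lemma awayι_reesProjToSpec (I : Ideal A) {i : ℕ} (hi : 0 < i) (s : reesAlgebra I)
    (hs : s ∈ reesGrading I i) :
    Proj.awayι (reesGrading I) s hs hi ≫ reesProjToSpec I =
      Spec.map (CommRingCat.ofHom (chartHom I s)) := by
  rw [reesProjToSpec, Proj.awayι_toSpecZero_assoc, ← Spec.map_comp, ← CommRingCat.ofHom_comp]
  rfl

/-- The morphism of blow-ups induced by `φ : A → B` with `I B = J`. -/
def reesProjMap (φ : A →+* B) (I : Ideal A) (J : Ideal B) (h : I.map φ = J) :
    Proj (reesGrading J) ⟶ Proj (reesGrading I) :=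
  Proj.map (reesMap φ I J h.le) (reesMap_irrelevant φ I J h)

lemma awayι_reesProjMap (φ : A →+* B) (I : Ideal A) (J : Ideal B) (h : I.map φ = J)
    {i : ℕ} (hi : 0 < i) (s : reesAlgebra I) (hs : s ∈ reesGrading I i) :
    Proj.awayι (reesGrading J) (reesMap φ I J h.le s) ((reesMap φ I J h.le).2 hs) hi ≫
      reesProjMap φ I J h =
    Spec.map (CommRingCat.ofHom (Away.map (reesMap φ I J h.le) s)) ≫
      Proj.awayι (reesGrading I) s hs hi :=
  Proj.awayι_comp_map _ _ hi s hs

lemma spec_chartHom_comp (φ : A →+* B) (I : Ideal A) (J : Ideal B) (h : I.map φ = J)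
    (s : reesAlgebra I) :
    (Away.map (reesMap φ I J h.le) s).comp (chartHom I s) =
      (chartHom J (reesMap φ I J h.le s)).comp φ :=
  RingHom.ext fun _ ↦ awayMap_chartHom _ _ _ _ _ _

lemma awayι_reesProjMap_toSpec (φ : A →+* B) (I : Ideal A) (J : Ideal B) (h : I.map φ = J)
    {i : ℕ} (hi : 0 < i) (s : reesAlgebra I) (hs : s ∈ reesGrading I i) :
    Proj.awayι (reesGrading J) (reesMap φ I J h.le s) ((reesMap φ I J h.le).2 hs) hi ≫
      reesProjMap φ I J h ≫ reesProjToSpec I =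
    Proj.awayι (reesGrading J) (reesMap φ I J h.le s) ((reesMap φ I J h.le).2 hs) hi ≫
      reesProjToSpec J ≫ Spec.map (CommRingCat.ofHom φ) := by
  rw [← Category.assoc, awayι_reesProjMap φ I J h hi s hs, Category.assoc,
    awayι_reesProjToSpec I hi s hs, ← Category.assoc,
    awayι_reesProjToSpec J hi (reesMap φ I J h.le s) ((reesMap φ I J h.le).2 hs),
    ← Spec.map_comp, ← Spec.map_comp, ← CommRingCat.ofHom_comp,
    ← CommRingCat.ofHom_comp, spec_chartHom_comp φ I J h]

lemma reesProjMap_toSpec (φ : A →+* B) (I : Ideal A) (J : Ideal B) (h : I.map φ = J) :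
    reesProjMap φ I J h ≫ reesProjToSpec I =
      reesProjToSpec J ≫ Spec.map (CommRingCat.ofHom φ) :=
  (Proj.mapAffineOpenCover _ (reesMap_irrelevant φ I J h)).openCover.hom_ext _ _ fun s ↦
    awayι_reesProjMap_toSpec φ I J h s.1.2 s.2.1 s.2.2

lemma reesProjMap_id (I : Ideal A) (h : I.map (RingHom.id A) = I) :
    reesProjMap (RingHom.id A) I I h = 𝟙 _ := by
  have : reesMap (RingHom.id A) I I h.le = .id _ := by
    ext x : 1
    apply Subtype.ext
    exact Polynomial.map_id
  rw [reesProjMap]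
  simp only [this]
  exact Proj.map_id

lemma reesProjMap_comp (φ : A →+* B) (ψ : B →+* C) (I : Ideal A) (J : Ideal B) (K : Ideal C)
    (h : I.map φ = J) (h' : J.map ψ = K) (h'' : I.map (ψ.comp φ) = K) :
    reesProjMap (ψ.comp φ) I K h'' = reesProjMap ψ J K h' ≫ reesProjMap φ I J h := by
  have : reesMap (ψ.comp φ) I K h''.le = (reesMap ψ J K h'.le).comp (reesMap φ I J h.le) := by
    ext x : 1
    apply Subtype.ext
    exact (Polynomial.map_map _ _ _).symm
  simp only [reesProjMap, this]
  exact Proj.map_comp _ _ _ _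

lemma isPullback_specMap_of_isLocalization {R S A B : Type} [CommRing R] [CommRing S] [CommRing A]
    [CommRing B] (φ : R →+* S) (c : R →+* A) (ψ : A →+* B) (d : S →+* B) (f : R)
    (hcomm : ψ.comp c = d.comp φ)
    (hφ : let := φ.toAlgebra; IsLocalization.Away f S)
    (hψ : let := ψ.toAlgebra; IsLocalization.Away (c f) B) :
    IsPullback (Spec.map (CommRingCat.ofHom ψ)) (Spec.map (CommRingCat.ofHom d))
      (Spec.map (CommRingCat.ofHom c)) (Spec.map (CommRingCat.ofHom φ)) := by
  let := φ.toAlgebra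
  let := ψ.toAlgebra
  have : IsLocalization.Away f S := hφ
  have : IsLocalization ((Submonoid.powers f).map c) B := by
    rw [Submonoid.map_powers]
    exact hψ
  exact isPullback_SpecMap_of_isPushout _ _ _ _
    (CommRingCat.isPushout_of_isLocalization c d hcomm.symm (.powers f))

lemma isPullback_awayι_reesProjMap (φ : A →+* B) (I : Ideal A) (J : Ideal B) (h : I.map φ = J)
    {i : ℕ} (hi : 0 < i) (s : reesAlgebra I) (hs : s ∈ reesGrading I i) :
    IsPullback
      (Spec.map (CommRingCat.ofHom (Away.map (reesMap φ I J h.le) s)))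
      (Proj.awayι (reesGrading J) (reesMap φ I J h.le s) ((reesMap φ I J h.le).2 hs) hi)
      (Proj.awayι (reesGrading I) s hs hi) (reesProjMap φ I J h) := by
  refine IsOpenImmersion.isPullback _ _ _ _ (awayι_reesProjMap ..) ?_
  rw [Proj.opensRange_awayι, Proj.opensRange_awayι]
  rfl

lemma isPullback_chart_rees (f : A) (φ : A →+* B)
    (hφ : let := φ.toAlgebra; IsLocalization.Away f B)
    (I : Ideal A) (J : Ideal B) (h : I.map φ = J)
    {i : ℕ} (hi : 0 < i) (s : reesAlgebra I) (hs : s ∈ reesGrading I i) :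
    IsPullback (pullback.snd (reesProjMap φ I J h) (Proj.awayι (reesGrading I) s hs hi))
      (pullback.fst (reesProjMap φ I J h) (Proj.awayι (reesGrading I) s hs hi) ≫ reesProjToSpec J)
      (Proj.awayι (reesGrading I) s hs hi ≫ reesProjToSpec I)
      (Spec.map (CommRingCat.ofHom φ)) := by
  have sq1 := isPullback_awayι_reesProjMap φ I J h hi s hs
  have sq2 := isPullback_specMap_of_isLocalization φ (chartHom I s)
    (Away.map (reesMap φ I J h.le) s) (chartHom J _) f
    (spec_chartHom_comp φ I J h s) hφ (by
      let := φ.toAlgebra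
      have := hφ
      exact isLocalization_away_rees f I J h s hs)
  refine sq2.of_iso (sq1.flip.isoPullback) (Iso.refl _) (Iso.refl _) (Iso.refl _) ?_ ?_ ?_ ?_
  · rw [Iso.refl_hom, Category.comp_id]
    exact (IsPullback.isoPullback_hom_snd sq1.flip).symm
  · rw [Iso.refl_hom, Category.comp_id, ← awayι_reesProjToSpec J hi _ ((reesMap φ I J h.le).2 hs)]
    exact ((IsPullback.isoPullback_hom_fst_assoc sq1.flip _)).symm
  · rw [Iso.refl_hom, Category.comp_id, Iso.refl_hom, Category.id_comp,
      ← awayι_reesProjToSpec I hi _ hs]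
  · simp

lemma isPullback_reesProjMap (f : A) (φ : A →+* B)
    (hφ : let := φ.toAlgebra; IsLocalization.Away f B)
    (I : Ideal A) (J : Ideal B) (h : I.map φ = J) :
    IsPullback (reesProjMap φ I J h) (reesProjToSpec J) (reesProjToSpec I)
      (Spec.map (CommRingCat.ofHom φ)) :=
  Scheme.isPullback_of_openCover _ _ _ _ (Proj.affineOpenCover (reesGrading I)).openCover
    fun s ↦ isPullback_chart_rees f φ hφ I J h s.1.2 s.2.1 s.2.2

/-- Restriction of functions from an affine open to a smaller one. -/
def resHom {X : Scheme.{0}} {U V : X.AffineZariskiSite} (i : U ⟶ V) :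
    Γ(X, V.toOpens) →+* Γ(X, U.toOpens) :=
  (X.presheaf.map (homOfLE (toOpens_mono i.le)).op).hom

/-- The ideal of sections of an ideal sheaf over an affine open. -/
def idealAt {X : Scheme.{0}} (I : X.IdealSheafData) (U : X.AffineZariskiSite) :
    Ideal Γ(X, U.toOpens) :=
  I.ideal ⟨U.1, U.2⟩

lemma map_idealAt {X : Scheme.{0}} (I : X.IdealSheafData) {U V : X.AffineZariskiSite} (i : U ⟶ V) :
    (idealAt I V).map (resHom i) = idealAt I U :=
  I.map_ideal (U := ⟨U.1, U.2⟩) (V := ⟨V.1, V.2⟩) (toOpens_mono i.le)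

lemma reesProjMap_congr {A B : Type} [CommRing A] [CommRing B] {φ φ' : A →+* B} (e : φ = φ')
    (I : Ideal A) (J : Ideal B)
    (h : I.map φ = J) (h' : I.map φ' = J) : reesProjMap φ I J h = reesProjMap φ' I J h' := by
  subst e; rfl

/-- The blow-ups of the affine opens `U` of `X` along `I(U)`. -/
def blowupFunctor (X : Scheme.{0}) (I : X.IdealSheafData) : X.AffineZariskiSite ⥤ Scheme.{0} where
  obj U := Proj (reesGrading (idealAt I U))
  map {U V} i := reesProjMap (resHom i) (idealAt I V) (idealAt I U) (map_idealAt I i)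
  map_id U := by
    refine (reesProjMap_congr ?_ _ _ _ (Ideal.map_id _)).trans
      (reesProjMap_id (idealAt I U) (Ideal.map_id _))
    exact congrArg CommRingCat.Hom.hom (X.presheaf.map_id _)
  map_comp {U V W} i j := by
    refine (reesProjMap_congr ?_ _ _ _ ?_).trans
      (reesProjMap_comp _ _ _ _ _ (map_idealAt I j) (map_idealAt I i) ?_)
    · exact congrArg CommRingCat.Hom.hom (X.presheaf.map_comp
        (homOfLE (toOpens_mono j.le)).op (homOfLE (toOpens_mono i.le)).op)
    all_goals rw [← Ideal.map_map, map_idealAt, map_idealAt]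

/-- The structure morphisms of the blow-ups of the affine opens. -/
def blowupFunctorToSpec (X : Scheme.{0}) (I : X.IdealSheafData) :
    blowupFunctor X I ⟶ toOpensFunctor X ⋙ X.presheaf.rightOp ⋙ Scheme.Spec where
  app U := reesProjToSpec (idealAt I U)
  naturality _ _ i := reesProjMap_toSpec (resHom i) _ _ (map_idealAt I i)

lemma equifibered_blowupFunctorToSpec (X : Scheme.{0}) (I : X.IdealSheafData) :
    (blowupFunctorToSpec X I).Equifibered := by
  rintro U V i
  obtain ⟨f, hf⟩ := i.le
  obtain rfl : V.basicOpen f = U := Subtype.ext hf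
  exact isPullback_reesProjMap f (resHom i) (V.2.isLocalization_basicOpen f) _ _ (map_idealAt I i)

/-- The blow-ups of the affine opens of `X`, with the data that glue them over `X`. -/
def blowupGluingData (X : Scheme.{0}) (I : X.IdealSheafData) :
    (directedCover X).RelativeGluingData where
  functor := blowupFunctor X I
  natTrans := blowupFunctorToSpec X I ≫ (restrictIsoSpec X).inv
  equifibered := (equifibered_blowupFunctorToSpec X I).comp (.of_isIso (restrictIsoSpec X).inv)

/-- The blow-up of a scheme `X` along an ideal sheaf `I`, the relative `Proj` of `⨁ₙ Iⁿ`. -/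
def blowup (X : Scheme.{0}) (I : X.IdealSheafData) : Scheme.{0} :=
  (blowupGluingData X I).glued

/-- The blow-down morphism. -/
def blowupMap (X : Scheme.{0}) (I : X.IdealSheafData) : blowup X I ⟶ X :=
  (blowupGluingData X I).toBase

/-- The blow-up of `X` along a closed subset with its reduced structure. -/
abbrev Bl (X : Scheme.{0}) (Z : Closeds X) : Scheme.{0} :=
  blowup X (.vanishingIdeal Z)

/-- The blow-down morphism of `Bl X Z`. -/
abbrev Bl.map (X : Scheme.{0}) (Z : Closeds X) : Bl X Z ⟶ X :=
  blowupMap X (.vanishingIdeal Z)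

/-- The exceptional set, the preimage of the center. -/
def Bl.exceptional (X : Scheme.{0}) (Z : Closeds X) : Closeds (Bl X Z) :=
  Z.preimage (Bl.map X Z).continuous

/-- The strict transform of a closed subset `C`: the closure of the preimage of `C \ Z`. -/
def Bl.strictTransform (X : Scheme.{0}) (Z C : Closeds X) : Closeds (Bl X Z) :=
  .closure (Bl.map X Z ⁻¹' (C \ Z))

end Blowup

section QuotientGrading

variable {A : Type} [CommRing A] [Algebra ℂ A] {𝒜 : ℕ → Submodule ℂ A} [GradedAlgebra 𝒜]

/-- The grading induced on the quotient by a homogeneous ideal. -/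
def quotientGrading (I : HomogeneousIdeal 𝒜) (n : ℕ) : Submodule ℂ (A ⧸ I.toIdeal) :=
  (𝒜 n).map (Ideal.Quotient.mkₐ ℂ I.toIdeal).toLinearMap

namespace quotientGrading

variable (I : HomogeneousIdeal 𝒜)

/-- The projection of degree-`n` parts. -/
def mk (n : ℕ) : 𝒜 n →+ quotientGrading I n where
  toFun a := ⟨Ideal.Quotient.mk I.toIdeal a, a, a.2, rfl⟩
  map_zero' := Subtype.ext (map_zero _)
  map_add' a b := Subtype.ext (map_add (Ideal.Quotient.mk I.toIdeal) (a : A) b)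

lemma mk_surjective (n : ℕ) : Function.Surjective (mk I n) := by
  rintro ⟨_, a, ha, rfl⟩
  exact ⟨⟨a, ha⟩, rfl⟩

instance : SetLike.GradedMonoid (quotientGrading I) where
  one_mem := ⟨1, SetLike.one_mem_graded 𝒜, map_one (Ideal.Quotient.mk I.toIdeal)⟩
  mul_mem := by
    rintro i j _ _ ⟨a, ha, rfl⟩ ⟨b, hb, rfl⟩
    exact ⟨a * b, SetLike.mul_mem_graded ha hb, map_mul (Ideal.Quotient.mk I.toIdeal) a b⟩

/-- The decomposition map of the quotient. -/
def decomposeHom : A ⧸ I.toIdeal →+ DirectSum ℕ fun i ↦ quotientGrading I i :=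
  QuotientAddGroup.lift _
    ((DirectSum.map (mk I)).comp (DirectSum.decomposeAddEquiv 𝒜).toAddMonoidHom) (by
      intro a ha
      refine DFinsupp.ext fun i ↦ Subtype.ext ?_
      exact Ideal.Quotient.eq_zero_iff_mem.mpr (I.isHomogeneous i ha))

lemma decomposeHom_mk {n : ℕ} (a : 𝒜 n) :
    decomposeHom I (Ideal.Quotient.mk I.toIdeal a) = DirectSum.of _ n (mk I n a) := by
  change DirectSum.map (mk I) (DirectSum.decompose 𝒜 (a : A)) = _
  rw [DirectSum.decompose_coe, DirectSum.map_of]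

instance : DirectSum.Decomposition (quotientGrading I) := by
  classical
  refine .ofAddHom _ (decomposeHom I) ?_ ?_
  · refine AddMonoidHom.ext fun x ↦ ?_
    obtain ⟨x, rfl⟩ := Ideal.Quotient.mk_surjective x
    induction x using DirectSum.Decomposition.inductionOn 𝒜 with
    | zero => simp
    | homogeneous a =>
      rw [AddMonoidHom.comp_apply, decomposeHom_mk, DirectSum.coeAddMonoidHom_of]
      rfl
    | add a b ha hb => rw [map_add, map_add, ha, hb, map_add]
  · refine DirectSum.addHom_ext fun n x ↦ ?_
    obtain ⟨a, rfl⟩ := mk_surjective I n x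
    rw [AddMonoidHom.comp_apply, DirectSum.coeAddMonoidHom_of]
    exact decomposeHom_mk I a

instance : GradedAlgebra (quotientGrading I) where

end quotientGrading
end QuotientGrading

section Geometry

attribute [local instance] MvPolynomial.gradedAlgebra

open MvPolynomial

/-- The structure morphism to `Spec ℂ` of `Proj` of a graded `ℂ`-algebra. -/
def projToSpecC {A : Type} [CommRing A] [Algebra ℂ A] (𝒜 : ℕ → Submodule ℂ A) [GradedAlgebra 𝒜] :
    Proj 𝒜 ⟶ Spec (.of ℂ) :=
  Proj.toSpecZero 𝒜 ≫ Spec.map (CommRingCat.ofHom (algebraMap ℂ (𝒜 0)))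

instance {A : Type} [CommRing A] [Algebra ℂ A] (𝒜 : ℕ → Submodule ℂ A) [GradedAlgebra 𝒜] :
    IsSeparated (projToSpecC 𝒜) :=
  inferInstanceAs (IsSeparated (_ ≫ _))

/-- The grading by degree of `ℂ[X₀, …, Xₙ]`. -/
abbrev coordGrading (n : ℕ) : ℕ → Submodule ℂ (MvPolynomial (Fin (n + 1)) ℂ) :=
  homogeneousSubmodule (Fin (n + 1)) ℂ

/-- Projective space of dimension `n` over `ℂ`. -/
abbrev PP (n : ℕ) : Scheme.{0} := Proj (coordGrading n)

lemma quasiCompact_toPP {n : ℕ} {X : Scheme.{0}} [IsAffine X] (f : X ⟶ PP n) : QuasiCompact f :=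
  .of_comp f (projToSpecC (coordGrading n))

lemma quasiSeparated_toPP {n : ℕ} {X : Scheme.{0}} [IsAffine X] (f : X ⟶ PP n) :
    QuasiSeparated f :=
  .of_comp f (projToSpecC (coordGrading n))

/-- The closed subset of projective space cut out by a (homogeneous) polynomial. -/
def zeroSet {n : ℕ} (f : MvPolynomial (Fin (n + 1)) ℂ) : Closeds (PP n) :=
  (Proj.basicOpen (coordGrading n) f).compl

/-! ### Plane curves as schemes -/

/-- The homogeneous ideal generated by a homogeneous polynomial. -/
def principalIdeal {d : ℕ} (f : MvPolynomial (Fin 3) ℂ) (hf : f.IsHomogeneous d) :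
    HomogeneousIdeal (coordGrading 2) where
  toSubmodule := Ideal.span {f}
  is_homogeneous' := Ideal.homogeneous_span _ _ (by
    rintro _ rfl
    exact ⟨d, hf⟩)

/-- The projective plane curve `f = 0`, i.e. the scheme `Proj (ℂ[X, Y, Z] / (f))`. -/
def planeCurve {d : ℕ} (f : MvPolynomial (Fin 3) ℂ) (hf : f.IsHomogeneous d) : Scheme.{0} :=
  Proj (quotientGrading (principalIdeal f hf))

/-- The structure morphism of a plane curve. -/
def planeCurve.toSpecC {d : ℕ} (f : MvPolynomial (Fin 3) ℂ) (hf : f.IsHomogeneous d) :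
    planeCurve f hf ⟶ Spec (.of ℂ) :=
  projToSpecC (quotientGrading (principalIdeal f hf))

/-- Two schemes over `S` are isomorphic over `S`. -/
def IsoOver {X Y S : Scheme.{0}} (f : X ⟶ S) (g : Y ⟶ S) : Prop :=
  ∃ e : X ≅ Y, e.hom ≫ g = f

lemma isHomogeneous_weierstrass (E : WeierstrassCurve ℂ) :
    E.toProjective.polynomial.IsHomogeneous 3 := by
  have hX (i : Fin 3) : (X i : MvPolynomial (Fin 3) ℂ).IsHomogeneous 1 := isHomogeneous_X _ _
  have h0 (a : ℂ) : (C a : MvPolynomial (Fin 3) ℂ).IsHomogeneous 0 := isHomogeneous_C _ _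
  rw [WeierstrassCurve.Projective.polynomial]
  refine .sub (.add (.add ?_ ?_) ?_) (.add (.add (.add ?_ ?_) ?_) ?_)
  · exact ((hX 1).pow 2).mul (hX 2)
  · exact (((h0 _).mul (hX 0)).mul (hX 1)).mul (hX 2)
  · exact ((h0 _).mul (hX 1)).mul ((hX 2).pow 2)
  · exact (hX 0).pow 3
  · exact ((h0 _).mul ((hX 0).pow 2)).mul (hX 2)
  · exact ((h0 _).mul (hX 0)).mul ((hX 2).pow 2)
  · exact (h0 _).mul ((hX 2).pow 3)

/-- A `ℂ`-scheme is an elliptic curve: it is isomorphic to a nonsingular Weierstrass cubic. -/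
def IsEllipticCurve {X : Scheme.{0}} (f : X ⟶ Spec (.of ℂ)) : Prop :=
  ∃ E : WeierstrassCurve ℂ, E.IsElliptic ∧
    IsoOver f (planeCurve.toSpecC _ (isHomogeneous_weierstrass E))

/-- A `ℂ`-scheme is an elliptic curve with the given `j`-invariant. -/
def IsEllipticCurveWithJ (j : ℂ) {X : Scheme.{0}} (f : X ⟶ Spec (.of ℂ)) : Prop :=
  ∃ (E : WeierstrassCurve ℂ) (_ : E.IsElliptic), E.j = j ∧
    IsoOver f (planeCurve.toSpecC _ (isHomogeneous_weierstrass E))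

/-- The cuspidal cubic `Y²Z = X³`. -/
def cuspidalCubic : MvPolynomial (Fin 3) ℂ := X 1 ^ 2 * X 2 - X 0 ^ 3

lemma isHomogeneous_cuspidalCubic : cuspidalCubic.IsHomogeneous 3 :=
  (((isHomogeneous_X _ _).pow 2).mul (isHomogeneous_X _ _)).sub ((isHomogeneous_X _ _).pow 3)

/-- The three concurrent lines `XY(X + Y) = 0`. -/
def concurrentLines : MvPolynomial (Fin 3) ℂ := X 0 * X 1 * (X 0 + X 1)

lemma isHomogeneous_concurrentLines : concurrentLines.IsHomogeneous 3 :=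
  ((isHomogeneous_X _ _).mul (isHomogeneous_X _ _)).mul
    ((isHomogeneous_X _ _).add (isHomogeneous_X _ _))

/-- Kodaira type II: the scheme-theoretic fiber is a cuspidal rational curve, which over `ℂ`
means that it is isomorphic to the plane cuspidal cubic. -/
def IsKodairaTypeII {X : Scheme.{0}} (f : X ⟶ Spec (.of ℂ)) : Prop :=
  IsoOver f (planeCurve.toSpecC _ isHomogeneous_cuspidalCubic)

/-- Kodaira type IV: the scheme-theoretic fiber is the reduced union of three smooth rational
curves through one point, meeting pairwise transversally there and nowhere else. Inside a smooth
surface such a fiber is isomorphic to the union of three concurrent lines in the plane (and not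
to three non-coplanar concurrent lines), and conversely. -/
def IsKodairaTypeIV {X : Scheme.{0}} (f : X ⟶ Spec (.of ℂ)) : Prop :=
  IsoOver f (planeCurve.toSpecC _ isHomogeneous_concurrentLines)

/-! ### Fibrations over the projective line -/

section Fibration

variable {W : Scheme.{0}}

/-- A `ℂ`-point of the projective line. -/
def CPoint : Type := { a : Spec (.of ℂ) ⟶ PP 1 // a ≫ projToSpecC (coordGrading 1) = 𝟙 _ }

/-- The `ℂ`-point `a` lies on the closed set `Z`. -/
def CPoint.LiesOn (a : CPoint) (Z : Closeds (PP 1)) : Prop :=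
  a.1 ⁻¹' (Z : Set (PP 1)) = Set.univ

/-- The scheme-theoretic fiber over a `ℂ`-point, as a `ℂ`-scheme. -/
abbrev fiberAt (π : W ⟶ PP 1) (a : CPoint) : pullback π a.1 ⟶ Spec (.of ℂ) :=
  pullback.snd π a.1

/-- `π : W ⟶ ℙ¹` is an elliptic fibration: `W` (with structure morphism `s`) is a smooth complete
surface (integral, proper, smooth of dimension two over `ℂ`), `π` is a surjective
morphism over `ℂ`, and the fibers over the `ℂ`-points of some nonempty open subset of `ℙ¹` are
elliptic curves. (Such a `π` is proper and flat, and all of its fibers are connected.) -/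
structure IsEllipticFibration (s : W ⟶ Spec (.of ℂ)) (π : W ⟶ PP 1) : Prop where
  isIntegral : IsIntegral W
  isProper : IsProper s
  smooth : SmoothOfRelativeDimension 2 s
  comp_eq : π ≫ projToSpecC (coordGrading 1) = s
  surjective : Surjective π
  exists_open : ∃ Z : Closeds (PP 1), Z ≠ ⊤ ∧
    ∀ a : CPoint, ¬ a.LiesOn Z → IsEllipticCurve (fiberAt π a)

/-- All smooth fibers (over `ℂ`-points) are isomorphic to each other. -/
def IsIsotrivial (π : W ⟶ PP 1) : Prop :=
  ∀ a b : CPoint, Smooth (fiberAt π a) → Smooth (fiberAt π b) →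
    IsoOver (fiberAt π a) (fiberAt π b)

/-- The discriminant set: the points of the base with singular fiber. -/
def discriminant (π : W ⟶ PP 1) : Set (PP 1) :=
  { a | ¬ Smooth (π.fiberToSpecResidueField a) }

end Fibration

/-- `c : W ⟶ Y` is a double cover with branch locus `B`: locally on `Y` the algebra of `W` is free
of rank two, and `B` is the set of points of `Y` near which `c` is not étale. -/
structure IsDoubleCover {W Y : Scheme.{0}} (c : W ⟶ Y) (B : Set Y) : Prop where
  isAffineHom : IsAffineHom c
  free_rank_two : ∀ y : Y, ∃ U : Y.Opens, y ∈ U ∧ IsAffineOpen U ∧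
    letI := (c.app U).hom.toAlgebra
    Nonempty (Module.Basis (Fin 2) Γ(Y, U) Γ(W, c ⁻¹ᵁ U))
  branch_eq : { y : Y | ¬ ∃ U : Y.Opens, y ∈ U ∧ Etale (c ∣_ U) } = B

/-! ### The surface attached to a plane sextic `X₀³ F₃(X₁, X₂) + F₆(X₁, X₂)` -/

section Surface

variable (F₃ F₆ : MvPolynomial (Fin 2) ℂ)

/-- The inclusion `ℂ[X₁, X₂] → ℂ[X₀, X₁, X₂]`; the variables of `ℂ[X₁, X₂]` are numbered
`0, 1`. -/
def pencil : coordGrading 1 →+*ᵍ coordGrading 2 where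
  __ := (rename Fin.succ : MvPolynomial (Fin 2) ℂ →ₐ[ℂ] MvPolynomial (Fin 3) ℂ).toRingHom
  map_mem hx := hx.rename_isHomogeneous

/-- The sextic polynomial `F = X₀³ F₃(X₁, X₂) + F₆(X₁, X₂)`. -/
def sextic : MvPolynomial (Fin 3) ℂ := X 0 ^ 3 * pencil F₃ + pencil F₆

lemma isHomogeneous_sextic {F₃ F₆ : MvPolynomial (Fin 2) ℂ} (h₃ : F₃.IsHomogeneous 3)
    (h₆ : F₆.IsHomogeneous 6) : (sextic F₃ F₆).IsHomogeneous 6 :=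
  (((isHomogeneous_X _ _).pow 3).mul h₃.rename_isHomogeneous).add h₆.rename_isHomogeneous

/-- The point `p = [1 : 0 : 0]` of the plane. -/
def p : Closeds (PP 2) := zeroSet (X 1) ⊓ zeroSet (X 2)

/-- The blow-up `Q` of the plane at `p`. -/
abbrev Q : Scheme.{0} := Bl (PP 2) p

/-- The exceptional divisor `E_p` in `Q`. -/
def Ep : Closeds Q := Bl.exceptional (PP 2) p

/-- The strict transform `K` in `Q` of the sextic curve `Z(F)`. -/
def K : Closeds Q := Bl.strictTransform (PP 2) p (zeroSet (sextic F₃ F₆))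

/-- The blow-up `R` of `Q` at the points `q₁, q₂, q₃` of `K ∩ E_p`. -/
abbrev R : Scheme.{0} := Bl Q (K F₃ F₆ ⊓ Ep)

/-- The strict transform of `K` in `R`. -/
def KHat : Closeds (R F₃ F₆) := Bl.strictTransform Q (K F₃ F₆ ⊓ Ep) (K F₃ F₆)

/-- The strict transform of `E_p` in `R`. -/
def EpHat : Closeds (R F₃ F₆) := Bl.strictTransform Q (K F₃ F₆ ⊓ Ep) Ep

/-- The composition `R ⟶ Q ⟶ ℙ²` of the two blow-downs. -/
def R.toPlane : R F₃ F₆ ⟶ PP 2 := Bl.map Q (K F₃ F₆ ⊓ Ep) ≫ Bl.map (PP 2) p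

variable {F₃ F₆}
variable (h₃ : F₃.IsHomogeneous 3) (h₆ : F₆.IsHomogeneous 6)

/-- The coordinate ring of the affine chart `X₀ ≠ 0` of the plane. -/
abbrev ChartRing : Type := HomogeneousLocalization.Away (coordGrading 2) (X 0)

/-- The function field of the plane. -/
abbrev PlaneFunctionField : Type := FractionRing ChartRing

/-- The function `F / X₀⁶` on the chart `X₀ ≠ 0`. -/
def dehomogenized : ChartRing :=
  .mk (coordGrading 2) (isHomogeneous_X ℂ (0 : Fin 3)) 6 (sextic F₃ F₆)
    (isHomogeneous_sextic h₃ h₆)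

/-- The function field `ℂ(ℙ²)(√(F / X₀⁶))` of the double plane `S² = F(X₀, X₁, X₂)`. -/
abbrev DoublePlaneFunctionField : Type :=
  AdjoinRoot (Polynomial.X ^ 2 -
    Polynomial.C (algebraMap ChartRing PlaneFunctionField (dehomogenized h₃ h₆)))

/-- The generic point of the double plane, mapping to the plane. -/
def genericDoublePoint : Spec (.of (DoublePlaneFunctionField h₃ h₆)) ⟶ PP 2 :=
  Spec.map (CommRingCat.ofHom ((algebraMap PlaneFunctionField (DoublePlaneFunctionField h₃ h₆)).comp
    (algebraMap ChartRing PlaneFunctionField))) ≫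
  Proj.awayι (coordGrading 2) (X 0) (isHomogeneous_X ℂ (0 : Fin 3)) one_pos

/-- The generic point of the double plane, mapping to `R` (which is birational to the plane). -/
def genericDoublePointToR :
    pullback (R.toPlane F₃ F₆) (genericDoublePoint h₃ h₆) ⟶ R F₃ F₆ :=
  pullback.fst (R.toPlane F₃ F₆) (genericDoublePoint h₃ h₆)

instance : QuasiCompact (genericDoublePointToR h₃ h₆) :=
  have := quasiCompact_toPP (genericDoublePoint h₃ h₆)
  inferInstanceAs (QuasiCompact (pullback.fst _ _))

instance : QuasiSeparated (genericDoublePointToR h₃ h₆) :=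
  have := quasiSeparated_toPP (genericDoublePoint h₃ h₆)
  inferInstanceAs (QuasiSeparated (pullback.fst _ _))

/-- The surface `W_F`: the normalization of `R` in the function field of the double plane `S² = F`.
The divisor of `F` on `R` is the sum of the strict transforms of `Z(F)` and `E_p`
and of an even divisor, so this is the double cover of `R` branched along these two curves. -/
def W : Scheme.{0} := (genericDoublePointToR h₃ h₆).normalization

/-- The double cover `W_F ⟶ R`. -/
def W.toR : W h₃ h₆ ⟶ R F₃ F₆ := (genericDoublePointToR h₃ h₆).fromNormalization

/-- The composition `W_F ⟶ R ⟶ Q ⟶ ℙ²`. -/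
def W.toPlane : W h₃ h₆ ⟶ PP 2 := W.toR h₃ h₆ ≫ R.toPlane F₃ F₆

/-- The structure morphism of `W_F`. -/
def W.toSpecC : W h₃ h₆ ⟶ Spec (.of ℂ) := W.toPlane h₃ h₆ ≫ projToSpecC (coordGrading 2)

/-- The open subset of the plane on which the `i`-th of the coordinates `X₁, X₂` is nonzero. -/
def planeChart (i : Fin 2) : (PP 2).Opens := Proj.basicOpen (coordGrading 2) (pencil (X i))

/-- The linear projection `[X₀ : X₁ : X₂] ↦ [X₁ : X₂]` on `planeChart i`. -/
def linearProjection (i : Fin 2) : (planeChart i).toScheme ⟶ PP 1 :=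
  (Proj.basicOpenIsoSpec (coordGrading 2) (pencil (X i))
    (pencil.map_mem (isHomogeneous_X ℂ i)) one_pos).hom ≫
  Spec.map (CommRingCat.ofHom (HomogeneousLocalization.Away.map pencil (X i))) ≫
  Proj.awayι (coordGrading 1) (X i) (isHomogeneous_X ℂ i) one_pos

/-- `π : W_F ⟶ ℙ¹` extends the rational map `W_F ⟶ ℙ² ⇢ ℙ¹` given by `[X₀ : X₁ : X₂] ↦ [X₁ : X₂]`
outside the preimage of `p`. -/
def ExtendsProjection (π : W h₃ h₆ ⟶ PP 1) : Prop :=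
  ∀ i : Fin 2, (W.toPlane h₃ h₆ ⁻¹ᵁ planeChart i).ι ≫ π =
    (W.toPlane h₃ h₆ ∣_ planeChart i) ≫ linearProjection i

end Surface

end Geometry

end

end PlaneSextic

open PlaneSextic

/-! The whole argument is a computation in explicit affine charts inside the two function fields.
Let `i` be one of the two coordinates of the base, `x = X_i / X₀`, `t` the slope, `u = 1 / x`, and
let `f₃`, `f₆` be the dehomogenized forms in `t`. Then `F / X₀⁶ = x³ (f₃ + x³ f₆) = x⁶ (f₃ u³ +
f₆)`. Modulo squares the branch function is `x (f₃ + x³ f₆)` near `E_p`, where `x = 0` is `E_p` and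
`f₃ + x³ f₆ = 0` is `K`. These curves meet in `x = f₃ = 0`, and since `f₃` is squarefree the ideal
`(x, f₃)` is radical, so it is the ideal to be blown up. Its blow-up has the charts `x = f₃ s` and
`f₃ = x r`. Removing squares leaves the branch functions `gC = f₃ u³ + f₆`, `gA = s + f₃² f₆ s⁴` and
`gB = r + x² f₆`, whose zero sets are the traces of the two strict transforms (`exists_charts_R`).

Adjoining a square root of these functions already gives the normalization. On the charts `A` and
`C` the base is a polynomial ring and `g` is squarefree, so trace and norm settle it
(`exists_of_isIntegralElem_quad`). The ring `x r = f₃` need not be factorial. There one compares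
with chart `C` after inverting `x` and uses that the double cover is reduced modulo `x`
(`Frame.exists_lift_eq_B`). The branch locus of `w² = g` is `g = 0` because `2` is invertible.

The projection is `t` on every chart. It glues, uniquely, because all charts share one dominant
generic point. With `r` eliminated, the charts of the surface over `ℂ[t]` are `w² = f₃ u³ + f₆`, `x
w² = f₃ + f₆ x³` and `w² = s + f₃² f₆ s⁴`. The first two are standard charts of the plane cubic `x
w² = f₃ z³ + f₆ x³`, and the third shares with the chart `w ≠ 0` of the cubic an open set containing
the point at infinity `x = z = 0`. So the family of cubics is an open subscheme of `W_F`. It is also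
proper over the affine line, hence equal to the full preimage of that line
(`SurfaceAtlas.exists_isPullback`, via `isPullback_of_isOpenImmersion_of_isProper`).

The fibers are therefore the cubics `x w² = α z³ + β x³`. They are smooth exactly for `α β ≠ 0`
(`IsCubicCone.smooth_iff`), and then a rescaling gives `Y² Z = X³ + Z³` with `j = 0`. For `β = 0`
they are cuspidal, for `α = 0` three concurrent lines. The two degenerations never coincide, as `f₃`
and `f₆` are coprime. The total space stays smooth at singular points of fibers because the zeros of
`f₃` and `f₆` are simple, so that the derivative along `t` does not vanish. -/

namespace PlaneSextic

noncomputable section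

/-! ### Ring-valued points of `Proj` from homogeneous coordinates -/

section ProjPoint

open HomogeneousLocalization

variable {S E F σ : Type} [CommRing S] [CommRing E] [CommRing F] [SetLike σ S]
  [AddSubgroupClass σ S] (𝒜 : ℕ → σ) [GradedRing 𝒜]

/-- The homomorphism `a / fⁿ ↦ θ a / (θ f)ⁿ` on the degree-zero part of a localization. -/
def awayLift (θ : S →+* E) (f : S) (hf : IsUnit (θ f)) : Away 𝒜 f →+* E :=
  (IsLocalization.Away.lift f hf : Localization.Away f →+* E).comp
    (algebraMap (Away 𝒜 f) (Localization.Away f))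

/-- This fraction-free form, together with the converse `awayLift_ext`, characterizes `awayLift` and
replaces computations in the localization. -/
lemma awayLift_mk_mul (θ : S →+* E) {f : S} (hu : IsUnit (θ f)) {d : ℕ} (hf : f ∈ 𝒜 d) (n : ℕ)
    (x : S) (hx : x ∈ 𝒜 (n • d)) :
    awayLift 𝒜 θ f hu (Away.mk 𝒜 hf n x hx) * θ f ^ n = θ x := by
  have h1 : (Localization.mk x (⟨f ^ n, n, rfl⟩ : Submonoid.powers f)) *
      algebraMap S (Localization.Away f) (f ^ n) = algebraMap S (Localization.Away f) x := by
    rw [Localization.mk_eq_mk']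
    exact IsLocalization.mk'_spec (Localization.Away f) x (⟨f ^ n, n, rfl⟩ : Submonoid.powers f)
  have h2 := congrArg (IsLocalization.Away.lift f hu : Localization.Away f →+* E) h1
  rw [map_mul, IsLocalization.Away.lift_eq, IsLocalization.Away.lift_eq, map_pow] at h2
  exact h2

lemma awayLift_ext {d : ℕ} {f : S} (hf : f ∈ 𝒜 d) {φ : Away 𝒜 f →+* E} {θ : S →+* E}
    (hu : IsUnit (θ f))
    (h : ∀ n x (hx : x ∈ 𝒜 (n • d)), φ (Away.mk 𝒜 hf n x hx) * θ f ^ n = θ x) :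
    φ = awayLift 𝒜 θ f hu := by
  ext z
  obtain ⟨n, x, hx, rfl⟩ := Away.mk_surjective 𝒜 hf z
  refine (hu.pow n).mul_right_cancel ?_
  rw [h, awayLift_mk_mul]

lemma comp_awayLift (χ : E →+* F) (θ : S →+* E) {d : ℕ} {f : S} (hf : f ∈ 𝒜 d)
    (hu : IsUnit (θ f)) :
    χ.comp (awayLift 𝒜 θ f hu) = awayLift 𝒜 (χ.comp θ) f (hu.map χ) := by
  refine awayLift_ext 𝒜 hf _ fun n x hx ↦ ?_
  rw [RingHom.comp_apply, RingHom.comp_apply, RingHom.comp_apply,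
    ← awayLift_mk_mul 𝒜 θ hu hf n x hx, map_mul, map_pow]

lemma awayLift_comp_awayMap (θ : S →+* E) {d e : ℕ} {f g x : S} (hf : f ∈ 𝒜 d) (hg : g ∈ 𝒜 e)
    (hx : x = f * g) (hu : IsUnit (θ x)) (hu' : IsUnit (θ f)) :
    (awayLift 𝒜 θ x hu).comp (awayMap 𝒜 hg hx) = awayLift 𝒜 θ f hu' := by
  refine awayLift_ext 𝒜 hf _ fun n a ha ↦ ?_
  have hx' : x ∈ 𝒜 (d + e) := hx ▸ SetLike.mul_mem_graded hf hg
  rw [RingHom.comp_apply, awayMap_mk 𝒜 hg hx n hf a ha]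
  have h := awayLift_mk_mul 𝒜 θ hu hx' n (a * g ^ n) (by
    rw [smul_add]; exact SetLike.mul_mem_graded ha (SetLike.pow_mem_graded _ hg))
  have hug : IsUnit (θ g ^ n) := by
    rw [hx, map_mul] at hu
    exact (isUnit_of_mul_isUnit_right hu).pow n
  refine hug.mul_right_cancel ?_
  have h3 : θ x = θ f * θ g := by rw [hx, map_mul]
  rw [← map_pow θ g, ← map_mul, ← h, h3, map_pow, mul_pow, mul_assoc]

/-- Numerator and denominator of a degree-zero fraction acquire the same power of `c`. -/
lemma awayLift_scale (θ θ' : S →+* E) (c : E) (h : ∀ n, ∀ a ∈ 𝒜 n, θ' a = c ^ n * θ a) {d : ℕ}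
    {f : S} (hf : f ∈ 𝒜 d) (hu : IsUnit (θ f)) (hu' : IsUnit (θ' f)) :
    awayLift 𝒜 θ f hu = awayLift 𝒜 θ' f hu' := by
  refine awayLift_ext 𝒜 hf _ fun n a ha ↦ ?_
  rw [h _ _ hf, mul_pow, ← mul_assoc, mul_right_comm, awayLift_mk_mul, h _ _ ha, ← pow_mul,
    smul_eq_mul, mul_comm, mul_comm d]

/-- The point of `Proj 𝒜` with values in `E` that has the homogeneous coordinates `θ`. -/
def projPoint (θ : S →+* E) {d : ℕ} {f : S} (hf : f ∈ 𝒜 d) (hd : 0 < d) (hu : IsUnit (θ f)) :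
    Spec (.of E) ⟶ Proj 𝒜 :=
  Spec.map (CommRingCat.ofHom (awayLift 𝒜 θ f hu)) ≫ Proj.awayι 𝒜 f hf hd

lemma specMap_projPoint (χ : E →+* F) (θ : S →+* E) {d : ℕ} {f : S} (hf : f ∈ 𝒜 d) (hd : 0 < d)
    (hu : IsUnit (θ f)) :
    Spec.map (CommRingCat.ofHom χ) ≫ projPoint 𝒜 θ hf hd hu =
      projPoint 𝒜 (χ.comp θ) hf hd (hu.map χ) := by
  rw [projPoint, projPoint, ← Category.assoc, ← Spec.map_comp, ← CommRingCat.ofHom_comp,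
    comp_awayLift 𝒜 χ θ hf]

/-- Proportional coordinates define the same point, whichever chart is used to write it: both sides
factor through the common chart where `f * g` is invertible, and there `awayLift_scale` applies. -/
lemma projPoint_congr {θ θ' : S →+* E} (c : E) (h : ∀ n, ∀ a ∈ 𝒜 n, θ' a = c ^ n * θ a) {d e : ℕ}
    {f g : S} (hf : f ∈ 𝒜 d) (hg : g ∈ 𝒜 e) (hd : 0 < d) (he : 0 < e) (hu : IsUnit (θ f))
    (hu' : IsUnit (θ' g)) :
    projPoint 𝒜 θ hf hd hu = projPoint 𝒜 θ' hg he hu' := by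
  have hug := hu'
  rw [h _ _ hg] at hug
  -- Since `θ' g = c ^ e * θ g` is a unit and `e > 0`, so is `c`.
  have huc : IsUnit c := (isUnit_pow_iff he.ne').mp (isUnit_of_mul_isUnit_left hug)
  have hux : IsUnit (θ (f * g)) := by
    rw [map_mul]; exact hu.mul (isUnit_of_mul_isUnit_right hug)
  have hux' : IsUnit (θ' (f * g)) := by
    rw [map_mul, h _ _ hf]; exact ((huc.pow d).mul hu).mul hu'
  have hfg : f * g ∈ 𝒜 (d + e) := SetLike.mul_mem_graded hf hg
  rw [projPoint, projPoint, ← awayLift_comp_awayMap 𝒜 θ hf hg rfl hux hu,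
    ← awayLift_comp_awayMap 𝒜 θ' hg hf (mul_comm f g) hux' hu', CommRingCat.ofHom_comp,
    CommRingCat.ofHom_comp, Spec.map_comp, Spec.map_comp, Category.assoc, Category.assoc,
    Proj.SpecMap_awayMap_awayι, Proj.SpecMap_awayMap_awayι, awayLift_scale 𝒜 θ θ' c h hfg hux hux']
  congr 1

/-- In the chart of `f` the locus `g ≠ 0` is given by `g ^ d / f ^ e`, whose value at the point is
`θ g ^ d` up to a unit. -/
lemma projPoint_preimage_basicOpen (θ : S →+* E) {d : ℕ} {f : S} (hf : f ∈ 𝒜 d) (hd : 0 < d)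
    (hu : IsUnit (θ f)) {e : ℕ} {g : S} (hg : g ∈ 𝒜 e) (he : 0 < e) :
    projPoint 𝒜 θ hf hd hu ⁻¹ᵁ Proj.basicOpen 𝒜 g = PrimeSpectrum.basicOpen (θ g) := by
  rw [projPoint, Scheme.Hom.comp_preimage, Proj.awayι_preimage_basicOpen 𝒜 hf hd hg he]
  have h : θ g ^ d ∣ awayLift 𝒜 θ f hu (Away.isLocalizationElem hf hg) ∧
      awayLift 𝒜 θ f hu (Away.isLocalizationElem hf hg) ∣ θ g ^ d := by
    have := awayLift_mk_mul 𝒜 θ hu hf e (g ^ d) (by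
      have := SetLike.pow_mem_graded d hg
      rwa [smul_eq_mul, mul_comm d] at this)
    rw [map_pow] at this
    refine ⟨?_, ?_⟩
    · rw [← this]
      exact ((hu.pow e).mul_right_dvd).mpr dvd_rfl
    · rw [← this]
      exact Dvd.intro _ rfl
  have h2 : PrimeSpectrum.basicOpen (awayLift 𝒜 θ f hu (Away.isLocalizationElem hf hg)) =
      PrimeSpectrum.basicOpen (θ g) := by
    rw [← PrimeSpectrum.basicOpen_pow (θ g) d hd]
    obtain ⟨⟨a, ha⟩, ⟨b, hb⟩⟩ := h
    refine le_antisymm ?_ ?_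
    · conv_lhs => rw [ha, PrimeSpectrum.basicOpen_mul]
      exact inf_le_left
    · conv_lhs => rw [hb, PrimeSpectrum.basicOpen_mul]
      exact inf_le_left
  rw [← h2]
  rfl

/-- The map `H` undoes the dehomogenization `θ`: it sends `θ a` to `a / f ^ n` for `a` of degree
`n`. Hence its composition with `awayLift` is the inclusion into the full localization, which gives
injectivity. Surjectivity follows from that of `θ`, because `θ f = 1` makes every `θ a` the value of
a degree-zero fraction. -/
lemma awayLift_bijective {θ : S →+* E} {f : S} (hf : f ∈ 𝒜 1) (hθ : θ f = 1)
    (hs : Function.Surjective θ) (H : E →+* Localization.Away f)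
    (hH : ∀ n, ∀ a ∈ 𝒜 n, H (θ a) * algebraMap S _ f ^ n = algebraMap S _ a) :
    Function.Bijective (awayLift 𝒜 θ f (hθ ▸ isUnit_one)) := by
  have hu : IsUnit (θ f) := hθ ▸ isUnit_one
  have key : ∀ n a (ha : a ∈ 𝒜 (n • 1)), awayLift 𝒜 θ f hu (Away.mk 𝒜 hf n a ha) = θ a := by
    intro n a ha
    have := awayLift_mk_mul 𝒜 θ hu hf n a ha
    rwa [hθ, one_pow, mul_one] at this
  refine ⟨?_, ?_⟩
  · have : ∀ z, H (awayLift 𝒜 θ f hu z) = z.val := by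
      intro z
      obtain ⟨n, x, hx, rfl⟩ := Away.mk_surjective 𝒜 hf z
      rw [key, Away.val_mk]
      have hx' : x ∈ 𝒜 n := by simpa using hx
      refine ((IsLocalization.Away.algebraMap_isUnit f).pow n).mul_right_cancel ?_
      rw [hH n x hx', ← map_pow, Localization.mk_eq_mk']
      exact (IsLocalization.mk'_spec (Localization.Away f) x
        (⟨f ^ n, n, rfl⟩ : Submonoid.powers f)).symm
    intro z z' hz
    apply val_injective
    rw [← this, ← this]
    exact congrArg H hz
  · intro b
    obtain ⟨a, rfl⟩ := hs b
    induction a using DirectSum.Decomposition.inductionOn 𝒜 with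
    | zero => exact ⟨0, by simp⟩
    | homogeneous a => exact ⟨Away.mk 𝒜 hf _ a (by rw [smul_eq_mul, mul_one]; exact a.2), key _ _ _⟩
    | add a b ha hb =>
      obtain ⟨a', ha⟩ := ha
      obtain ⟨b', hb⟩ := hb
      exact ⟨a' + b', by rw [map_add, map_add, ha, hb]⟩

lemma isIso_specMap_of_bijective {φ : E →+* F} (h : Function.Bijective φ) :
    IsIso (Spec.map (CommRingCat.ofHom φ)) := by
  have : IsIso (CommRingCat.ofHom φ) := by
    rw [ConcreteCategory.isIso_iff_bijective]
    exact h
  infer_instance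

lemma isOpenImmersion_projPoint (θ : S →+* E) {d : ℕ} {f : S} (hf : f ∈ 𝒜 d) (hd : 0 < d)
    (hu : IsUnit (θ f)) (h : Function.Bijective (awayLift 𝒜 θ f hu)) :
    IsOpenImmersion (projPoint 𝒜 θ hf hd hu) := by
  have := isIso_specMap_of_bijective h
  rw [projPoint]
  infer_instance

lemma opensRange_projPoint (θ : S →+* E) {d : ℕ} {f : S} (hf : f ∈ 𝒜 d) (hd : 0 < d)
    (hu : IsUnit (θ f)) (h : Function.Bijective (awayLift 𝒜 θ f hu)) :
    Set.range (projPoint 𝒜 θ hf hd hu) = Proj.basicOpen 𝒜 f := by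
  have := isIso_specMap_of_bijective h
  rw [← Proj.opensRange_awayι 𝒜 f hf hd, projPoint]
  rw [← Scheme.Hom.opensRange_comp_of_isIso (Spec.map (CommRingCat.ofHom (awayLift 𝒜 θ f hu)))]
  rfl

end ProjPoint

/-! ### Gluing along charts with a common generic point -/

section Glue

variable {ι : Type} {X Y E : Scheme.{0}} {U : ι → Scheme.{0}}

lemma isDominant_of_comp_openImmersion {V : Scheme.{0}} (e : E ⟶ V) (j : V ⟶ X)
    [IsOpenImmersion j] [IsDominant (e ≫ j)] : IsDominant e := by
  refine ⟨?_⟩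
  have h : Dense (Set.range (e ≫ j)) := (inferInstance : IsDominant (e ≫ j)).1
  intro v
  rw [mem_closure_iff]
  intro O hO hv
  obtain ⟨_, ⟨w, hw, rfl⟩, ⟨z, hz⟩⟩ := h.inter_open_nonempty _ (j.isOpenEmbedding.isOpenMap O hO) ⟨_, v, hv, rfl⟩
  refine ⟨w, hw, z, ?_⟩
  apply j.isOpenEmbedding.injective
  rw [← hz]
  rfl

/-- Morphisms on the charts of a scheme that agree at a common generic point glue, if the target is
separated. -/
lemma exists_glue (i : ∀ k, U k ⟶ X) [∀ k, IsOpenImmersion (i k)]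
    (hi : ∀ x : X, ∃ k, x ∈ Set.range (i k)) [∀ k, IsReduced (U k)] (e : ∀ k, E ⟶ U k)
    [∀ k, IsDominant (e k)] (η : E ⟶ X) (he : ∀ k, e k ≫ i k = η) [Y.IsSeparated]
    (f : ∀ k, U k ⟶ Y) (g : E ⟶ Y) (hf : ∀ k, e k ≫ f k = g) :
    ∃ F : X ⟶ Y, ∀ k, i k ≫ F = f k := by
  choose k hk using hi
  let 𝒰 : X.OpenCover :=
    { I₀ := ι
      X := U
      f := i
      mem₀ := by
        rw [Scheme.ofArrows_mem_precoverage_iff]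
        exact ⟨fun x ↦ ⟨k x, hk x⟩, inferInstance⟩ }
  refine ⟨𝒰.glueMorphisms f fun a b ↦ ?_, fun a ↦ Scheme.Cover.ι_glueMorphisms 𝒰 f _ a⟩
  change pullback.fst (i a) (i b) ≫ f a = pullback.snd (i a) (i b) ≫ f b
  have : IsReduced (pullback (i a) (i b)) := isReduced_of_isOpenImmersion (pullback.fst (i a) (i b))
  -- The generic point lies in every overlap and is dominant there. The overlap is reduced and the
  -- target separated, so agreement at the generic point is agreement on the overlap.
  let l : E ⟶ pullback (i a) (i b) := pullback.lift (e a) (e b) (by rw [he, he])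
  have hl : l ≫ pullback.fst (i a) (i b) = e a := pullback.lift_fst _ _ _
  have : IsDominant (l ≫ pullback.fst (i a) (i b)) := by rw [hl]; infer_instance
  have : IsDominant l := isDominant_of_comp_openImmersion l (pullback.fst (i a) (i b))
  refine ext_of_isDominant l ?_
  rw [← Category.assoc, ← Category.assoc, hl, pullback.lift_snd, hf, hf]

lemma hom_ext_of_charts (i : ∀ k, U k ⟶ X) [∀ k, IsOpenImmersion (i k)]
    (hi : ∀ x : X, ∃ k, x ∈ Set.range (i k)) {f g : X ⟶ Y} (h : ∀ k, i k ≫ f = i k ≫ g) : f = g := by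
  choose k hk using hi
  let 𝒰 : X.OpenCover :=
    { I₀ := ι
      X := U
      f := i
      mem₀ := by
        rw [Scheme.ofArrows_mem_precoverage_iff]
        exact ⟨fun x ↦ ⟨k x, hk x⟩, inferInstance⟩ }
  exact 𝒰.hom_ext f g h

/-- Gluing in both directions produces morphisms that are mutually inverse on charts. -/
lemma exists_iso_of_charts (i : ∀ k, U k ⟶ X) [∀ k, IsOpenImmersion (i k)]
    (hi : ∀ x : X, ∃ k, x ∈ Set.range (i k)) (j : ∀ k, U k ⟶ Y) [∀ k, IsOpenImmersion (j k)]
    (hj : ∀ y : Y, ∃ k, y ∈ Set.range (j k)) [∀ k, IsReduced (U k)] (e : ∀ k, E ⟶ U k)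
    [∀ k, IsDominant (e k)] (η : E ⟶ X) (he : ∀ k, e k ≫ i k = η) (η' : E ⟶ Y)
    (he' : ∀ k, e k ≫ j k = η') [X.IsSeparated] [Y.IsSeparated] :
    ∃ F : X ≅ Y, ∀ k, i k ≫ F.hom = j k := by
  obtain ⟨F, hF⟩ := exists_glue i hi e η he j η' he'
  obtain ⟨G, hG⟩ := exists_glue j hj e η' he' i η he
  refine ⟨⟨F, G, hom_ext_of_charts i hi fun k ↦ ?_, hom_ext_of_charts j hj fun k ↦ ?_⟩, hF⟩
  · rw [← Category.assoc, hF, hG, Category.comp_id]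
  · rw [← Category.assoc, hG, hF, Category.comp_id]

lemma isDominant_specMap {A B : Type} [CommRing A] [CommRing B] {φ : A →+* B}
    (h : Function.Injective φ) : IsDominant (Spec.map (CommRingCat.ofHom φ)) :=
  ⟨(PrimeSpectrum.denseRange_comap_iff_ker_le_nilRadical φ).mpr
    ((RingHom.injective_iff_ker_eq_bot φ).mp h ▸ bot_le)⟩

end Glue

/-! ### Recognizing the charts of a blow-up -/

section BlowupCharts

open Polynomial HomogeneousLocalization Scheme.AffineZariskiSite reesGrading

variable {A B : Type} [CommRing A] [CommRing B]

/-- `φ : A → B` is the chart of the blow-up of `Spec A` along `I` on which `g ∈ I` generates the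
exceptional ideal. -/
structure IsBlowupChart (I : Ideal A) (g : A) (φ : A →+* B) : Prop where
  mem : g ∈ I
  mem_nonZeroDivisors : φ g ∈ nonZeroDivisors B
  dvd : ∀ a ∈ I, φ g ∣ φ a
  injective : Function.Injective φ
  exists_eq : ∀ b, ∃ n, ∃ a ∈ I ^ n, φ g ^ n * b = φ a

/-- The elements `b` with `g ^ n * b` in the image of `I ^ n` for some `n` form a subring, so it
suffices to examine ring generators over `A`. -/
lemma IsBlowupChart.of_adjoin {I : Ideal A} {g : A} {φ : A →+* B} (mem : g ∈ I)
    (nzd : φ g ∈ nonZeroDivisors B) (dvd : ∀ a ∈ I, φ g ∣ φ a) (inj : Function.Injective φ)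
    (T : Set B) (hT : Subring.closure (Set.range φ ∪ T) = ⊤)
    (h : ∀ b ∈ T, ∃ a ∈ I, φ g * b = φ a) : IsBlowupChart I g φ := by
  refine ⟨mem, nzd, dvd, inj, fun b ↦ ?_⟩
  have hb : b ∈ Subring.closure (Set.range φ ∪ T) := by rw [hT]; trivial
  induction hb using Subring.closure_induction with
  | mem b hb =>
    obtain ⟨a, rfl⟩ | hb := hb
    · exact ⟨0, a, by simp, by simp⟩
    · obtain ⟨a, ha, hab⟩ := h b hb
      exact ⟨1, a, by simpa using ha, by simpa using hab⟩
  | zero => exact ⟨0, 0, by simp, by simp⟩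
  | one => exact ⟨0, 1, by simp, by simp⟩
  | add x y _ _ hx hy =>
    obtain ⟨n, a, ha, hax⟩ := hx
    obtain ⟨m, b, hb, hby⟩ := hy
    refine ⟨n + m, g ^ m * a + g ^ n * b, add_mem ?_ ?_, ?_⟩
    · rw [mul_comm, pow_add]; exact Ideal.mul_mem_mul ha (Ideal.pow_mem_pow mem m)
    · rw [pow_add]; exact Ideal.mul_mem_mul (Ideal.pow_mem_pow mem n) hb
    · rw [map_add, map_mul, map_mul, ← hax, ← hby, map_pow, map_pow]; ring
  | neg x _ hx =>
    obtain ⟨n, a, ha, hax⟩ := hx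
    exact ⟨n, -a, neg_mem ha, by rw [map_neg, ← hax]; ring⟩
  | mul x y _ _ hx hy =>
    obtain ⟨n, a, ha, hax⟩ := hx
    obtain ⟨m, b, hb, hby⟩ := hy
    refine ⟨n + m, a * b, ?_, ?_⟩
    · rw [pow_add]; exact Ideal.mul_mem_mul ha hb
    · rw [map_mul, ← hax, ← hby]; ring

lemma isBlowupChart_top : IsBlowupChart (⊤ : Ideal A) 1 (RingHom.id A) :=
  ⟨trivial, by simp, by simp, Function.injective_id, fun b ↦ ⟨0, b, by simp, by simp⟩⟩

namespace IsBlowupChart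

variable {I : Ideal A} {g : A} {φ : A →+* B}

lemma pow_dvd (h : IsBlowupChart I g φ) (n : ℕ) : ∀ a ∈ I ^ n, φ g ^ n ∣ φ a := by
  intro a ha
  have h1 : I.map φ ≤ Ideal.span {φ g} := by
    rw [Ideal.map_le_iff_le_comap]
    intro a ha
    exact Ideal.mem_span_singleton.mpr (h.dvd a ha)
  have h2 := Ideal.pow_right_mono h1 n (by
    rw [← Ideal.map_pow]; exact Ideal.mem_map_of_mem φ ha)
  rwa [Ideal.span_singleton_pow, Ideal.mem_span_singleton] at h2

variable (I g φ) in
/-- Evaluation of the Rees algebra at `1 / φ g`. -/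
def eval : reesAlgebra I →+* Localization.Away (φ g) :=
  (eval₂RingHom ((algebraMap B (Localization.Away (φ g))).comp φ)
    (IsLocalization.Away.invSelf (φ g))).comp (reesAlgebra I).val.toRingHom

lemma eval_elt (n : ℕ) (a : A) (ha : a ∈ I ^ n) :
    eval I g φ (elt I n a ha) = algebraMap B _ (φ a) * IsLocalization.Away.invSelf (φ g) ^ n :=
  eval₂_monomial _ _

lemma eval_elt_self (hg : g ∈ I ^ 1) : eval I g φ (elt I 1 g hg) = 1 := by
  rw [eval_elt, pow_one, IsLocalization.Away.mul_invSelf]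

/-- Both rings embed into `B[1 / φ g]`. The fraction `a tⁿ / (g t)ⁿ` goes to `φ a / (φ g)ⁿ`, which
is injective because `φ` is, lands in `B` by divisibility, and fills `B` by `exists_eq`. -/
lemma exists_equiv (h : IsBlowupChart I g φ) (hg : g ∈ I ^ 1) :
    ∃ e : Away (reesGrading I) (elt I 1 g hg) ≃+* B,
      (e : _ →+* B).comp (chartHom I (elt I 1 g hg)) = φ := by
  set f := elt I 1 g hg with hfdef
  have hu : IsUnit (eval I g φ f) := by rw [eval_elt_self]; exact isUnit_one
  set α := awayLift (reesGrading I) (eval I g φ) f hu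
  set inv : Localization.Away (φ g) := IsLocalization.Away.invSelf (φ g)
  have hinv : algebraMap B _ (φ g) * inv = 1 := IsLocalization.Away.mul_invSelf _
  have hβ : Function.Injective (algebraMap B (Localization.Away (φ g))) :=
    IsLocalization.injective _ (Submonoid.powers_le.mpr h.mem_nonZeroDivisors)
  have hα : ∀ n a (ha : a ∈ I ^ (n • 1)), α (Away.mk _ (elt_mem I 1 g hg) n (elt I _ a ha)
      (elt_mem ..)) = algebraMap B _ (φ a) * inv ^ n := by
    intro n a ha
    have h1 := awayLift_mk_mul (reesGrading I) (eval I g φ) hu (elt_mem I 1 g hg) n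
      (elt I _ a ha) (elt_mem ..)
    rw [eval_elt_self hg, one_pow, mul_one, eval_elt] at h1
    exact h1.trans (by rw [smul_eq_mul, mul_one])
  have hc : ∀ a, α (chartHom I f a) = algebraMap B _ (φ a) := by
    intro a
    have : chartHom I f a = Away.mk _ (elt_mem I 1 g hg) 0 (elt I _ a (by simp)) (elt_mem ..) := by
      apply val_injective
      rw [val_chartHom, Away.val_mk]
      congr 1
    rw [this, hα]; simp
  have hαinj : Function.Injective α := by
    rw [injective_iff_map_eq_zero]
    intro z hz
    obtain ⟨n, x, hx, rfl⟩ := Away.mk_surjective _ (elt_mem I 1 g hg) z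
    obtain ⟨a, ha, rfl⟩ := exists_elt hx
    rw [hα] at hz
    have h0 : algebraMap B (Localization.Away (φ g)) (φ a) = 0 := by
      calc _ = algebraMap B (Localization.Away (φ g)) (φ a) * inv ^ n *
          (algebraMap B _ (φ g)) ^ n := by
            rw [mul_assoc, ← mul_pow, mul_comm inv, hinv, one_pow, mul_one]
        _ = 0 := by rw [hz, zero_mul]
    have ha0 : a = 0 := h.injective (by rw [map_zero]; exact hβ (by rw [h0, map_zero]))
    subst ha0
    apply val_injective
    rw [Away.val_mk, val_zero, Localization.mk_eq_mk', IsLocalization.mk'_eq_zero_iff]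
    exact ⟨1, (one_mul _).trans (Subtype.ext (monomial_zero_right _))⟩
  have hmem : ∀ z, ∃ b, algebraMap B _ b = α z := by
    intro z
    obtain ⟨n, x, hx, rfl⟩ := Away.mk_surjective _ (elt_mem I 1 g hg) z
    obtain ⟨a, ha, rfl⟩ := exists_elt hx
    obtain ⟨b, hb⟩ := h.pow_dvd n a (by simpa using ha)
    refine ⟨b, ?_⟩
    rw [hα, hb, map_mul, map_pow, mul_right_comm, ← mul_pow, hinv, one_pow, one_mul]
  choose e he using hmem
  have hsurj : Function.Surjective e := by
    intro b
    obtain ⟨n, a, ha, hab⟩ := h.exists_eq b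
    refine ⟨Away.mk _ (elt_mem I 1 g hg) n (elt I _ a (by simpa using ha)) (elt_mem ..), ?_⟩
    apply hβ
    rw [he, hα, ← hab, map_mul, map_pow, mul_right_comm, ← mul_pow, hinv, one_pow, one_mul]
  let E : Away (reesGrading I) f →+* B :=
    { toFun := e
      map_one' := hβ (by rw [he, map_one, map_one])
      map_zero' := hβ (by rw [he, map_zero, map_zero])
      map_mul' := fun x y ↦ hβ (by rw [he, map_mul, map_mul, he, he])
      map_add' := fun x y ↦ hβ (by rw [he, map_add, map_add, he, he]) }
  refine ⟨RingEquiv.ofBijective E ⟨fun x y hxy ↦ hαinj ?_, hsurj⟩, ?_⟩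
  · rw [← he, ← he]
    exact congrArg _ hxy
  · ext a
    apply hβ
    rw [← hc]
    exact he _

lemma exists_openImmersion (h : IsBlowupChart I g φ) (hg : g ∈ I ^ 1) :
    ∃ c : Spec (.of B) ⟶ Proj (reesGrading I), IsOpenImmersion c ∧
      c ≫ reesProjToSpec I = Spec.map (CommRingCat.ofHom φ) ∧
      Set.range c = Proj.basicOpen (reesGrading I) (elt I 1 g hg) := by
  obtain ⟨e, he⟩ := h.exists_equiv hg
  have := isIso_specMap_of_bijective (φ := (e : Away (reesGrading I) (elt I 1 g hg) →+* B)) e.bijective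
  refine ⟨Spec.map (CommRingCat.ofHom (e : _ →+* B)) ≫
    Proj.awayι (reesGrading I) (elt I 1 g hg) (elt_mem ..) one_pos, inferInstance, ?_, ?_⟩
  · rw [Category.assoc, awayι_reesProjToSpec, ← Spec.map_comp, ← CommRingCat.ofHom_comp, he]
  · rw [← Proj.opensRange_awayι (reesGrading I) _ (elt_mem I 1 g hg) one_pos,
      ← Scheme.Hom.opensRange_comp_of_isIso
        (Spec.map (CommRingCat.ofHom (e : Away (reesGrading I) (elt I 1 g hg) →+* B)))]
    rfl

end IsBlowupChart

/-- Because `I ^ (1 + n) = I * I ^ n`, the degree-one elements `g_k t` generate the irrelevant ideal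
of the Rees algebra. -/
lemma iSup_basicOpen_rees {I : Ideal A} {κ : Type} (g : κ → A) (hg : ∀ k, g k ∈ I ^ 1)
    (hI : Ideal.span (Set.range g) = I) :
    ⨆ k, Proj.basicOpen (reesGrading I) (elt I 1 (g k) (hg k)) = ⊤ := by
  refine Proj.iSup_basicOpen_eq_top _ _ ?_
  rw [HomogeneousIdeal.toIdeal_irrelevant_le]
  intro i hi x hx
  obtain ⟨a, ha, rfl⟩ := exists_elt hx
  obtain ⟨n, rfl⟩ : ∃ n, i = 1 + n := ⟨i - 1, by omega⟩
  set J := Ideal.span (Set.range fun k ↦ elt I 1 (g k) (hg k))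
  have key : ∀ a ∈ I, ∀ b (hb : b ∈ I ^ n) (hab : a * b ∈ I ^ (1 + n)),
      elt I (1 + n) (a * b) hab ∈ J := by
    intro a ha
    rw [← hI] at ha
    induction ha using Submodule.span_induction with
    | mem a ha =>
      obtain ⟨k, rfl⟩ := ha
      intro b hb hab
      have : elt I (1 + n) (g k * b) hab = elt I n b hb * elt I 1 (g k) (hg k) := by
        rw [mul_comm (elt I n b hb)]
        exact Subtype.ext (monomial_mul_monomial _ _ _ _).symm
      rw [this]
      exact Ideal.mul_mem_left _ _ (Ideal.subset_span ⟨k, rfl⟩)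
    | zero =>
      intro b hb hab
      have : elt I (1 + n) (0 * b) hab = 0 := Subtype.ext (by simp [elt])
      rw [this]; exact zero_mem _
    | add x y hx hy h1 h2 =>
      intro b hb hab
      rw [← Ideal.span, hI] at hx hy
      have hm : ∀ z ∈ I, z * b ∈ I ^ (1 + n) := fun z hz ↦ by
        rw [pow_add, pow_one]; exact Ideal.mul_mem_mul hz hb
      have : elt I (1 + n) ((x + y) * b) hab =
          elt I (1 + n) (x * b) (hm x hx) + elt I (1 + n) (y * b) (hm y hy) :=
        Subtype.ext (by simp [elt, add_mul])
      rw [this]; exact add_mem (h1 b hb _) (h2 b hb _)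
    | smul c x hx h1 =>
      intro b hb hab
      rw [← Ideal.span, hI] at hx
      have hm : x * b ∈ I ^ (1 + n) := by rw [pow_add, pow_one]; exact Ideal.mul_mem_mul hx hb
      have : elt I (1 + n) ((c • x) * b) hab =
          algebraMap A (reesAlgebra I) c * elt I (1 + n) (x * b) hm :=
        Subtype.ext (by simp [elt, C_mul_monomial, mul_assoc])
      rw [this]; exact Ideal.mul_mem_left _ _ (h1 b hb _)
  have ha' : a ∈ I * I ^ n := by rwa [pow_add, pow_one] at ha
  have hle : I * I ^ n = I ^ (1 + n) := by rw [pow_add, pow_one]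
  suffices ∀ h : a ∈ I ^ (1 + n), elt I (1 + n) a h ∈ J from this ha
  clear ha hx
  induction ha' using Submodule.mul_induction_on' with
  | mem_mul_mem x hx y hy => exact fun h ↦ key x hx y hy h
  | add x hx y hy h1 h2 =>
    intro h
    have : elt I (1 + n) (x + y) h = elt I (1 + n) x (hle ▸ hx) + elt I (1 + n) y (hle ▸ hy) :=
      Subtype.ext (by simp [elt])
    rw [this]; exact add_mem (h1 _) (h2 _)

/-- The blow-up is built from rings of sections over affine opens, while the charts are computed in
polynomial rings. This transports a chart between the two. -/
lemma IsBlowupChart.comp_equiv {C : Type} [CommRing C] {I : Ideal A} {g : A} {φ : A →+* B}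
    (h : IsBlowupChart I g φ) (e : C ≃+* A) :
    IsBlowupChart (I.comap (e : C →+* A)) (e.symm g) (φ.comp (e : C →+* A)) := by
  have hg : (φ.comp (e : C →+* A)) (e.symm g) = φ g := by simp
  have hpow : ∀ n, (I ^ n).comap (e : C →+* A) = (I.comap (e : C →+* A)) ^ n := by
    intro n
    have h1 (J : Ideal A) : J.comap (e : C →+* A) = J.map (e.symm : A →+* C) :=
      (Ideal.map_comap_of_equiv e.symm).symm
    rw [h1, h1, Ideal.map_pow]
  have hm : ∀ (J : Ideal A) a, a ∈ J → e.symm a ∈ J.comap (e : C →+* A) := fun J a ha ↦ by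
    rw [Ideal.mem_comap]
    exact (e.apply_symm_apply a).symm ▸ ha
  refine ⟨hm _ _ h.mem, hg ▸ h.mem_nonZeroDivisors,
    fun a ha ↦ hg ▸ h.dvd _ ha, h.injective.comp e.injective, fun b ↦ ?_⟩
  obtain ⟨n, a, ha, hab⟩ := h.exists_eq b
  refine ⟨n, e.symm a, ?_, by rw [hg, hab]; simp⟩
  rw [← hpow]
  exact hm _ _ ha

/-- The open immersion of the blow-up of an affine open. -/
def blowupι (X : Scheme.{0}) (I : X.IdealSheafData) (U : X.AffineZariskiSite) :
    Proj (reesGrading (idealAt I U)) ⟶ blowup X I :=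
  (blowupGluingData X I).cover.f U

lemma isPullback_blowupι_opens (X : Scheme.{0}) (I : X.IdealSheafData) (U : X.AffineZariskiSite) :
    IsPullback (reesProjToSpec (idealAt I U) ≫ U.2.isoSpec.inv) (blowupι X I U)
      U.toOpens.ι (blowupMap X I) := (blowupGluingData X I).isPullback_natTrans_ι_toBase U

lemma isPullback_blowupι (X : Scheme.{0}) (I : X.IdealSheafData) (U : X.AffineZariskiSite) :
    IsPullback (reesProjToSpec (idealAt I U)) (blowupι X I U) U.2.fromSpec (blowupMap X I) := by
  have h := isPullback_blowupι_opens X I U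
  refine h.of_iso (Iso.refl _) U.2.isoSpec (Iso.refl _) (Iso.refl _) ?_ ?_ ?_ ?_
  · simp
  · simp
  · exact (by simp : U.toOpens.ι ≫ 𝟙 X = U.2.isoSpec.hom ≫ U.2.fromSpec)
  · simp

instance (X : Scheme.{0}) (I : X.IdealSheafData) (U : X.AffineZariskiSite) :
    IsOpenImmersion (blowupι X I U) :=
  MorphismProperty.of_isPullback (isPullback_blowupι X I U) (by infer_instance)

/-- The coordinate ring of an affine open subscheme, from a parametrization. -/
lemma exists_affineSite {X : Scheme.{0}} (j : Spec (.of A) ⟶ X) [IsOpenImmersion j] :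
    ∃ (U : X.AffineZariskiSite) (e : Γ(X, U.toOpens) ≃+* A),
      Spec.map (CommRingCat.ofHom (e : Γ(X, U.toOpens) →+* A)) ≫ U.2.fromSpec = j ∧
      (U.toOpens : Set X) = Set.range j := by
  let U : X.AffineZariskiSite := ⟨j.opensRange, isAffineOpen_opensRange j⟩
  let i : Spec Γ(X, U.toOpens) ≅ Spec (.of A) :=
    IsOpenImmersion.isoOfRangeEq U.2.fromSpec j (by
      rw [IsAffineOpen.range_fromSpec]; rfl)
  let φ : Γ(X, U.toOpens) ⟶ .of A := Spec.preimage i.inv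
  have hφ : Spec.map φ = i.inv := Spec.map_preimage _
  have : IsIso φ := by
    have : IsIso (Scheme.Spec.map φ.op) := by
      change IsIso (Spec.map φ)
      rw [hφ]; infer_instance
    have : IsIso φ.op := isIso_of_reflects_iso φ.op Scheme.Spec
    exact (isIso_op_iff φ).mp this
  refine ⟨U, (asIso φ).commRingCatIsoToRingEquiv, ?_, rfl⟩
  change Spec.map φ ≫ _ = _
  rw [hφ, IsOpenImmersion.isoOfRangeEq_inv_fac]

/-- The charts of a blow-up along a closed subset over an affine open subscheme. -/
theorem exists_blowup_charts {X : Scheme.{0}} (Z : Closeds X) (j : Spec (.of A) ⟶ X)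
    [IsOpenImmersion j] {κ : Type} (g : κ → A)
    (hg : Ideal.span (Set.range g) = PrimeSpectrum.vanishingIdeal (j ⁻¹' Z))
    (B : κ → Type) [∀ k, CommRing (B k)] (φ : ∀ k, A →+* B k)
    (h : ∀ k, IsBlowupChart (PrimeSpectrum.vanishingIdeal (j ⁻¹' Z)) (g k) (φ k)) :
    ∃ c : ∀ k, Spec (.of (B k)) ⟶ Bl X Z, (∀ k, IsOpenImmersion (c k)) ∧
      (∀ k, c k ≫ Bl.map X Z = Spec.map (CommRingCat.ofHom (φ k)) ≫ j) ∧
      ∀ y, Bl.map X Z y ∈ Set.range j → ∃ k, y ∈ Set.range (c k) := by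
  obtain ⟨U, e, he, hU⟩ := exists_affineSite j
  have hI : idealAt (.vanishingIdeal Z) U =
      (PrimeSpectrum.vanishingIdeal (j ⁻¹' Z)).comap (e : Γ(X, U.toOpens) →+* A) := by
    ext a
    change a ∈ PrimeSpectrum.vanishingIdeal (U.2.fromSpec ⁻¹' Z) ↔ _
    rw [Ideal.mem_comap, PrimeSpectrum.mem_vanishingIdeal, PrimeSpectrum.mem_vanishingIdeal]
    -- Vanishing is tested at points, and every point of the affine open comes from a point of `Spec
    -- A`.
    have hs : Function.Surjective (Spec.map (CommRingCat.ofHom (e : Γ(X, U.toOpens) →+* A))) := by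
      have := isIso_specMap_of_bijective (φ := (e : Γ(X, U.toOpens) →+* A)) e.bijective
      exact (Scheme.homeoOfIso (asIso
        (Spec.map (CommRingCat.ofHom (e : Γ(X, U.toOpens) →+* A))))).surjective
    refine hs.forall.trans (forall_congr' fun x ↦ ?_)
    rw [← he]
    rfl
  have hch : ∀ k, IsBlowupChart (idealAt (.vanishingIdeal Z) U) (e.symm (g k))
      ((φ k).comp (e : Γ(X, U.toOpens) →+* A)) := fun k ↦ hI ▸ (h k).comp_equiv e
  have hspan : Ideal.span (Set.range fun k ↦ e.symm (g k)) = idealAt (.vanishingIdeal Z) U := by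
    rw [hI, ← hg, Set.range_comp', ← RingEquiv.coe_toRingHom e.symm, ← Ideal.map_span]
    exact Ideal.map_comap_of_equiv e.symm
  choose c hc1 hc2 hc3 using fun k ↦ (hch k).exists_openImmersion (by simpa using (hch k).mem)
  have hp := isPullback_blowupι X (.vanishingIdeal Z) U
  refine ⟨fun k ↦ c k ≫ blowupι X (.vanishingIdeal Z) U, fun k ↦ inferInstance, fun k ↦ ?_, ?_⟩
  · rw [Category.assoc, ← hp.w, ← Category.assoc, hc2, CommRingCat.ofHom_comp, Spec.map_comp,
      Category.assoc, he]
  · intro y hy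
    have hy' : y ∈ Set.range (blowupι X (.vanishingIdeal Z) U) := by
      rw [← hU, ← U.2.range_fromSpec] at hy
      obtain ⟨x, hx⟩ := hy
      obtain ⟨z, -, hz⟩ := Scheme.exists_preimage_of_isPullback hp x y hx
      exact ⟨z, hz⟩
    obtain ⟨z, rfl⟩ := hy'
    have hz : z ∈ (⨆ k, Proj.basicOpen (reesGrading (idealAt (.vanishingIdeal Z) U))
        (elt _ 1 (e.symm (g k)) (by simpa using (hch k).mem)) : Opens _) := by
      rw [iSup_basicOpen_rees _ _ hspan]; trivial
    obtain ⟨k, hk⟩ := Opens.mem_iSup.mp hz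
    rw [← SetLike.mem_coe, ← hc3] at hk
    obtain ⟨w, rfl⟩ := hk
    exact ⟨k, w, rfl⟩

/-- For finitely generated `I` the Rees algebra is of finite type over its degree-zero part, which
is `A` itself. -/
lemma isProper_reesProjToSpec (I : Ideal A) (hI : I.FG) : IsProper (reesProjToSpec I) := by
  have h1 : Algebra.FiniteType A (reesAlgebra I) :=
    (Subalgebra.fg_iff_finiteType _).mp (reesAlgebra.fg hI)
  have : IsScalarTower A (reesGrading I 0) (reesAlgebra I) :=
    IsScalarTower.of_algebraMap_eq (R := A) (S := reesGrading I 0) (A := reesAlgebra I) fun _ ↦ rfl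
  have h2 : Algebra.FiniteType (reesGrading I 0) (reesAlgebra I) :=
    .of_restrictScalars_finiteType A _ _
  have : IsIso (Spec.map (CommRingCat.ofHom (R := A) (S := reesGrading I 0)
      (algebraMap A (reesGrading I 0)))) := by
    refine isIso_specMap_of_bijective ⟨fun a b hab ↦ ?_, fun z ↦ ?_⟩
    · have := congrArg (fun z : reesGrading I 0 ↦ (z : reesAlgebra I).1) hab
      exact C_injective this
    · obtain ⟨z, hz⟩ := z
      obtain ⟨a, ha, rfl⟩ := exists_elt hz
      exact ⟨a, Subtype.ext (Subtype.ext rfl)⟩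
  rw [reesProjToSpec]
  infer_instance

/-- Properness is local on the target. The noetherian hypothesis makes the ideals of the affine
pieces finitely generated. -/
lemma isProper_blowupMap (X : Scheme.{0}) [IsLocallyNoetherian X] (I : X.IdealSheafData) :
    IsProper (blowupMap X I) := by
  refine (IsZariskiLocalAtTarget.iff_of_openCover (P := @IsProper) (directedCover X)).mpr
    fun U ↦ ?_
  have h := (isPullback_blowupι_opens X I U).flip
  change IsProper (pullback.snd (blowupMap X I) U.toOpens.ι)
  rw [← h.isoPullback_inv_snd]
  have : IsNoetherianRing Γ(X, U.toOpens) :=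
    IsLocallyNoetherian.component_noetherian ⟨U.1, U.2⟩
  have := isProper_reesProjToSpec (idealAt I U) (IsNoetherian.noetherian _)
  infer_instance

/-- Over an affine open disjoint from the center, the blow-up is an isomorphism. -/
lemma exists_blowup_chart_of_disjoint {X : Scheme.{0}} (Z : Closeds X) (j : Spec (.of A) ⟶ X)
    [IsOpenImmersion j] (h : ∀ x, j x ∉ Z) :
    ∃ c : Spec (.of A) ⟶ Bl X Z, IsOpenImmersion c ∧ c ≫ Bl.map X Z = j ∧
      ∀ y, Bl.map X Z y ∈ Set.range j → y ∈ Set.range c := by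
  have hZ : PrimeSpectrum.vanishingIdeal (j ⁻¹' Z) = ⊤ := by
    have : (j ⁻¹' Z : Set _) = ∅ := Set.eq_empty_of_forall_notMem h
    exact (congrArg PrimeSpectrum.vanishingIdeal this).trans PrimeSpectrum.vanishingIdeal_empty
  obtain ⟨c, h1, h2, h3⟩ := exists_blowup_charts Z j (fun _ : Unit ↦ (1 : A))
    (by rw [hZ, Set.range_const, Ideal.span_singleton_one]) (fun _ ↦ A) (fun _ ↦ RingHom.id A)
    (fun _ ↦ by rw [hZ]; exact isBlowupChart_top)
  refine ⟨c (), h1 (), (h2 ()).trans ?_, fun y hy ↦ (h3 y hy).elim fun _ h ↦ h⟩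
  rw [CommRingCat.ofHom_id, Spec.map_id, Category.id_comp]

/-- Expresses that `f` is an isomorphism over the image of `j`. It is used to see that a point of
the target in that image lifts uniquely. -/
lemma isPullback_of_openImmersion {T X Y : Scheme.{0}} (f : X ⟶ Y) (j : T ⟶ Y)
    [IsOpenImmersion j] (c : T ⟶ X) [IsOpenImmersion c] (h : c ≫ f = j)
    (hr : ∀ y, f y ∈ Set.range j → y ∈ Set.range c) : IsPullback c (𝟙 T) f j := by
  refine (IsOpenImmersion.isPullback (𝟙 T) c j f (by rw [h, Category.id_comp]) ?_).flip
  refine le_antisymm (fun y hy ↦ hr y hy) ?_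
  rintro _ ⟨t, rfl⟩
  exact ⟨t, by rw [← h]; rfl⟩

end BlowupCharts

/-! ### Integral closure in quadratic extensions -/

section Quadratic

open Polynomial

variable {A K L : Type} [CommRing A] [Field K] [Field L] [Algebra K L]

/-- `ψ` is the embedding of a domain into its field of fractions. -/
structure IsFracHom (ψ : A →+* K) : Prop where
  injective : Function.Injective ψ
  exists_eq : ∀ k, ∃ a b, ψ b ≠ 0 ∧ k * ψ b = ψ a

lemma IsFracHom.isFractionRing [IsDomain A] {ψ : A →+* K} (h : IsFracHom ψ) :
    let := ψ.toAlgebra; IsFractionRing A K := by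
  let := ψ.toAlgebra
  refine (isLocalization_iff (nonZeroDivisors A) K).mpr ⟨?_, ?_, ?_⟩
  · rintro ⟨b, hb⟩
    exact isUnit_iff_ne_zero.mpr
      ((map_ne_zero_iff ψ h.injective).mpr (nonZeroDivisors.ne_zero hb))
  · intro k
    obtain ⟨a, b, hb, hab⟩ := h.exists_eq k
    exact ⟨⟨a, ⟨b, mem_nonZeroDivisors_of_ne_zero fun h0 ↦ hb (by rw [h0, map_zero])⟩⟩, hab⟩
  · intro a b hab
    exact ⟨1, by rw [h.injective hab]⟩

lemma IsFracHom.of_comp {B : Type} [CommRing B] {ψ : A →+* K} (h : IsFracHom ψ) (φ : A →+* B)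
    (ψ' : B →+* K) (hφ : ψ'.comp φ = ψ) (inj : Function.Injective ψ') : IsFracHom ψ' := by
  refine ⟨inj, fun k ↦ ?_⟩
  obtain ⟨a, b, hb, hab⟩ := h.exists_eq k
  rw [← hφ] at hb hab
  exact ⟨φ a, φ b, hb, hab⟩

lemma exists_of_isIntegralElem [IsDomain A] [UniqueFactorizationMonoid A] {ψ : A →+* K}
    (hψ : IsFracHom ψ) {k : K} (hk : ψ.IsIntegralElem k) : ∃ a, ψ a = k := by
  let := ψ.toAlgebra
  have hfr : IsFractionRing A K := hψ.isFractionRing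
  exact IsIntegrallyClosed.algebraMap_eq_of_integral (R := A) hk

/-- A factorial domain is integrally closed, so a square root of `β` would lie in `A`, and a
squarefree nonunit is not a square in `A`. -/
lemma not_exists_sq [IsDomain A] [UniqueFactorizationMonoid A] {ψ : A →+* K}
    (hψ : IsFracHom ψ) {β : A} (hβ : Squarefree β) (hu : ¬ IsUnit β) (k : K) : k ^ 2 ≠ ψ β := by
  intro h
  obtain ⟨a, rfl⟩ := exists_of_isIntegralElem hψ (k := k)
    ⟨X ^ 2 - C β, monic_X_pow_sub_C β two_ne_zero, by simp [h]⟩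
  rw [← map_pow] at h
  have h' := hψ.injective h
  have := hβ a (by rw [← h', sq])
  exact hu (h' ▸ this.pow 2)

/-- For `z = a + b w` integral over `A`, the trace `2 a` and the norm `a² - b² β` lie in `A`. As `2`
is invertible, `a` and `b² β` lie in `A`. If `b = n / m` in lowest terms, then `m²` divides `β`, so
`m` is a unit by squarefreeness. -/
lemma exists_of_isIntegralElem_quad [IsDomain A] [UniqueFactorizationMonoid A] {ψ : A →+* K}
    (hψ : IsFracHom ψ) (h2 : IsUnit (2 : A)) {β : A} (hβ : Squarefree β) {w : L}
    (hw : w ^ 2 = algebraMap K L (ψ β)) (hwK : ∀ k : K, algebraMap K L k ≠ w)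
    (hL : ∀ z : L, ∃ a b : K, z = algebraMap K L a + algebraMap K L b * w) {z : L}
    (hz : ((algebraMap K L).comp ψ).IsIntegralElem z) :
    ∃ p q : A, z = algebraMap K L (ψ p) + algebraMap K L (ψ q) * w := by
  let := ψ.toAlgebra
  let := ((algebraMap K L).comp ψ).toAlgebra
  have : IsScalarTower A K L := .of_algebraMap_eq fun _ ↦ rfl
  have hfr : IsFractionRing A K := hψ.isFractionRing
  have : FaithfulSMul A L := by
    rw [faithfulSMul_iff_algebraMap_injective]
    exact (algebraMap K L).injective.comp hψ.injective
  have hz' : IsIntegral A z := hz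
  obtain ⟨a, b, hab⟩ := hL z
  by_cases hb : b = 0
  · subst hb
    rw [map_zero, zero_mul, add_zero] at hab
    have : IsIntegral A a := by
      rw [hab] at hz'
      exact (isIntegral_algebraMap_iff (algebraMap K L).injective).mp hz'
    obtain ⟨p, hp⟩ := exists_of_isIntegralElem hψ this
    exact ⟨p, 0, by rw [hab, hp]; simp⟩
  have hzK : ∀ k : K, algebraMap K L k ≠ z := by
    intro k hk
    apply hwK ((k - a) / b)
    have hb' : algebraMap K L b ≠ 0 := by simpa using hb
    rw [map_div₀, map_sub, hk, hab]
    field_simp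
    ring
  -- The polynomial with roots `a ± b w`. It is minimal because `z` is not in `K`, so it has
  -- coefficients in the integrally closed ring `A`.
  set Q : K[X] := X ^ 2 - C (2 * a) * X + C (a ^ 2 - b ^ 2 * ψ β) with hQ
  have hQm : Q.Monic := by rw [hQ]; monicity!
  have hQd : Q.natDegree = 2 := by rw [hQ]; compute_degree!
  have hQz : aeval z Q = 0 := by
    rw [hQ, hab]
    simp only [map_add, map_sub, map_mul, aeval_C, aeval_X, map_pow, map_ofNat]
    linear_combination (algebraMap K L b) ^ 2 * hw
  have hzi : IsIntegral K z := hz'.tower_top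
  have hmin : minpoly K z = Q := by
    refine (eq_of_monic_of_dvd_of_natDegree_le (minpoly.monic hzi) hQm (minpoly.dvd K z hQz)
      ?_).symm
    rw [hQd, minpoly.two_le_natDegree_iff hzi]
    rintro ⟨k, hk⟩
    exact hzK k hk
  have hmin' := minpoly.isIntegrallyClosed_eq_field_fractions' K hz'
  rw [hmin] at hmin'
  have hc : ∀ n, Q.coeff n = ψ ((minpoly A z).coeff n) := fun n ↦ by rw [hmin', coeff_map]; rfl
  have hc0 := hc 0
  have hc1 := hc 1
  have e0 : Q.coeff 0 = a ^ 2 - b ^ 2 * ψ β := by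
    rw [hQ, coeff_add, coeff_C_zero, coeff_sub, coeff_C_mul]; simp
  have e1 : Q.coeff 1 = - (2 * a) := by
    rw [hQ, coeff_add, coeff_C_succ, coeff_sub, coeff_C_mul, coeff_X_one, coeff_X_pow]; simp
  rw [e0] at hc0
  rw [e1] at hc1
  obtain ⟨v, hv⟩ := h2.exists_left_inv
  have hv' : ψ v * 2 = 1 := by rw [← map_ofNat ψ 2, ← map_mul, hv, map_one]
  obtain ⟨p, hp⟩ : ∃ p, ψ p = a := by
    refine ⟨-(v * (minpoly A z).coeff 1), ?_⟩
    rw [map_neg, map_mul, ← hc1]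
    linear_combination a * hv'
  obtain ⟨e, he⟩ : ∃ e, b ^ 2 * ψ β = ψ e := by
    refine ⟨p ^ 2 - (minpoly A z).coeff 0, ?_⟩
    rw [map_sub, map_pow, hp, ← hc0]; ring
  obtain ⟨n, m, hnm, hb'⟩ := IsFractionRing.exists_reduced_fraction (A := A) b
  have hm0 : ψ m ≠ 0 := (map_ne_zero_iff ψ hψ.injective).mpr (nonZeroDivisors.ne_zero m.2)
  have hb'' : b * ψ m = ψ n := by rw [← hb']; exact IsLocalization.mk'_spec K n m
  -- Clearing the denominator in `b² β = e`. Coprimality of `n` and `m` then moves `m²` onto `β`.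
  have hd : n ^ 2 * β = (m : A) ^ 2 * e := by
    apply hψ.injective
    simp only [map_mul, map_pow]
    rw [← hb'', ← he]; ring
  have hdvd : (m : A) ^ 2 ∣ β := by
    have : IsRelPrime ((m : A) ^ 2) (n ^ 2) := (hnm.symm.pow_left).pow_right
    exact this.dvd_of_dvd_mul_left ⟨e, hd⟩
  have hmu := hβ m (by rwa [← sq])
  obtain ⟨v', hv'⟩ := hmu.exists_right_inv
  refine ⟨p, n * v', ?_⟩
  have : ψ (n * v') = b := by
    rw [map_mul, ← hb'', mul_assoc, ← map_mul, hv', map_one, mul_one]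
  rw [hab, hp, this]

/-- Elements that become integral after multiplication by powers of `u`. -/
lemma exists_pow_mul_isIntegralElem {A' : Type} [CommRing A'] {φ : A →+* L} {φ' : A' →+* L} (u : A')
    (h : ∀ a, ∃ (N : ℕ) (a' : A'), φ' u ^ N * φ a = φ' a') {z : L} (hz : φ.IsIntegralElem z) :
    ∃ N : ℕ, φ'.IsIntegralElem (φ' u ^ N * z) := by
  obtain ⟨p, hp, hpz⟩ := hz
  choose N a' hN using h
  -- A common exponent that clears the denominators of all coefficients simultaneously.
  let M := p.support.sup fun i ↦ N (p.coeff i)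
  have hM : ∀ i, ∃ b, φ' u ^ M * φ (p.coeff i) = φ' b := by
    intro i
    by_cases hi : i ∈ p.support
    · have hle : N (p.coeff i) ≤ M := Finset.le_sup (f := fun i ↦ N (p.coeff i)) hi
      refine ⟨u ^ (M - N (p.coeff i)) * a' (p.coeff i), ?_⟩
      rw [map_mul, ← hN, map_pow, ← mul_assoc, ← pow_add, Nat.sub_add_cancel hle]
    · exact ⟨0, by rw [notMem_support_iff.mp hi]; simp⟩
  refine ⟨M, ?_⟩
  -- Scaling the roots by `u ^ M` multiplies the coefficient of degree `i` by a power of `u ^ M`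
  -- that is positive below the leading term, which is enough to move it into `A'`.
  set q := (p.map φ).scaleRoots (φ' u ^ M) with hq
  have hqm : q.Monic := (monic_scaleRoots_iff _).mpr (hp.map φ)
  have hqz : Polynomial.eval (φ' u ^ M * z) q = 0 := by
    have := scaleRoots_eval₂_mul (p := p.map φ) (RingHom.id L) z (φ' u ^ M)
    rw [RingHom.id_apply] at this
    rw [hq, Polynomial.eval, this, ← Polynomial.eval, Polynomial.eval_map, hpz, mul_zero]
  have hl : q ∈ lifts φ' := by
    rw [lifts_iff_coeff_lifts]
    intro i
    rw [hq, coeff_scaleRoots, coeff_map]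
    obtain hi | hi := lt_or_ge i (p.map φ).natDegree
    · obtain ⟨b, hb⟩ := hM i
      refine ⟨b * (u ^ M) ^ ((p.map φ).natDegree - i - 1), ?_⟩
      obtain ⟨k, hk⟩ : ∃ k, (p.map φ).natDegree - i = k + 1 := ⟨(p.map φ).natDegree - i - 1, by omega⟩
      rw [hk, map_mul, ← hb, Nat.add_sub_cancel, pow_succ, map_pow, map_pow]; ring
    · obtain rfl | hi := eq_or_lt_of_le hi
      · refine ⟨1, ?_⟩
        have : φ (p.coeff (p.map φ).natDegree) = 1 := by
          rw [← coeff_map]; exact (hp.map φ)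
        rw [this]; simp
      · refine ⟨0, ?_⟩
        rw [← coeff_map, coeff_eq_zero_of_natDegree_lt hi]; simp
  obtain ⟨q', hq', -, hqm'⟩ := lifts_and_natDegree_eq_and_monic hl hqm
  refine ⟨q', hqm', ?_⟩
  rw [← Polynomial.eval_map, hq', hqz]

/-- A form of normality: `D` contains the integral elements `z` with `x z ∈ D` if `D / x` is
reduced. -/
lemma mem_range_of_isIntegralElem {D : Type} [CommRing D] {Δ : D →+* L}
    (hΔ : Function.Injective Δ) {x : D} (hx : ∀ (y : D) (n : ℕ), x ∣ y ^ n → x ∣ y)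
    (hx0 : x ≠ 0) {z : L} (hz : Δ.IsIntegralElem z) (n : ℕ) (h : ∃ y, Δ y = Δ x ^ n * z) :
    ∃ y, Δ y = z := by
  have hx0' : Δ x ≠ 0 := (map_ne_zero_iff Δ hΔ).mpr hx0
  induction n with
  | zero => simpa using h
  | succ n ih =>
    -- One factor of `x` is removed at a time.
    apply ih
    obtain ⟨y, hy⟩ := h
    have hz' : Δ.IsIntegralElem (Δ x ^ n * z) := by
      rw [← map_pow]; exact (Δ.isIntegralElem_map).mul _ hz
    obtain ⟨p, hp, hpz⟩ := hz'
    have hy' : Δ y = Δ x * (Δ x ^ n * z) := by rw [hy]; ring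
    have h1 : eval₂ Δ (Δ y) (scaleRoots p x) = 0 := by
      rw [hy']; exact scaleRoots_eval₂_eq_zero Δ hpz
    rw [eval₂_at_apply, map_eq_zero_iff Δ hΔ] at h1
    -- In the scaled equation satisfied by `y` every nonleading coefficient is divisible by `x`, so
    -- only the leading power of `y` survives modulo `x`.
    have h2 : x ∣ y ^ p.natDegree := by
      have h3 := congrArg (Ideal.Quotient.mk (Ideal.span {x})) h1
      rw [map_zero, eval_eq_sum_range, map_sum, natDegree_scaleRoots,
        Finset.sum_range_succ, Finset.sum_eq_zero, zero_add] at h3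
      · rw [Ideal.Quotient.eq_zero_iff_mem, Ideal.mem_span_singleton, coeff_scaleRoots,
          hp.coeff_natDegree] at h3
        simpa using h3
      · intro i hi
        rw [Finset.mem_range] at hi
        rw [Ideal.Quotient.eq_zero_iff_mem, Ideal.mem_span_singleton, coeff_scaleRoots]
        exact Dvd.dvd.mul_right (Dvd.dvd.mul_left (dvd_pow_self x (by omega)) _) _
    obtain ⟨y', rfl⟩ := hx y _ h2
    refine ⟨y', mul_left_cancel₀ hx0' ?_⟩
    rw [← map_mul, hy']

end Quadratic

/-! ### The branch functions in the charts of the second blow-up -/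

section Branch

open Polynomial

/-- If `ψ' b = 0`, write `g ^ n b = φ a`. Then `ψ a = 0`, so `a = 0`, and `g` is not a zero divisor.
-/
lemma IsBlowupChart.injective_of_comp {A B K : Type} [CommRing A] [CommRing B] [Field K]
    {I : Ideal A} {g : A} {φ : A →+* B} (h : IsBlowupChart I g φ) {ψ : A →+* K}
    (hψ : Function.Injective ψ) {ψ' : B →+* K} (hc : ψ'.comp φ = ψ) : Function.Injective ψ' := by
  rw [injective_iff_map_eq_zero]
  intro b hb
  obtain ⟨n, a, -, ha⟩ := h.exists_eq b
  have : ψ a = 0 := by rw [← hc, RingHom.comp_apply, ← ha, map_mul, hb, mul_zero]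
  rw [map_eq_zero_iff ψ hψ] at this
  rw [this, map_zero] at ha
  exact (mul_left_mem_nonZeroDivisors_eq_zero_iff (pow_mem h.mem_nonZeroDivisors n)).mp ha

variable (f₃ f₆ : ℂ[X])

/-- The branch curve in the chart with coordinates `t`, `u = 1 / x`. -/
def gC : ℂ[X][X] := X ^ 3 * C f₃ + C f₆

/-- The branch curve in the chart with coordinates `t`, `s = x / f₃`. -/
def gA : ℂ[X][X] := X + C (f₃ ^ 2 * f₆) * X ^ 4

/-- The coordinate ring of the chart with coordinates `t`, `x`, `r = f₃ / x`. -/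
abbrev AB : Type := AdjoinRoot (C X * X - C (C f₃) : ℂ[X][X][X])

/-- The branch curve in the chart with coordinates `t`, `x`, `r = f₃ / x`. -/
def gB : AB f₃ := AdjoinRoot.root _ + AdjoinRoot.of _ (X ^ 2 * C f₆)

/-- The chart `x = f₃ s` of the blow-up. -/
def φA : ℂ[X][X] →+* ℂ[X][X] := eval₂RingHom C (C f₃ * X)

/-- The chart `f₃ = x r` of the blow-up. -/
def φB : ℂ[X][X] →+* AB f₃ := AdjoinRoot.of _

variable {f₃ f₆}

lemma subring_polynomial_eq_top {R : Type} [CommRing R] (S : Subring R[X]) (hC : ∀ a, C a ∈ S)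
    (hX : X ∈ S) : S = ⊤ := by
  rw [eq_top_iff]
  rintro p -
  induction p using Polynomial.induction_on' with
  | add p q hp hq => exact add_mem hp hq
  | monomial n a =>
    rw [← C_mul_X_pow_eq_monomial]
    exact mul_mem (hC a) (pow_mem hX n)

lemma subring_adjoinRoot_eq_top {R : Type} [CommRing R] {G : R[X]} (S : Subring (AdjoinRoot G))
    (hC : ∀ a, AdjoinRoot.of G a ∈ S) (hX : AdjoinRoot.root G ∈ S) : S = ⊤ := by
  have h := subring_polynomial_eq_top (S.comap (AdjoinRoot.mk G)) hC hX
  rw [eq_top_iff]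
  rintro p -
  obtain ⟨p, rfl⟩ := AdjoinRoot.mk_surjective p
  exact (h ▸ Subring.mem_top p : p ∈ _)

lemma X_mul_root : φB f₃ X * AdjoinRoot.root _ = φB f₃ (C f₃) := by
  have := AdjoinRoot.eval₂_root (C X * X - C (C f₃) : ℂ[X][X][X])
  rw [eval₂_sub, eval₂_mul, eval₂_C, eval₂_X, eval₂_C, sub_eq_zero] at this
  exact this

lemma φA_injective (h : f₃ ≠ 0) : Function.Injective (φA f₃) := by
  rw [injective_iff_map_eq_zero]
  intro p hp
  ext1 n
  have h1 := congrArg (fun q ↦ coeff q n) hp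
  change (p.comp (C f₃ * X)).coeff n = _ at h1
  rw [comp_C_mul_X_coeff, coeff_zero, mul_eq_zero] at h1
  rw [coeff_zero]
  exact h1.resolve_right (pow_ne_zero _ h)

lemma prime_C_X : Prime (C (X : ℂ[X][X])) := prime_C_iff.mpr prime_X

lemma not_C_X_dvd (h : f₃ ≠ 0) : ¬ C (X : ℂ[X][X]) ∣ C (C f₃) := by
  rw [C_dvd_iff_dvd_coeff]
  intro h'
  have := h' 0
  rw [coeff_C_zero, X_dvd_iff, coeff_C_zero] at this
  exact h this

/-- If `x y` is a multiple `(x r - f₃) z`, then the prime `x` divides `f₃ z` but not `f₃`, so it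
divides `z` and can be cancelled. -/
lemma φB_X_mem_nonZeroDivisors (h : f₃ ≠ 0) : φB f₃ X ∈ nonZeroDivisors (AB f₃) := by
  rw [mem_nonZeroDivisors_iff_right]
  intro y hy
  obtain ⟨y, rfl⟩ := AdjoinRoot.mk_surjective y
  rw [φB, ← AdjoinRoot.mk_C, ← map_mul, AdjoinRoot.mk_eq_zero] at hy
  rw [AdjoinRoot.mk_eq_zero]
  obtain ⟨z, hz⟩ := hy
  have h1 : C (X : ℂ[X][X]) ∣ C (C f₃) * z :=
    ⟨X * z - y, by linear_combination hz⟩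
  obtain ⟨z', rfl⟩ := (prime_C_X.dvd_or_dvd h1).resolve_left (not_C_X_dvd h)
  refine ⟨z', mul_right_cancel₀ prime_C_X.ne_zero ?_⟩
  rw [hz]; ring

/-- Nonzero multiples of `x r - f₃` have positive degree in `r`. -/
lemma φB_injective : Function.Injective (φB f₃) := by
  rw [injective_iff_map_eq_zero]
  intro p hp
  rw [φB, ← AdjoinRoot.mk_C, AdjoinRoot.mk_eq_zero] at hp
  obtain ⟨z, hz⟩ := hp
  by_contra hp0
  have hz0 : z ≠ 0 := by
    rintro rfl
    rw [mul_zero, C_eq_zero] at hz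
    exact hp0 hz
  have hd : (C X * X - C (C f₃) : ℂ[X][X][X]).natDegree = 1 := by
    rw [natDegree_sub_C, natDegree_C_mul_X _ X_ne_zero]
  have := congrArg natDegree hz
  rw [natDegree_C, natDegree_mul (ne_zero_of_natDegree_gt (n := 0) (by omega)) hz0, hd] at this
  omega

lemma isBlowupChart_φA (h : f₃ ≠ 0) :
    IsBlowupChart (Ideal.span {X, C f₃}) (C f₃) (φA f₃) := by
  have hC : φA f₃ (C f₃) = C f₃ := eval₂_C _ _
  have hX : φA f₃ X = C f₃ * X := eval₂_X _ _
  refine .of_adjoin (Ideal.subset_span (by simp)) ?_ ?_ (φA_injective h) {X} ?_ ?_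
  · rw [hC]; exact mem_nonZeroDivisors_of_ne_zero (C_ne_zero.mpr h)
  · intro a ha
    obtain ⟨c, d, rfl⟩ := Ideal.mem_span_pair.mp ha
    rw [hC]
    refine ⟨φA f₃ c * X + φA f₃ d, ?_⟩
    rw [map_add, map_mul, map_mul, hC, hX]; ring
  · exact subring_polynomial_eq_top _ (fun a ↦ Subring.subset_closure (.inl ⟨C a, eval₂_C _ _⟩))
      (Subring.subset_closure (.inr rfl))
  · rintro _ rfl
    exact ⟨X, Ideal.subset_span (by simp), by rw [hC, hX]⟩

lemma isBlowupChart_φB (h : f₃ ≠ 0) :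
    IsBlowupChart (Ideal.span {X, C f₃}) X (φB f₃) := by
  refine .of_adjoin (Ideal.subset_span (by simp)) (φB_X_mem_nonZeroDivisors h) ?_ φB_injective
    {AdjoinRoot.root _} ?_ ?_
  · intro a ha
    obtain ⟨c, d, rfl⟩ := Ideal.mem_span_pair.mp ha
    refine ⟨φB f₃ c + φB f₃ d * AdjoinRoot.root _, ?_⟩
    rw [map_add, map_mul, map_mul, ← X_mul_root]; ring
  · exact subring_adjoinRoot_eq_top _ (fun a ↦ Subring.subset_closure (.inl ⟨a, rfl⟩))
      (Subring.subset_closure (.inr rfl))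
  · rintro _ rfl
    exact ⟨C f₃, Ideal.subset_span (by simp), X_mul_root⟩

/-- A common divisor with a nonzero constant is itself constant, so it divides every coefficient of
`q`. One coefficient coprime to `a` suffices. -/
lemma isRelPrime_C {a : ℂ[X]} (ha : a ≠ 0) {q : ℂ[X][X]} (n : ℕ) (hq : IsRelPrime a (q.coeff n)) :
    IsRelPrime (C a) q := by
  intro d hd hdq
  have hdeg : d.natDegree = 0 := by
    have := natDegree_le_of_dvd hd (C_ne_zero.mpr ha)
    rwa [natDegree_C, Nat.le_zero] at this
  rw [eq_C_of_natDegree_eq_zero hdeg] at hd hdq ⊢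
  refine isUnit_C.mpr (hq ?_ ?_)
  · rw [C_dvd_iff_dvd_coeff] at hd
    simpa using hd 0
  · rw [C_dvd_iff_dvd_coeff] at hdq
    exact hdq n

lemma isRelPrime_X {q : ℂ[X][X]} (h : q.coeff 0 ≠ 0) : IsRelPrime X q := by
  intro d hd hdq
  rw [(irreducible_X (R := ℂ[X])).dvd_iff] at hd
  refine hd.resolve_right fun h' ↦ h ?_
  exact X_dvd_iff.mp (h'.dvd.trans hdq)

lemma coeff_zero_gC : (gC f₃ f₆).coeff 0 = f₆ := by simp [gC]

lemma coeff_three_gC : (gC f₃ f₆).coeff 3 = f₃ := by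
  simp [gC]

lemma derivative_gC : derivative (gC f₃ f₆) = C 3 * (X ^ 2 * C f₃) := by
  rw [gC, derivative_add, derivative_C, derivative_mul, derivative_C, derivative_X_pow]
  simp; ring

lemma isUnit_C_natCast {n : ℕ} (h : n ≠ 0) : IsUnit (C (n : ℂ[X])) := by
  rw [isUnit_C, ← C_eq_natCast, isUnit_C]
  exact isUnit_iff_ne_zero.mpr (by exact_mod_cast h)

/-- A square factor divides the derivative `3 u² f₃` in `u`. But `gC` is coprime to `u`, its
constant term `f₆` being nonzero, and to `f₃`, since `f₃` and `f₆` are coprime. -/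
lemma squarefree_gC (hF : Squarefree (f₃ * f₆)) : Squarefree (gC f₃ f₆) := by
  intro h hh
  have h1 : h ∣ gC f₃ f₆ := (dvd_mul_right h h).trans hh
  have h2 : h ∣ derivative (gC f₃ f₆) := by
    obtain ⟨q, hq⟩ := hh
    rw [hq, derivative_mul, derivative_mul]
    exact ⟨derivative h * q + derivative h * q + h * derivative q, by ring⟩
  rw [derivative_gC] at h2
  have h3 : h ∣ X ^ 2 * C f₃ := (isUnit_C_natCast (n := 3) (by norm_num)).dvd_mul_left.mp h2
  have h4 : IsRelPrime (X ^ 2) (gC f₃ f₆) := .pow_left (isRelPrime_X (by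
    rw [coeff_zero_gC]; exact right_ne_zero_of_mul hF.ne_zero))
  have h5 : IsRelPrime (C f₃) (gC f₃ f₆) := isRelPrime_C (left_ne_zero_of_mul hF.ne_zero) 0 (by
    rw [coeff_zero_gC]; exact (squarefree_mul_iff.mp hF).1)
  exact (h4.mul_left h5) h3 h1

lemma not_isUnit_gC (h : f₃ ≠ 0) : ¬ IsUnit (gC f₃ f₆) := by
  intro hu
  obtain ⟨c, -, hc⟩ := Polynomial.isUnit_iff.mp hu
  have := coeff_three_gC (f₃ := f₃) (f₆ := f₆)
  rw [← hc, coeff_C_succ] at this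
  exact h this.symm

lemma derivative_gA : derivative (gA f₃ f₆) = 1 + C (4 * (f₃ ^ 2 * f₆)) * X ^ 3 := by
  rw [gA, derivative_add, derivative_X, derivative_C_mul, derivative_X_pow, C_mul]
  simp; ring

lemma squarefree_gA : Squarefree (gA f₃ f₆) := by
  refine Separable.squarefree ?_
  obtain ⟨v, hv⟩ := (isUnit_C_natCast (n := 3) (by norm_num)).exists_right_inv
  have hv : (3 : ℂ[X][X]) * v = 1 := by rwa [Nat.cast_ofNat, map_ofNat] at hv
  -- Bézout coefficients for `g = s + c s⁴` and `g' = 1 + 4 c s³`, where `c = f₃² f₆` and `v = 1 /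
  -- 3`.
  refine ⟨-16 * v * C (f₃ ^ 2 * f₆) * X ^ 2, 1 + 4 * v * C (f₃ ^ 2 * f₆) * X ^ 3, ?_⟩
  rw [derivative_gA, gA, C_mul (a := 4), map_ofNat]
  linear_combination (-4 * C (f₃ ^ 2 * f₆) * X ^ 3) * hv

/-! ### Exchanging `x` and `1 / x` -/

section Inverse

variable {K : Type} [Field K] {τ : ℂ[X] →+* K} {x : K}

lemma eval₂_inv_reverse (hx : x ≠ 0) (p : ℂ[X][X]) :
    eval₂RingHom τ x⁻¹ p.reverse * x ^ p.natDegree = eval₂RingHom τ x p := by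
  let := invertibleOfNonzero hx
  have := eval₂_reverse_mul_pow τ x p
  rwa [invOf_eq_inv] at this

lemma eval₂_reverse_inv (hx : x ≠ 0) (p : ℂ[X][X]) :
    eval₂RingHom τ x p.reverse * x⁻¹ ^ p.natDegree = eval₂RingHom τ x⁻¹ p := by
  have := eval₂_inv_reverse (τ := τ) (inv_ne_zero hx) p
  rwa [inv_inv] at this

/-- Reversing polynomials turns expressions in `x` into expressions in `1 / x` up to powers of `x`.
These powers are compensated crosswise in numerator and denominator. -/
lemma isFracHom_inv (hx : x ≠ 0) (h : IsFracHom (eval₂RingHom τ x)) :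
    IsFracHom (eval₂RingHom τ x⁻¹) := by
  refine ⟨?_, fun k ↦ ?_⟩
  · rw [injective_iff_map_eq_zero]
    intro p hp
    rw [← eval₂_reverse_inv hx, mul_eq_zero, or_iff_left (pow_ne_zero _ (inv_ne_zero hx)),
      map_eq_zero_iff _ h.injective, reverse_eq_zero] at hp
    exact hp
  · obtain ⟨a, b, hb, hab⟩ := h.exists_eq k
    have hX : eval₂RingHom τ x⁻¹ X = x⁻¹ := eval₂_X _ _
    rw [← eval₂_inv_reverse hx] at hb hab
    rw [← eval₂_inv_reverse hx] at hab
    refine ⟨a.reverse * X ^ b.natDegree, b.reverse * X ^ a.natDegree, ?_, ?_⟩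
    · rw [map_mul, map_pow, hX]
      exact mul_ne_zero (left_ne_zero_of_mul hb) (pow_ne_zero _ (inv_ne_zero hx))
    · rw [map_mul, map_mul, map_pow, map_pow, hX]
      calc _ = (k * (eval₂RingHom τ x⁻¹ b.reverse * x ^ b.natDegree)) * x⁻¹ ^ b.natDegree *
            x⁻¹ ^ a.natDegree := by
            rw [inv_pow, inv_pow]; field_simp
        _ = _ := by rw [hab, inv_pow, inv_pow]; field_simp

end Inverse

/-- The plane birational coordinates `t`, `x` and a square root of the branch function. -/
structure Frame (f₃ f₆ : ℂ[X]) (K L : Type) [Field K] [Field L] [Algebra K L] where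
  τ : ℂ[X] →+* K
  x : K
  w : L
  x_ne_zero : x ≠ 0
  isFracHom : IsFracHom (eval₂RingHom τ x)
  sq_eq : w ^ 2 = algebraMap K L (τ f₃ * x⁻¹ ^ 3 + τ f₆)
  exists_eq : ∀ z : L, ∃ a b : K, z = algebraMap K L a + algebraMap K L b * w

namespace Frame

variable {K L : Type} [Field K] [Field L] [Algebra K L] (𝔽 : Frame f₃ f₆ K L)

lemma τ_injective : Function.Injective 𝔽.τ := by
  have := 𝔽.isFracHom.injective.comp (C_injective (R := ℂ[X]))
  convert this
  ext; simp

/-- The function field as a field extension of the chart with coordinates `t`, `u = 1 / x`. -/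
def ψC : ℂ[X][X] →+* K := eval₂RingHom 𝔽.τ 𝔽.x⁻¹

/-- The function field as a field extension of the chart with coordinates `t`, `s = x / f₃`. -/
def ψA : ℂ[X][X] →+* K := eval₂RingHom 𝔽.τ (𝔽.x / 𝔽.τ f₃)

/-- The function field as a field extension of the chart with coordinates `t`, `x`,
`r = f₃ / x`. -/
def ψB : AB f₃ →+* K := AdjoinRoot.lift (eval₂RingHom 𝔽.τ 𝔽.x) (𝔽.τ f₃ / 𝔽.x) (by
  have := 𝔽.x_ne_zero
  simp; field_simp; simp)

lemma isFracHom_ψC : IsFracHom 𝔽.ψC := isFracHom_inv 𝔽.x_ne_zero 𝔽.isFracHom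

lemma τ_ne_zero (h : f₃ ≠ 0) : 𝔽.τ f₃ ≠ 0 := (map_ne_zero_iff _ 𝔽.τ_injective).mpr h

lemma ψA_comp (h : f₃ ≠ 0) : 𝔽.ψA.comp (φA f₃) = eval₂RingHom 𝔽.τ 𝔽.x := by
  have := 𝔽.τ_ne_zero h
  refine ringHom_ext' ?_ ?_
  · ext <;> simp [ψA, φA]
  · simp [ψA, φA]; field_simp

lemma ψB_comp : 𝔽.ψB.comp (φB f₃) = eval₂RingHom 𝔽.τ 𝔽.x := by
  ext <;> simp [ψB, φB]

lemma ψB_root : 𝔽.ψB (AdjoinRoot.root _) = 𝔽.τ f₃ / 𝔽.x := AdjoinRoot.lift_root _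

lemma isFracHom_ψA (h : f₃ ≠ 0) : IsFracHom 𝔽.ψA :=
  𝔽.isFracHom.of_comp (φA f₃) _ (𝔽.ψA_comp h)
    ((isBlowupChart_φA h).injective_of_comp 𝔽.isFracHom.injective (𝔽.ψA_comp h))

lemma isFracHom_ψB (h : f₃ ≠ 0) : IsFracHom 𝔽.ψB :=
  𝔽.isFracHom.of_comp (φB f₃) _ 𝔽.ψB_comp
    ((isBlowupChart_φB h).injective_of_comp 𝔽.isFracHom.injective 𝔽.ψB_comp)

lemma ψC_gC : 𝔽.ψC (gC f₃ f₆) = 𝔽.τ f₃ * 𝔽.x⁻¹ ^ 3 + 𝔽.τ f₆ := by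
  simp [ψC, gC]

/-- The square root of the branch function on the chart with coordinates `t`, `x`, `r`. -/
def wB : L := algebraMap K L 𝔽.x * 𝔽.w

/-- The square root of the branch function on the chart with coordinates `t`, `s`. -/
def wA : L := algebraMap K L (𝔽.x ^ 2 / 𝔽.τ f₃) * 𝔽.w

/-- With `r = f₃ / x` one has `x² (f₃ / x³ + f₆) = r + x² f₆`. -/
lemma wB_sq : 𝔽.wB ^ 2 = algebraMap K L (𝔽.ψB (gB f₃ f₆)) := by
  have hx := 𝔽.x_ne_zero
  have h1 : 𝔽.ψB (AdjoinRoot.of _ (X ^ 2 * C f₆)) = 𝔽.x ^ 2 * 𝔽.τ f₆ := by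
    simp [ψB]; ring
  rw [wB, mul_pow, 𝔽.sq_eq, ← map_pow, ← map_mul, gB, map_add, ψB_root, h1]
  congr 1
  field_simp

/-- With `s = x / f₃` one has `(x² / f₃)² (f₃ / x³ + f₆) = s + f₃² f₆ s⁴`. -/
lemma wA_sq (h : f₃ ≠ 0) : 𝔽.wA ^ 2 = algebraMap K L (𝔽.ψA (gA f₃ f₆)) := by
  have hx := 𝔽.x_ne_zero
  have h0 := 𝔽.τ_ne_zero h
  rw [wA, mul_pow, 𝔽.sq_eq, ← map_pow, ← map_mul]
  congr 1
  simp [ψA, gA, C_pow, -map_pow, eval₂_pow]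
  field_simp

/-- `gC` is a squarefree nonunit in a factorial ring. The other two square roots differ from `w` by
factors in `K` and inherit the property. -/
lemma w_notMem (hF : Squarefree (f₃ * f₆)) (k : K) : algebraMap K L k ≠ 𝔽.w := by
  intro h
  have h1 := 𝔽.sq_eq
  rw [← h, ← map_pow, ← ψC_gC] at h1
  exact not_exists_sq 𝔽.isFracHom_ψC (squarefree_gC hF)
    (not_isUnit_gC (left_ne_zero_of_mul hF.ne_zero)) k ((algebraMap K L).injective h1)

lemma wB_notMem (hF : Squarefree (f₃ * f₆)) (k : K) : algebraMap K L k ≠ 𝔽.wB := by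
  intro h
  have hx := 𝔽.x_ne_zero
  apply 𝔽.w_notMem hF (k / 𝔽.x)
  rw [map_div₀, h, wB, mul_div_cancel_left₀]
  simpa using hx

lemma wA_notMem (hF : Squarefree (f₃ * f₆)) (k : K) : algebraMap K L k ≠ 𝔽.wA := by
  intro h
  have hx := 𝔽.x_ne_zero
  have h0 := 𝔽.τ_ne_zero (left_ne_zero_of_mul hF.ne_zero)
  apply 𝔽.w_notMem hF (k / (𝔽.x ^ 2 / 𝔽.τ f₃))
  rw [map_div₀, h, wA, mul_div_cancel_left₀]
  simpa using ⟨hx, h0⟩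

end Frame

/-- The affine double cover with branch function `g`. -/
abbrev Dbl {A : Type} [CommRing A] (g : A) : Type := AdjoinRoot (X ^ 2 - C g : A[X])

/-! ### Affine double covers -/

section Dbl

variable {A K L : Type} [CommRing A] [Field K] [Field L] [Algebra K L]

lemma natDegree_dbl [Nontrivial A] (g : A) : (X ^ 2 - C g : A[X]).natDegree = 2 :=
  natDegree_X_pow_sub_C

lemma monic_dbl (g : A) : (X ^ 2 - C g : A[X]).Monic := monic_X_pow_sub_C g two_ne_zero

/-- The square root of the branch function. -/
abbrev Dbl.root (g : A) : Dbl g := AdjoinRoot.root _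

lemma Dbl.root_sq (g : A) : Dbl.root g ^ 2 = AdjoinRoot.of _ g := by
  have := AdjoinRoot.eval₂_root (X ^ 2 - C g : A[X])
  rw [eval₂_sub, eval₂_C, eval₂_pow, eval₂_X, sub_eq_zero] at this
  exact this

lemma Dbl.exists_eq (g : A) (z : Dbl g) :
    ∃ a b : A, z = AdjoinRoot.of _ a + AdjoinRoot.of _ b * Dbl.root g := by
  cases subsingleton_or_nontrivial A
  · have := Module.subsingleton A (Dbl g)
    exact ⟨0, 0, Subsingleton.elim _ _⟩
  obtain ⟨P, rfl⟩ := AdjoinRoot.mk_surjective z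
  have hm := monic_dbl g
  have h1 : (P %ₘ (X ^ 2 - C g)).natDegree ≤ 1 := by
    have := natDegree_modByMonic_lt P hm (by
      intro h; simpa [h] using (natDegree_dbl g).symm)
    rw [natDegree_dbl] at this
    omega
  have h2 : AdjoinRoot.mk (X ^ 2 - C g) P = AdjoinRoot.mk (X ^ 2 - C g) (P %ₘ (X ^ 2 - C g)) := by
    rw [AdjoinRoot.mk_eq_mk]
    exact ⟨P /ₘ (X ^ 2 - C g), by
      linear_combination -modByMonic_add_div P (X ^ 2 - C g)⟩
  rw [h2, eq_X_add_C_of_natDegree_le_one h1]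
  exact ⟨(P %ₘ (X ^ 2 - C g)).coeff 0, (P %ₘ (X ^ 2 - C g)).coeff 1, by simp [add_comm]⟩

/-- The homomorphism from an affine double cover given by a square root of the branch function. -/
def Dbl.lift {g : A} (ψ : A →+* K) (w : L) (hw : w ^ 2 = algebraMap K L (ψ g)) : Dbl g →+* L :=
  AdjoinRoot.lift ((algebraMap K L).comp ψ) w (by simp [hw])

variable {g : A} {ψ : A →+* K} {w : L} (hw : w ^ 2 = algebraMap K L (ψ g))

lemma Dbl.lift_of (a : A) : Dbl.lift ψ w hw (AdjoinRoot.of _ a) = algebraMap K L (ψ a) :=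
  AdjoinRoot.lift_of _

lemma Dbl.lift_root : Dbl.lift ψ w hw (Dbl.root g) = w := AdjoinRoot.lift_root _

/-- Since `w` is not in `K`, the elements `1` and `w` are linearly independent over `K`. -/
lemma Dbl.lift_injective (hψ : Function.Injective ψ) (hwK : ∀ k : K, algebraMap K L k ≠ w) :
    Function.Injective (Dbl.lift ψ w hw) := by
  rw [injective_iff_map_eq_zero]
  intro z hz
  obtain ⟨a, b, rfl⟩ := Dbl.exists_eq g z
  rw [map_add, map_mul, lift_of, lift_of, lift_root] at hz
  have hb : ψ b = 0 := by
    by_contra hb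
    have hb' : algebraMap K L (ψ b) ≠ 0 := by simpa using hb
    apply hwK (-ψ a / ψ b)
    rw [map_div₀, map_neg]
    field_simp
    linear_combination -hz
  rw [hb, map_zero, zero_mul, add_zero, map_eq_zero] at hz
  rw [map_eq_zero_iff ψ hψ] at hz hb
  rw [hz, hb]; simp

end Dbl

/-! ### The affine double covers are integrally closed -/

section IntegralClosure

variable {K L : Type} [Field K] [Field L] [Algebra K L] (𝔽 : Frame f₃ f₆ K L)

namespace Frame

lemma isUnit_two : IsUnit (2 : ℂ[X][X]) := by
  have := isUnit_C_natCast (n := 2) (by norm_num)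
  rwa [Nat.cast_ofNat, map_ofNat] at this

lemma exists_lift_eq_C (hF : Squarefree (f₃ * f₆)) {z : L}
    (hz : ((algebraMap K L).comp 𝔽.ψC).IsIntegralElem z)
    (hw : 𝔽.w ^ 2 = algebraMap K L (𝔽.ψC (gC f₃ f₆))) :
    ∃ y, Dbl.lift 𝔽.ψC 𝔽.w hw y = z := by
  obtain ⟨p, q, rfl⟩ := exists_of_isIntegralElem_quad 𝔽.isFracHom_ψC isUnit_two
    (squarefree_gC hF) hw (𝔽.w_notMem hF) 𝔽.exists_eq hz
  exact ⟨AdjoinRoot.of _ p + AdjoinRoot.of _ q * Dbl.root _, by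
    rw [map_add, map_mul, Dbl.lift_of, Dbl.lift_of, Dbl.lift_root]⟩

lemma exists_lift_eq_A (hF : Squarefree (f₃ * f₆)) {z : L}
    (hz : ((algebraMap K L).comp 𝔽.ψA).IsIntegralElem z)
    (hw : 𝔽.wA ^ 2 = algebraMap K L (𝔽.ψA (gA f₃ f₆))) :
    ∃ y, Dbl.lift 𝔽.ψA 𝔽.wA hw y = z := by
  have hL : ∀ z : L, ∃ a b : K, z = algebraMap K L a + algebraMap K L b * 𝔽.wA := by
    intro z
    obtain ⟨a, b, rfl⟩ := 𝔽.exists_eq z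
    have hx := 𝔽.x_ne_zero
    have h0 := 𝔽.τ_ne_zero (left_ne_zero_of_mul hF.ne_zero)
    refine ⟨a, b * (𝔽.τ f₃ / 𝔽.x ^ 2), ?_⟩
    rw [wA, ← mul_assoc, ← map_mul]
    congr 3
    field_simp
  obtain ⟨p, q, rfl⟩ := exists_of_isIntegralElem_quad
    (𝔽.isFracHom_ψA (left_ne_zero_of_mul hF.ne_zero)) isUnit_two
    squarefree_gA hw (𝔽.wA_notMem hF) hL hz
  exact ⟨AdjoinRoot.of _ p + AdjoinRoot.of _ q * Dbl.root _, by
    rw [map_add, map_mul, Dbl.lift_of, Dbl.lift_of, Dbl.lift_root]⟩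

end Frame

section Reduction

variable {R : Type} [CommRing R] (q : ℂ[X] →+* R) (hq : q f₃ = 0)

/-- Reduction modulo `x`. -/
def redAB : AB f₃ →+* R[X] :=
  -- Modulo `x` the relation `x r = f₃` becomes `f₃ = 0`, and `w² = r + x² f₆` becomes `w² = r`. So
  -- `r` goes to `X ^ 2`, the variable `X` standing for `w`.
  AdjoinRoot.lift (eval₂RingHom (C.comp q) 0) (X ^ 2) (by simp [hq])

lemma redAB_φB (p : ℂ[X][X]) : redAB q hq (φB f₃ p) = C (q (p.coeff 0)) := by
  rw [redAB, φB, AdjoinRoot.lift_of, coe_eval₂RingHom, eval₂_at_zero, RingHom.comp_apply]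

lemma redAB_root : redAB q hq (AdjoinRoot.root _) = X ^ 2 := by
  rw [redAB, AdjoinRoot.lift_root]

lemma redAB_gB : redAB q hq (gB f₃ f₆) = X ^ 2 := by
  have : gB f₃ f₆ = AdjoinRoot.root _ + φB f₃ (X ^ 2 * C f₆) := rfl
  rw [this, map_add, redAB_root, redAB_φB]
  simp

variable (f₆) in
/-- Reduction of the double cover modulo `x`. -/
def redB : Dbl (gB f₃ f₆) →+* R[X] :=
  AdjoinRoot.lift (redAB q hq) X (by
    rw [eval₂_sub, eval₂_X_pow, eval₂_C, redAB_gB, sub_self])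

lemma redB_of (a : AB f₃) : redB f₆ q hq (AdjoinRoot.of _ a) = redAB q hq a := by
  rw [redB, AdjoinRoot.lift_of]

lemma redB_root : redB f₆ q hq (Dbl.root _) = X := by
  rw [redB, AdjoinRoot.lift_root]

end Reduction

lemma exists_eval₂_add_mul {R D : Type} [CommRing R] [CommRing D] (σ : R →+* D) (x w : D)
    (h : ∀ S : Subring D, (∀ a, σ a ∈ S) → x ∈ S → w ∈ S → S = ⊤) (y : D) :
    ∃ (P : R[X]) (y' : D), y = eval₂ σ w P + x * y' := by
  let S : Subring D :=
    { carrier := { y | ∃ (P : R[X]) (y' : D), y = eval₂ σ w P + x * y' }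
      mul_mem' := by
        rintro _ _ ⟨P, y, rfl⟩ ⟨Q, z, rfl⟩
        exact ⟨P * Q, y * eval₂ σ w Q + z * eval₂ σ w P + x * y * z, by rw [eval₂_mul]; ring⟩
      one_mem' := ⟨1, 0, by simp⟩
      add_mem' := by
        rintro _ _ ⟨P, y, rfl⟩ ⟨Q, z, rfl⟩
        exact ⟨P + Q, y + z, by rw [eval₂_add]; ring⟩
      zero_mem' := ⟨0, 0, by simp⟩
      neg_mem' := by
        rintro _ ⟨P, y, rfl⟩
        exact ⟨-P, -y, by rw [eval₂_neg]; ring⟩ }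
  have hS : S = ⊤ := h S (fun a ↦ ⟨C a, 0, by simp⟩) ⟨0, 1, by simp⟩ ⟨X, 0, by simp⟩
  exact (hS ▸ Subring.mem_top y : y ∈ S)

/-- The generator `r` is redundant on the double cover, as `r = w² - x² f₆`. -/
lemma subring_dblB_eq_top (S : Subring (Dbl (gB f₃ f₆)))
    (hσ : ∀ a, AdjoinRoot.of _ (φB f₃ (C a)) ∈ S) (hx : AdjoinRoot.of _ (φB f₃ X) ∈ S)
    (hw : Dbl.root _ ∈ S) : S = ⊤ := by
  have h1 : (S.comap (AdjoinRoot.of _)).comap (φB f₃) = ⊤ := subring_polynomial_eq_top _ hσ hx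
  have h2 : ∀ p, AdjoinRoot.of _ (φB f₃ p) ∈ S := fun p ↦ (h1 ▸ Subring.mem_top p : p ∈ _)
  refine subring_adjoinRoot_eq_top _ (fun a ↦ ?_) hw
  have h3 : S.comap (AdjoinRoot.of _) = ⊤ := subring_adjoinRoot_eq_top _ h2 (by
    have := (Dbl.root_sq (gB f₃ f₆)).trans (map_add (AdjoinRoot.of _) (AdjoinRoot.root _)
      (φB f₃ (X ^ 2 * C f₆)))
    rw [← sub_eq_iff_eq_add] at this
    rw [Subring.mem_comap, ← this]
    exact sub_mem (pow_mem hw 2) (h2 _))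
  exact (h3 ▸ Subring.mem_top a : a ∈ _)

/-- Write `y = P(w) + x y'`. If the reduction vanishes, the coefficients of `P` are multiples of `f₃
= x r`, so `x` divides `y`. -/
lemma of_X_dvd_of_redB_eq_zero {R : Type} [CommRing R] (q : ℂ[X] →+* R)
    (hq : ∀ a, q a = 0 ↔ f₃ ∣ a) {y : Dbl (gB f₃ f₆)}
    (h : redB f₆ q ((hq _).mpr dvd_rfl) y = 0) : AdjoinRoot.of _ (φB f₃ X) ∣ y := by
  set σ : ℂ[X] →+* Dbl (gB f₃ f₆) := (AdjoinRoot.of _).comp ((φB f₃).comp C) with hσ'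
  obtain ⟨P, y', rfl⟩ := exists_eval₂_add_mul σ
    (AdjoinRoot.of _ (φB f₃ X)) (Dbl.root _) subring_dblB_eq_top y
  have hσ : (redB f₆ q ((hq _).mpr dvd_rfl)).comp σ = C.comp q := by
    refine RingHom.ext fun a ↦ ?_
    rw [RingHom.comp_apply, hσ', RingHom.comp_apply, RingHom.comp_apply, redB_of, redAB_φB,
      coeff_C_zero, RingHom.comp_apply]
  rw [map_add, map_mul, redB_of, redAB_φB, coeff_X_zero, map_zero, map_zero, zero_mul, add_zero,
    hom_eval₂, hσ, redB_root] at h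
  have h1 : P.map q = 0 := by rw [← h]; rfl
  refine dvd_add ?_ (dvd_mul_right _ _)
  rw [eval₂_eq_sum_range]
  refine Finset.dvd_sum fun i _ ↦ Dvd.dvd.mul_right ?_ _
  have h2 : (P.map q).coeff i = 0 := by rw [h1, coeff_zero]
  rw [coeff_map, hq] at h2
  obtain ⟨c, hc⟩ := h2
  rw [hc, hσ', RingHom.comp_apply, RingHom.comp_apply, C_mul, map_mul, ← X_mul_root, map_mul,
    map_mul]
  exact Dvd.intro _ (mul_assoc ..).symm

/-- Reduction modulo `x` takes values in polynomials in `w` over `ℂ[t] / f₃`. This ring is reduced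
because `f₃` is squarefree, so the reduction of `y`, being nilpotent, is zero. -/
lemma of_X_dvd_of_dvd_pow (h : Squarefree f₃) (y : Dbl (gB f₃ f₆)) (n : ℕ)
    (hy : AdjoinRoot.of _ (φB f₃ X) ∣ y ^ n) : AdjoinRoot.of _ (φB f₃ X) ∣ y := by
  have hq (a : ℂ[X]) : Ideal.Quotient.mk (Ideal.span {f₃}) a = 0 ↔ f₃ ∣ a := by
    rw [Ideal.Quotient.eq_zero_iff_mem, Ideal.mem_span_singleton]
  have : _root_.IsReduced (ℂ[X] ⧸ Ideal.span {f₃}) := by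
    rw [← Ideal.isRadical_iff_quotient_reduced, ← isRadical_iff_span_singleton]
    exact h.isRadical
  generalize hq' : Ideal.Quotient.mk (Ideal.span {f₃}) = q at hq
  apply of_X_dvd_of_redB_eq_zero q hq
  have h1 : redB f₆ q ((hq _).mpr dvd_rfl) y ^ n = 0 := by
    obtain ⟨c, hc⟩ := hy
    rw [← map_pow, hc, map_mul, redB_of, redAB_φB, coeff_X_zero, map_zero, map_zero, zero_mul]
  have h2 := Polynomial.isNilpotent_iff.mp (⟨n, h1⟩ : IsNilpotent (redB f₆ q _ y))
  ext1 i
  exact (h2 i).eq_zero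

namespace Frame

/-- The ring `x r = f₃` need not be factorial, so the trace and norm argument is not available. A
power of `u = 1 / x` makes `z` integral over chart `C`, where integral closedness is known. Thus `x
^ n z` lies in the double cover `D` for some `n`, and since `D` is reduced modulo `x`, so does `z`.
-/
lemma exists_lift_eq_B (hF : Squarefree (f₃ * f₆)) {z : L}
    (hz : ((algebraMap K L).comp 𝔽.ψB).IsIntegralElem z)
    (hw : 𝔽.wB ^ 2 = algebraMap K L (𝔽.ψB (gB f₃ f₆))) :
    ∃ y, Dbl.lift 𝔽.ψB 𝔽.wB hw y = z := by
  have hf₃ := left_ne_zero_of_mul hF.ne_zero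
  have hx := 𝔽.x_ne_zero
  have hwC : 𝔽.w ^ 2 = algebraMap K L (𝔽.ψC (gC f₃ f₆)) := by rw [𝔽.sq_eq, ψC_gC]
  have hXC : 𝔽.ψC X = 𝔽.x⁻¹ := eval₂_X _ _
  have hcB : ∀ p, 𝔽.ψB (φB f₃ p) = eval₂RingHom 𝔽.τ 𝔽.x p := fun p ↦
    RingHom.congr_fun 𝔽.ψB_comp p
  have hXB : 𝔽.ψB (φB f₃ X) = 𝔽.x := by rw [hcB]; exact eval₂_X _ _
  obtain ⟨N, hN⟩ := exists_pow_mul_isIntegralElem (φ := (algebraMap K L).comp 𝔽.ψB)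
    (φ' := (algebraMap K L).comp 𝔽.ψC) X (fun b ↦ by
      obtain ⟨n, a, -, ha⟩ := (isBlowupChart_φB (f₃ := f₃) hf₃).exists_eq b
      refine ⟨a.natDegree, a.reverse * X ^ n, ?_⟩
      have h1 := congrArg 𝔽.ψB ha
      rw [map_mul, map_pow, hXB, hcB, ← eval₂_inv_reverse hx] at h1
      rw [RingHom.comp_apply, RingHom.comp_apply, RingHom.comp_apply, map_mul 𝔽.ψC, map_pow 𝔽.ψC,
        hXC, ← map_pow, ← map_mul]
      congr 1
      calc _ = 𝔽.x⁻¹ ^ a.natDegree * (𝔽.x ^ n * 𝔽.ψB b) * 𝔽.x⁻¹ ^ n := by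
            rw [inv_pow, inv_pow]; field_simp
        _ = _ := by rw [h1, inv_pow, inv_pow, ψC]; field_simp) hz
  obtain ⟨y, hy⟩ := 𝔽.exists_lift_eq_C hF hN hwC
  obtain ⟨p, q, rfl⟩ := Dbl.exists_eq _ y
  rw [map_add, map_mul, Dbl.lift_of, Dbl.lift_of, Dbl.lift_root, RingHom.comp_apply, hXC] at hy
  have hz' : (Dbl.lift 𝔽.ψB 𝔽.wB hw).IsIntegralElem z := by
    obtain ⟨P, hP, hPz⟩ := hz
    refine ⟨P.map (AdjoinRoot.of _), hP.map _, ?_⟩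
    rw [eval₂_map]
    have h1 : (Dbl.lift 𝔽.ψB 𝔽.wB hw).comp (AdjoinRoot.of _) = (algebraMap K L).comp 𝔽.ψB :=
      RingHom.ext fun a ↦ Dbl.lift_of hw a
    rw [h1, hPz]
  have hinj := Dbl.lift_injective hw (𝔽.isFracHom_ψB hf₃).injective (𝔽.wB_notMem hF)
  have hxB : Dbl.lift 𝔽.ψB 𝔽.wB hw (AdjoinRoot.of _ (φB f₃ X)) = algebraMap K L 𝔽.x := by
    rw [Dbl.lift_of, hXB]
  have hxL : algebraMap K L 𝔽.x ≠ 0 := by simpa using hx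
  -- After multiplication by `x ^ (deg p + deg q)` the values of `p` and `q` at `1 / x` become
  -- polynomials in `x`. The extra factor `x` turns `w` into the root `x w` of this chart.
  refine mem_range_of_isIntegralElem hinj (of_X_dvd_of_dvd_pow (squarefree_mul_iff.mp hF).2.1)
    (fun h0 ↦ hxL (by rw [← hxB, h0, map_zero])) hz' (p.natDegree + q.natDegree + 1) ?_
  refine ⟨AdjoinRoot.of _ (φB f₃ (X ^ (N + q.natDegree + 1) * p.reverse)) +
    AdjoinRoot.of _ (φB f₃ (X ^ (N + p.natDegree) * q.reverse)) * Dbl.root _, ?_⟩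
  rw [map_add, map_mul (Dbl.lift _ _ hw), Dbl.lift_of, Dbl.lift_of, Dbl.lift_root, hxB, hcB, hcB]
  have hz2 : z = algebraMap K L 𝔽.x ^ N * (algebraMap K L (𝔽.ψC p) +
      algebraMap K L (𝔽.ψC q) * 𝔽.w) := by
    rw [hy, map_inv₀, inv_pow]; field_simp
  rw [hz2, ψC, ← eval₂_reverse_inv hx p, ← eval₂_reverse_inv hx q, wB]
  have hX : eval₂RingHom 𝔽.τ 𝔽.x X = 𝔽.x := eval₂_X _ _
  simp only [map_mul, map_pow, hX, map_inv₀, inv_pow]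
  field_simp
  ring

end Frame

end IntegralClosure

/-! ### The three types of charts in a uniform shape -/

section DoubleChart

/-- An affine chart of a normal double cover of a surface with function field `K`. -/
structure DoubleChart (K L : Type) [Field K] [Field L] [Algebra K L] where
  A : Type
  [commRing : CommRing A]
  g : A
  ψ : A →+* K
  w : L
  param : ℂ[X] →+* A
  sq_eq : w ^ 2 = algebraMap K L (ψ g)
  injective : Function.Injective ψ
  notMem (k : K) : algebraMap K L k ≠ w
  exists_lift_eq (z : L) : ((algebraMap K L).comp ψ).IsIntegralElem z →
    ∃ y, Dbl.lift ψ w sq_eq y = z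

attribute [instance] DoubleChart.commRing

namespace DoubleChart

variable {K L : Type} [Field K] [Field L] [Algebra K L] (𝒟 : DoubleChart K L)

/-- The coordinate ring of the double cover. -/
abbrev D : Type := Dbl 𝒟.g

/-- The embedding of the coordinate ring of the double cover into the function field. -/
def Δ : 𝒟.D →+* L := Dbl.lift 𝒟.ψ 𝒟.w 𝒟.sq_eq

lemma Δ_injective : Function.Injective 𝒟.Δ := Dbl.lift_injective _ 𝒟.injective 𝒟.notMem

lemma Δ_comp_of : 𝒟.Δ.comp (AdjoinRoot.of _) = (algebraMap K L).comp 𝒟.ψ :=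
  RingHom.ext fun a ↦ Dbl.lift_of 𝒟.sq_eq a

end DoubleChart

variable {K L : Type} [Field K] [Field L] [Algebra K L] (𝔽 : Frame f₃ f₆ K L)

namespace Frame

/-- The charts of the double cover given by a frame: `none` is the chart with coordinates `t`,
`1 / x`, `some true` the one with coordinates `t`, `x / f₃`, and `some false` the one with
coordinates `t`, `x`, `f₃ / x`. -/
def chart (hF : Squarefree (f₃ * f₆)) : Option Bool → DoubleChart K L
  | none =>
    { A := ℂ[X][X]
      g := gC f₃ f₆
      ψ := 𝔽.ψC
      w := 𝔽.w
      param := C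
      sq_eq := by rw [𝔽.sq_eq, ψC_gC]
      injective := 𝔽.isFracHom_ψC.injective
      notMem := 𝔽.w_notMem hF
      exists_lift_eq := fun _ hz ↦ 𝔽.exists_lift_eq_C hF hz _ }
  | some true =>
    { A := ℂ[X][X]
      g := gA f₃ f₆
      ψ := 𝔽.ψA
      w := 𝔽.wA
      param := C
      sq_eq := 𝔽.wA_sq (left_ne_zero_of_mul hF.ne_zero)
      injective := (𝔽.isFracHom_ψA (left_ne_zero_of_mul hF.ne_zero)).injective
      notMem := 𝔽.wA_notMem hF
      exists_lift_eq := fun _ hz ↦ 𝔽.exists_lift_eq_A hF hz _ }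
  | some false =>
    { A := AB f₃
      g := gB f₃ f₆
      ψ := 𝔽.ψB
      w := 𝔽.wB
      param := (φB f₃).comp C
      sq_eq := 𝔽.wB_sq
      injective := (𝔽.isFracHom_ψB (left_ne_zero_of_mul hF.ne_zero)).injective
      notMem := 𝔽.wB_notMem hF
      exists_lift_eq := fun _ hz ↦ 𝔽.exists_lift_eq_B hF hz _ }

lemma chart_ψ_param (hF : Squarefree (f₃ * f₆)) (k : Option Bool) :
    (𝔽.chart hF k).ψ.comp (𝔽.chart hF k).param = 𝔽.τ := by
  match k with
  | none => exact eval₂RingHom_comp_C _ _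
  | some true => exact eval₂RingHom_comp_C _ _
  | some false =>
    refine Eq.trans ?_ (eval₂RingHom_comp_C 𝔽.τ 𝔽.x)
    rw [← 𝔽.ψB_comp]
    rfl

end Frame

end DoubleChart

end Branch

/-! ### Standard charts of the line and the plane, and dehomogenization -/

section PolynomialProj

open MvPolynomial

attribute [local instance] MvPolynomial.gradedAlgebra

/-- A monomial of degree `n` picks up one factor `c` for each variable. In this form the lemma
compares two systems of homogeneous coordinates of one point. -/
lemma map_eq_pow_mul_of_isHomogeneous {σ E R : Type} [CommRing R] [CommRing E]
    {θ θ' : MvPolynomial σ R →+* E}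
    (hC : ∀ r, θ' (C r) = θ (C r)) (c : E) (hX : ∀ j, θ' (X j) = c * θ (X j)) {n : ℕ}
    {a : MvPolynomial σ R} (ha : a.IsHomogeneous n) : θ' a = c ^ n * θ a := by
  have key : ∀ d : σ →₀ ℕ, ∀ r, θ' (monomial d r) = c ^ d.degree * θ (monomial d r) := by
    intro d r
    rw [monomial_eq, map_mul, map_mul, hC, Finsupp.prod, map_prod, map_prod]
    simp only [map_pow, hX, mul_pow]
    rw [Finset.prod_mul_distrib, Finset.prod_pow_eq_pow_sum]
    rw [Finsupp.degree_apply]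
    ring
  rw [a.as_sum, map_sum, map_sum, Finset.mul_sum]
  refine Finset.sum_congr rfl fun d hd ↦ ?_
  rw [key, ha.degree_eq_sum_deg_support hd, Finsupp.degree_apply]

/-- The localization homomorphism of a polynomial ring at a variable. -/
abbrev locVar {σ : Type} (i : σ) :
    MvPolynomial σ ℂ →+* Localization.Away (X i : MvPolynomial σ ℂ) := algebraMap _ _

/-- A dehomogenization identifies a standard chart of projective space. -/
lemma awayLift_bijective_of_dehom {n : ℕ} {E : Type} [CommRing E]
    {θ : MvPolynomial (Fin (n + 1)) ℂ →+* E} (i : Fin (n + 1)) (hθ : θ (X i) = 1)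
    (hs : Function.Surjective θ)
    (H : E →+* Localization.Away (X i : MvPolynomial (Fin (n + 1)) ℂ))
    (hC : ∀ r, H (θ (C r)) = locVar i (C r))
    (hX : ∀ j, H (θ (X j)) * locVar i (X i) = locVar i (X j)) :
    Function.Bijective (awayLift (coordGrading n) θ (X i) (hθ ▸ isUnit_one)) := by
  refine awayLift_bijective _ (isHomogeneous_X _ _) hθ hs H fun m a ha ↦ ?_
  have := map_eq_pow_mul_of_isHomogeneous (θ := H.comp θ) (θ' := locVar i)
    (fun r ↦ (hC r).symm) (locVar i (X i)) (fun j ↦ by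
      rw [RingHom.comp_apply, ← hX j, mul_comm]) ha
  rw [this, mul_comm]
  rfl

/-- The quotient of two variables in a localization. -/
def varDiv {σ : Type} (i j : σ) : Localization.Away (X i : MvPolynomial σ ℂ) :=
  IsLocalization.Away.invSelf (X i : MvPolynomial σ ℂ) * locVar i (X j)

lemma varDiv_mul {σ : Type} (i j : σ) :
    varDiv i j * locVar i (X i) = locVar i (X j) := by
  have := IsLocalization.Away.mul_invSelf (S := Localization.Away (X i : MvPolynomial σ ℂ))
    (X i : MvPolynomial σ ℂ)
  rw [varDiv, mul_right_comm, mul_comm (IsLocalization.Away.invSelf _), this, one_mul]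

/-- The dehomogenization `X i = 1` in two variables. -/
def dehom (i : Fin 2) : MvPolynomial (Fin 2) ℂ →+* Polynomial ℂ :=
  (aeval fun j ↦ if j = i then 1 else Polynomial.X : MvPolynomial (Fin 2) ℂ →ₐ[ℂ] Polynomial ℂ)

lemma dehom_X (i : Fin 2) : dehom i (X i) = 1 := by simp [dehom]

lemma dehom_X_rev (i : Fin 2) : dehom i (X (1 - i)) = Polynomial.X := by
  fin_cases i <;> simp [dehom]

lemma dehom_C (i : Fin 2) (r : ℂ) : dehom i (C r) = Polynomial.C r := by
  simp [dehom]

lemma fin_two_eq (i j : Fin 2) : j = i ∨ j = 1 - i := by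
  fin_cases i <;> fin_cases j <;> simp

lemma dehom_bijective (i : Fin 2) :
    Function.Bijective (awayLift (coordGrading 1) (dehom i) (X i)
      ((dehom_X i).symm ▸ isUnit_one)) := by
  -- The inverse of the dehomogenization sends the affine coordinate to the quotient of the two
  -- homogeneous ones.
  let H : Polynomial ℂ →+* Localization.Away (X i : MvPolynomial (Fin 2) ℂ) :=
    Polynomial.eval₂RingHom ((locVar i).comp C) (varDiv i (1 - i))
  refine awayLift_bijective_of_dehom i (dehom_X i) ?_ H ?_ ?_
  · rw [← RingHom.range_eq_top]
    refine subring_polynomial_eq_top _ (fun a ↦ ⟨C a, dehom_C i a⟩) ⟨X (1 - i), dehom_X_rev i⟩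
  · intro r; rw [dehom_C]; simp [H]
  · intro j
    obtain rfl | rfl := fin_two_eq i j
    · rw [dehom_X, map_one, one_mul]
    · rw [dehom_X_rev]; simp [H, varDiv_mul]

/-- The chart `X i ≠ 0` of the projective line. -/
def lineChart (i : Fin 2) : Spec (.of (Polynomial ℂ)) ⟶ PP 1 :=
  projPoint (coordGrading 1) (dehom i) (isHomogeneous_X ℂ i) one_pos
    ((dehom_X i).symm ▸ isUnit_one)

instance (i : Fin 2) : IsOpenImmersion (lineChart i) :=
  isOpenImmersion_projPoint _ _ _ _ _ (dehom_bijective i)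

lemma range_lineChart (i : Fin 2) :
    Set.range (lineChart i) = Proj.basicOpen (coordGrading 1) (X i) :=
  opensRange_projPoint _ _ _ _ _ (dehom_bijective i)

/-- The dehomogenization `X 0 = 1` in three variables. -/
def dehomZero : MvPolynomial (Fin 3) ℂ →+* MvPolynomial (Fin 2) ℂ :=
  (aeval (Fin.cons 1 X) : MvPolynomial (Fin 3) ℂ →ₐ[ℂ] MvPolynomial (Fin 2) ℂ)

lemma dehomZero_X_zero : dehomZero (X 0) = 1 := by simp [dehomZero]

lemma dehomZero_X_succ (j : Fin 2) : dehomZero (X j.succ) = X j := by simp [dehomZero]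

lemma dehomZero_C (r : ℂ) : dehomZero (C r) = C r := by simp [dehomZero]

lemma dehomZero_pencil (f : MvPolynomial (Fin 2) ℂ) : dehomZero (pencil f) = f := by
  change aeval (Fin.cons 1 X) (rename Fin.succ f) = f
  rw [aeval_rename]
  have : (Fin.cons 1 X ∘ Fin.succ : Fin 2 → MvPolynomial (Fin 2) ℂ) = X := by
    ext j : 1; simp
  rw [this, aeval_X_left_apply]

lemma dehomZero_bijective :
    Function.Bijective (awayLift (coordGrading 2) dehomZero (X 0)
      (dehomZero_X_zero.symm ▸ isUnit_one)) := by
  let H : MvPolynomial (Fin 2) ℂ →+* Localization.Away (X 0 : MvPolynomial (Fin 3) ℂ) :=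
    eval₂Hom ((locVar 0).comp C) fun j ↦ varDiv 0 j.succ
  refine awayLift_bijective_of_dehom 0 dehomZero_X_zero (fun a ↦ ⟨_, dehomZero_pencil a⟩) H ?_ ?_
  · intro r; rw [dehomZero_C]; simp [H]
  · refine Fin.cases ?_ fun j ↦ ?_
    · rw [dehomZero_X_zero, map_one, one_mul]
    · rw [dehomZero_X_succ]; simp [H, varDiv_mul]

/-- The chart `X 0 ≠ 0` of the plane. -/
def planeChartZero : Spec (.of (MvPolynomial (Fin 2) ℂ)) ⟶ PP 2 :=
  projPoint (coordGrading 2) dehomZero (isHomogeneous_X ℂ 0) one_pos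
    (dehomZero_X_zero.symm ▸ isUnit_one)

instance : IsOpenImmersion planeChartZero :=
  isOpenImmersion_projPoint _ _ _ _ _ dehomZero_bijective

lemma range_planeChartZero :
    Set.range planeChartZero = Proj.basicOpen (coordGrading 2) (X 0) :=
  opensRange_projPoint _ _ _ _ _ dehomZero_bijective

open Polynomial in
/-- The dehomogenization `X (i + 1) = 1` in three variables. -/
def dehomSucc (i : Fin 2) : MvPolynomial (Fin 3) ℂ →+* ℂ[X][X] :=
  (aeval (Fin.cons Polynomial.X fun j ↦ Polynomial.C (dehom i (X j))) :
    MvPolynomial (Fin 3) ℂ →ₐ[ℂ] ℂ[X][X])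

lemma dehomSucc_X_zero (i : Fin 2) : dehomSucc i (X 0) = Polynomial.X := by simp [dehomSucc]

lemma dehomSucc_X_succ (i j : Fin 2) : dehomSucc i (X j.succ) = Polynomial.C (dehom i (X j)) := by
  simp [dehomSucc]

lemma dehomSucc_C (i : Fin 2) (r : ℂ) : dehomSucc i (C r) = Polynomial.C (Polynomial.C r) := by
  simp [dehomSucc]

lemma dehomSucc_X_self (i : Fin 2) : dehomSucc i (X i.succ) = 1 := by
  rw [dehomSucc_X_succ, dehom_X, map_one]

lemma dehomSucc_pencil (i : Fin 2) (f : MvPolynomial (Fin 2) ℂ) :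
    dehomSucc i (pencil f) = Polynomial.C (dehom i f) := by
  have : ((dehomSucc i).comp (pencil : MvPolynomial (Fin 2) ℂ →+* MvPolynomial (Fin 3) ℂ)) =
      Polynomial.C.comp (dehom i) := by
    refine ringHom_ext (fun r ↦ ?_) (fun j ↦ ?_)
    · change dehomSucc i (rename Fin.succ (C r)) = _
      rw [rename_C, dehomSucc_C, RingHom.comp_apply, dehom_C]
    · change dehomSucc i (rename Fin.succ (X j)) = _
      rw [rename_X, dehomSucc_X_succ, RingHom.comp_apply]
  exact RingHom.congr_fun this f

lemma dehomSucc_bijective (i : Fin 2) :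
    Function.Bijective (awayLift (coordGrading 2) (dehomSucc i) (X i.succ)
      ((dehomSucc_X_self i).symm ▸ isUnit_one)) := by
  let H : Polynomial (Polynomial ℂ) →+* Localization.Away (X i.succ : MvPolynomial (Fin 3) ℂ) :=
    Polynomial.eval₂RingHom (Polynomial.eval₂RingHom ((locVar i.succ).comp C)
      (varDiv i.succ (1 - i).succ)) (varDiv i.succ 0)
  refine awayLift_bijective_of_dehom i.succ (dehomSucc_X_self i) ?_ H ?_ ?_
  · rw [← RingHom.range_eq_top]
    refine subring_polynomial_eq_top _ (fun a ↦ ?_) ⟨X 0, dehomSucc_X_zero i⟩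
    obtain ⟨b, rfl⟩ : ∃ b, dehom i b = a := by
      have := subring_polynomial_eq_top (dehom i).range (fun a ↦ ⟨C a, dehom_C i a⟩)
        ⟨X (1 - i), dehom_X_rev i⟩
      exact (this ▸ Subring.mem_top a : a ∈ (dehom i).range)
    exact ⟨_, dehomSucc_pencil i b⟩
  · intro r; rw [dehomSucc_C]; simp [H]
  · refine Fin.cases ?_ fun j ↦ ?_
    · rw [dehomSucc_X_zero]; simp [H, varDiv_mul]
    · obtain rfl | rfl := fin_two_eq i j
      · rw [dehomSucc_X_self, map_one, one_mul]
      · rw [dehomSucc_X_succ, dehom_X_rev]; simp [H, varDiv_mul]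

/-- The chart `X (i + 1) ≠ 0` of the plane. -/
def planeChartSucc (i : Fin 2) : Spec (.of (Polynomial (Polynomial ℂ))) ⟶ PP 2 :=
  projPoint (coordGrading 2) (dehomSucc i) (isHomogeneous_X ℂ i.succ) one_pos
    ((dehomSucc_X_self i).symm ▸ isUnit_one)

instance (i : Fin 2) : IsOpenImmersion (planeChartSucc i) :=
  isOpenImmersion_projPoint _ _ _ _ _ (dehomSucc_bijective i)

lemma range_planeChartSucc (i : Fin 2) :
    Set.range (planeChartSucc i) = Proj.basicOpen (coordGrading 2) (X i.succ) :=
  opensRange_projPoint _ _ _ _ _ (dehomSucc_bijective i)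

/-- The standard charts cover projective space. -/
lemma exists_mem_basicOpen_X {n : ℕ} (y : PP n) :
    ∃ i, y ∈ Proj.basicOpen (coordGrading n) (X i) := by
  have h : ⨆ i, Proj.basicOpen (coordGrading n) (X i) = ⊤ := by
    refine Proj.iSup_basicOpen_eq_top _ _ ?_
    rw [HomogeneousIdeal.toIdeal_irrelevant_le]
    intro m hm x hx
    change x ∈ Ideal.span (Set.range X)
    rw [← pow_one (Ideal.span (Set.range X)), mem_pow_idealOfVars_iff']
    intro d hd
    refine IsHomogeneous.coeff_eq_zero (n := m) hx ?_
    omega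
  have : y ∈ ⨆ i, Proj.basicOpen (coordGrading n) (X i) := h ▸ trivial
  simpa using this

lemma projPoint_preimage_zeroSet {n : ℕ} {E : Type} [CommRing E]
    (θ : MvPolynomial (Fin (n + 1)) ℂ →+* E) {d : ℕ} {f : MvPolynomial (Fin (n + 1)) ℂ}
    (hf : f ∈ coordGrading n d) (hd : 0 < d) (hu : IsUnit (θ f)) {e : ℕ}
    {g : MvPolynomial (Fin (n + 1)) ℂ} (hg : g.IsHomogeneous e) (he : 0 < e) :
    projPoint (coordGrading n) θ hf hd hu ⁻¹' (zeroSet g) = PrimeSpectrum.zeroLocus {θ g} := by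
  have h := projPoint_preimage_basicOpen (coordGrading n) θ hf hd hu hg he
  have h1 : (projPoint (coordGrading n) θ hf hd hu ⁻¹' (zeroSet g) : Set _) =
      (projPoint (coordGrading n) θ hf hd hu ⁻¹ᵁ Proj.basicOpen (coordGrading n) g : Set _)ᶜ := rfl
  rw [h1, h]
  ext y
  refine Iff.trans ?_ (Set.singleton_subset_iff (s := (y.asIdeal : Set E))).symm
  change ¬ (θ g ∉ y.asIdeal) ↔ θ g ∈ y.asIdeal
  exact not_not

/-- In a fixed degree `n`, dehomogenizing is passing to `a / X_i ^ n`, and this fraction determines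
`a`. -/
lemma eq_zero_of_dehom_eq_zero (i : Fin 2) {n : ℕ} {a : MvPolynomial (Fin 2) ℂ}
    (ha : a.IsHomogeneous n) (h : dehom i a = 0) : a = 0 := by
  have hX : X i ∈ coordGrading 1 1 := isHomogeneous_X ℂ i
  have ha' : a ∈ coordGrading 1 (n • 1) := by rw [smul_eq_mul, mul_one]; exact ha
  have h1 := awayLift_mk_mul (coordGrading 1) (dehom i) ((dehom_X i).symm ▸ isUnit_one) hX n a ha'
  have e : dehom i (X i) ^ n = 1 := by rw [dehom_X, one_pow]
  rw [e, mul_one, h, map_eq_zero_iff _ (dehom_bijective i).injective] at h1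
  have h2 := congrArg HomogeneousLocalization.val h1
  rw [HomogeneousLocalization.Away.val_mk, HomogeneousLocalization.val_zero,
    Localization.mk_eq_mk', IsLocalization.mk'_eq_zero_iff] at h2
  obtain ⟨⟨_, m, rfl⟩, hm⟩ := h2
  exact (mul_eq_zero.mp hm).resolve_left (pow_ne_zero _ (X_ne_zero i))

open Polynomial in
/-- The chart `X (1 - i) = X i * t` of the blow-up of the plane in the origin. -/
def φE (i : Fin 2) : MvPolynomial (Fin 2) ℂ →+* ℂ[X][X] :=
  (aeval fun j ↦ Polynomial.X * Polynomial.C (dehom i (X j)) :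
    MvPolynomial (Fin 2) ℂ →ₐ[ℂ] ℂ[X][X])

lemma φE_X (i j : Fin 2) : φE i (X j) = Polynomial.X * Polynomial.C (dehom i (X j)) := by
  simp [φE]

lemma φE_X_self (i : Fin 2) : φE i (X i) = Polynomial.X := by
  rw [φE_X, dehom_X, map_one, mul_one]

lemma φE_C (i : Fin 2) (r : ℂ) : φE i (C r) = Polynomial.C (Polynomial.C r) := by
  simp [φE]

lemma φE_of_isHomogeneous (i : Fin 2) {n : ℕ} {a : MvPolynomial (Fin 2) ℂ}
    (ha : a.IsHomogeneous n) : φE i a = Polynomial.X ^ n * Polynomial.C (dehom i a) :=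
  map_eq_pow_mul_of_isHomogeneous (θ := Polynomial.C.comp (dehom i))
    (fun r ↦ by rw [φE_C, RingHom.comp_apply, dehom_C]) _ (fun j ↦ φE_X i j) ha

/-- The component of degree `n` contributes exactly the coefficient of `x ^ n`, and that
coefficient, its dehomogenization, determines it. -/
lemma φE_injective (i : Fin 2) : Function.Injective (φE i) := by
  rw [injective_iff_map_eq_zero]
  intro a ha
  rw [← sum_homogeneousComponent a] at ha ⊢
  rw [map_sum] at ha
  refine Finset.sum_eq_zero fun n hn ↦
    eq_zero_of_dehom_eq_zero i (homogeneousComponent_isHomogeneous n a) ?_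
  have h := congrArg (fun q ↦ Polynomial.coeff q n) ha
  simp only [φE_of_isHomogeneous i (homogeneousComponent_isHomogeneous _ a),
    Polynomial.finsetSum_coeff, Polynomial.coeff_X_pow_mul', Polynomial.coeff_C,
    Polynomial.coeff_zero] at h
  rw [Finset.sum_eq_single n] at h
  · simpa using h
  · intro m _ hm
    by_cases hmn : m ≤ n
    · rw [if_pos hmn, if_neg (by omega)]
    · rw [if_neg hmn]
  · exact fun h ↦ absurd hn h

lemma isBlowupChart_φE (i : Fin 2) : IsBlowupChart (idealOfVars (Fin 2) ℂ) (X i) (φE i) := by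
  refine .of_adjoin (Ideal.subset_span ⟨i, rfl⟩) ?_ ?_ (φE_injective i) {Polynomial.C Polynomial.X}
    ?_ ?_
  · rw [φE_X_self]; exact mem_nonZeroDivisors_of_ne_zero Polynomial.X_ne_zero
  · intro a ha
    rw [φE_X_self]
    induction ha using Submodule.span_induction with
    | mem a ha => obtain ⟨j, rfl⟩ := ha; rw [φE_X]; exact dvd_mul_right _ _
    | zero => rw [map_zero]; exact dvd_zero _
    | add a b _ _ ha hb => rw [map_add]; exact dvd_add ha hb
    | smul c a _ ha => rw [smul_eq_mul, map_mul]; exact ha.mul_left _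
  · refine subring_polynomial_eq_top _ (fun a ↦ ?_) (Subring.subset_closure (.inl ⟨X i, φE_X_self i⟩))
    have := subring_polynomial_eq_top ((Subring.closure (Set.range (φE i) ∪
      {Polynomial.C Polynomial.X})).comap Polynomial.C) (fun r ↦
        Subring.subset_closure (.inl ⟨C r, φE_C i r⟩)) (Subring.subset_closure (.inr rfl))
    exact (this ▸ Subring.mem_top a : a ∈ _)
  · rintro _ rfl
    exact ⟨X (1 - i), Ideal.subset_span ⟨1 - i, rfl⟩, by rw [φE_X_self, φE_X, dehom_X_rev]⟩

/-- Homogenizations exist. -/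
lemma exists_homogenization (i : Fin 2) (p : Polynomial ℂ) :
    ∃ P : MvPolynomial (Fin 2) ℂ, P.IsHomogeneous p.natDegree ∧ dehom i P = p ∧
      (p ≠ 0 → ¬ X i ∣ P) := by
  refine ⟨∑ k ∈ Finset.range (p.natDegree + 1),
    C (p.coeff k) * X (1 - i) ^ k * X i ^ (p.natDegree - k), ?_, ?_, ?_⟩
  · refine IsHomogeneous.sum _ _ _ fun k hk ↦ ?_
    have hk' : k ≤ p.natDegree := by rw [Finset.mem_range] at hk; omega
    have := ((isHomogeneous_C (Fin 2) (p.coeff k)).mul (isHomogeneous_X_pow (1 - i) k)).mul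
      (isHomogeneous_X_pow i (p.natDegree - k))
    rwa [show 0 + k + (p.natDegree - k) = p.natDegree by omega] at this
  · rw [map_sum]
    conv_rhs => rw [p.as_sum_range_C_mul_X_pow]
    refine Finset.sum_congr rfl fun k _ ↦ ?_
    rw [map_mul, map_mul, map_pow, map_pow, dehom_C, dehom_X, dehom_X_rev, one_pow, mul_one]
  · intro hp
    rintro ⟨q, hq⟩
    -- At `X_i = 0` with the other variable `1`, only the leading coefficient of `p` remains.
    have h := congrArg (aeval (fun j ↦ if j = i then (0 : ℂ) else 1)) hq
    have hi : 1 - i ≠ i := by fin_cases i <;> simp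
    rw [map_mul, aeval_X, if_pos rfl, zero_mul, map_sum] at h
    simp only [map_mul, map_pow, aeval_X, if_neg hi, if_true, one_pow, mul_one] at h
    rw [Finset.sum_range_succ, Finset.sum_eq_zero, zero_add, Nat.sub_self, pow_zero, mul_one] at h
    · simp at h
      exact hp h
    · intro k hk
      rw [Finset.mem_range] at hk
      rw [zero_pow (by omega), mul_zero]

/-- A square dividing the dehomogenization is homogenized to `H²` with `H` prime to `X_i`. It
divides `a` up to a power of `X_i`, hence divides `a`. -/
lemma squarefree_dehom (i : Fin 2) {n : ℕ} {a : MvPolynomial (Fin 2) ℂ} (ha : a.IsHomogeneous n)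
    (hs : Squarefree a) : Squarefree (dehom i a) := by
  rintro h ⟨q, hq⟩
  have hd0 : dehom i a ≠ 0 := fun h0 ↦ hs.ne_zero (eq_zero_of_dehom_eq_zero i ha h0)
  have hh0 : h ≠ 0 := by rintro rfl; simp [hd0] at hq
  obtain ⟨H, hH, rfl, hHX⟩ := exists_homogenization i h
  obtain ⟨Q, hQ, rfl, -⟩ := exists_homogenization i q
  set m := (dehom i H).natDegree
  set l := (dehom i Q).natDegree
  -- The powers of `X_i` bring both sides to the same degree, so that equality may be tested after
  -- dehomogenization.
  have h1 : X i ^ (m + m + l) * a = X i ^ n * (H * H * Q) := by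
    rw [← sub_eq_zero]
    refine eq_zero_of_dehom_eq_zero i (n := n + (m + m + l)) (.sub ?_ ?_) ?_
    · rw [add_comm n]; exact (isHomogeneous_X_pow i _).mul ha
    · exact (isHomogeneous_X_pow i _).mul ((hH.mul hH).mul hQ)
    · rw [map_sub, map_mul, map_mul, map_pow, map_pow, dehom_X, hq]; simp
  have h2 : IsRelPrime (X i) H := (irreducible_iff_prime.mpr (X_prime (i := i))).isRelPrime_iff_not_dvd.mpr
    (hHX hh0)
  have h3 : IsRelPrime (H * H) (X i ^ (m + m + l)) :=
    (IsRelPrime.mul_left h2.symm h2.symm).pow_right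
  have h4 : H * H ∣ a := h3.dvd_of_dvd_mul_left ⟨X i ^ n * Q, by rw [h1]; ring⟩
  exact (hs H h4).map (dehom i)

end PolynomialProj

attribute [local instance] MvPolynomial.gradedAlgebra

/-! ### Presentations of the function fields -/

section PlaneFrame

open MvPolynomial

variable {K L : Type} [Field K] [Field L] [Algebra K L] (ζ : MvPolynomial (Fin 2) ℂ →+* K)

/-- The embedding of the coordinate ring of the line given by the quotient of the coordinates. -/
def slopeHom (i : Fin 2) : Polynomial ℂ →+* K :=
  Polynomial.eval₂RingHom (ζ.comp C) (ζ (X (1 - i)) / ζ (X i))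

variable {ζ}

lemma IsFracHom.X_ne_zero (h : IsFracHom ζ) (i : Fin 2) : ζ (X i) ≠ 0 :=
  (map_ne_zero_iff _ h.injective).mpr (MvPolynomial.X_ne_zero i)

lemma slopeHom_dehom_X (h : IsFracHom ζ) (i j : Fin 2) :
    ζ (X i) * slopeHom ζ i (dehom i (X j)) = ζ (X j) := by
  have := h.X_ne_zero i
  obtain rfl | rfl := fin_two_eq i j
  · rw [dehom_X, map_one, mul_one]
  · rw [dehom_X_rev, slopeHom, Polynomial.coe_eval₂RingHom, Polynomial.eval₂_X]
    field_simp

lemma eval₂_slopeHom_comp (h : IsFracHom ζ) (i : Fin 2) :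
    (Polynomial.eval₂RingHom (slopeHom ζ i) (ζ (X i))).comp (φE i) = ζ := by
  refine ringHom_ext (fun r ↦ ?_) fun j ↦ ?_
  · rw [RingHom.comp_apply, φE_C]; simp [slopeHom]
  · rw [RingHom.comp_apply, φE_X, map_mul, Polynomial.coe_eval₂RingHom, Polynomial.eval₂_X,
      Polynomial.eval₂_C, slopeHom_dehom_X h]

lemma isFracHom_slopeHom (h : IsFracHom ζ) (i : Fin 2) :
    IsFracHom (Polynomial.eval₂RingHom (slopeHom ζ i) (ζ (X i))) :=
  h.of_comp (φE i) _ (eval₂_slopeHom_comp h i)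
    ((isBlowupChart_φE i).injective_of_comp h.injective (eval₂_slopeHom_comp h i))

lemma map_eq_slopeHom (h : IsFracHom ζ) (i : Fin 2) {n : ℕ} {a : MvPolynomial (Fin 2) ℂ}
    (ha : a.IsHomogeneous n) : ζ a = ζ (X i) ^ n * slopeHom ζ i (dehom i a) := by
  conv_lhs => rw [← eval₂_slopeHom_comp h i, RingHom.comp_apply, φE_of_isHomogeneous i ha]
  rw [map_mul, map_pow, Polynomial.coe_eval₂RingHom, Polynomial.eval₂_X, Polynomial.eval₂_C]

variable {F₃ F₆ : MvPolynomial (Fin 2) ℂ}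

lemma squarefree_dehom_mul (h₃ : F₃.IsHomogeneous 3) (h₆ : F₆.IsHomogeneous 6)
    (hF : Squarefree (F₃ * F₆)) (i : Fin 2) : Squarefree (dehom i F₃ * dehom i F₆) := by
  rw [← map_mul]
  exact squarefree_dehom i (h₃.mul h₆) hF

/-- The function `F₃ + F₆` is `x⁶` times the branch function `gC`, hence in the same square class.
-/
lemma sq_ne_map_add (h : IsFracHom ζ) (h₃ : F₃.IsHomogeneous 3) (h₆ : F₆.IsHomogeneous 6)
    (hF : Squarefree (F₃ * F₆)) (k : K) : k ^ 2 ≠ ζ (F₃ + F₆) := by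
  intro hk
  have hx := h.X_ne_zero 0
  have hF' := squarefree_dehom_mul h₃ h₆ hF 0
  refine not_exists_sq (isFracHom_inv hx (isFracHom_slopeHom h 0)) (squarefree_gC hF')
    (not_isUnit_gC (left_ne_zero_of_mul hF'.ne_zero)) (k * (ζ (X 0))⁻¹ ^ 3) ?_
  rw [mul_pow, hk, map_add, map_eq_slopeHom h 0 h₃, map_eq_slopeHom h 0 h₆]
  simp [gC]
  field_simp

variable (K L F₃ F₆) in
/-- A presentation of the function fields of the plane and of the double plane. -/
structure PlaneFrame where
  ζ : MvPolynomial (Fin 2) ℂ →+* K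
  w : L
  isFracHom : IsFracHom ζ
  sq_eq : w ^ 2 = algebraMap K L (ζ (F₃ + F₆))
  exists_eq : ∀ z : L, ∃ a b : K, z = algebraMap K L a + algebraMap K L b * w

namespace PlaneFrame

variable (𝔓 : PlaneFrame K L F₃ F₆) (h₃ : F₃.IsHomogeneous 3) (h₆ : F₆.IsHomogeneous 6)

/-- The frame on the part of the blow-up of the plane where `X (1 - i) / X i` is regular. -/
def frame (i : Fin 2) : Frame (dehom i F₃) (dehom i F₆) K L where
  τ := slopeHom 𝔓.ζ i
  x := 𝔓.ζ (X i)
  -- Dividing the square root of `F / X₀⁶` by `x³` gives a square root of `f₃ u³ + f₆`.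
  w := algebraMap K L (𝔓.ζ (X i))⁻¹ ^ 3 * 𝔓.w
  x_ne_zero := 𝔓.isFracHom.X_ne_zero i
  isFracHom := isFracHom_slopeHom 𝔓.isFracHom i
  sq_eq := by
    have hx := 𝔓.isFracHom.X_ne_zero i
    rw [mul_pow, 𝔓.sq_eq, ← map_pow, ← map_pow, ← map_mul, map_add,
      map_eq_slopeHom 𝔓.isFracHom i h₃, map_eq_slopeHom 𝔓.isFracHom i h₆]
    congr 1
    field_simp
  exists_eq := by
    intro z
    have hx := 𝔓.isFracHom.X_ne_zero i
    obtain ⟨a, b, rfl⟩ := 𝔓.exists_eq z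
    refine ⟨a, b * 𝔓.ζ (X i) ^ 3, ?_⟩
    rw [← mul_assoc, ← map_pow (algebraMap K L), ← map_mul (algebraMap K L)]
    congr 3
    field_simp

/-- The charts of the double plane over the charts of the blow-up `R`. -/
def chart (hF : Squarefree (F₃ * F₆)) (k : Fin 2 × Option Bool) : DoubleChart K L :=
  (𝔓.frame h₃ h₆ k.1).chart (squarefree_dehom_mul h₃ h₆ hF k.1) k.2

/-- The generic point of the plane. -/
def genericPoint : Spec (.of K) ⟶ PP 2 := Spec.map (CommRingCat.ofHom 𝔓.ζ) ≫ planeChartZero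

/-- The normalizations `X₀ = 1` and `X_i = 1` of the coordinates of the generic point are
proportional with factor `x`. -/
lemma specMap_planeChartSucc (i : Fin 2) :
    Spec.map (CommRingCat.ofHom (𝔓.frame h₃ h₆ i).ψC) ≫ planeChartSucc i = 𝔓.genericPoint := by
  have hx := 𝔓.isFracHom.X_ne_zero i
  refine (specMap_projPoint (coordGrading 2) _ _ _ _ _).trans
    (Eq.trans ?_ (specMap_projPoint (coordGrading 2) _ _ _ _ _).symm)
  refine projPoint_congr _ (𝔓.ζ (X i)) (fun n a ha ↦ ?_) _ _ _ _ _ _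
  refine map_eq_pow_mul_of_isHomogeneous (fun r ↦ ?_) _ (Fin.cases ?_ fun j ↦ ?_) ha
  · rw [RingHom.comp_apply, RingHom.comp_apply, dehomZero_C, dehomSucc_C]
    simp [Frame.ψC, frame, slopeHom]
  · rw [RingHom.comp_apply, RingHom.comp_apply, dehomZero_X_zero, dehomSucc_X_zero, map_one]
    simp [Frame.ψC, frame, hx]
  · rw [RingHom.comp_apply, RingHom.comp_apply, dehomZero_X_succ, dehomSucc_X_succ,
      ← slopeHom_dehom_X 𝔓.isFracHom i j]
    simp [Frame.ψC, frame]

end PlaneFrame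

end PlaneFrame

/-! ### Equations of strict transforms -/

section StrictTransform

variable {A : Type} [CommRing A]

/-- If `a` vanishes on the difference, then `h a` vanishes on the whole zero set of `g`, so `g`
divides a power of `h a`. As `h` is not a zero divisor modulo `g`, it divides that power of `a`. -/
lemma closure_zeroLocus_diff {g h : A} (n : ℕ) (hg : ∀ y, g ∣ h * y → g ∣ y) :
    closure (PrimeSpectrum.zeroLocus {h ^ n * g} \ PrimeSpectrum.zeroLocus {h}) =
      PrimeSpectrum.zeroLocus {g} := by
  have hg' : ∀ m y, g ∣ h ^ m * y → g ∣ y := by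
    intro m
    induction m with
    | zero => intro y hy; simpa using hy
    | succ m ih => intro y hy; exact hg _ (ih _ (by rwa [pow_succ, mul_assoc] at hy))
  refine subset_antisymm ?_ ?_
  · refine closure_minimal ?_ (PrimeSpectrum.isClosed_zeroLocus _)
    rintro y ⟨h1, h2⟩
    rw [PrimeSpectrum.mem_zeroLocus, Set.singleton_subset_iff, SetLike.mem_coe] at h1 h2 ⊢
    exact (y.2.mem_or_mem h1).resolve_left fun h3 ↦ h2 (y.2.mem_of_pow_mem n h3)
  · rw [← PrimeSpectrum.zeroLocus_vanishingIdeal_eq_closure]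
    intro y hy a ha
    rw [SetLike.mem_coe, PrimeSpectrum.mem_vanishingIdeal] at ha
    have h1 : h * a ∈ PrimeSpectrum.vanishingIdeal (PrimeSpectrum.zeroLocus {g}) := by
      rw [PrimeSpectrum.mem_vanishingIdeal]
      intro z hz
      by_cases hh : h ∈ z.asIdeal
      · exact z.asIdeal.mul_mem_right _ hh
      · refine z.asIdeal.mul_mem_left _ (ha z ⟨?_, ?_⟩)
        · rw [PrimeSpectrum.mem_zeroLocus, Set.singleton_subset_iff, SetLike.mem_coe] at hz ⊢
          exact z.asIdeal.mul_mem_left _ hz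
        · rwa [PrimeSpectrum.mem_zeroLocus, Set.singleton_subset_iff]
    rw [← PrimeSpectrum.zeroLocus_span, PrimeSpectrum.vanishingIdeal_zeroLocus_eq_radical] at h1
    obtain ⟨m, hm⟩ := h1
    rw [Ideal.mem_span_singleton, mul_pow] at hm
    rw [PrimeSpectrum.mem_zeroLocus, Set.singleton_subset_iff, SetLike.mem_coe] at hy
    exact y.2.mem_of_pow_mem m (Ideal.mem_of_dvd _ (hg' m _ hm) hy)

/-- Taking preimages under an open map commutes with closure. -/
lemma preimage_strictTransform {X : Scheme.{0}} (Z C : Closeds X) {T : Scheme.{0}}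
    (c : T ⟶ Bl X Z) [IsOpenImmersion c] {m : T ⟶ X} (hc : c ≫ Bl.map X Z = m) :
    c ⁻¹' (Bl.strictTransform X Z C) = closure (m ⁻¹' C \ m ⁻¹' Z) := by
  subst hc
  exact (c.isOpenEmbedding.isOpenMap.preimage_closure_eq_closure_preimage c.continuous _)

lemma preimage_strictTransform_eq {X : Scheme.{0}} (Z C : Closeds X)
    (c : Spec (.of A) ⟶ Bl X Z) [IsOpenImmersion c] {m : Spec (.of A) ⟶ X}
    (hc : c ≫ Bl.map X Z = m) {g h : A} (n : ℕ)
    (hC : m ⁻¹' C = PrimeSpectrum.zeroLocus {h ^ n * g})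
    (hZ : m ⁻¹' Z = PrimeSpectrum.zeroLocus {h}) (hg : ∀ y, g ∣ h * y → g ∣ y) :
    c ⁻¹' (Bl.strictTransform X Z C) = PrimeSpectrum.zeroLocus {g} := by
  rw [preimage_strictTransform Z C c hc, hC, hZ]
  exact closure_zeroLocus_diff n hg

lemma specMap_preimage_zeroLocus {B : Type} [CommRing B] (φ : A →+* B) {X : Scheme.{0}}
    (j : Spec (.of A) ⟶ X) {S : Set X} {s : Set A} (h : j ⁻¹' S = PrimeSpectrum.zeroLocus s) :
    (Spec.map (CommRingCat.ofHom φ) ≫ j) ⁻¹' S = PrimeSpectrum.zeroLocus (φ '' s) := by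
  have h1 : (Spec.map (CommRingCat.ofHom φ) ≫ j) ⁻¹' S =
      (PrimeSpectrum.comap φ) ⁻¹' (j ⁻¹' S) := by
    rw [Scheme.Hom.comp_base]; rfl
  rw [h1]
  exact (congrArg (PrimeSpectrum.comap φ ⁻¹' ·) h).trans
    (PrimeSpectrum.preimage_comap_zeroLocus φ s)

end StrictTransform

/-! ### The blow-up of the plane in a point -/

section BlowupOfPlane

open Polynomial

variable {F₃ F₆ : MvPolynomial (Fin 2) ℂ}

lemma coe_p : (p : Set (PP 2)) =
    (zeroSet (MvPolynomial.X (Fin.succ 0) : MvPolynomial (Fin 3) ℂ) : Set (PP 2)) ∩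
    (zeroSet (MvPolynomial.X (Fin.succ 1) : MvPolynomial (Fin 3) ℂ) : Set (PP 2)) := rfl

lemma planeChartZero_preimage_zeroSet {e : ℕ} {g : MvPolynomial (Fin 3) ℂ} (hg : g.IsHomogeneous e)
    (he : 0 < e) : planeChartZero ⁻¹' (zeroSet g) = PrimeSpectrum.zeroLocus {dehomZero g} :=
  projPoint_preimage_zeroSet dehomZero _ _ _ hg he

lemma planeChartSucc_preimage_zeroSet (i : Fin 2) {e : ℕ} {g : MvPolynomial (Fin 3) ℂ}
    (hg : g.IsHomogeneous e) (he : 0 < e) :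
    planeChartSucc i ⁻¹' (zeroSet g) = PrimeSpectrum.zeroLocus {dehomSucc i g} :=
  projPoint_preimage_zeroSet (dehomSucc i) _ _ _ hg he

lemma planeChartZero_preimage_p :
    planeChartZero ⁻¹' (p : Set (PP 2)) = PrimeSpectrum.zeroLocus (Set.range MvPolynomial.X) := by
  rw [coe_p, Set.preimage_inter, planeChartZero_preimage_zeroSet (MvPolynomial.isHomogeneous_X _ _)
    one_pos, planeChartZero_preimage_zeroSet (MvPolynomial.isHomogeneous_X _ _) one_pos,
    dehomZero_X_succ, dehomZero_X_succ]
  refine (PrimeSpectrum.zeroLocus_union _ _).symm.trans (congrArg _ ?_)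
  ext a
  simp only [Set.mem_union, Set.mem_singleton_iff, Set.mem_range, Fin.exists_fin_two]
  exact or_congr eq_comm eq_comm

/-- The ideal is the kernel of the constant coefficient, with values in a field. Hence the reduced
structure on `p` is given by the ideal of the variables. -/
lemma isRadical_idealOfVars : (MvPolynomial.idealOfVars (Fin 2) ℂ).IsRadical := by
  have h : ∀ a, a ∈ MvPolynomial.idealOfVars (Fin 2) ℂ ↔ MvPolynomial.constantCoeff a = 0 := by
    intro a
    rw [← pow_one (MvPolynomial.idealOfVars (Fin 2) ℂ), MvPolynomial.mem_pow_idealOfVars_iff']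
    refine ⟨fun h ↦ h 0 (by simp), fun h d hd ↦ ?_⟩
    have : d = 0 := by
      rw [← Finsupp.degree_eq_zero_iff]; omega
    rw [this]; exact h
  rintro a ⟨n, hn⟩
  rw [h, map_pow] at hn
  rw [h]
  exact (pow_eq_zero_iff (by rintro rfl; simp at hn)).mp hn

lemma vanishingIdeal_p : PrimeSpectrum.vanishingIdeal (planeChartZero ⁻¹' (p : Set (PP 2))) =
    MvPolynomial.idealOfVars (Fin 2) ℂ := by
  refine (congrArg PrimeSpectrum.vanishingIdeal planeChartZero_preimage_p).trans ?_
  rw [← PrimeSpectrum.zeroLocus_span, PrimeSpectrum.vanishingIdeal_zeroLocus_eq_radical]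
  exact isRadical_idealOfVars.radical

lemma planeChartSucc_notMem_p (i : Fin 2) (x) : planeChartSucc i x ∉ p := by
  intro hx
  have h : x ∈ planeChartSucc i ⁻¹' (zeroSet (MvPolynomial.X i.succ : MvPolynomial (Fin 3) ℂ)) := by
    rw [← SetLike.mem_coe, coe_p] at hx
    fin_cases i
    · exact hx.1
    · exact hx.2
  rw [planeChartSucc_preimage_zeroSet i (MvPolynomial.isHomogeneous_X _ _) one_pos,
    dehomSucc_X_self] at h
  exact absurd (Set.singleton_subset_iff.mp h) (Ideal.ne_top_iff_one _ |>.mp x.2.ne_top)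

/-- The standard charts of the blow-up of the plane in a point. -/
lemma exists_charts_Q : ∃ q q' : Fin 2 → (Spec (.of ℂ[X][X]) ⟶ Q),
    (∀ i, IsOpenImmersion (q i)) ∧ (∀ i, IsOpenImmersion (q' i)) ∧
    (∀ i, q i ≫ Bl.map (PP 2) p = Spec.map (CommRingCat.ofHom (φE i)) ≫ planeChartZero) ∧
    (∀ i, q' i ≫ Bl.map (PP 2) p = planeChartSucc i) ∧
    (∀ i y, Bl.map (PP 2) p y ∈ Set.range (planeChartSucc i) → y ∈ Set.range (q' i)) ∧
    ∀ y, (∃ i, y ∈ Set.range (q i)) ∨ ∃ i, y ∈ Set.range (q' i) := by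
  obtain ⟨q, hq1, hq2, hq3⟩ := exists_blowup_charts p planeChartZero
    (fun j ↦ (MvPolynomial.X j : MvPolynomial (Fin 2) ℂ)) (by
      rw [vanishingIdeal_p, MvPolynomial.idealOfVars]) (fun _ ↦ ℂ[X][X]) φE (fun i ↦ by
      rw [vanishingIdeal_p]; exact isBlowupChart_φE i)
  choose q' hq1' hq2' hq3' using fun i ↦
    exists_blowup_chart_of_disjoint p (planeChartSucc i) (planeChartSucc_notMem_p i)
  refine ⟨q, q', hq1, hq1', hq2, hq2', hq3', fun y ↦ ?_⟩
  obtain ⟨j, hj⟩ := exists_mem_basicOpen_X (Bl.map (PP 2) p y)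
  induction j using Fin.cases with
  | zero => exact .inl (hq3 y (by rw [range_planeChartZero]; exact hj))
  | succ i => exact .inr ⟨i, hq3' i y (by rw [range_planeChartSucc]; exact hj)⟩

lemma specMap_φE_preimage_p (i : Fin 2) :
    (Spec.map (CommRingCat.ofHom (φE i)) ≫ planeChartZero) ⁻¹' (p : Set (PP 2)) =
      PrimeSpectrum.zeroLocus {(X : ℂ[X][X])} := by
  rw [specMap_preimage_zeroLocus _ _ planeChartZero_preimage_p]
  refine subset_antisymm (PrimeSpectrum.zeroLocus_anti_mono ?_) ?_
  · rintro _ rfl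
    exact ⟨_, ⟨i, rfl⟩, φE_X_self i⟩
  · rintro y hy _ ⟨_, ⟨j, rfl⟩, rfl⟩
    rw [φE_X]
    exact y.asIdeal.mul_mem_right _ (Set.singleton_subset_iff.mp hy)

lemma specMap_φE_preimage_sextic (i : Fin 2) (h₃ : F₃.IsHomogeneous 3) (h₆ : F₆.IsHomogeneous 6) :
    (Spec.map (CommRingCat.ofHom (φE i)) ≫ planeChartZero) ⁻¹' (zeroSet (sextic F₃ F₆)) =
      PrimeSpectrum.zeroLocus
        {(X : ℂ[X][X]) ^ 3 * (C (dehom i F₃) + X ^ 3 * C (dehom i F₆))} := by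
  rw [specMap_preimage_zeroLocus _ _ (planeChartZero_preimage_zeroSet (isHomogeneous_sextic h₃ h₆)
    (by norm_num)), Set.image_singleton, sextic, map_add, map_mul, map_pow, dehomZero_X_zero,
    one_pow, one_mul, dehomZero_pencil, dehomZero_pencil, map_add, φE_of_isHomogeneous i h₃,
    φE_of_isHomogeneous i h₆]
  congr 2
  ring

lemma planeChartSucc_preimage_sextic (i : Fin 2) (h₃ : F₃.IsHomogeneous 3)
    (h₆ : F₆.IsHomogeneous 6) :
    planeChartSucc i ⁻¹' (zeroSet (sextic F₃ F₆)) =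
      PrimeSpectrum.zeroLocus {gC (dehom i F₃) (dehom i F₆)} := by
  rw [planeChartSucc_preimage_zeroSet i (isHomogeneous_sextic h₃ h₆) (by norm_num), sextic, map_add,
    map_mul, map_pow, dehomSucc_X_zero, dehomSucc_pencil, dehomSucc_pencil, gC]

lemma zeroLocus_one {A : Type} [CommRing A] : PrimeSpectrum.zeroLocus {(1 : A)} = ∅ := by
  simp

/-- The constant term `f₃` in `x` is nonzero, so the equation of the strict transform is coprime to
the exceptional equation `x`. -/
lemma dvd_of_dvd_X_mul {f₃ f₆ : ℂ[X]} (h : f₃ ≠ 0) (y : ℂ[X][X])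
    (hy : C f₃ + X ^ 3 * C f₆ ∣ X * y) : C f₃ + X ^ 3 * C f₆ ∣ y :=
  (isRelPrime_X (by simpa using h)).symm.dvd_of_dvd_mul_left hy

section
variable {i : Fin 2} {q : Spec (.of ℂ[X][X]) ⟶ Q}

lemma preimage_Ep (hq : q ≫ Bl.map (PP 2) p = Spec.map (CommRingCat.ofHom (φE i)) ≫ planeChartZero) :
    q ⁻¹' Ep = PrimeSpectrum.zeroLocus {(X : ℂ[X][X])} := by
  rw [← specMap_φE_preimage_p i, ← hq]
  rfl

lemma preimage_K [IsOpenImmersion q] (h₃ : F₃.IsHomogeneous 3) (h₆ : F₆.IsHomogeneous 6) (h : dehom i F₃ ≠ 0)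
    (hq : q ≫ Bl.map (PP 2) p = Spec.map (CommRingCat.ofHom (φE i)) ≫ planeChartZero) :
    q ⁻¹' K F₃ F₆ =
      PrimeSpectrum.zeroLocus {(C (dehom i F₃) + X ^ 3 * C (dehom i F₆) : ℂ[X][X])} :=
  preimage_strictTransform_eq _ _ q hq 3 (specMap_φE_preimage_sextic i h₃ h₆)
    (specMap_φE_preimage_p i) (dvd_of_dvd_X_mul h)

lemma preimage_Ep_eq_empty (hq : q ≫ Bl.map (PP 2) p = planeChartSucc i) :
    q ⁻¹' (Ep : Set Q) = ∅ := by
  refine Set.eq_empty_of_forall_notMem fun x hx ↦ planeChartSucc_notMem_p i x ?_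
  rw [← hq]
  exact hx

lemma preimage_K_eq_gC [IsOpenImmersion q] (h₃ : F₃.IsHomogeneous 3) (h₆ : F₆.IsHomogeneous 6)
    (hq : q ≫ Bl.map (PP 2) p = planeChartSucc i) :
    q ⁻¹' K F₃ F₆ = PrimeSpectrum.zeroLocus {gC (dehom i F₃) (dehom i F₆)} :=
  preimage_strictTransform_eq _ _ q hq (h := 1) 0
    (by rw [pow_zero, one_mul]; exact planeChartSucc_preimage_sextic i h₃ h₆)
    (by
      rw [zeroLocus_one]
      exact Set.eq_empty_of_forall_notMem (planeChartSucc_notMem_p i))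
    (fun y hy ↦ by rwa [one_mul] at hy)

/-- On `x = 0` the equation `f₃ + x³ f₆` of `K` reduces to `f₃`. -/
lemma preimage_K_inf_Ep [IsOpenImmersion q] (h₃ : F₃.IsHomogeneous 3)
    (h₆ : F₆.IsHomogeneous 6) (h : dehom i F₃ ≠ 0)
    (hq : q ≫ Bl.map (PP 2) p = Spec.map (CommRingCat.ofHom (φE i)) ≫ planeChartZero) :
    q ⁻¹' ((K F₃ F₆ ⊓ Ep : Closeds Q) : Set Q) =
      PrimeSpectrum.zeroLocus {(X : ℂ[X][X]), C (dehom i F₃)} := by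
  rw [Closeds.coe_inf, Set.preimage_inter, preimage_K h₃ h₆ h hq, preimage_Ep hq]
  ext y
  change (_ ⊆ (y.asIdeal : Set ℂ[X][X]) ∧ _ ⊆ (y.asIdeal : Set ℂ[X][X])) ↔
    _ ⊆ (y.asIdeal : Set ℂ[X][X])
  simp only [Set.singleton_subset_iff, Set.insert_subset_iff, SetLike.mem_coe]
  constructor
  · rintro ⟨h1, h2⟩
    refine ⟨h2, (y.asIdeal.add_mem_iff_left ?_).mp h1⟩
    exact y.asIdeal.mul_mem_right _ (y.asIdeal.pow_mem_of_mem h2 3 (by norm_num))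
  · rintro ⟨h2, h1⟩
    refine ⟨y.asIdeal.add_mem h1 ?_, h2⟩
    exact y.asIdeal.mul_mem_right _ (y.asIdeal.pow_mem_of_mem h2 3 (by norm_num))

/-- Membership means that `f` divides the constant term, and a squarefree `f` dividing a power
divides the base. Thus the reduced center of the second blow-up is cut out by `x` and `f₃`. -/
lemma isRadical_span_X_C {f : ℂ[X]} (hf : Squarefree f) :
    (Ideal.span {(X : ℂ[X][X]), C f}).IsRadical := by
  have h : ∀ a, a ∈ Ideal.span {(X : ℂ[X][X]), C f} ↔ f ∣ a.coeff 0 := by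
    intro a
    rw [Ideal.mem_span_pair]
    constructor
    · rintro ⟨b, c, rfl⟩
      simp [Polynomial.mul_coeff_zero]
    · rintro ⟨c, hc⟩
      refine ⟨a.divX, C c, ?_⟩
      rw [← C_mul, mul_comm c, ← hc, divX_mul_X_add]
  rintro a ⟨n, hn⟩
  rw [h, coeff_zero_eq_eval_zero, eval_pow] at hn
  rw [h, coeff_zero_eq_eval_zero]
  exact hf.isRadical n _ hn

lemma vanishingIdeal_K_inf_Ep [IsOpenImmersion q] (h₃ : F₃.IsHomogeneous 3)
    (h₆ : F₆.IsHomogeneous 6)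
    (h : Squarefree (dehom i F₃))
    (hq : q ≫ Bl.map (PP 2) p = Spec.map (CommRingCat.ofHom (φE i)) ≫ planeChartZero) :
    PrimeSpectrum.vanishingIdeal (q ⁻¹' ((K F₃ F₆ ⊓ Ep : Closeds Q) : Set Q)) =
      Ideal.span {(X : ℂ[X][X]), C (dehom i F₃)} := by
  refine (congrArg PrimeSpectrum.vanishingIdeal (preimage_K_inf_Ep h₃ h₆ h.ne_zero hq)).trans ?_
  rw [← PrimeSpectrum.zeroLocus_span, PrimeSpectrum.vanishingIdeal_zeroLocus_eq_radical]
  exact (isRadical_span_X_C h).radical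

end

end BlowupOfPlane

/-! ### The branch curves in the second blow-up -/

section BranchCharts

open Polynomial

variable {f₃ f₆ : ℂ[X]}

lemma φA_X : φA f₃ X = C f₃ * X := eval₂_X _ _

lemma φA_C (a : ℂ[X]) : φA f₃ (C a) = C a := eval₂_C _ _

lemma zeroLocus_pair_eq {A : Type} [CommRing A] {a b : A} (h : b ∣ a) :
    PrimeSpectrum.zeroLocus {a, b} = PrimeSpectrum.zeroLocus {b} := by
  refine subset_antisymm (PrimeSpectrum.zeroLocus_anti_mono (by simp)) fun y hy ↦ ?_
  change _ ⊆ (y.asIdeal : Set A) at hy ⊢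
  simp only [Set.singleton_subset_iff, Set.insert_subset_iff, SetLike.mem_coe] at hy ⊢
  exact ⟨Ideal.mem_of_dvd _ h hy, hy⟩

lemma φA_branch : φA f₃ (C f₃ + X ^ 3 * C f₆) =
    C f₃ ^ 1 * (1 + C (f₃ ^ 2 * f₆) * X ^ 3) := by
  rw [map_add, map_mul, map_pow, φA_X, φA_C, φA_C]
  simp only [C_mul, C_pow]
  ring

lemma φB_branch : φB f₃ (C f₃ + X ^ 3 * C f₆) = φB f₃ X ^ 1 * gB f₃ f₆ := by
  have : gB f₃ f₆ = AdjoinRoot.root _ + φB f₃ (X ^ 2 * C f₆) := rfl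
  rw [this, map_add, map_mul, map_pow, ← X_mul_root, map_mul, map_pow]
  ring

lemma dvd_of_dvd_C_mul (h : f₃ ≠ 0) (y : ℂ[X][X])
    (hy : 1 + C (f₃ ^ 2 * f₆) * X ^ 3 ∣ C f₃ * y) : 1 + C (f₃ ^ 2 * f₆) * X ^ 3 ∣ y := by
  refine IsRelPrime.dvd_of_dvd_mul_left ?_ hy
  refine (isRelPrime_C h 0 ?_).symm
  have : (1 + C (f₃ ^ 2 * f₆) * X ^ 3 : ℂ[X][X]).coeff 0 = 1 := by
    rw [coeff_add, coeff_one_zero, mul_coeff_zero, coeff_X_pow]; simp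
  rw [this]
  exact isRelPrime_one_right

lemma X_dvd_of_dvd_C_mul (h : f₃ ≠ 0) (y : ℂ[X][X]) (hy : X ∣ C f₃ * y) : X ∣ y := by
  rw [X_dvd_iff] at hy ⊢
  rw [coeff_C_mul] at hy
  exact (mul_eq_zero.mp hy).resolve_left h

/-- Modulo `gB` the coordinate `r` can be eliminated as `-x² f₆`, which leaves `ℂ[t, x] / (f₃ + x³
f₆)`. There `x` is not a zero divisor. -/
lemma gB_dvd_of_dvd_X_mul (h : f₃ ≠ 0) (y : AB f₃) (hy : gB f₃ f₆ ∣ φB f₃ X * y) :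
    gB f₃ f₆ ∣ y := by
  have hg : gB f₃ f₆ = AdjoinRoot.root _ + φB f₃ (X ^ 2 * C f₆) := rfl
  -- Modulo `gB` every element is represented by a polynomial in `t` and `x` alone.
  obtain ⟨P, z, rfl⟩ : ∃ P z, y = φB f₃ P + gB f₃ f₆ * z := by
    let S : Subring (AB f₃) :=
      { carrier := { y | ∃ P z, y = φB f₃ P + gB f₃ f₆ * z }
        mul_mem' := by
          rintro _ _ ⟨P, y, rfl⟩ ⟨Q, z, rfl⟩
          exact ⟨P * Q, y * φB f₃ Q + z * φB f₃ P + gB f₃ f₆ * y * z, by rw [map_mul]; ring⟩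
        one_mem' := ⟨1, 0, by simp⟩
        add_mem' := by
          rintro _ _ ⟨P, y, rfl⟩ ⟨Q, z, rfl⟩
          exact ⟨P + Q, y + z, by rw [map_add]; ring⟩
        zero_mem' := ⟨0, 0, by simp⟩
        neg_mem' := by
          rintro _ ⟨P, y, rfl⟩
          exact ⟨-P, -y, by rw [map_neg]; ring⟩ }
    have hS : S = ⊤ := subring_adjoinRoot_eq_top S (fun a ↦ ⟨a, 0, by simp [φB]⟩)
      ⟨-(X ^ 2 * C f₆), 1, by rw [hg, map_neg]; ring⟩
    exact (hS ▸ Subring.mem_top y : y ∈ S)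
  have hP : gB f₃ f₆ ∣ φB f₃ (X * P) := by
    rw [mul_add] at hy
    rw [map_mul]
    exact (dvd_add_left ⟨φB f₃ X * z, by ring⟩).mp hy
  refine dvd_add ?_ (dvd_mul_right _ _)
  obtain ⟨R, _, m, hm⟩ : ∃ (R : Type) (_ : CommRing R) (m : ℂ[X][X] →+* R),
      ∀ a, m a = 0 ↔ C f₃ + X ^ 3 * C f₆ ∣ a :=
    ⟨ℂ[X][X] ⧸ Ideal.span {(C f₃ + X ^ 3 * C f₆ : ℂ[X][X])}, inferInstance, Ideal.Quotient.mk _,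
      fun a ↦ by rw [Ideal.Quotient.eq_zero_iff_mem, Ideal.mem_span_singleton]⟩
  -- The elimination map `r ↦ -x² f₆`. It kills `gB`, so it detects divisibility of polynomials in
  -- `t`, `x` by `f₃ + x³ f₆`.
  let χ : AB f₃ →+* R := AdjoinRoot.lift m (m (-(X ^ 2 * C f₆))) (by
    rw [eval₂_sub, eval₂_mul, eval₂_C, eval₂_X, eval₂_C, ← map_mul, ← map_sub, hm]
    exact ⟨-1, by ring⟩)
  have h1 : χ (gB f₃ f₆) = 0 := by
    rw [hg, map_add]
    change χ (AdjoinRoot.root _) + χ (AdjoinRoot.of _ _) = 0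
    rw [AdjoinRoot.lift_root, AdjoinRoot.lift_of, ← map_add, neg_add_cancel, map_zero]
  have h2 : χ (φB f₃ (X * P)) = 0 := by
    obtain ⟨c, hc⟩ := hP
    rw [hc, map_mul, h1, zero_mul]
  have h3 : χ (φB f₃ (X * P)) = m (X * P) := AdjoinRoot.lift_of _
  rw [h3, hm] at h2
  obtain ⟨c, rfl⟩ := dvd_of_dvd_X_mul h P h2
  rw [map_mul, φB_branch, pow_one]
  exact ⟨φB f₃ X * φB f₃ c, by ring⟩

end BranchCharts

/-! ### The charts of `R` -/

section ChartsOfR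

open Polynomial

namespace Frame

variable {f₃ f₆ : ℂ[X]} {K L : Type} [Field K] [Field L] [Algebra K L] (𝔽 : Frame f₃ f₆ K L)
  (hF : Squarefree (f₃ * f₆))

/-- The homomorphisms to the coordinate rings of the charts of the second blow-up. -/
def blowupHom : ∀ b : Bool, ℂ[X][X] →+* (𝔽.chart hF (some b)).A
  | true => φA f₃
  | false => φB f₃

variable (f₃) in
/-- The generators of the center of the second blow-up. -/
def blowupGen : Bool → ℂ[X][X]
  | true => C f₃
  | false => X

lemma range_blowupGen : Set.range (blowupGen f₃) = {X, C f₃} := by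
  ext a
  simp only [Set.mem_range, Bool.exists_bool, Set.mem_insert_iff, Set.mem_singleton_iff]
  exact or_congr eq_comm eq_comm

lemma isBlowupChart_blowupHom (b : Bool) :
    IsBlowupChart (Ideal.span {X, C f₃}) (blowupGen f₃ b) (𝔽.blowupHom hF b) := by
  cases b
  · exact isBlowupChart_φB (left_ne_zero_of_mul hF.ne_zero)
  · exact isBlowupChart_φA (left_ne_zero_of_mul hF.ne_zero)

lemma chart_ψ_comp_blowupHom (b : Bool) :
    (𝔽.chart hF (some b)).ψ.comp (𝔽.blowupHom hF b) = eval₂RingHom 𝔽.τ 𝔽.x := by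
  cases b
  · exact 𝔽.ψB_comp
  · exact 𝔽.ψA_comp (left_ne_zero_of_mul hF.ne_zero)

end Frame

variable {F₃ F₆ : MvPolynomial (Fin 2) ℂ} {K L : Type} [Field K] [Field L] [Algebra K L]
  (𝔓 : PlaneFrame K L F₃ F₆) (h₃ : F₃.IsHomogeneous 3) (h₆ : F₆.IsHomogeneous 6)
  (hF : Squarefree (F₃ * F₆))

section

variable {f₃ f₆ : ℂ[X]} {X' : Scheme.{0}} (C₁ C₂ : Closeds X') (q : Spec (.of ℂ[X][X]) ⟶ X')

/-- In this chart `x = 0` is the exceptional divisor itself, so the strict transform of `E_p` is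
empty. That of `K` is `r + x² f₆ = 0`. -/
lemma preimage_branch_φB (hf₃ : f₃ ≠ 0)
    (h₁ : q ⁻¹' C₁ = PrimeSpectrum.zeroLocus {C f₃ + X ^ 3 * C f₆})
    (h₂ : q ⁻¹' C₂ = PrimeSpectrum.zeroLocus {(X : ℂ[X][X])})
    (h₁₂ : q ⁻¹' ((C₁ ⊓ C₂ : Closeds X') : Set X') = PrimeSpectrum.zeroLocus {(X : ℂ[X][X]), C f₃})
    (c : Spec (.of (AB f₃)) ⟶ Bl X' (C₁ ⊓ C₂)) [IsOpenImmersion c]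
    (hc : c ≫ Bl.map X' (C₁ ⊓ C₂) = Spec.map (CommRingCat.ofHom (φB f₃)) ≫ q) :
    c ⁻¹' (Bl.strictTransform X' (C₁ ⊓ C₂) C₁ ∪ Bl.strictTransform X' (C₁ ⊓ C₂) C₂ : Set _) =
      PrimeSpectrum.zeroLocus {gB f₃ f₆} := by
  have e₁ := specMap_preimage_zeroLocus (φB f₃) q h₁
  have e₂ := specMap_preimage_zeroLocus (φB f₃) q h₂
  have e₁₂ := specMap_preimage_zeroLocus (φB f₃) q h₁₂
  rw [Set.image_singleton] at e₁ e₂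
  rw [Set.image_pair, Set.pair_comm, zeroLocus_pair_eq (Dvd.intro _ X_mul_root)] at e₁₂
  rw [φB_branch] at e₁
  rw [← pow_one (φB f₃ X), ← mul_one (φB f₃ X ^ 1)] at e₂
  rw [Set.preimage_union, preimage_strictTransform_eq _ _ c hc 1 e₁ e₁₂ (gB_dvd_of_dvd_X_mul hf₃),
    preimage_strictTransform_eq _ _ c hc 1 e₂ e₁₂ (fun _ _ ↦ one_dvd _), zeroLocus_one]
  exact Set.union_empty _

/-- With the exceptional factor `f₃` removed, `K` becomes `1 + f₃² f₆ s³` and `E_p` becomes `s`.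
Their product is `gA`. -/
lemma preimage_branch_φA (hf₃ : f₃ ≠ 0)
    (h₁ : q ⁻¹' C₁ = PrimeSpectrum.zeroLocus {C f₃ + X ^ 3 * C f₆})
    (h₂ : q ⁻¹' C₂ = PrimeSpectrum.zeroLocus {(X : ℂ[X][X])})
    (h₁₂ : q ⁻¹' ((C₁ ⊓ C₂ : Closeds X') : Set X') = PrimeSpectrum.zeroLocus {(X : ℂ[X][X]), C f₃})
    (c : Spec (.of ℂ[X][X]) ⟶ Bl X' (C₁ ⊓ C₂)) [IsOpenImmersion c]
    (hc : c ≫ Bl.map X' (C₁ ⊓ C₂) = Spec.map (CommRingCat.ofHom (φA f₃)) ≫ q) :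
    c ⁻¹' (Bl.strictTransform X' (C₁ ⊓ C₂) C₁ ∪ Bl.strictTransform X' (C₁ ⊓ C₂) C₂ : Set _) =
      PrimeSpectrum.zeroLocus {gA f₃ f₆} := by
  have e₁ := specMap_preimage_zeroLocus (φA f₃) q h₁
  have e₂ := specMap_preimage_zeroLocus (φA f₃) q h₂
  have e₁₂ := specMap_preimage_zeroLocus (φA f₃) q h₁₂
  rw [Set.image_singleton] at e₁ e₂
  rw [Set.image_pair, φA_X, φA_C, zeroLocus_pair_eq (Dvd.intro _ rfl)] at e₁₂
  rw [φA_branch] at e₁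
  rw [φA_X, ← pow_one (C f₃)] at e₂
  rw [Set.preimage_union, preimage_strictTransform_eq _ _ c hc 1 e₁ e₁₂ (dvd_of_dvd_C_mul hf₃),
    preimage_strictTransform_eq _ _ c hc 1 e₂ e₁₂ (X_dvd_of_dvd_C_mul hf₃)]
  have hg : gA f₃ f₆ = (1 + C (f₃ ^ 2 * f₆) * X ^ 3) * X := by
    rw [gA]; ring
  rw [hg]
  ext y
  change (_ ⊆ (y.asIdeal : Set ℂ[X][X]) ∨ _ ⊆ (y.asIdeal : Set ℂ[X][X])) ↔
    _ ⊆ (y.asIdeal : Set ℂ[X][X])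
  simp only [Set.singleton_subset_iff, SetLike.mem_coe]
  exact y.2.mul_mem_iff_mem_or_mem.symm

lemma preimage_branch_of_disjoint {g : ℂ[X][X]} (h : ∀ x, q x ∉ C₁ ⊓ C₂)
    (h₁ : q ⁻¹' C₁ = PrimeSpectrum.zeroLocus {g}) (h₂ : q ⁻¹' (C₂ : Set X') = ∅)
    (c : Spec (.of ℂ[X][X]) ⟶ Bl X' (C₁ ⊓ C₂)) [IsOpenImmersion c]
    (hc : c ≫ Bl.map X' (C₁ ⊓ C₂) = q) :
    c ⁻¹' (Bl.strictTransform X' (C₁ ⊓ C₂) C₁ ∪ Bl.strictTransform X' (C₁ ⊓ C₂) C₂ : Set _) =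
      PrimeSpectrum.zeroLocus {g} := by
  rw [Set.preimage_union, preimage_strictTransform_eq (h := 1) _ _ c hc 0
      (by rw [pow_zero, one_mul]; exact h₁)
      (by rw [zeroLocus_one]; exact Set.eq_empty_of_forall_notMem h)
      (fun y hy ↦ by rwa [one_mul] at hy),
    preimage_strictTransform _ _ c hc, h₂, Set.empty_sdiff, closure_empty]
  exact Set.union_empty _

lemma specMap_comp_of_comp_eq {A : Type} [CommRing A] {ζ : MvPolynomial (Fin 2) ℂ →+* K}
    {φ : ℂ[X][X] →+* A} {ψ : A →+* K} {θ : ℂ[X][X] →+* K} {i : Fin 2} (h : ψ.comp φ = θ)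
    (h' : θ.comp (φE i) = ζ) :
    Spec.map (CommRingCat.ofHom ψ) ≫ Spec.map (CommRingCat.ofHom φ) ≫
      Spec.map (CommRingCat.ofHom (φE i)) ≫ planeChartZero =
    Spec.map (CommRingCat.ofHom ζ) ≫ planeChartZero := by
  subst h h'
  rw [RingHom.comp_assoc, CommRingCat.ofHom_comp, CommRingCat.ofHom_comp, Spec.map_comp,
    Spec.map_comp, Category.assoc, Category.assoc]

end

/-- The charts of the blow-up `R`. -/
theorem exists_charts_R :
    ∃ (c : ∀ k, Spec (.of (𝔓.chart h₃ h₆ hF k).A) ⟶ R F₃ F₆) (η : Spec (.of K) ⟶ R F₃ F₆),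
      (∀ k, IsOpenImmersion (c k)) ∧ (∀ y, ∃ k, y ∈ Set.range (c k)) ∧
      (∀ k, Spec.map (CommRingCat.ofHom (𝔓.chart h₃ h₆ hF k).ψ) ≫ c k = η) ∧
      (∀ k, c k ⁻¹' ((KHat F₃ F₆ : Set (R F₃ F₆)) ∪ EpHat F₃ F₆) =
        PrimeSpectrum.zeroLocus {(𝔓.chart h₃ h₆ hF k).g}) ∧
      (∀ i, c (i, none) ≫ R.toPlane F₃ F₆ = planeChartSucc i) ∧
      (∀ i y, R.toPlane F₃ F₆ y ∈ Set.range (planeChartSucc i) → y ∈ Set.range (c (i, none))) := by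
  obtain ⟨q, q', hq, hq', hqm, hqm', hqr, hqc⟩ := exists_charts_Q
  have hf (i) := squarefree_dehom_mul h₃ h₆ hF i
  have hf₃ (i) : Squarefree (dehom i F₃) := (squarefree_mul_iff.mp (hf i)).2.1
  have hdis (i) (x) : q' i x ∉ PlaneSextic.K F₃ F₆ ⊓ Ep := fun hx ↦ by
    have h1 : x ∈ q' i ⁻¹' (Ep : Set Q) := hx.2
    rw [preimage_Ep_eq_empty (hqm' i)] at h1
    exact h1
  choose c hc hcm hcr using fun i ↦ exists_blowup_charts (PlaneSextic.K F₃ F₆ ⊓ Ep) (q i)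
    (Frame.blowupGen (dehom i F₃)) (by
      rw [vanishingIdeal_K_inf_Ep h₃ h₆ (hf₃ i) (hqm i), Frame.range_blowupGen])
    (fun b ↦ ((𝔓.frame h₃ h₆ i).chart (hf i) (some b)).A) ((𝔓.frame h₃ h₆ i).blowupHom (hf i))
    (fun b ↦ by
      rw [vanishingIdeal_K_inf_Ep h₃ h₆ (hf₃ i) (hqm i)]
      exact (𝔓.frame h₃ h₆ i).isBlowupChart_blowupHom (hf i) b)
  choose c' hc' hcm' hcr' using fun i ↦
    exists_blowup_chart_of_disjoint (PlaneSextic.K F₃ F₆ ⊓ Ep) (q' i) (hdis i)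
  let d : ∀ k, Spec (.of (𝔓.chart h₃ h₆ hF k).A) ⟶ R F₃ F₆
    | (i, none) => c' i
    | (i, some b) => c i b
  have hd : ∀ k, IsOpenImmersion (d k)
    | (i, none) => hc' i
    | (i, some b) => hc i b
  have hdp (i) : d (i, none) ≫ R.toPlane F₃ F₆ = planeChartSucc i := by
    rw [R.toPlane, ← Category.assoc, ← hqm', ← hcm' i]
    rfl
  have hdr (i y) (hy : R.toPlane F₃ F₆ y ∈ Set.range (planeChartSucc i)) :
      y ∈ Set.range (d (i, none)) :=
    hcr' i y (hqr i _ (by rwa [R.toPlane, Scheme.Hom.comp_apply] at hy))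
  have hgen : ∀ k, Spec.map (CommRingCat.ofHom (𝔓.chart h₃ h₆ hF k).ψ) ≫ d k ≫ R.toPlane F₃ F₆ =
      𝔓.genericPoint
    | (i, none) => by rw [hdp]; exact 𝔓.specMap_planeChartSucc h₃ h₆ i
    | (i, some b) => by
      have h1 : d (i, some b) ≫ R.toPlane F₃ F₆ =
          Spec.map (CommRingCat.ofHom ((𝔓.frame h₃ h₆ i).blowupHom (hf i) b)) ≫
            Spec.map (CommRingCat.ofHom (φE i)) ≫ planeChartZero := by
        rw [R.toPlane, ← Category.assoc]
        refine (congrArg (· ≫ Bl.map (PP 2) p) (hcm i b)).trans ?_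
        rw [Category.assoc, hqm]
      rw [h1]
      exact specMap_comp_of_comp_eq ((𝔓.frame h₃ h₆ i).chart_ψ_comp_blowupHom (hf i) b)
        (eval₂_slopeHom_comp 𝔓.isFracHom i)
  have := hd (0, none)
  -- Over one standard chart of the plane the map from `R` is an isomorphism, so the generic point
  -- of the plane has a unique lift to `R`. This identifies the generic points of all charts.
  have hpb := isPullback_of_openImmersion (R.toPlane F₃ F₆) (planeChartSucc 0) (d (0, none))
    (hdp 0) (hdr 0)
  refine ⟨d, Spec.map (CommRingCat.ofHom (𝔓.chart h₃ h₆ hF (0, none)).ψ) ≫ d (0, none), hd,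
    fun y ↦ ?_, fun k ↦ ?_, ?_, hdp, hdr⟩
  · obtain ⟨i, hi⟩ | ⟨i, hi⟩ := hqc (Bl.map Q (PlaneSextic.K F₃ F₆ ⊓ Ep) y)
    · obtain ⟨b, hb⟩ := hcr i y hi
      exact ⟨(i, some b), hb⟩
    · exact ⟨(i, none), hcr' i y hi⟩
  · have e : (Spec.map (CommRingCat.ofHom (𝔓.chart h₃ h₆ hF k).ψ) ≫ d k) ≫ R.toPlane F₃ F₆ =
        Spec.map (CommRingCat.ofHom (𝔓.frame h₃ h₆ 0).ψC) ≫ planeChartSucc 0 := by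
      rw [Category.assoc, hgen, 𝔓.specMap_planeChartSucc h₃ h₆ 0]
    have h1 := hpb.lift_fst _ _ e
    have h2 := hpb.lift_snd _ _ e
    rw [Category.comp_id] at h2
    rw [← h1, h2]
    rfl
  · rintro ⟨i, _ | b⟩
    · exact preimage_branch_of_disjoint _ _ (q' i) (hdis i) (preimage_K_eq_gC h₃ h₆ (hqm' i))
        (preimage_Ep_eq_empty (hqm' i)) (c' i) (hcm' i)
    · have := hc i b
      have h1 := preimage_K h₃ h₆ (hf₃ i).ne_zero (hqm i)
      have h2 := preimage_Ep (hqm i)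
      have h3 := preimage_K_inf_Ep h₃ h₆ (hf₃ i).ne_zero (hqm i)
      cases b
      · have : IsOpenImmersion (X := Spec (.of (AB (dehom i F₃)))) (c i false) := hc i false
        exact preimage_branch_φB _ _ (q i) (hf₃ i).ne_zero h1 h2 h3 (c i false) (hcm i false)
      · have : IsOpenImmersion (X := Spec (.of ℂ[X][X])) (c i true) := hc i true
        exact preimage_branch_φA _ _ (q i) (hf₃ i).ne_zero h1 h2 h3 (c i true) (hcm i true)

end ChartsOfR

/-! ### Affine charts of a normalization -/

section NormalizationChart

variable {A D L : Type} [CommRing A] [CommRing D] [CommRing L]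

lemma exists_equiv_of_range_eq {B : Type} [CommRing B] {a : B →+* L} {b : D →+* L}
    (ha : Function.Injective a) (hb : Function.Injective b) (h : a.range = b.range) :
    ∃ β : B ≃+* D, b.comp (β : B →+* D) = a := by
  let eb : D ≃+* b.range := RingEquiv.ofBijective b.rangeRestrict
    ⟨fun x y hxy ↦ hb (congrArg Subtype.val hxy), b.rangeRestrict_surjective⟩
  let ea : B ≃+* a.range := RingEquiv.ofBijective a.rangeRestrict
    ⟨fun x y hxy ↦ ha (congrArg Subtype.val hxy), a.rangeRestrict_surjective⟩
  refine ⟨(ea.trans (RingEquiv.subringCongr h)).trans eb.symm, RingHom.ext fun x ↦ ?_⟩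
  have := congrArg Subtype.val (eb.apply_symm_apply (RingEquiv.subringCongr h (ea x)))
  exact this

/-- The chart of a normalization over an affine open, for a spectrum with known integral closure. -/
theorem exists_normalization_chart {X Y : Scheme.{0}} (f : X ⟶ Y) [QuasiCompact f]
    [QuasiSeparated f] (c : Spec (.of A) ⟶ Y) [IsOpenImmersion c] (ε : Spec (.of L) ≅ X)
    (σ : A →+* L) (hσ : ε.hom ≫ f = Spec.map (CommRingCat.ofHom σ) ≫ c) (ι : A →+* D)
    (Δ : D →+* L) (hΔ : Function.Injective Δ) (hι : Δ.comp ι = σ)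
    (hr : ∀ z, σ.IsIntegralElem z ↔ z ∈ Δ.range) :
    ∃ d : Spec (.of D) ⟶ f.normalization,
      IsPullback d (Spec.map (CommRingCat.ofHom ι)) f.fromNormalization c ∧
      Spec.map (CommRingCat.ofHom Δ) ≫ d = ε.hom ≫ f.toNormalization := by
  obtain ⟨⟨U, hUa⟩, e, he, hU⟩ := exists_affineSite c
  change Γ(Y, U) ≃+* A at e
  change Spec.map (CommRingCat.ofHom (e : Γ(Y, U) →+* A)) ≫ hUa.fromSpec = c at he
  change (U : Set Y) = _ at hU
  have hU' : U = c.opensRange := Opens.ext hU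
  let V : X.Opens := f ⁻¹ᵁ U
  let ℓ : Spec (.of L) ⟶ V := IsOpenImmersion.lift V.ι ε.hom (by
    rintro _ ⟨z, rfl⟩
    rw [Scheme.Opens.range_ι]
    change f (ε.hom z) ∈ U
    rw [← Scheme.Hom.comp_apply, hσ, hU', Scheme.Hom.comp_apply]
    exact ⟨_, rfl⟩)
  have hℓ : ℓ ≫ V.ι = ε.hom := IsOpenImmersion.lift_fac _ _ _
  -- The morphism from `Spec L` already lands in the affine open, so the preimage of that open is
  -- all of `X`.
  have hι' : IsIso V.ι := by
    have : IsSplitEpi V.ι := ⟨⟨⟨ε.inv ≫ ℓ, by rw [Category.assoc, hℓ, Iso.inv_hom_id]⟩⟩⟩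
    exact isIso_of_mono_of_isSplitEpi _
  have hℓ' : IsIso ℓ := by
    have : IsIso (ℓ ≫ V.ι) := by rw [hℓ]; infer_instance
    exact IsIso.of_isIso_comp_right ℓ V.ι
  have hV : IsAffineOpen V := IsAffine.of_isIso (inv ℓ)
  have hT : IsIso V.toSpecΓ := by rw [← hV.isoSpec_hom]; infer_instance
  let α : Γ(X, V) ⟶ .of L := Spec.preimage (ℓ ≫ V.toSpecΓ)
  have hα : Spec.map α = ℓ ≫ V.toSpecΓ := Spec.map_preimage _
  have hαi : IsIso α := by
    have : IsIso (Scheme.Spec.map α.op) := by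
      change IsIso (Spec.map α)
      rw [hα]; infer_instance
    have : IsIso α.op := isIso_of_reflects_iso α.op Scheme.Spec
    exact (isIso_op_iff α).mp this
  have hαf : (f.app U) ≫ α =
      CommRingCat.ofHom (e : Γ(Y, U) →+* A) ≫ CommRingCat.ofHom σ := by
    apply Spec.map_injective
    rw [← cancel_mono hUa.fromSpec, Spec.map_comp, Spec.map_comp, hα, Category.assoc, Category.assoc,
      Category.assoc, he, ← hσ, ← hℓ, Category.assoc]
    congr 1
    change (f ⁻¹ᵁ U).toSpecΓ ≫ _ = (f ⁻¹ᵁ U).ι ≫ f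
    simp
  have hαf' (y : Γ(Y, U)) : α.hom ((f.app U).hom y) = σ (e y) :=
    congrArg (fun h ↦ h.hom y) hαf
  let := (f.app U).hom.toAlgebra
  let B := integralClosure Γ(Y, U) Γ(X, V)
  have hαb : Function.Bijective α.hom := (ConcreteCategory.isIso_iff_bijective α).mp hαi
  -- Integrality over the sections of the affine open is integrality over `A` along `σ`, because `e`
  -- and `α` are isomorphisms. By hypothesis these elements are the image of `D`.
  have hint (z : Γ(X, V)) : z ∈ B ↔ σ.IsIntegralElem (α.hom z) := by
    have hcomp : α.hom.comp (f.app U).hom = σ.comp (e : Γ(Y, U) →+* A) :=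
      congrArg CommRingCat.Hom.hom hαf
    constructor
    · rintro ⟨P, hP, hPz⟩
      refine ⟨P.map (e : Γ(Y, U) →+* A), hP.map _, ?_⟩
      rw [Polynomial.eval₂_map, ← hcomp, ← Polynomial.hom_eval₂]
      change α.hom (Polynomial.eval₂ (algebraMap Γ(Y, U) Γ(X, V)) z P) = 0
      rw [hPz, map_zero]
    · rintro ⟨P, hP, hPz⟩
      refine ⟨P.map (e.symm : A →+* Γ(Y, U)), hP.map _, hαb.1 ?_⟩
      rw [map_zero, Polynomial.eval₂_map, Polynomial.hom_eval₂, ← hPz]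
      congr 1
      ext a
      rw [RingHom.comp_apply, RingHom.comp_apply]
      refine (hαf' _).trans ?_
      exact congrArg σ (e.apply_symm_apply a)
  obtain ⟨β, hβ⟩ := exists_equiv_of_range_eq (a := α.hom.comp B.val.toRingHom) (b := Δ)
    (hαb.1.comp Subtype.val_injective) hΔ (by
      ext z
      constructor
      · rintro ⟨b, rfl⟩
        exact (hr _).mp ((hint _).mp b.2)
      · intro hz
        obtain ⟨z, rfl⟩ := hαb.2 z
        exact ⟨⟨z, (hint _).mpr ((hr _).mpr hz)⟩, rfl⟩)
  have := isIso_specMap_of_bijective (φ := (β : B →+* D)) β.bijective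
  let N : Spec (.of B) ⟶ f.normalization := f.normalizationOpenCover.f ⟨U, hUa⟩
  have hN : N ≫ f.fromNormalization =
      Spec.map (CommRingCat.ofHom (algebraMap Γ(Y, U) B)) ≫ hUa.fromSpec :=
    f.ι_fromNormalization ⟨U, hUa⟩
  have hNo : IsOpenImmersion N :=
    f.normalizationOpenCover.map_prop (⟨U, hUa⟩ : Scheme.AffineZariskiSite Y)
  have hNr : f.fromNormalization ⁻¹ᵁ U = N.opensRange := f.fromNormalization_preimage ⟨U, hUa⟩
  have hNt : V.ι ≫ f.toNormalization =
      V.toSpecΓ ≫ Spec.map (CommRingCat.ofHom B.val.toRingHom) ≫ N :=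
    f.ι_toNormalization ⟨U, hUa⟩
  have hβι : (β : B →+* D).comp (algebraMap Γ(Y, U) B) = ι.comp (e : Γ(Y, U) →+* A) := by
    ext y
    apply hΔ
    exact (RingHom.congr_fun hβ _).trans ((hαf' y).trans (RingHom.congr_fun hι (e y)).symm)
  refine ⟨Spec.map (CommRingCat.ofHom (β : B →+* D)) ≫ N,
    (IsOpenImmersion.isPullback (Spec.map (CommRingCat.ofHom ι)) _ c f.fromNormalization ?_ ?_).flip,
    ?_⟩
  · rw [Category.assoc, hN, ← he, ← Category.assoc, ← Category.assoc, ← Spec.map_comp,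
      ← Spec.map_comp, ← CommRingCat.ofHom_comp, ← CommRingCat.ofHom_comp, hβι]
  · rw [← hU', hNr]
    exact (Scheme.Hom.opensRange_comp_of_isIso _ _).symm
  · have h1 : Spec.map (CommRingCat.ofHom Δ) ≫ Spec.map (CommRingCat.ofHom (β : B →+* D)) =
        (ℓ ≫ V.toSpecΓ) ≫ Spec.map (CommRingCat.ofHom B.val.toRingHom) := by
      rw [← hα, ← Spec.map_comp, ← Spec.map_comp]
      exact congrArg (fun h ↦ Spec.map (CommRingCat.ofHom h)) hβ
    rw [← hℓ, Category.assoc, hNt, ← Category.assoc, h1, Category.assoc, Category.assoc]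

end NormalizationChart

/-! ### The charts of `W_F` -/

section ChartsOfW

open MvPolynomial

lemma DoubleChart.isIntegralElem_Δ {K L : Type} [Field K] [Field L] [Algebra K L]
    (𝒟 : DoubleChart K L) (y : 𝒟.D) : ((algebraMap K L).comp 𝒟.ψ).IsIntegralElem (𝒟.Δ y) := by
  have : Module.Finite 𝒟.A 𝒟.D := (monic_dbl 𝒟.g).finite_adjoinRoot
  obtain ⟨P, hP, hPy⟩ := Algebra.IsIntegral.isIntegral (R := 𝒟.A) y
  refine ⟨P, hP, ?_⟩
  rw [← 𝒟.Δ_comp_of, ← Polynomial.hom_eval₂]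
  exact (congrArg 𝒟.Δ hPy).trans (map_zero _)

variable {F₃ F₆ : MvPolynomial (Fin 2) ℂ} (h₃ : F₃.IsHomogeneous 3) (h₆ : F₆.IsHomogeneous 6)

/-- The coordinate ring of the chart `X 0 ≠ 0` is a polynomial ring. -/
def chartRingEquiv : ChartRing ≃+* MvPolynomial (Fin 2) ℂ :=
  RingEquiv.ofBijective _ dehomZero_bijective

instance : IsDomain ChartRing := chartRingEquiv.toMulEquiv.isDomain _

/-- The embedding of the polynomial ring in two variables into the function field of the plane. -/
def planeζ : MvPolynomial (Fin 2) ℂ →+* PlaneFunctionField :=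
  (algebraMap ChartRing PlaneFunctionField).comp chartRingEquiv.symm

lemma planeζ_apply (a : ChartRing) :
    planeζ (chartRingEquiv a) = algebraMap ChartRing PlaneFunctionField a :=
  congrArg (algebraMap ChartRing PlaneFunctionField) (chartRingEquiv.symm_apply_apply a)

lemma isFracHom_planeζ : IsFracHom planeζ where
  injective := (IsFractionRing.injective ChartRing PlaneFunctionField).comp
    chartRingEquiv.symm.injective
  exists_eq k := by
    obtain ⟨a, b, hb, rfl⟩ := IsFractionRing.div_surjective (A := ChartRing) k
    have hb' : algebraMap ChartRing PlaneFunctionField b ≠ 0 :=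
      (map_ne_zero_iff _ (IsFractionRing.injective ChartRing PlaneFunctionField)).mpr
        (nonZeroDivisors.ne_zero hb)
    refine ⟨chartRingEquiv a, chartRingEquiv b, ?_, ?_⟩
    · rwa [planeζ_apply]
    · rw [planeζ_apply, planeζ_apply, div_mul_cancel₀ _ hb']

lemma chartRingEquiv_dehomogenized : chartRingEquiv (dehomogenized h₃ h₆) = F₃ + F₆ := by
  have h := awayLift_mk_mul (coordGrading 2) dehomZero (dehomZero_X_zero.symm ▸ isUnit_one)
    (isHomogeneous_X ℂ (0 : Fin 3)) 6 (sextic F₃ F₆) (isHomogeneous_sextic h₃ h₆)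
  have h1 : dehomZero (X 0) ^ 6 = 1 := by rw [dehomZero_X_zero, one_pow]
  rw [h1, mul_one] at h
  refine h.trans ?_
  rw [sextic, map_add, map_mul, map_pow, dehomZero_X_zero, one_pow, one_mul, dehomZero_pencil,
    dehomZero_pencil]

/-- The branch function is not a square in the function field of the plane, so the ring in which `R`
is normalized is a field. -/
lemma irreducible_doublePlane (hF : Squarefree (F₃ * F₆)) :
    Irreducible (Polynomial.X ^ 2 -
      Polynomial.C (algebraMap ChartRing PlaneFunctionField (dehomogenized h₃ h₆))) := by
  refine X_pow_sub_C_irreducible_of_prime Nat.prime_two fun b ↦ ?_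
  rw [← planeζ_apply, chartRingEquiv_dehomogenized]
  exact sq_ne_map_add isFracHom_planeζ h₃ h₆ hF b

/-- The function field of the double plane, with its square root of `F / X₀⁶`. -/
def planeFrame [Fact (Irreducible (Polynomial.X ^ 2 -
      Polynomial.C (algebraMap ChartRing PlaneFunctionField (dehomogenized h₃ h₆))))] :
    PlaneFrame PlaneFunctionField (DoublePlaneFunctionField h₃ h₆) F₃ F₆ where
  ζ := planeζ
  w := Dbl.root _
  isFracHom := isFracHom_planeζ
  sq_eq := by
    rw [Dbl.root_sq, ← chartRingEquiv_dehomogenized h₃ h₆, planeζ_apply]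
    rfl
  exists_eq z := Dbl.exists_eq _ z

lemma genericDoublePoint_eq [Fact (Irreducible (Polynomial.X ^ 2 -
      Polynomial.C (algebraMap ChartRing PlaneFunctionField (dehomogenized h₃ h₆))))] :
    genericDoublePoint h₃ h₆ = Spec.map (CommRingCat.ofHom
      (algebraMap PlaneFunctionField (DoublePlaneFunctionField h₃ h₆))) ≫
      (planeFrame h₃ h₆).genericPoint := by
  rw [genericDoublePoint, CommRingCat.ofHom_comp, Spec.map_comp, Category.assoc]
  congr 1
  rw [PlaneFrame.genericPoint]
  refine Eq.trans ?_ (Category.assoc _ _ _)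
  congr 1
  rw [← Spec.map_comp]
  congr 1
  ext a
  exact (planeζ_apply a).symm

/-- The double plane has a presentation of its function field. -/
lemma exists_planeFrame (hF : Squarefree (F₃ * F₆)) :
    ∃ (K L : Type) (_ : Field K) (_ : Field L) (_ : Algebra K L) (𝔓 : PlaneFrame K L F₃ F₆)
      (e : Spec (.of L) ≅ Spec (.of (DoublePlaneFunctionField h₃ h₆))),
      e.hom ≫ genericDoublePoint h₃ h₆ =
        Spec.map (CommRingCat.ofHom (algebraMap K L)) ≫ 𝔓.genericPoint := by
  have : Fact (Irreducible (Polynomial.X ^ 2 -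
      Polynomial.C (algebraMap ChartRing PlaneFunctionField (dehomogenized h₃ h₆)))) :=
    ⟨irreducible_doublePlane h₃ h₆ hF⟩
  exact ⟨PlaneFunctionField, DoublePlaneFunctionField h₃ h₆, inferInstance, inferInstance,
    inferInstance, planeFrame h₃ h₆, Iso.refl _, by
      rw [Iso.refl_hom, Category.id_comp]; exact genericDoublePoint_eq h₃ h₆⟩

variable {h₃ h₆} {K L : Type} [Field K] [Field L] [Algebra K L] (𝔓 : PlaneFrame K L F₃ F₆)

/-- The charts of the surface `W` over the charts of the blow-up `R`. -/
theorem exists_charts_W (hF : Squarefree (F₃ * F₆))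
    (e : Spec (.of L) ≅ Spec (.of (DoublePlaneFunctionField h₃ h₆)))
    (he : e.hom ≫ genericDoublePoint h₃ h₆ =
      Spec.map (CommRingCat.ofHom (algebraMap K L)) ≫ 𝔓.genericPoint) :
    ∃ (c : ∀ k, Spec (.of (𝔓.chart h₃ h₆ hF k).A) ⟶ R F₃ F₆)
      (d : ∀ k, Spec (.of (𝔓.chart h₃ h₆ hF k).D) ⟶ W h₃ h₆)
      (η : Spec (.of L) ⟶ W h₃ h₆),
      (∀ k, IsOpenImmersion (c k)) ∧ (∀ y, ∃ k, y ∈ Set.range (c k)) ∧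
      (∀ k, c k ⁻¹' ((KHat F₃ F₆ : Set (R F₃ F₆)) ∪ EpHat F₃ F₆) =
        PrimeSpectrum.zeroLocus {(𝔓.chart h₃ h₆ hF k).g}) ∧
      (∀ k, IsPullback (d k) (Spec.map (CommRingCat.ofHom (AdjoinRoot.of _))) (W.toR h₃ h₆) (c k)) ∧
      (∀ k, Spec.map (CommRingCat.ofHom (𝔓.chart h₃ h₆ hF k).Δ) ≫ d k = η) ∧
      (∀ i, c (i, none) ≫ R.toPlane F₃ F₆ = planeChartSucc i) ∧
      (∀ k, Spec.map (CommRingCat.ofHom (𝔓.chart h₃ h₆ hF k).ψ) ≫ c k ≫ R.toPlane F₃ F₆ =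
        𝔓.genericPoint) ∧ IsIntegral (W h₃ h₆) := by
  obtain ⟨c, η, hc, hcov, hη, hbr, hpl, hr⟩ := exists_charts_R 𝔓 h₃ h₆ hF
  let c₀ : Spec (.of (Polynomial (Polynomial ℂ))) ⟶ R F₃ F₆ := c (0, none)
  have hc₀ : IsOpenImmersion c₀ := hc (0, none)
  have hpl₀ : c₀ ≫ R.toPlane F₃ F₆ = planeChartSucc 0 := hpl 0
  have hp := isPullback_of_openImmersion (R.toPlane F₃ F₆) (planeChartSucc 0) c₀ hpl₀ (hr 0)
  let l : Spec (.of L) ⟶ Spec (.of K) := Spec.map (CommRingCat.ofHom (algebraMap K L))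
  let m : Spec (.of K) ⟶ Spec (.of (Polynomial (Polynomial ℂ))) :=
    Spec.map (CommRingCat.ofHom (𝔓.frame h₃ h₆ 0).ψC)
  have hm : m ≫ c₀ = η := hη (0, none)
  have hm' : m ≫ planeChartSucc 0 = 𝔓.genericPoint := 𝔓.specMap_planeChartSucc h₃ h₆ 0
  have hgen : η ≫ R.toPlane F₃ F₆ = 𝔓.genericPoint := by
    rw [← hm, Category.assoc, hpl₀, hm']
  -- The map from `R` is an isomorphism over a chart containing the generic point, so base change to
  -- `R` leaves the generic point of the double plane unchanged.
  have hP : IsPullback (l ≫ η) e.hom (R.toPlane F₃ F₆) (genericDoublePoint h₃ h₆) := by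
    have h1 : IsPullback (l ≫ m) e.hom (𝟙 _) (e.inv ≫ l ≫ m) := IsPullback.of_vert_isIso ⟨by simp⟩
    have h2 := h1.paste_horiz hp.flip.flip
    have e1 : (l ≫ m) ≫ c₀ = l ≫ η := by rw [Category.assoc, hm]
    have e2 : (e.inv ≫ l ≫ m) ≫ planeChartSucc 0 = genericDoublePoint h₃ h₆ := by
      rw [Category.assoc, Category.assoc, hm', ← he, Iso.inv_hom_id_assoc]
    rwa [e1, e2] at h2
  let ε := hP.isoPullback
  have hε : ε.hom ≫ genericDoublePointToR h₃ h₆ = l ≫ η := hP.isoPullback_hom_fst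
  have : Nonempty ((pullback (R.toPlane F₃ F₆) (genericDoublePoint h₃ h₆) : Scheme.{0}) : Type) :=
    ⟨ε.hom (Classical.arbitrary _)⟩
  have hX : IsIntegral (pullback (R.toPlane F₃ F₆) (genericDoublePoint h₃ h₆)) :=
    isIntegral_of_isOpenImmersion ε.inv
  have key : ∀ k, ∃ d : Spec (.of (𝔓.chart h₃ h₆ hF k).D) ⟶ W h₃ h₆,
      IsPullback d (Spec.map (CommRingCat.ofHom (AdjoinRoot.of _))) (W.toR h₃ h₆) (c k) ∧
      Spec.map (CommRingCat.ofHom (𝔓.chart h₃ h₆ hF k).Δ) ≫ d =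
        ε.hom ≫ (genericDoublePointToR h₃ h₆).toNormalization := fun k ↦ by
    have := hc k
    exact exists_normalization_chart (genericDoublePointToR h₃ h₆) (c k) ε
      ((algebraMap _ _).comp (𝔓.chart h₃ h₆ hF k).ψ) (by
        rw [hε, CommRingCat.ofHom_comp, Spec.map_comp, Category.assoc, hη])
      (AdjoinRoot.of _) (𝔓.chart h₃ h₆ hF k).Δ (𝔓.chart h₃ h₆ hF k).Δ_injective
      -- Integral closedness of the double chart gives one inclusion. Finiteness of the double cover
      -- over the base ring gives the other.
      (𝔓.chart h₃ h₆ hF k).Δ_comp_of fun z ↦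
        ⟨fun hz ↦ (𝔓.chart h₃ h₆ hF k).exists_lift_eq z hz,
          fun ⟨y, hy⟩ ↦ hy ▸ (𝔓.chart h₃ h₆ hF k).isIntegralElem_Δ y⟩
  choose d hd hd' using key
  refine ⟨c, d, ε.hom ≫ (genericDoublePointToR h₃ h₆).toNormalization, hc, hcov, hbr, hd, hd', hpl,
    fun k ↦ ?_, ?_⟩
  · rw [← hgen, ← hη k, Category.assoc]
  · rw [W]
    infer_instance

end ChartsOfW

/-! ### Double covers and their branch loci -/

section DoubleCover

open Polynomial

lemma exists_basis_two {S T : Type} [CommRing S] [CommRing T] (p : S →+* T) (r : T)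
    (hs : ∀ z, ∃ a b, z = p a + p b * r) (hi : ∀ a b, p a + p b * r = 0 → a = 0 ∧ b = 0) :
    letI := p.toAlgebra
    Nonempty (Module.Basis (Fin 2) S T) := by
  let := p.toAlgebra
  have hsm (a : S) (z : T) : a • z = p a * z := rfl
  refine ⟨Module.Basis.mk (v := ![1, r]) ?_ ?_⟩
  · rw [LinearIndependent.pair_iff]
    intro a b h
    rw [hsm, hsm, mul_one] at h
    exact hi a b h
  · rintro z -
    obtain ⟨a, b, rfl⟩ := hs z
    have h1 : p a + p b * r = a • (1 : T) + b • r := by rw [hsm, hsm, mul_one]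
    rw [h1]
    exact add_mem (Submodule.smul_mem _ _ (Submodule.subset_span ⟨0, rfl⟩))
      (Submodule.smul_mem _ _ (Submodule.subset_span ⟨1, rfl⟩))

lemma Dbl.eq_zero_of_add_eq_zero {A : Type} [CommRing A] (g a b : A)
    (h : AdjoinRoot.of _ a + AdjoinRoot.of _ b * Dbl.root g = 0) : a = 0 ∧ b = 0 := by
  cases subsingleton_or_nontrivial A
  · exact ⟨Subsingleton.elim _ _, Subsingleton.elim _ _⟩
  have h1 : AdjoinRoot.mk (X ^ 2 - C g) (C a + C b * X) = 0 := by
    rw [map_add, map_mul]; exact h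
  rw [AdjoinRoot.mk_eq_zero] at h1
  have h2 : C a + C b * X = 0 := by
    by_contra h0
    refine (monic_dbl g).not_dvd_of_natDegree_lt h0 ?_ h1
    rw [natDegree_dbl, add_comm]
    exact Nat.lt_succ_of_le natDegree_linear_le
  constructor
  · simpa using congrArg (fun q ↦ q.coeff 0) h2
  · simpa using congrArg (fun q ↦ q.coeff 1) h2

/-- The homomorphism of double covers induced by a homomorphism of base rings. -/
def Dbl.map {A B : Type} [CommRing A] [CommRing B] (χ : A →+* B) (g : A) : Dbl g →+* Dbl (χ g) :=
  AdjoinRoot.lift ((AdjoinRoot.of _).comp χ) (Dbl.root (χ g)) (by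
    rw [eval₂_sub, eval₂_X_pow, eval₂_C, Dbl.root_sq, RingHom.comp_apply, sub_self])

lemma Dbl.map_of {A B : Type} [CommRing A] [CommRing B] (χ : A →+* B) (g a : A) :
    Dbl.map χ g (AdjoinRoot.of _ a) = AdjoinRoot.of _ (χ a) := by
  rw [Dbl.map, AdjoinRoot.lift_of, RingHom.comp_apply]

lemma Dbl.map_comp_of {A B : Type} [CommRing A] [CommRing B] (χ : A →+* B) (g : A) :
    (Dbl.map χ g).comp (AdjoinRoot.of _) = (AdjoinRoot.of _).comp χ :=
  RingHom.ext fun _ ↦ Dbl.map_of ..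

lemma Dbl.map_root {A B : Type} [CommRing A] [CommRing B] (χ : A →+* B) (g : A) :
    Dbl.map χ g (Dbl.root g) = Dbl.root _ := AdjoinRoot.lift_root _

lemma AdjoinRoot.ringHom_ext' {A E : Type} [CommRing A] [CommRing E] {f : A[X]}
    {a b : AdjoinRoot f →+* E} (h : a.comp (AdjoinRoot.of f) = b.comp (AdjoinRoot.of f))
    (hr : a (AdjoinRoot.root f) = b (AdjoinRoot.root f)) : a = b := by
  refine RingHom.ext fun z ↦ ?_
  obtain ⟨z, rfl⟩ := AdjoinRoot.mk_surjective z
  have : a.comp (AdjoinRoot.mk f) = b.comp (AdjoinRoot.mk f) := Polynomial.ringHom_ext' h (by simpa)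
  exact RingHom.congr_fun this z

/-- Adjoining a square root commutes with base change. This permits testing étaleness over residue
fields and localizations. -/
lemma isPushout_dbl {A B : Type} [CommRing A] [CommRing B] (χ : A →+* B) (g : A) :
    IsPushout (CommRingCat.ofHom (AdjoinRoot.of (X ^ 2 - C g))) (CommRingCat.ofHom χ)
      (CommRingCat.ofHom (Dbl.map χ g)) (CommRingCat.ofHom (AdjoinRoot.of (X ^ 2 - C (χ g)))) := by
  have key (s : PushoutCocone (CommRingCat.ofHom (AdjoinRoot.of (X ^ 2 - C g)))
      (CommRingCat.ofHom χ)) :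
      (X ^ 2 - C (χ g)).eval₂ s.inr.hom (s.inl.hom (Dbl.root g)) = 0 := by
    have h := RingHom.congr_fun (congrArg CommRingCat.Hom.hom s.condition) g
    change s.inl.hom (AdjoinRoot.of _ g) = s.inr.hom (χ g) at h
    rw [eval₂_sub, eval₂_X_pow, eval₂_C, ← map_pow, Dbl.root_sq, h, sub_self]
  refine ⟨⟨?_⟩, ⟨PushoutCocone.IsColimit.mk _ (fun s ↦ CommRingCat.ofHom (AdjoinRoot.lift s.inr.hom
    (s.inl.hom (Dbl.root g)) (key s))) (fun s ↦ ?_) (fun s ↦ ?_) (fun s m h₁ h₂ ↦ ?_)⟩⟩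
  · rw [← CommRingCat.ofHom_comp, ← CommRingCat.ofHom_comp, Dbl.map_comp_of]
  · ext1
    refine AdjoinRoot.ringHom_ext' ?_ ?_
    · have h := congrArg CommRingCat.Hom.hom s.condition
      refine Eq.trans (RingHom.ext fun a ↦ ?_) h.symm
      change AdjoinRoot.lift _ _ (key s) (Dbl.map χ g (AdjoinRoot.of _ a)) = _
      rw [Dbl.map_of, AdjoinRoot.lift_of]
      rfl
    · change AdjoinRoot.lift _ _ (key s) (Dbl.map χ g (Dbl.root g)) = _
      rw [Dbl.map_root, AdjoinRoot.lift_root]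
  · ext1
    exact RingHom.ext fun _ ↦ AdjoinRoot.lift_of (key s)
  · ext1
    refine AdjoinRoot.ringHom_ext' ?_ ?_
    · refine (congrArg CommRingCat.Hom.hom h₂).trans (RingHom.ext fun _ ↦ ?_)
      exact (AdjoinRoot.lift_of (key s)).symm
    · have h3 := RingHom.congr_fun (congrArg CommRingCat.Hom.hom h₁) (Dbl.root g)
      change m.hom (Dbl.map χ g (Dbl.root g)) = _ at h3
      rw [Dbl.map_root] at h3
      exact h3.trans (AdjoinRoot.lift_root (key s)).symm

lemma isPullback_dbl {A B : Type} [CommRing A] [CommRing B] (χ : A →+* B) (g : A) :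
    IsPullback (Spec.map (CommRingCat.ofHom (Dbl.map χ g)))
      (Spec.map (CommRingCat.ofHom (AdjoinRoot.of (X ^ 2 - C (χ g)))))
      (Spec.map (CommRingCat.ofHom (AdjoinRoot.of (X ^ 2 - C g))))
      (Spec.map (CommRingCat.ofHom χ)) :=
  isPullback_SpecMap_of_isPushout _ _ _ _ (isPushout_dbl χ g)

lemma etale_of_dbl {A : Type} [CommRing A] {g : A} (hg : IsUnit g) (h2 : IsUnit (2 : A)) :
    (AdjoinRoot.of (X ^ 2 - C g)).Etale := by
  obtain ⟨u, hu⟩ := hg.exists_right_inv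
  obtain ⟨v, hv⟩ := h2.exists_right_inv
  let P : StandardEtalePair A :=
    { f := X ^ 2 - C g
      monic_f := monic_dbl g
      g := 1
      -- With `g u = 1` and `2 v = 1` one has `2 X * (u v X) - u (X² - g) = 1`, so the polynomial is
      -- separable.
      cond := ⟨C (u * v) * X, - C u, 1, by
        have hu' : C g * C u = 1 := by rw [← C_mul, hu, C_1]
        have hv' : 2 * C v = 1 := by
          have : (2 : A[X]) = C 2 := (map_ofNat C 2).symm
          rw [this, ← C_mul, hv, C_1]
        simp only [derivative_sub, derivative_X_pow, derivative_C, C_mul]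
        simp only [Nat.cast_ofNat, map_ofNat]
        linear_combination C u * X ^ 2 * hv' + hu'⟩ }
  have h1 : IsLocalization.Away (1 : AdjoinRoot (X ^ 2 - C g)) (AdjoinRoot (X ^ 2 - C g)) :=
    IsLocalization.away_of_isUnit_of_bijective _ isUnit_one Function.bijective_id
  let e : AdjoinRoot (X ^ 2 - C g) ≃ₐ[A] P.Ring := by
    refine .trans ?_ P.equivAwayAdjoinRoot.symm
    have h2 : IsLocalization.Away (1 : AdjoinRoot (X ^ 2 - C g))
        (Localization.Away (AdjoinRoot.mk P.f P.g)) := by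
      have : (1 : AdjoinRoot (X ^ 2 - C g)) = AdjoinRoot.mk P.f P.g := (map_one _).symm
      rw [this]
      exact Localization.isLocalization
    exact (IsLocalization.algEquiv (.powers (1 : AdjoinRoot (X ^ 2 - C g))) _ _).restrictScalars A
  have : Algebra.Etale A (AdjoinRoot (X ^ 2 - C g)) := .of_equiv e.symm
  change (algebraMap A (AdjoinRoot (X ^ 2 - C g))).Etale
  exact RingHom.etale_algebraMap.mpr this

/-- Over a field an étale algebra is reduced, whereas a square root of `0` is a nonzero nilpotent.
-/
lemma not_etale_of_dbl {k : Type} [Field k] {g : k} (hg : g = 0) :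
    ¬ (AdjoinRoot.of (X ^ 2 - C g)).Etale := by
  intro h
  have h1 : Algebra.Etale k (AdjoinRoot (X ^ 2 - C g)) := RingHom.etale_algebraMap.mp h
  have h2 : _root_.IsReduced (AdjoinRoot (X ^ 2 - C g)) :=
    Algebra.FormallyUnramified.isReduced_of_field k _
  have h3 : Dbl.root g = 0 := by
    refine IsNilpotent.eq_zero ⟨2, ?_⟩
    rw [Dbl.root_sq, hg, map_zero]
  have := Dbl.eq_zero_of_add_eq_zero g 0 1 (by rw [h3, map_zero, mul_zero, add_zero])
  exact one_ne_zero this.2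

variable {W Y : Scheme.{0}} (f : W ⟶ Y) {A : Type} [CommRing A] {g : A}
  (c : Spec (.of A) ⟶ Y) [IsOpenImmersion c] (d : Spec (.of (Dbl g)) ⟶ W)

lemma exists_basis_of_dbl
    (h : IsPullback d (Spec.map (CommRingCat.ofHom (AdjoinRoot.of (X ^ 2 - C g)))) f c) :
    letI := (f.app c.opensRange).hom.toAlgebra
    Nonempty (Module.Basis (Fin 2) Γ(Y, c.opensRange) Γ(W, f ⁻¹ᵁ c.opensRange)) := by
  have hd : IsOpenImmersion d := MorphismProperty.of_isPullback h.flip inferInstance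
  have hU : f ⁻¹ᵁ c.opensRange ≤ d.opensRange := by
    intro w hw
    obtain ⟨x, hx⟩ := hw
    obtain ⟨z, hz, -⟩ := Scheme.Pullback.exists_preimage_pullback w x hx.symm
    exact ⟨h.isoPullback.inv z, by rw [← Scheme.Hom.comp_apply, h.isoPullback_inv_fst, hz]⟩
  have e1 : (⊤ : (Spec (.of A)).Opens) = c ⁻¹ᵁ c.opensRange := by simp
  have e2 : (⊤ : (Spec (.of (Dbl g))).Opens) = d ⁻¹ᵁ f ⁻¹ᵁ c.opensRange := by
    rw [← Scheme.Hom.comp_preimage, h.w, Scheme.Hom.comp_preimage, ← e1]; rfl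
  have h1 : IsIso (c.appLE c.opensRange ⊤ e1.le) := by
    have := c.isIso_app c.opensRange le_rfl
    rw [Scheme.Hom.appLE]
    have : IsIso ((Spec (.of A)).presheaf.map (homOfLE e1.le).op) := by
      rw [show homOfLE e1.le = eqToHom e1 from rfl]; infer_instance
    infer_instance
  have h2 : IsIso (d.appLE (f ⁻¹ᵁ c.opensRange) ⊤ e2.le) := by
    have := d.isIso_app (f ⁻¹ᵁ c.opensRange) hU
    rw [Scheme.Hom.appLE]
    have : IsIso ((Spec (.of (Dbl g))).presheaf.map (homOfLE e2.le).op) := by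
      rw [show homOfLE e2.le = eqToHom e2 from rfl]; infer_instance
    infer_instance
  let a := c.appLE c.opensRange ⊤ e1.le ≫ (Scheme.ΓSpecIso (.of A)).hom
  let b := d.appLE (f ⁻¹ᵁ c.opensRange) ⊤ e2.le ≫ (Scheme.ΓSpecIso (.of (Dbl g))).hom
  have ha : Function.Bijective a.hom := (ConcreteCategory.isIso_iff_bijective a).mp inferInstance
  have hb : Function.Bijective b.hom := (ConcreteCategory.isIso_iff_bijective b).mp inferInstance
  have hab : f.app c.opensRange ≫ b =
      a ≫ CommRingCat.ofHom (AdjoinRoot.of (X ^ 2 - C g)) := by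
    simp only [a, b, Category.assoc]
    rw [← Scheme.ΓSpecIso_naturality, ← Category.assoc, ← Category.assoc]
    congr 1
    have e3 : (Spec.map (CommRingCat.ofHom (AdjoinRoot.of (X ^ 2 - C g)))).appTop =
      (Spec.map (CommRingCat.ofHom (AdjoinRoot.of (X ^ 2 - C g)))).appLE ⊤ ⊤ le_top :=
      (Scheme.Hom.appLE_eq_app _).symm
    have e4 {p q : Spec (.of (Dbl g)) ⟶ Y} (hpq : p = q) (hp hq) :
        p.appLE c.opensRange ⊤ hp = q.appLE c.opensRange ⊤ hq := by subst hpq; rfl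
    rw [← Scheme.Hom.appLE_eq_app, e3]
    exact (Scheme.Hom.appLE_comp_appLE ..).trans
      ((e4 h.w _ _).trans (Scheme.Hom.appLE_comp_appLE ..).symm)
  have hab' (x) : b.hom ((f.app c.opensRange).hom x) = AdjoinRoot.of _ (a.hom x) :=
    congrArg (fun h ↦ h.hom x) hab
  obtain ⟨r, hr⟩ := hb.2 (Dbl.root g)
  refine exists_basis_two _ r (fun z ↦ ?_) fun x y hxy ↦ ?_
  · obtain ⟨p, q, hpq⟩ := Dbl.exists_eq g (b.hom z)
    obtain ⟨p, rfl⟩ := ha.2 p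
    obtain ⟨q, rfl⟩ := ha.2 q
    refine ⟨p, q, hb.1 ?_⟩
    rw [hpq, map_add, map_mul, hab', hab', hr]
  · have h3 := congrArg b.hom hxy
    rw [map_add, map_mul, hab', hab', hr, map_zero] at h3
    obtain ⟨h4, h5⟩ := Dbl.eq_zero_of_add_eq_zero g _ _ h3
    rw [← map_zero a.hom] at h4 h5
    exact ⟨ha.1 h4, ha.1 h5⟩

lemma etale_morphismRestrict_iff {B : Type} [CommRing B] (c' : Spec (.of B) ⟶ Y)
    [IsOpenImmersion c'] {E : Type} [CommRing E] (ι : B →+* E) (d' : Spec (.of E) ⟶ W)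
    (h : IsPullback d' (Spec.map (CommRingCat.ofHom ι)) f c') :
    Etale (f ∣_ c'.opensRange) ↔ ι.Etale := by
  let P : MorphismProperty Scheme.{0} := @Etale
  have : P.IsStableUnderBaseChange := Etale.etale_isStableUnderBaseChange
  change P _ ↔ _
  rw [P.arrow_mk_iso_iff (morphismRestrictOpensRange f c'),
    ← P.cancel_left_of_respectsIso h.isoPullback.hom, h.isoPullback_hom_snd]
  exact HasRingHomProperty.Spec_iff (P := @Etale)

/-- Where `g` vanishes, base change to the residue field is not étale. Elsewhere `g` may be
inverted, and the cover becomes standard étale. -/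
lemma exists_etale_iff_of_dbl (h2 : IsUnit (2 : A))
    (h : IsPullback d (Spec.map (CommRingCat.ofHom (AdjoinRoot.of (X ^ 2 - C g)))) f c)
    (x : PrimeSpectrum A) :
    (∃ U : Y.Opens, c x ∈ U ∧ Etale (f ∣_ U)) ↔ g ∉ x.asIdeal := by
  constructor
  · rintro ⟨U, hxU, hU⟩ hg
    let χ := algebraMap A x.asIdeal.ResidueField
    have hχ : χ g = 0 := Ideal.algebraMap_residueField_eq_zero.mpr hg
    let q : Spec (.of x.asIdeal.ResidueField) ⟶ Y := Spec.map (CommRingCat.ofHom χ) ≫ c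
    have hq := (isPullback_dbl χ g).paste_horiz h
    have hqU : Set.range q ⊆ Set.range U.ι := by
      rintro _ ⟨z, rfl⟩
      rw [Scheme.Opens.range_ι]
      have : Spec.map (CommRingCat.ofHom χ) z = x := by
        have hz : z = (⊥ : PrimeSpectrum x.asIdeal.ResidueField) :=
          Subsingleton.elim (α := PrimeSpectrum x.asIdeal.ResidueField) _ _
        rw [hz]
        refine PrimeSpectrum.ext ?_
        change Ideal.comap χ ⊥ = x.asIdeal
        rw [← RingHom.ker_eq_comap_bot]
        exact Ideal.ker_algebraMap_residueField _
      rw [Scheme.Hom.comp_apply, this]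
      exact hxU
    -- Étaleness over a neighbourhood would descend to the fiber over the residue field, since the
    -- residue point factors through that neighbourhood.
    have h3 : IsPullback (pullback.fst (f ∣_ U) (IsOpenImmersion.lift U.ι q hqU) ≫ (f ⁻¹ᵁ U).ι)
        (pullback.snd (f ∣_ U) (IsOpenImmersion.lift U.ι q hqU)) f q := by
      have := (IsPullback.of_hasPullback (f ∣_ U) (IsOpenImmersion.lift U.ι q hqU)).paste_horiz
        (isPullback_morphismRestrict f U).flip
      rwa [IsOpenImmersion.lift_fac] at this
    have h4 : Etale (Spec.map (CommRingCat.ofHom (AdjoinRoot.of (X ^ 2 - C (χ g))))) := by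
      have h5 : (hq.isoIsPullback _ _ h3).hom ≫ pullback.snd (f ∣_ U) (IsOpenImmersion.lift U.ι q hqU) =
          Spec.map (CommRingCat.ofHom (AdjoinRoot.of (X ^ 2 - C (χ g)))) :=
        IsPullback.isoIsPullback_hom_snd _ _ _ _
      rw [← h5]
      infer_instance
    rw [HasRingHomProperty.Spec_iff (P := @Etale)] at h4
    exact not_etale_of_dbl hχ h4
  · intro hg
    let χ := algebraMap A (Localization.Away g)
    let q : Spec (.of (Localization.Away g)) ⟶ Y := Spec.map (CommRingCat.ofHom χ) ≫ c
    have hq := (isPullback_dbl χ g).paste_horiz h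
    have : IsOpenImmersion (Spec.map (CommRingCat.ofHom χ)) :=
      inferInstance
    refine ⟨q.opensRange, ?_, (etale_morphismRestrict_iff f q _ _ hq).mpr ?_⟩
    · have hx : x ∈ Set.range (Spec.map (CommRingCat.ofHom χ)) := by
        have := PrimeSpectrum.localization_away_comap_range (Localization.Away g) g
        refine (Set.ext_iff.mp this x).mpr hg
      obtain ⟨z, hz⟩ := hx
      exact ⟨z, by rw [Scheme.Hom.comp_apply, hz]⟩
    · refine etale_of_dbl (IsLocalization.Away.algebraMap_isUnit g) ?_
      have := h2.map χ
      rwa [map_ofNat] at this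

/-- A morphism is a double cover if it is given by adjoining square roots on an open cover. -/
theorem isDoubleCover_of_charts [IsAffineHom f] {ι : Type} {A : ι → Type}
    [∀ k, CommRing (A k)] {g : ∀ k, A k} (c : ∀ k, Spec (.of (A k)) ⟶ Y)
    (hc : ∀ k, IsOpenImmersion (c k)) (hcov : ∀ y, ∃ k, y ∈ Set.range (c k))
    (d : ∀ k, Spec (.of (Dbl (g k))) ⟶ W)
    (h : ∀ k, IsPullback (d k) (Spec.map (CommRingCat.ofHom (AdjoinRoot.of _))) f (c k))
    (h2 : ∀ k, IsUnit (2 : A k)) {B : Set Y}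
    (hB : ∀ k, c k ⁻¹' B = PrimeSpectrum.zeroLocus {g k}) : IsDoubleCover f B where
  isAffineHom := inferInstance
  free_rank_two y := by
    obtain ⟨k, hk⟩ := hcov y
    have := hc k
    exact ⟨(c k).opensRange, hk, isAffineOpen_opensRange _, exists_basis_of_dbl f (c k) (d k) (h k)⟩
  branch_eq := by
    ext y
    obtain ⟨k, x, rfl⟩ := hcov y
    have := hc k
    refine ((exists_etale_iff_of_dbl f (c k) (d k) (h2 k) (h k) x).not.trans not_not).trans ?_
    refine Iff.trans ?_ (Set.ext_iff.mp (hB k) x).symm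
    exact (Set.singleton_subset_iff (a := g k) (s := (PrimeSpectrum.asIdeal x : Set (A k)))).symm

end DoubleCover

/-! ### The Jacobian criterion for hypersurfaces, and rings with one relation -/

section Hypersurface

open MvPolynomial

variable {ι R D E : Type} [CommRing R] [CommRing D] [CommRing E]

/-- The coordinate ring of an affine hypersurface. -/
abbrev Hyp (G : MvPolynomial ι R) : Type :=
  MvPolynomial ι R ⧸ Ideal.span (Set.range fun _ : Unit ↦ G)

lemma hyp_mk_eq_zero {G : MvPolynomial ι R} : (Ideal.Quotient.mk _ G : Hyp G) = 0 :=
  Ideal.Quotient.eq_zero_iff_mem.mpr (Ideal.subset_span ⟨(), rfl⟩)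

/-- The hypersurface presentation has Jacobian `∂G / ∂X_j`, which becomes invertible after
localization. -/
lemma isStandardSmooth_away_pderiv {n : ℕ} (G : MvPolynomial (Fin (n + 1)) R) (j : Fin (n + 1))
    (S : Type) [CommRing S] [Algebra R S] [Algebra (Hyp G) S] [IsScalarTower R (Hyp G) S]
    [IsLocalization.Away (Ideal.Quotient.mk _ (pderiv j G) : Hyp G) S] :
    Algebra.IsStandardSmoothOfRelativeDimension n R S := by
  let P₁ : Algebra.PreSubmersivePresentation R (Hyp G) (Fin (n + 1)) Unit :=
    .naive (fun _ ↦ j) (fun _ _ _ ↦ rfl)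
  let P₂ := Algebra.PreSubmersivePresentation.localizationAway S
    (Ideal.Quotient.mk _ (pderiv j G) : Hyp G)
  have h₁ : P₁.jacobian = Ideal.Quotient.mk _ (pderiv j G) := by
    rw [Algebra.PreSubmersivePresentation.jacobian_eq_jacobiMatrix_det]
    have h₂ : aeval P₁.val = Ideal.Quotient.mkₐ R (Ideal.span (Set.range fun _ : Unit ↦ G)) := by
      ext i
      rw [aeval_X]
      rfl
    have h₃ : P₁.jacobiMatrix () () = pderiv j G :=
      Algebra.PreSubmersivePresentation.jacobiMatrix_naive ..
    rw [Matrix.det_unique, Algebra.Generators.algebraMap_apply, h₂]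
    exact congrArg (Ideal.Quotient.mk _) h₃
  let Q : Algebra.SubmersivePresentation R S (Unit ⊕ Fin (n + 1)) (Unit ⊕ Unit) :=
    { P₂.comp P₁ with
      jacobian_isUnit := by
        rw [Algebra.PreSubmersivePresentation.comp_jacobian_eq_jacobian_smul_jacobian,
          Algebra.PreSubmersivePresentation.localizationAway_jacobian, h₁, Algebra.smul_def]
        exact (IsLocalization.Away.algebraMap_isUnit _).mul
          (IsLocalization.Away.algebraMap_isUnit _) }
  -- The inverse of the partial derivative adds one generator and one relation: `n + 2` generators
  -- and two relations.
  refine ⟨⟨_, _, inferInstance, inferInstance, ⟨Q, ?_⟩⟩⟩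
  simp [Algebra.Presentation.dimension]
  omega

/-- If the partial derivatives did not generate the unit ideal of the coordinate ring, they would
all vanish in the residue field of some maximal ideal. -/
lemma smoothOfRelativeDimension_of_pderiv {n : ℕ} (G : MvPolynomial (Fin (n + 1)) R)
    (h : ∀ (k : Type) [Field k] (χ : MvPolynomial (Fin (n + 1)) R →+* k), χ G = 0 →
      ∃ j, χ (pderiv j G) ≠ 0) :
    SmoothOfRelativeDimension n (Spec.map (CommRingCat.ofHom (algebraMap R (Hyp G)))) := by
  rw [HasRingHomProperty.Spec_iff (P := @SmoothOfRelativeDimension n)]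
  refine ⟨Set.range fun j ↦ Ideal.Quotient.mk _ (pderiv j G), ?_, ?_⟩
  · by_contra h1
    obtain ⟨m, hm, hle⟩ := Ideal.exists_le_maximal _ h1
    let := Ideal.Quotient.field m
    obtain ⟨j, hj⟩ := h (Hyp G ⧸ m) ((Ideal.Quotient.mk m).comp (Ideal.Quotient.mk _)) (by
      rw [RingHom.comp_apply, hyp_mk_eq_zero, map_zero])
    exact hj (Ideal.Quotient.eq_zero_iff_mem.mpr (hle (Ideal.subset_span ⟨j, rfl⟩)))
  · rintro _ ⟨j, rfl⟩
    have h2 := isStandardSmooth_away_pderiv G j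
      (Localization.Away (Ideal.Quotient.mk _ (pderiv j G) : Hyp G))
    change RingHom.IsStandardSmoothOfRelativeDimension n
      ((algebraMap (Hyp G) (Localization.Away _)).comp (algebraMap R (Hyp G)))
    rw [← IsScalarTower.algebraMap_eq]
    exact (RingHom.isStandardSmoothOfRelativeDimension_algebraMap n).mpr h2

/-- The ring `D` is presented over `R` by generators `y` with the single relation `G`. -/
structure IsPresented (σ : R →+* D) (y : ι → D) (G : MvPolynomial ι R) : Prop where
  rel : eval₂ σ y G = 0
  gen (S : Subring D) : (∀ a, σ a ∈ S) → (∀ i, y i ∈ S) → S = ⊤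
  lift (E : Type) [CommRing E] (ρ : R →+* E) (z : ι → E) : eval₂ ρ z G = 0 →
    ∃ h : D →+* E, h.comp σ = ρ ∧ ∀ i, h (y i) = z i

lemma subring_mvPolynomial_eq_top (S : Subring (MvPolynomial ι R)) (hC : ∀ a, C a ∈ S)
    (hX : ∀ i, X i ∈ S) : S = ⊤ := by
  rw [eq_top_iff]
  rintro p -
  induction p using MvPolynomial.induction_on with
  | C a => exact hC a
  | add p q hp hq => exact add_mem hp hq
  | mul_X p i hp => exact mul_mem hp (hX i)

lemma isPresented_hyp (G : MvPolynomial ι R) :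
    IsPresented (algebraMap R (Hyp G)) (fun i ↦ Ideal.Quotient.mk _ (X i)) G where
  rel := by
    have h1 : eval₂Hom (algebraMap R (Hyp G)) (fun i ↦ Ideal.Quotient.mk _ (X i)) =
        Ideal.Quotient.mk (Ideal.span (Set.range fun _ : Unit ↦ G)) := by
      ext
      · rw [RingHom.comp_apply, eval₂Hom_C]; rfl
      · rw [eval₂Hom_X']
    exact (RingHom.congr_fun h1 G).trans hyp_mk_eq_zero
  gen S hσ hy := by
    have h1 := subring_mvPolynomial_eq_top (S.comap (Ideal.Quotient.mk _)) hσ hy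
    rw [eq_top_iff]
    rintro p -
    obtain ⟨p, rfl⟩ := Ideal.Quotient.mk_surjective p
    exact (h1 ▸ Subring.mem_top p : p ∈ _)
  lift E _ ρ z hz := by
    have h0 : ∀ a ∈ Ideal.span (Set.range fun _ : Unit ↦ G), eval₂Hom ρ z a = 0 := by
      intro a ha
      have : Ideal.span (Set.range fun _ : Unit ↦ G) ≤ RingHom.ker (eval₂Hom ρ z) := by
        rw [Ideal.span_le]
        rintro _ ⟨-, rfl⟩
        exact hz
      exact this ha
    refine ⟨Ideal.Quotient.lift _ (eval₂Hom ρ z) h0, RingHom.ext fun a ↦ ?_, fun i ↦ ?_⟩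
    · exact (Ideal.Quotient.lift_mk _ _ h0).trans (eval₂Hom_C ρ z a)
    · exact (Ideal.Quotient.lift_mk _ _ h0).trans (eval₂Hom_X' ρ z i)

namespace IsPresented

variable {σ : R →+* D} {y : ι → D} {G : MvPolynomial ι R}

lemma hom_ext (h : IsPresented σ y G) {a b : D →+* E} (hσ : a.comp σ = b.comp σ)
    (hy : ∀ i, a (y i) = b (y i)) : a = b := by
  have := h.gen (a.eqLocus b) (fun r ↦ RingHom.congr_fun hσ r) hy
  exact RingHom.ext fun d ↦ (this ▸ Subring.mem_top d : d ∈ a.eqLocus b)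

lemma exists_equiv (h : IsPresented σ y G) {D' : Type} [CommRing D'] {σ' : R →+* D'} {y' : ι → D'}
    (h' : IsPresented σ' y' G) :
    ∃ e : D ≃+* D', (∀ a, e (σ a) = σ' a) ∧ ∀ i, e (y i) = y' i := by
  obtain ⟨f, hf, hfy⟩ := h.lift D' σ' y' h'.rel
  obtain ⟨g, hg, hgy⟩ := h'.lift D σ y h.rel
  refine ⟨RingEquiv.ofRingHom f g (h'.hom_ext ?_ fun i ↦ ?_) (h.hom_ext ?_ fun i ↦ ?_),
    fun a ↦ RingHom.congr_fun hf a, hfy⟩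
  · rw [RingHom.comp_assoc, hg, hf, RingHom.id_comp]
  · rw [RingHom.comp_apply, hgy, hfy, RingHom.id_apply]
  · rw [RingHom.comp_assoc, hf, hg, RingHom.id_comp]
  · rw [RingHom.comp_apply, hfy, hgy, RingHom.id_apply]

lemma smoothOfRelativeDimension {n : ℕ} {y : Fin (n + 1) → D} {G : MvPolynomial (Fin (n + 1)) R}
    (hP : IsPresented σ y G)
    (h : ∀ (k : Type) [Field k] (χ : MvPolynomial (Fin (n + 1)) R →+* k), χ G = 0 →
      ∃ j, χ (pderiv j G) ≠ 0) :
    SmoothOfRelativeDimension n (Spec.map (CommRingCat.ofHom σ)) := by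
  obtain ⟨e, he, -⟩ := (isPresented_hyp G).exists_equiv hP
  have h1 : σ = (e : Hyp G →+* D).comp (algebraMap R (Hyp G)) :=
    RingHom.ext fun a ↦ (he a).symm
  have := smoothOfRelativeDimension_of_pderiv G h
  have : IsIso (Spec.map (CommRingCat.ofHom (e : Hyp G →+* D))) := isIso_specMap_of_bijective e.bijective
  rw [h1, CommRingCat.ofHom_comp, Spec.map_comp]
  let P : MorphismProperty Scheme.{0} := @SmoothOfRelativeDimension n
  have : P.IsStableUnderBaseChange := smoothOfRelativeDimension_isStableUnderBaseChange n
  exact (P.cancel_left_of_respectsIso _ _).mpr ‹_›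

/-- A presentation is a universal property, so mapping its coefficients presents the base change. -/
lemma isPushout (h : IsPresented σ y G) {κ D' : Type} [CommRing κ] [CommRing D'] {χ : R →+* κ}
    {σ' : κ →+* D'} {y' : ι → D'} (h' : IsPresented σ' y' (map χ G)) {q : D →+* D'}
    (hq : q.comp σ = σ'.comp χ) (hqy : ∀ i, q (y i) = y' i) :
    IsPushout (CommRingCat.ofHom σ) (CommRingCat.ofHom χ) (CommRingCat.ofHom q)
      (CommRingCat.ofHom σ') := by
  have key (s : PushoutCocone (CommRingCat.ofHom σ) (CommRingCat.ofHom χ)) :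
      eval₂ s.inr.hom (fun i ↦ s.inl.hom (y i)) (map χ G) = 0 := by
    have h1 : s.inl.hom.comp σ = s.inr.hom.comp χ := congrArg CommRingCat.Hom.hom s.condition
    rw [eval₂_map, ← h1]
    have h2 := MvPolynomial.eval₂_comp_left s.inl.hom σ y G
    rw [h.rel, map_zero] at h2
    exact h2.symm
  choose l hl hly using fun s ↦ h'.lift _ _ _ (key s)
  refine ⟨⟨?_⟩, ⟨PushoutCocone.IsColimit.mk _ (fun s ↦ CommRingCat.ofHom (l s)) (fun s ↦ ?_)
    (fun s ↦ ?_) (fun s m h₁ h₂ ↦ ?_)⟩⟩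
  · rw [← CommRingCat.ofHom_comp, ← CommRingCat.ofHom_comp, hq]
  · ext1
    refine h.hom_ext ?_ fun i ↦ ?_
    · have h1 : s.inl.hom.comp σ = s.inr.hom.comp χ := congrArg CommRingCat.Hom.hom s.condition
      change ((l s).comp q).comp σ = _
      rw [RingHom.comp_assoc, hq, ← RingHom.comp_assoc, hl, h1]
    · change l s (q (y i)) = _
      rw [hqy, hly]
  · ext1
    exact hl s
  · ext1
    refine h'.hom_ext ?_ fun i ↦ ?_
    · exact (congrArg CommRingCat.Hom.hom h₂).trans (hl s).symm
    · have h3 := RingHom.congr_fun (congrArg CommRingCat.Hom.hom h₁) (y i)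
      change m.hom (q (y i)) = _ at h3
      rw [hqy] at h3
      exact h3.trans (hly s i).symm

end IsPresented

/-- The isomorphism `ℂ[t][y, w] ≅ ℂ[t, y, w]`. -/
def flat : MvPolynomial (Fin 2) (Polynomial R) →+* MvPolynomial (Fin 3) R :=
  eval₂Hom (Polynomial.eval₂RingHom C (X 0)) fun i ↦ X i.succ

lemma eval₂_flat (ρ : R →+* E) (z : Fin 3 → E) (G : MvPolynomial (Fin 2) (Polynomial R)) :
    eval₂ ρ z (flat G) =
      eval₂ (Polynomial.eval₂RingHom ρ (z 0)) (fun i ↦ z i.succ) G := by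
  have : (eval₂Hom ρ z).comp flat =
      eval₂Hom (Polynomial.eval₂RingHom ρ (z 0)) (fun i ↦ z i.succ) := by
    ext <;> simp [flat]
  exact RingHom.congr_fun this G

/-- Regards the parameter `t` as a further generator over `ℂ`. The same equation then serves for the
fibers, over `ℂ[t]`, and for the total space. -/
lemma IsPresented.flat {σ : Polynomial R →+* D} {y : Fin 2 → D}
    {G : MvPolynomial (Fin 2) (Polynomial R)} (h : IsPresented σ y G) :
    IsPresented (σ.comp Polynomial.C) (Fin.cons (σ Polynomial.X) y : Fin 3 → D) (flat G) where
  rel := by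
    rw [eval₂_flat]
    refine Eq.trans ?_ h.rel
    congr 1
    ext <;> simp
  gen S hσ hy := by
    refine h.gen S (fun a ↦ ?_) fun i ↦ by simpa using hy i.succ
    have := subring_polynomial_eq_top (S.comap σ) hσ (hy 0)
    exact (this ▸ Subring.mem_top a : a ∈ S.comap σ)
  lift E _ ρ z hz := by
    rw [eval₂_flat] at hz
    obtain ⟨q, hq, hqy⟩ := h.lift E _ _ hz
    refine ⟨q, ?_, Fin.cases ?_ fun i ↦ ?_⟩
    · rw [← RingHom.comp_assoc, hq, Polynomial.eval₂RingHom_comp_C]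
    · rw [Fin.cons_zero, ← RingHom.comp_apply, hq]; simp
    · rw [Fin.cons_succ, hqy]

end Hypersurface

/-! ### Equations of the surface over the base, and singular points of fibers -/

section ChartRel

variable {R : Type} [CommRing R]

open MvPolynomial in
/-- The equations of the charts of the elliptic surface. -/
def chartRel (a b : R) : Option Bool → MvPolynomial (Fin 2) R
  | none => X 1 ^ 2 - C a * X 0 ^ 3 - C b
  | some true => X 1 ^ 2 - X 0 - C (a ^ 2 * b) * X 0 ^ 4
  | some false => X 0 * X 1 ^ 2 - C a - C b * X 0 ^ 3

lemma map_chartRel {S : Type} [CommRing S] (χ : R →+* S) (a b : R) (k : Option Bool) :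
    MvPolynomial.map χ (chartRel a b k) = chartRel (χ a) (χ b) k := by
  match k with
  | none => simp [chartRel]
  | some true => simp [chartRel]
  | some false => simp [chartRel]

section Eval

variable {k : Type} [Field k] (χ : MvPolynomial (Fin 2) R →+* k) (a b : R)

open MvPolynomial

lemma chartRel_none_eval {y w α β : k} (hy : χ (X 0) = y) (hw : χ (X 1) = w) (ha : χ (C a) = α)
    (hb : χ (C b) = β) : χ (chartRel a b none) = w ^ 2 - α * y ^ 3 - β ∧
    χ (pderiv 0 (chartRel a b none)) = - (3 * α * y ^ 2) ∧
    χ (pderiv 1 (chartRel a b none)) = 2 * w := by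
  subst hy hw ha hb
  have h1 : (pderiv 0 (X 1 : MvPolynomial (Fin 2) R)) = 0 := pderiv_X_of_ne one_ne_zero
  have h2 : (pderiv 1 (X 0 : MvPolynomial (Fin 2) R)) = 0 := pderiv_X_of_ne zero_ne_one
  simp only [chartRel, map_sub, map_mul, map_pow, pderiv_mul, pderiv_pow, pderiv_C, pderiv_X_self,
    h1, h2, map_natCast, map_zero, map_one, true_and, map_add]
  constructor <;> (push_cast; ring)

lemma chartRel_true_eval {y w α β : k} (hy : χ (X 0) = y) (hw : χ (X 1) = w) (ha : χ (C a) = α)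
    (hb : χ (C b) = β) : χ (chartRel a b (some true)) = w ^ 2 - y - α ^ 2 * β * y ^ 4 ∧
    χ (pderiv 0 (chartRel a b (some true))) = - 1 - 4 * α ^ 2 * β * y ^ 3 ∧
    χ (pderiv 1 (chartRel a b (some true))) = 2 * w := by
  subst hy hw ha hb
  have h1 : (pderiv 0 (X 1 : MvPolynomial (Fin 2) R)) = 0 := pderiv_X_of_ne one_ne_zero
  have h2 : (pderiv 1 (X 0 : MvPolynomial (Fin 2) R)) = 0 := pderiv_X_of_ne zero_ne_one
  simp only [chartRel, map_sub, map_mul, map_pow, pderiv_mul, pderiv_pow, pderiv_C, pderiv_X_self,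
    h1, h2, map_natCast, map_zero, map_one, true_and, map_add]
  constructor <;> (push_cast; ring)

lemma chartRel_false_eval {y w α β : k} (hy : χ (X 0) = y) (hw : χ (X 1) = w) (ha : χ (C a) = α)
    (hb : χ (C b) = β) : χ (chartRel a b (some false)) = y * w ^ 2 - α - β * y ^ 3 ∧
    χ (pderiv 0 (chartRel a b (some false))) = w ^ 2 - 3 * β * y ^ 2 ∧
    χ (pderiv 1 (chartRel a b (some false))) = 2 * y * w := by
  subst hy hw ha hb
  have h1 : (pderiv 0 (X 1 : MvPolynomial (Fin 2) R)) = 0 := pderiv_X_of_ne one_ne_zero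
  have h2 : (pderiv 1 (X 0 : MvPolynomial (Fin 2) R)) = 0 := pderiv_X_of_ne zero_ne_one
  simp only [chartRel, map_sub, map_mul, map_pow, pderiv_mul, pderiv_pow, pderiv_C, pderiv_X_self,
    h1, h2, map_natCast, map_zero, map_one, true_and, map_add]
  constructor <;> (push_cast; ring)

variable {χ a b} in
/-- A singular point of a fiber of a chart of the elliptic surface. -/
lemma singular_point_chartRel (h2 : (2 : k) ≠ 0) (h3 : (3 : k) ≠ 0) (i : Option Bool)
    (hχ : χ (chartRel a b i) = 0) (h : ∀ j, χ (pderiv j (chartRel a b i)) = 0) :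
    (i = none ∧ χ (C b) = 0 ∧ (χ (C a) = 0 ∨ χ (X 0) = 0)) ∨
    (i = some false ∧ χ (C a) = 0 ∧ (χ (C b) = 0 ∨ χ (X 0) = 0)) := by
  have h0 := h 0
  have h1 := h 1
  match i with
  | none =>
    obtain ⟨e, e0, e1⟩ := chartRel_none_eval χ a b rfl rfl rfl rfl
    rw [e1, mul_eq_zero, or_iff_right h2] at h1
    rw [e0, neg_eq_zero, mul_eq_zero, mul_eq_zero, or_iff_right h3, sq_eq_zero_iff] at h0
    rw [e, h1] at hχ
    -- Here `w = 0` and `α y² = 0`, so the equation leaves `β = 0`.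
    refine .inl ⟨rfl, ?_, h0⟩
    obtain h0 | h0 := h0 <;> rw [h0] at hχ <;> linear_combination -hχ
  | some true =>
    obtain ⟨e, e0, e1⟩ := chartRel_true_eval χ a b rfl rfl rfl rfl
    rw [e1, mul_eq_zero, or_iff_right h2] at h1
    rw [e0] at h0
    rw [e, h1] at hχ
    have : χ (X 0) ≠ 0 := by
      intro hy
      rw [hy] at h0
      exact one_ne_zero (α := k) (by linear_combination -h0)
    -- From `w = 0` and `y ≠ 0` the equation gives `α² β y³ = -1`. The derivative is then `3`, so
    -- this chart has no singular point in any fiber.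
    have h4 : χ (C a) ^ 2 * χ (C b) * χ (X 0) ^ 3 = -1 := by
      apply mul_left_cancel₀ this
      linear_combination -hχ
    exact absurd (by linear_combination h0 + 4 * h4) h3
  | some false =>
    obtain ⟨e, e0, e1⟩ := chartRel_false_eval χ a b rfl rfl rfl rfl
    rw [e1, mul_assoc, mul_eq_zero, or_iff_right h2, mul_eq_zero] at h1
    rw [e0] at h0
    rw [e] at hχ
    refine .inr ⟨rfl, ?_⟩
    by_cases hy : χ (X 0) = 0
    · rw [hy] at hχ
      exact ⟨by linear_combination -hχ, .inr hy⟩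
    -- For `x ≠ 0` one has `w = 0`, the derivative forces `β = 0`, and then the equation forces `α =
    -- 0`.
    · rw [or_iff_right hy] at h1
      rw [h1] at h0 hχ
      have h5 : 3 * χ (X 0) ^ 2 * χ (C b) = 0 := by linear_combination -h0
      rw [mul_eq_zero, or_iff_right (mul_ne_zero h3 (pow_ne_zero 2 hy))] at h5
      rw [h5] at hχ
      exact ⟨by linear_combination -hχ, .inl h5⟩

end Eval

end ChartRel

/-! ### Presentations of the charts, and smoothness of the total space -/

section Presentation

open Polynomial

variable (f₃ f₆ : ℂ[X])

lemma isPresented_none : IsPresented ((AdjoinRoot.of (X ^ 2 - C (gC f₃ f₆))).comp C)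
    ![AdjoinRoot.of _ X, Dbl.root _] (chartRel f₃ f₆ none) where
  rel := by
    have h := (Dbl.root_sq (gC f₃ f₆)).trans
      (map_add (AdjoinRoot.of (X ^ 2 - C (gC f₃ f₆))) (X ^ 3 * C f₃) (C f₆))
    rw [map_mul, map_pow] at h
    simp only [chartRel, MvPolynomial.eval₂_sub, MvPolynomial.eval₂_mul, MvPolynomial.eval₂_pow,
      MvPolynomial.eval₂_X, MvPolynomial.eval₂_C, RingHom.comp_apply, Matrix.cons_val_zero,
      Matrix.cons_val_one]
    linear_combination h
  gen S hσ hy := by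
    refine subring_adjoinRoot_eq_top S (fun a ↦ ?_) (hy 1)
    have := subring_polynomial_eq_top (S.comap (AdjoinRoot.of _)) hσ (hy 0)
    exact (this ▸ Subring.mem_top a : a ∈ _)
  lift E _ ρ z hz := by
    refine ⟨AdjoinRoot.lift (eval₂RingHom ρ (z 0)) (z 1) ?_, ?_, Fin.forall_fin_two.mpr ⟨?_, ?_⟩⟩
    · simp [chartRel] at hz
      simp [gC, eval₂_pow]
      linear_combination hz
    · rw [← RingHom.comp_assoc, AdjoinRoot.lift_comp_of, eval₂RingHom_comp_C]
    · simp
    · simp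

lemma isPresented_true : IsPresented ((AdjoinRoot.of (X ^ 2 - C (gA f₃ f₆))).comp C)
    ![AdjoinRoot.of _ X, Dbl.root _] (chartRel f₃ f₆ (some true)) where
  rel := by
    have h := (Dbl.root_sq (gA f₃ f₆)).trans
      (map_add (AdjoinRoot.of (X ^ 2 - C (gA f₃ f₆))) X (C (f₃ ^ 2 * f₆) * X ^ 4))
    rw [map_mul _ _ (X ^ 4), map_pow _ X] at h
    simp only [chartRel, MvPolynomial.eval₂_sub, MvPolynomial.eval₂_mul, MvPolynomial.eval₂_pow,
      MvPolynomial.eval₂_X, MvPolynomial.eval₂_C, RingHom.comp_apply, Matrix.cons_val_zero,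
      Matrix.cons_val_one]
    linear_combination h
  gen S hσ hy := by
    refine subring_adjoinRoot_eq_top S (fun a ↦ ?_) (hy 1)
    have := subring_polynomial_eq_top (S.comap (AdjoinRoot.of _)) hσ (hy 0)
    exact (this ▸ Subring.mem_top a : a ∈ _)
  lift E _ ρ z hz := by
    refine ⟨AdjoinRoot.lift (eval₂RingHom ρ (z 0)) (z 1) ?_, ?_, Fin.forall_fin_two.mpr ⟨?_, ?_⟩⟩
    · simp [chartRel] at hz
      simp [gA, eval₂_pow]
      linear_combination hz
    · rw [← RingHom.comp_assoc, AdjoinRoot.lift_comp_of, eval₂RingHom_comp_C]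
    · simp
    · simp

lemma of_gB : AdjoinRoot.of (X ^ 2 - C (gB f₃ f₆)) (AdjoinRoot.root _) =
    Dbl.root _ ^ 2 - AdjoinRoot.of _ (φB f₃ (X ^ 2 * C f₆)) := by
  rw [Dbl.root_sq, eq_sub_iff_add_eq, ← map_add]
  rfl

/-- Substituting `r = w² - x² f₆` into `x r = f₃` eliminates `r` and leaves `x w² = f₃ + f₆ x³`. -/
lemma isPresented_false :
    IsPresented ((AdjoinRoot.of (X ^ 2 - C (gB f₃ f₆))).comp ((φB f₃).comp C))
      ![AdjoinRoot.of _ (φB f₃ X), Dbl.root _] (chartRel f₃ f₆ (some false)) where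
  rel := by
    have h1 := congrArg (AdjoinRoot.of (X ^ 2 - C (gB f₃ f₆))) (X_mul_root (f₃ := f₃))
    rw [map_mul, of_gB, map_mul (φB f₃), map_mul, map_pow (φB f₃), map_pow] at h1
    simp only [chartRel, MvPolynomial.eval₂_sub, MvPolynomial.eval₂_mul, MvPolynomial.eval₂_pow,
      MvPolynomial.eval₂_X, MvPolynomial.eval₂_C, RingHom.comp_apply, Matrix.cons_val_zero,
      Matrix.cons_val_one]
    linear_combination h1
  gen S hσ hy := subring_dblB_eq_top S hσ (hy 0) (hy 1)
  lift E _ ρ z hz := by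
    have h1 : z 0 * (z 1 ^ 2 - z 0 ^ 2 * ρ f₆) = ρ f₃ := by
      simp [chartRel] at hz
      linear_combination hz
    let α : AB f₃ →+* E := AdjoinRoot.lift (eval₂RingHom ρ (z 0)) (z 1 ^ 2 - z 0 ^ 2 * ρ f₆) (by
      simp [h1])
    have hα (p) : α (φB f₃ p) = eval₂RingHom ρ (z 0) p := AdjoinRoot.lift_of _
    have hr : α (AdjoinRoot.root _) = z 1 ^ 2 - z 0 ^ 2 * ρ f₆ := AdjoinRoot.lift_root _
    have hg : α (gB f₃ f₆) = z 1 ^ 2 := by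
      refine (map_add α (AdjoinRoot.root _) (φB f₃ (X ^ 2 * C f₆))).trans ?_
      rw [hr, hα]
      simp
      ring
    have h2 : (X ^ 2 - C (gB f₃ f₆)).eval₂ α (z 1) = 0 := by
      rw [eval₂_sub, eval₂_X_pow, eval₂_C, hg, sub_self]
    refine ⟨AdjoinRoot.lift α (z 1) h2, ?_, Fin.forall_fin_two.mpr ⟨?_, ?_⟩⟩
    · refine RingHom.ext fun a ↦ ?_
      refine (AdjoinRoot.lift_of h2).trans ((hα (C a)).trans ?_)
      simp
    · refine (AdjoinRoot.lift_of h2).trans ((hα X).trans ?_)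
      simp
    · exact AdjoinRoot.lift_root h2

variable {f₃ f₆} {K L : Type} [Field K] [Field L] [Algebra K L] (𝔽 : Frame f₃ f₆ K L)

/-- The parameter of a chart relative to the base of the fibration. -/
def Frame.coord : Option Bool → K
  | none => 𝔽.x⁻¹
  | some true => 𝔽.x / 𝔽.τ f₃
  | some false => 𝔽.x

lemma Frame.exists_isPresented (hF : Squarefree (f₃ * f₆)) (k : Option Bool) :
    ∃ y : Fin 2 → (𝔽.chart hF k).D,
      IsPresented ((AdjoinRoot.of _).comp (𝔽.chart hF k).param) y (chartRel f₃ f₆ k) ∧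
      (𝔽.chart hF k).Δ (y 0) = algebraMap K L (𝔽.coord k) ∧
      (𝔽.chart hF k).Δ (y 1) = (𝔽.chart hF k).w := by
  match k with
  | none =>
    refine ⟨_, isPresented_none f₃ f₆, (Dbl.lift_of _ _).trans ?_, Dbl.lift_root _⟩
    exact congrArg (algebraMap K L) (eval₂_X _ _)
  | some true =>
    refine ⟨_, isPresented_true f₃ f₆, (Dbl.lift_of _ _).trans ?_, Dbl.lift_root _⟩
    exact congrArg (algebraMap K L) (eval₂_X _ _)
  | some false =>
    refine ⟨_, isPresented_false f₃ f₆, (Dbl.lift_of _ _).trans ?_, Dbl.lift_root _⟩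
    refine congrArg (algebraMap K L) ((RingHom.congr_fun 𝔽.ψB_comp X).trans (eval₂_X _ _))

section Flat

open MvPolynomial (pderiv)

lemma pderiv_eval₂ {ι R : Type} [CommRing R] (i j : ι) (p : R[X]) :
    pderiv i (eval₂RingHom MvPolynomial.C (MvPolynomial.X j) p) =
      eval₂RingHom MvPolynomial.C (MvPolynomial.X j) (derivative p) *
        pderiv i (MvPolynomial.X j : MvPolynomial ι R) := by
  induction p using Polynomial.induction_on' with
  | add p q hp hq => rw [map_add, map_add, hp, hq, map_add, map_add, add_mul]
  | monomial n a =>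
    rw [derivative_monomial]
    simp only [coe_eval₂RingHom, eval₂_monomial, MvPolynomial.pderiv_mul, MvPolynomial.pderiv_C,
      MvPolynomial.pderiv_pow, map_mul, map_natCast]
    ring

lemma pderiv_succ_flat {R : Type} [CommRing R] (i : Fin 2) (G : MvPolynomial (Fin 2) R[X]) :
    pderiv i.succ (flat G) = flat (pderiv i G) := by
  induction G using MvPolynomial.induction_on with
  | add p q hp hq => rw [map_add, map_add, hp, hq, map_add, map_add]
  | C a =>
    have : flat (MvPolynomial.C a) = eval₂RingHom MvPolynomial.C (MvPolynomial.X 0) a :=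
      MvPolynomial.eval₂Hom_C ..
    rw [this, pderiv_eval₂, MvPolynomial.pderiv_X_of_ne (Fin.succ_ne_zero i).symm, mul_zero,
      MvPolynomial.pderiv_C, map_zero]
  | mul_X p j hp =>
    have : flat (MvPolynomial.X j : MvPolynomial (Fin 2) R[X]) = MvPolynomial.X j.succ :=
      MvPolynomial.eval₂Hom_X' ..
    rw [map_mul, MvPolynomial.pderiv_mul, hp, MvPolynomial.pderiv_mul, map_add, map_mul, map_mul,
      this]
    congr 2
    by_cases hij : j = i
    · subst hij
      rw [MvPolynomial.pderiv_X_self, MvPolynomial.pderiv_X_self, map_one]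
    · rw [MvPolynomial.pderiv_X_of_ne hij, MvPolynomial.pderiv_X_of_ne (by simpa using hij), map_zero]

end Flat

/-- The total spaces of the charts of the elliptic surface are smooth. -/
lemma exists_pderiv_flat_chartRel_ne_zero (hF : Squarefree (f₃ * f₆)) {k : Type} [Field k]
    (χ : MvPolynomial (Fin 3) ℂ →+* k) (i : Option Bool) (hχ : χ (flat (chartRel f₃ f₆ i)) = 0) :
    ∃ j, χ (MvPolynomial.pderiv j (flat (chartRel f₃ f₆ i))) ≠ 0 := by
  by_contra! h
  let T : ℂ[X] →+* MvPolynomial (Fin 3) ℂ := eval₂RingHom MvPolynomial.C (MvPolynomial.X 0)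
  have hT (f : ℂ[X]) : MvPolynomial.pderiv 0 (T f) = T (derivative f) := by
    refine (pderiv_eval₂ 0 0 f).trans ?_
    rw [MvPolynomial.pderiv_X_self, mul_one]
  have hTC (f : ℂ[X]) : flat (MvPolynomial.C f) = T f := MvPolynomial.eval₂Hom_C ..
  have hX (j : Fin 2) : flat (MvPolynomial.X j : MvPolynomial (Fin 2) ℂ[X]) = MvPolynomial.X j.succ :=
    MvPolynomial.eval₂Hom_X' ..
  let ρ : ℂ[X] →+* k := χ.comp T
  have e (n : ℕ) (hn : n ≠ 0) : (n : k) ≠ 0 := by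
    have := (map_ne_zero_iff _ (χ.comp MvPolynomial.C).injective (x := (n : ℂ))).mpr
      (by exact_mod_cast hn)
    rwa [map_natCast] at this
  have e2 : (2 : k) ≠ 0 := by exact_mod_cast e 2 (by norm_num)
  have e3 : (3 : k) ≠ 0 := by exact_mod_cast e 3 (by norm_num)
  -- In characteristic zero squarefree means separable, so a zero of `f` is never a zero of its
  -- derivative.
  have hsep {f : ℂ[X]} (hf : Squarefree f) (h0 : ρ f = 0) (h1 : ρ (derivative f) = 0) : False := by
    obtain ⟨p, q, hpq⟩ := (PerfectField.separable_iff_squarefree.mpr hf)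
    have := congrArg ρ hpq
    rw [map_add, map_mul, map_mul, h0, h1, mul_zero, mul_zero, add_zero, map_one] at this
    exact zero_ne_one this
  have hcop (h0 : ρ f₃ = 0) (h1 : ρ f₆ = 0) : False := by
    obtain ⟨p, q, hpq⟩ := (squarefree_mul_iff.mp hF).1.isCoprime
    have := congrArg ρ hpq
    rw [map_add, map_mul, map_mul, h0, h1, mul_zero, mul_zero, add_zero, map_one] at this
    exact zero_ne_one this
  have hC (f : ℂ[X]) : χ.comp flat (MvPolynomial.C f) = ρ f := congrArg χ (hTC f)
  have hn' (j : Fin 2) : MvPolynomial.pderiv 0 (MvPolynomial.X (R := ℂ) j.succ) = 0 :=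
    MvPolynomial.pderiv_X_of_ne (Fin.succ_ne_zero j)
  have hn (j : Fin 2) (n : ℕ) :
      MvPolynomial.pderiv 0 (MvPolynomial.X (R := ℂ) j.succ ^ n) = 0 := by
    rw [MvPolynomial.pderiv_pow, hn', mul_zero]
  -- A singular point of the surface is singular in its fiber. Either `f₃` and `f₆` vanish together,
  -- which is excluded, or the fiber coordinate is zero and the derivative in `t` reduces, up to
  -- sign, to `f₆'` or `f₃'` at a simple zero.
  obtain ⟨rfl, hb, ha⟩ | ⟨rfl, ha, hb⟩ := singular_point_chartRel (χ := χ.comp flat) e2 e3 i hχ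
    fun j ↦ (congrArg χ (pderiv_succ_flat j _)).symm.trans (h j.succ)
  · rw [hC] at ha hb
    obtain ha | hy := ha
    · exact hcop ha hb
    · change χ (flat _) = 0 at hy
      have h0 := h 0
      simp only [chartRel, map_sub, map_mul, map_pow, hTC, hX, MvPolynomial.pderiv_mul, hT, hn,
        mul_zero, add_zero] at h0
      rw [hX] at hy
      rw [hy] at h0
      refine hsep (squarefree_mul_iff.mp hF).2.2 hb ?_
      change χ (T _) = 0
      rw [map_zero] at h0
      linear_combination -h0
  · rw [hC] at ha hb
    obtain hb | hy := hb
    · exact hcop ha hb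
    · change χ (flat _) = 0 at hy
      have h0 := h 0
      simp only [chartRel, map_sub, map_mul, map_pow, hTC, hX, MvPolynomial.pderiv_mul, hT, hn, hn',
        mul_zero, add_zero] at h0
      rw [hX] at hy
      rw [hy] at h0
      refine hsep (squarefree_mul_iff.mp hF).2.1 ha ?_
      change χ (T _) = 0
      rw [map_zero] at h0
      linear_combination -h0

end Presentation

/-! ### Structure morphisms, local properties and properness -/

section Structure

open HomogeneousLocalization

variable {A E : Type} [CommRing A] [Algebra ℂ A] [CommRing E] (𝒜 : ℕ → Submodule ℂ A)
  [GradedAlgebra 𝒜]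

lemma projPoint_projToSpecC (θ : A →+* E) {d : ℕ} {f : A} (hf : f ∈ 𝒜 d) (hd : 0 < d)
    (hu : IsUnit (θ f)) :
    projPoint 𝒜 θ hf hd hu ≫ projToSpecC 𝒜 =
      Spec.map (CommRingCat.ofHom (θ.comp (algebraMap ℂ A))) := by
  rw [projPoint, projToSpecC, Category.assoc, Proj.awayι_toSpecZero_assoc, ← Spec.map_comp,
    ← Spec.map_comp, ← CommRingCat.ofHom_comp, ← CommRingCat.ofHom_comp]
  congr 2
  refine RingHom.ext fun r ↦ ?_
  change (IsLocalization.Away.lift f hu : Localization.Away f →+* E)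
    (algebraMap A (Localization.Away f) (algebraMap ℂ A r)) = _
  rw [IsLocalization.Away.lift_eq]
  rfl

end Structure

section Local

variable {ι : Type} {U : ι → Scheme.{0}} {X Y : Scheme.{0}}

lemma of_charts (P : MorphismProperty Scheme.{0}) [IsZariskiLocalAtSource P] (i : ∀ k, U k ⟶ X)
    [∀ k, IsOpenImmersion (i k)] (hi : ∀ x : X, ∃ k, x ∈ Set.range (i k)) (f : X ⟶ Y)
    (h : ∀ k, P (i k ≫ f)) : P f := by
  choose k hk using hi
  let 𝒰 : X.OpenCover :=
    { I₀ := ι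
      X := U
      f := i
      mem₀ := by
        rw [Scheme.ofArrows_mem_precoverage_iff]
        exact ⟨fun x ↦ ⟨k x, hk x⟩, inferInstance⟩ }
  exact (IsZariskiLocalAtSource.iff_of_openCover 𝒰).mpr h

lemma exists_mem_range_of_isPullback {V : Scheme.{0}} {d : V ⟶ X} {l : V ⟶ U i} {f : X ⟶ Y}
    {c : U i ⟶ Y} (h : IsPullback d l f c) {x : X} (hx : f x ∈ Set.range c) : x ∈ Set.range d := by
  obtain ⟨y, hy⟩ := hx
  obtain ⟨z, hz, -⟩ := Scheme.Pullback.exists_preimage_pullback x y hy.symm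
  exact ⟨h.isoPullback.inv z, by rw [← Scheme.Hom.comp_apply, h.isoPullback_inv_fst, hz]⟩

end Local

section Proper

lemma isProper_PP (n : ℕ) : IsProper (projToSpecC (coordGrading n)) := by
  have : IsScalarTower ℂ (coordGrading n 0) (MvPolynomial (Fin (n + 1)) ℂ) :=
    IsScalarTower.of_algebraMap_eq (R := ℂ) (S := coordGrading n 0)
      (A := MvPolynomial (Fin (n + 1)) ℂ) fun _ ↦ rfl
  have h2 : Algebra.FiniteType (coordGrading n 0) (MvPolynomial (Fin (n + 1)) ℂ) :=
    .of_restrictScalars_finiteType ℂ _ _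
  have : IsIso (Spec.map (CommRingCat.ofHom (algebraMap ℂ (coordGrading n 0)))) := by
    refine isIso_specMap_of_bijective ⟨fun a b hab ↦
      MvPolynomial.C_injective _ _ (congrArg Subtype.val hab), fun z ↦ ?_⟩
    obtain ⟨z, hz⟩ := z
    have h1 : z.totalDegree = 0 := MvPolynomial.totalDegree_zero_iff_isHomogeneous _ |>.mpr hz
    rw [MvPolynomial.totalDegree_eq_zero_iff_eq_C] at h1
    exact ⟨_, Subtype.ext h1.symm⟩
  rw [projToSpecC]
  infer_instance

instance (n : ℕ) : IsLocallyNoetherian (PP n) :=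
  have := isProper_PP n
  LocallyOfFiniteType.isLocallyNoetherian (projToSpecC (coordGrading n))

/-- Both blow-ups are proper. The intermediate scheme is again locally noetherian because the first
is of finite type over the plane. -/
lemma isProper_toPlane (F₃ F₆ : MvPolynomial (Fin 2) ℂ) : IsProper (R.toPlane F₃ F₆) := by
  have h1 : IsProper (Bl.map (PP 2) p) := isProper_blowupMap _ _
  have : IsLocallyNoetherian Q := LocallyOfFiniteType.isLocallyNoetherian (Bl.map (PP 2) p)
  have h2 : IsProper (Bl.map Q (K F₃ F₆ ⊓ Ep)) := isProper_blowupMap _ _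
  rw [R.toPlane]
  infer_instance

end Proper

/-! ### An atlas of `W_F` and its double cover structure -/

variable {F₃ F₆ : MvPolynomial (Fin 2) ℂ} (h₃ : F₃.IsHomogeneous 3) (h₆ : F₆.IsHomogeneous 6)
  (hF : Squarefree (F₃ * F₆))

/-- An atlas of the double plane. -/
structure SurfaceAtlas where
  {K L : Type}
  [fieldK : Field K]
  [fieldL : Field L]
  [algebra : Algebra K L]
  𝔓 : PlaneFrame K L F₃ F₆
  d (k : Fin 2 × Option Bool) : Spec (.of (𝔓.chart h₃ h₆ hF k).D) ⟶ W h₃ h₆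
  η : Spec (.of L) ⟶ W h₃ h₆
  isOpenImmersion k : IsOpenImmersion (d k)
  cover w : ∃ k, w ∈ Set.range (d k)
  Δ_comp k : Spec.map (CommRingCat.ofHom (𝔓.chart h₃ h₆ hF k).Δ) ≫ d k = η
  toPlane i : d (i, none) ≫ W.toPlane h₃ h₆ =
    Spec.map (CommRingCat.ofHom (AdjoinRoot.of _)) ≫ planeChartSucc i
  toSpecC k : d k ≫ W.toSpecC h₃ h₆ = Spec.map (CommRingCat.ofHom
    (((AdjoinRoot.of _).comp (𝔓.chart h₃ h₆ hF k).param).comp Polynomial.C))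

attribute [instance] SurfaceAtlas.fieldK SurfaceAtlas.fieldL SurfaceAtlas.algebra
  SurfaceAtlas.isOpenImmersion

variable {h₃ h₆ hF}

lemma PlaneFrame.ψ_param_C {K L : Type} [Field K] [Field L] [Algebra K L]
    (𝔓 : PlaneFrame K L F₃ F₆) (k : Fin 2 × Option Bool) :
    ((𝔓.chart h₃ h₆ hF k).ψ.comp (𝔓.chart h₃ h₆ hF k).param).comp Polynomial.C =
      𝔓.ζ.comp MvPolynomial.C := by
  refine (congrArg (·.comp Polynomial.C) ((𝔓.frame h₃ h₆ k.1).chart_ψ_param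
    (squarefree_dehom_mul h₃ h₆ hF k.1) k.2)).trans ?_
  exact Polynomial.eval₂RingHom_comp_C _ _

variable (h₃ h₆ hF) in
/-- The double plane has an atlas, and it is a double cover. -/
theorem exists_surfaceAtlas : Nonempty (SurfaceAtlas h₃ h₆ hF) ∧ IsIntegral (W h₃ h₆) ∧
    IsProper (W.toR h₃ h₆) ∧
    IsDoubleCover (W.toR h₃ h₆) ((KHat F₃ F₆ : Set (R F₃ F₆)) ∪ EpHat F₃ F₆) := by
  obtain ⟨K, L, _, _, _, 𝔓, e, he⟩ := exists_planeFrame h₃ h₆ hF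
  obtain ⟨c, d, η, hc, hcov, hbr, hd, hΔ, hpl, hgen, hW⟩ := exists_charts_W 𝔓 hF e he
  have hd' (k) : IsOpenImmersion (d k) :=
    have := hc k
    MorphismProperty.of_isPullback (P := @IsOpenImmersion) (hd k).flip inferInstance
  have hcov' (w) : ∃ k, w ∈ Set.range (d k) := by
    obtain ⟨k, hk⟩ := hcov (W.toR h₃ h₆ w)
    exact ⟨k, exists_mem_range_of_isPullback (U := fun k ↦ Spec (.of (𝔓.chart h₃ h₆ hF k).A)) (hd k) hk⟩
  have hi : IsIntegralHom (W.toR h₃ h₆) :=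
    inferInstanceAs (IsIntegralHom (genericDoublePointToR h₃ h₆).fromNormalization)
  have hC (k) : c k ≫ R.toPlane F₃ F₆ ≫ projToSpecC (coordGrading 2) =
      Spec.map (CommRingCat.ofHom ((𝔓.chart h₃ h₆ hF k).param.comp Polynomial.C)) := by
    -- A morphism from the chart to `Spec ℂ` is a ring homomorphism. Two of these agree once they
    -- agree after the injective map to the function field, that is, at the generic point.
    obtain ⟨φ, hφ⟩ := Spec.map_surjective
      (c k ≫ R.toPlane F₃ F₆ ≫ projToSpecC (coordGrading 2))
    rw [← hφ]
    congr 1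
    have h1 : Spec.map (CommRingCat.ofHom (𝔓.chart h₃ h₆ hF k).ψ) ≫
        c k ≫ R.toPlane F₃ F₆ ≫ projToSpecC (coordGrading 2) =
        Spec.map (CommRingCat.ofHom (𝔓.ζ.comp MvPolynomial.C)) := by
      have := congrArg (· ≫ projToSpecC (coordGrading 2)) (hgen k)
      simp only [Category.assoc] at this
      rw [this, PlaneFrame.genericPoint]
      refine (congrArg (· ≫ projToSpecC (coordGrading 2))
        (specMap_projPoint (coordGrading 2) _ _ _ _ _)).trans
        ((projPoint_projToSpecC (coordGrading 2) _ _ _ _).trans ?_)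
      congr 2
      refine RingHom.ext fun r ↦ ?_
      exact congrArg 𝔓.ζ (dehomZero_C r)
    rw [← hφ, ← Spec.map_comp] at h1
    have h2 := Spec.map_injective h1
    ext r
    refine (𝔓.chart h₃ h₆ hF k).injective ?_
    have h3 := congrArg (fun h ↦ h.hom r) h2
    exact h3.trans (RingHom.congr_fun (𝔓.ψ_param_C k) r).symm
  refine ⟨⟨⟨𝔓, d, η, hd', hcov', hΔ, fun i ↦ ?_, fun k ↦ ?_⟩⟩, hW, ?_, ?_⟩
  · rw [W.toPlane, ← Category.assoc, (hd _).w, Category.assoc]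
    exact congrArg (Spec.map _ ≫ ·) (hpl i)
  · rw [W.toSpecC, W.toPlane, Category.assoc, ← Category.assoc, (hd _).w, Category.assoc, hC,
      ← Spec.map_comp, ← CommRingCat.ofHom_comp, RingHom.comp_assoc]
  -- A normalization morphism is integral, and the charts show that this one is of finite type. So
  -- it is finite, hence proper.
  · have : LocallyOfFiniteType (W.toR h₃ h₆) := by
      let P : MorphismProperty Scheme.{0} := @LocallyOfFiniteType
      have : IsZariskiLocalAtSource P :=
        HasRingHomProperty.instIsZariskiLocalAtSource (P := @LocallyOfFiniteType)
      refine of_charts P d hcov' _ fun k ↦ ?_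
      rw [(hd k).w]
      change LocallyOfFiniteType _
      have := hc k
      have h1 : LocallyOfFiniteType (Spec.map (CommRingCat.ofHom
          (AdjoinRoot.of (Polynomial.X ^ 2 - Polynomial.C (𝔓.chart h₃ h₆ hF k).g)))) := by
        rw [HasRingHomProperty.Spec_iff (P := @LocallyOfFiniteType)]
        change (algebraMap _ (AdjoinRoot _)).FiniteType
        exact (RingHom.finiteType_algebraMap).mpr inferInstance
      infer_instance
    have : IsFinite (W.toR h₃ h₆) :=
      (IsFinite.iff_isIntegralHom_and_locallyOfFiniteType _).mpr ⟨hi, this⟩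
    infer_instance
  · refine isDoubleCover_of_charts (W.toR h₃ h₆) c hc hcov d hd (fun k ↦ ?_) hbr
    have := (isUnit_iff_ne_zero.mpr (two_ne_zero (α := ℂ))).map
      ((𝔓.chart h₃ h₆ hF k).param.comp Polynomial.C)
    rwa [map_ofNat] at this

/-! ### The linear projection in coordinates -/

section Line

open HomogeneousLocalization

lemma awayLift_comp_map {A B E : Type} [CommRing A] [CommRing B] [CommRing E] [Algebra ℂ A]
    [Algebra ℂ B] {𝒜 : ℕ → Submodule ℂ A} {ℬ : ℕ → Submodule ℂ B} [GradedAlgebra 𝒜]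
    [GradedAlgebra ℬ] (g : 𝒜 →+*ᵍ ℬ) (θ : B →+* E) {d : ℕ} {f : A} (hf : f ∈ 𝒜 d)
    (hu : IsUnit (θ (g f))) :
    (awayLift ℬ θ (g f) hu).comp (Away.map g f) =
      awayLift 𝒜 (θ.comp (g : A →+* B)) f hu := by
  refine awayLift_ext 𝒜 hf _ fun n x hx ↦ ?_
  rw [RingHom.comp_apply, Away.map_mk]
  exact awayLift_mk_mul ℬ θ hu (g.2 hf) n (g x) (g.2 hx)

/-- Both slopes describe the point with homogeneous coordinates given by `ζ`, written in different
charts of the line. -/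
lemma specMap_slopeHom {K : Type} [Field K] {ζ : MvPolynomial (Fin 2) ℂ →+* K} (h : IsFracHom ζ)
    (i j : Fin 2) :
    Spec.map (CommRingCat.ofHom (slopeHom ζ i)) ≫ lineChart i =
      Spec.map (CommRingCat.ofHom (slopeHom ζ j)) ≫ lineChart j := by
  have key (i : Fin 2) : Spec.map (CommRingCat.ofHom (slopeHom ζ i)) ≫ lineChart i =
      projPoint (coordGrading 1) ζ (MvPolynomial.isHomogeneous_X ℂ i) one_pos
        (isUnit_iff_ne_zero.mpr (h.X_ne_zero i)) := by
    refine (specMap_projPoint (coordGrading 1) _ _ _ _ _).trans ?_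
    refine projPoint_congr _ (ζ (MvPolynomial.X i)) (fun n a ha ↦ ?_) _ _ _ _ _ _
    exact map_eq_slopeHom h i ha
  rw [key, key]
  exact projPoint_congr _ 1 (fun n a ha ↦ by rw [one_pow, one_mul]) _ _ _ _ _ _

/-- The factorization of `planeChartSucc i` through `planeChart i`. -/
def planeChartSuccLift (i : Fin 2) :
    Spec (.of (Polynomial (Polynomial ℂ))) ⟶ (planeChart i).toScheme :=
  Spec.map (CommRingCat.ofHom (awayLift (coordGrading 2) (dehomSucc i) (pencil (MvPolynomial.X i))
    (by
      change IsUnit (dehomSucc i (MvPolynomial.rename Fin.succ (MvPolynomial.X i)))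
      rw [MvPolynomial.rename_X, dehomSucc_X_succ, dehom_X, map_one]
      exact isUnit_one))) ≫
  (Proj.basicOpenIsoSpec (coordGrading 2) (pencil (MvPolynomial.X i))
    (pencil.map_mem (MvPolynomial.isHomogeneous_X ℂ i)) one_pos).inv

lemma planeChartSuccLift_ι (i : Fin 2) :
    planeChartSuccLift i ≫ (planeChart i).ι = planeChartSucc i := by
  have h : pencil (MvPolynomial.X i) = MvPolynomial.X i.succ := MvPolynomial.rename_X _ _
  refine (Category.assoc _ _ _).trans ?_
  exact projPoint_congr (coordGrading 2) 1 (fun n a ha ↦ by rw [one_pow, one_mul])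
    (pencil.map_mem (MvPolynomial.isHomogeneous_X ℂ i)) (MvPolynomial.isHomogeneous_X ℂ i.succ)
    one_pos one_pos _ _

/-- In the coordinates `t`, `u` the projection is the inclusion of polynomials in `t`. -/
lemma planeChartSuccLift_linearProjection (i : Fin 2) :
    planeChartSuccLift i ≫ linearProjection i =
      Spec.map (CommRingCat.ofHom Polynomial.C) ≫ lineChart i := by
  have h1 : (dehomSucc i).comp (pencil : MvPolynomial (Fin 2) ℂ →+* MvPolynomial (Fin 3) ℂ) =
      Polynomial.C.comp (dehom i) := RingHom.ext fun a ↦ dehomSucc_pencil i a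
  have hu : IsUnit (dehomSucc i (pencil (MvPolynomial.X i))) := by
    change IsUnit (dehomSucc i (MvPolynomial.rename Fin.succ (MvPolynomial.X i)))
    rw [MvPolynomial.rename_X, dehomSucc_X_succ, dehom_X, map_one]
    exact isUnit_one
  have h2 := awayLift_comp_map pencil (dehomSucc i) (MvPolynomial.isHomogeneous_X ℂ i) hu
  refine (Category.assoc _ _ _).trans ?_
  refine (congrArg (_ ≫ ·) (Iso.inv_hom_id_assoc _ _)).trans ?_
  refine Eq.trans ?_ (specMap_projPoint (coordGrading 1) Polynomial.C (dehom i) _ _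
    (by rw [dehom_X]; simp)).symm
  refine (Category.assoc _ _ _).symm.trans ?_
  refine congrArg (· ≫ Proj.awayι (coordGrading 1) _ (MvPolynomial.isHomogeneous_X ℂ i) one_pos) ?_
  refine (Spec.map_comp _ _).symm.trans ?_
  refine congrArg (fun g ↦ Spec.map (CommRingCat.ofHom g)) (h2.trans ?_)
  simp only [h1]

end Line

section Dominant

lemma isDominant_of_charts {ι : Type} {U : ι → Scheme.{0}} {X E : Scheme.{0}} (d : ∀ k, U k ⟶ X)
    [∀ k, IsOpenImmersion (d k)] (hd : ∀ x : X, ∃ k, x ∈ Set.range (d k)) (e : ∀ k, E ⟶ U k)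
    [∀ k, IsDominant (e k)] (η : E ⟶ X) (he : ∀ k, e k ≫ d k = η) : IsDominant η := by
  refine ⟨fun x ↦ ?_⟩
  rw [mem_closure_iff]
  intro O hO hx
  obtain ⟨k, y, rfl⟩ := hd x
  obtain ⟨_, hz, ⟨t, rfl⟩⟩ := ((inferInstance : IsDominant (e k)).1).inter_open_nonempty _
    (hO.preimage (d k).continuous) ⟨y, hx⟩
  exact ⟨_, hz, t, by rw [← he k, Scheme.Hom.comp_apply]⟩

end Dominant

variable {F₃ F₆ : MvPolynomial (Fin 2) ℂ} {h₃ : F₃.IsHomogeneous 3} {h₆ : F₆.IsHomogeneous 6}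
  {hF : Squarefree (F₃ * F₆)}

/-! ### Existence, uniqueness and first properties of `π_F` -/

namespace SurfaceAtlas

variable (𝔄 : SurfaceAtlas h₃ h₆ hF)

/-- The coordinate ring of a chart. -/
abbrev D (k : Fin 2 × Option Bool) : Type := (𝔄.𝔓.chart h₃ h₆ hF k).D

/-- The embedding of the coordinate ring of a chart into the function field. -/
abbrev Δ (k : Fin 2 × Option Bool) : 𝔄.D k →+* 𝔄.L := (𝔄.𝔓.chart h₃ h₆ hF k).Δ

lemma Δ_injective (k) : Function.Injective (𝔄.Δ k) := (𝔄.𝔓.chart h₃ h₆ hF k).Δ_injective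

instance (k) : IsDomain (𝔄.D k) := (𝔄.Δ_injective k).isDomain

instance (k) : IsDominant (Spec.map (CommRingCat.ofHom (𝔄.Δ k))) :=
  isDominant_specMap (𝔄.Δ_injective k)

/-- The coordinate of the base as a function on a chart. -/
def σ (k : Fin 2 × Option Bool) : Polynomial ℂ →+* 𝔄.D k :=
  (AdjoinRoot.of _).comp (𝔄.𝔓.chart h₃ h₆ hF k).param

lemma exists_isPresented (k : Fin 2 × Option Bool) :
    ∃ y : Fin 2 → 𝔄.D k,
      IsPresented (𝔄.σ k) y (chartRel (dehom k.1 F₃) (dehom k.1 F₆) k.2) ∧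
      𝔄.Δ k (y 0) = algebraMap 𝔄.K 𝔄.L ((𝔄.𝔓.frame h₃ h₆ k.1).coord k.2) ∧
      𝔄.Δ k (y 1) = (𝔄.𝔓.chart h₃ h₆ hF k).w :=
  (𝔄.𝔓.frame h₃ h₆ k.1).exists_isPresented (squarefree_dehom_mul h₃ h₆ hF k.1) k.2

/-- The coordinate of the base as an element of the function field. -/
def τ (i : Fin 2) : Polynomial ℂ →+* 𝔄.L := (algebraMap 𝔄.K 𝔄.L).comp (slopeHom 𝔄.𝔓.ζ i)

lemma Δ_comp_σ (k) : (𝔄.Δ k).comp (𝔄.σ k) = 𝔄.τ k.1 := by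
  have h1 := (𝔄.𝔓.frame h₃ h₆ k.1).chart_ψ_param (squarefree_dehom_mul h₃ h₆ hF k.1) k.2
  refine RingHom.ext fun a ↦ ?_
  refine (RingHom.congr_fun (𝔄.𝔓.chart h₃ h₆ hF k).Δ_comp_of _).trans ?_
  exact congrArg (algebraMap 𝔄.K 𝔄.L) (RingHom.congr_fun h1 a)

/-- The projection of a chart to the projective line. -/
def proj (k : Fin 2 × Option Bool) : Spec (.of (𝔄.D k)) ⟶ PP 1 :=
  Spec.map (CommRingCat.ofHom (𝔄.σ k)) ≫ lineChart k.1

lemma specMap_Δ_proj (k) : Spec.map (CommRingCat.ofHom (𝔄.Δ k)) ≫ 𝔄.proj k =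
    Spec.map (CommRingCat.ofHom (𝔄.τ 0)) ≫ lineChart 0 := by
  rw [proj, ← Category.assoc, ← Spec.map_comp, ← CommRingCat.ofHom_comp, Δ_comp_σ, τ, τ,
    CommRingCat.ofHom_comp, CommRingCat.ofHom_comp, Spec.map_comp, Spec.map_comp, Category.assoc,
    Category.assoc, specMap_slopeHom 𝔄.𝔓.isFracHom k.1 0]

instance : IsDominant 𝔄.η :=
  isDominant_of_charts 𝔄.d 𝔄.cover (fun k ↦ Spec.map (CommRingCat.ofHom (𝔄.Δ k))) 𝔄.η 𝔄.Δ_comp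

/-- The generic point is dominant in each reduced chart and the line is separated, so a morphism to
the line is determined there. -/
lemma eta_comp_iff (π : W h₃ h₆ ⟶ PP 1) :
    𝔄.η ≫ π = Spec.map (CommRingCat.ofHom (𝔄.τ 0)) ≫ lineChart 0 ↔
      ∀ k, 𝔄.d k ≫ π = 𝔄.proj k := by
  constructor
  · intro h k
    refine ext_of_isDominant (Spec.map (CommRingCat.ofHom (𝔄.Δ k))) ?_
    rw [← Category.assoc, 𝔄.Δ_comp, h, specMap_Δ_proj]
  · intro h
    rw [← 𝔄.Δ_comp (0, none), Category.assoc, h, specMap_Δ_proj]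

lemma specMap_comp_assoc' {A B C : Type} [CommRing A] [CommRing B] [CommRing C] (g : A →+* B)
    (h : B →+* C) {X Y : Scheme.{0}} (f : X ⟶ Spec (.of C)) (l : Spec (.of A) ⟶ Y) :
    (f ≫ Spec.map (CommRingCat.ofHom h)) ≫ Spec.map (CommRingCat.ofHom g) ≫ l =
      f ≫ Spec.map (CommRingCat.ofHom (h.comp g)) ≫ l := by
  simp [CommRingCat.ofHom_comp, Spec.map_comp]

lemma eta_toPlane (i : Fin 2) : ∃ q : Spec (.of 𝔄.L) ⟶ Spec (.of (Polynomial (Polynomial ℂ))),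
    𝔄.η ≫ W.toPlane h₃ h₆ = q ≫ planeChartSucc i ∧
    q ≫ Spec.map (CommRingCat.ofHom Polynomial.C) ≫ lineChart i =
      Spec.map (CommRingCat.ofHom (𝔄.τ 0)) ≫ lineChart 0 := by
  refine ⟨Spec.map (CommRingCat.ofHom (𝔄.Δ (i, none))) ≫
    Spec.map (CommRingCat.ofHom (AdjoinRoot.of _)), ?_, ?_⟩
  · rw [← 𝔄.Δ_comp (i, none), Category.assoc, 𝔄.toPlane]
    rfl
  · exact (specMap_comp_assoc' (𝔄.𝔓.chart h₃ h₆ hF (i, none)).param _ _ (lineChart i)).trans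
      (𝔄.specMap_Δ_proj (i, none))

theorem extendsProjection_iff (π : W h₃ h₆ ⟶ PP 1) :
    ExtendsProjection h₃ h₆ π ↔ ∀ k, 𝔄.d k ≫ π = 𝔄.proj k := by
  rw [← eta_comp_iff]
  -- The generic point of the surface lies over each chart where the projection is regular. Hence
  -- the extension property, too, is a condition at the generic point only.
  have key (i : Fin 2) : ∃ l : Spec (.of 𝔄.L) ⟶ (W.toPlane h₃ h₆ ⁻¹ᵁ planeChart i).toScheme,
      l ≫ (W.toPlane h₃ h₆ ⁻¹ᵁ planeChart i).ι = 𝔄.η ∧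
      l ≫ (W.toPlane h₃ h₆ ∣_ planeChart i) ≫ linearProjection i =
        Spec.map (CommRingCat.ofHom (𝔄.τ 0)) ≫ lineChart 0 := by
    obtain ⟨q, hq, hq'⟩ := 𝔄.eta_toPlane i
    let l := IsOpenImmersion.lift (W.toPlane h₃ h₆ ⁻¹ᵁ planeChart i).ι 𝔄.η (by
      rintro _ ⟨z, rfl⟩
      rw [Scheme.Opens.range_ι]
      change W.toPlane h₃ h₆ (𝔄.η z) ∈ planeChart i
      rw [← Scheme.Hom.comp_apply, hq, ← planeChartSuccLift_ι, ← Category.assoc,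
        Scheme.Hom.comp_apply]
      exact (planeChart i).range_ι.le ⟨_, rfl⟩)
    have hl : l ≫ (W.toPlane h₃ h₆ ⁻¹ᵁ planeChart i).ι = 𝔄.η := IsOpenImmersion.lift_fac _ _ _
    refine ⟨l, hl, ?_⟩
    have h1 : l ≫ (W.toPlane h₃ h₆ ∣_ planeChart i) = q ≫ planeChartSuccLift i := by
      rw [← cancel_mono (planeChart i).ι, Category.assoc, morphismRestrict_ι, ← Category.assoc, hl,
        hq, Category.assoc, planeChartSuccLift_ι]
    rw [← Category.assoc, h1, Category.assoc, planeChartSuccLift_linearProjection, hq']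
  constructor
  · intro h
    obtain ⟨l, hl, hl'⟩ := key 0
    rw [← hl, Category.assoc, h 0, hl']
  · intro h i
    obtain ⟨l, hl, hl'⟩ := key i
    have : IsReduced (W h₃ h₆) := by
      have := (exists_surfaceAtlas h₃ h₆ hF).2.1
      infer_instance
    have : IsDominant (l ≫ (W.toPlane h₃ h₆ ⁻¹ᵁ planeChart i).ι) := by rw [hl]; infer_instance
    have : IsDominant l :=
      isDominant_of_comp_openImmersion l (W.toPlane h₃ h₆ ⁻¹ᵁ planeChart i).ι
    refine ext_of_isDominant l ?_
    rw [hl', ← Category.assoc, hl, h]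

theorem existsUnique_extendsProjection (𝔄 : SurfaceAtlas h₃ h₆ hF) :
    ∃! π : W h₃ h₆ ⟶ PP 1, ExtendsProjection h₃ h₆ π := by
  obtain ⟨π, hπ⟩ := exists_glue 𝔄.d 𝔄.cover (fun k ↦ Spec.map (CommRingCat.ofHom (𝔄.Δ k))) 𝔄.η
    𝔄.Δ_comp 𝔄.proj _ 𝔄.specMap_Δ_proj
  refine ⟨π, (𝔄.extendsProjection_iff π).mpr hπ, fun π' h ↦ ?_⟩
  have h1 := (𝔄.extendsProjection_iff π').mp h
  exact hom_ext_of_charts 𝔄.d 𝔄.cover fun k ↦ (h1 k).trans (hπ k).symm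

lemma lineChart_toSpecC (i : Fin 2) : lineChart i ≫ projToSpecC (coordGrading 1) =
    Spec.map (CommRingCat.ofHom Polynomial.C) := by
  refine (projPoint_projToSpecC (coordGrading 1) _ _ _ _).trans ?_
  congr 2
  exact RingHom.ext fun r ↦ dehom_C i r

lemma comp_toSpecC (𝔄 : SurfaceAtlas h₃ h₆ hF) {π : W h₃ h₆ ⟶ PP 1} (hπ : ∀ k, 𝔄.d k ≫ π = 𝔄.proj k) :
    π ≫ projToSpecC (coordGrading 1) = W.toSpecC h₃ h₆ := by
  refine hom_ext_of_charts 𝔄.d 𝔄.cover fun k ↦ ?_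
  rw [← Category.assoc, hπ, proj, Category.assoc, lineChart_toSpecC, 𝔄.toSpecC, ← Spec.map_comp,
    ← CommRingCat.ofHom_comp]
  rfl

lemma exists_mem_range_lineChart (y : PP 1) : ∃ i, y ∈ Set.range (lineChart i) := by
  obtain ⟨j, hj⟩ := exists_mem_basicOpen_X y
  exact ⟨j, by rw [range_lineChart]; exact hj⟩

lemma surjective (𝔄 : SurfaceAtlas h₃ h₆ hF) {π : W h₃ h₆ ⟶ PP 1} (hπ : ∀ k, 𝔄.d k ≫ π = 𝔄.proj k) :
    Surjective π := by
  refine ⟨fun y ↦ ?_⟩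
  obtain ⟨i, x, rfl⟩ := exists_mem_range_lineChart y
  obtain ⟨z, hz, -⟩ := 𝔄.exists_isPresented (i, some true)
  -- The curve `s = w = 0` is a section over the chart of the line, which gives surjectivity.
  obtain ⟨q, hq, -⟩ := hz.lift _ (RingHom.id _) ![0, 0] (by simp [chartRel])
  refine ⟨𝔄.d (i, some true) (Spec.map (CommRingCat.ofHom q) x), ?_⟩
  rw [← Scheme.Hom.comp_apply, ← Scheme.Hom.comp_apply, hπ, proj, ← Category.assoc,
    ← Spec.map_comp, ← CommRingCat.ofHom_comp, hq]
  simp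

/-- The charts are hypersurfaces over `ℂ` in the coordinates `t`, fiber coordinate and root. The
Jacobian criterion applies. -/
lemma smooth (𝔄 : SurfaceAtlas h₃ h₆ hF) : SmoothOfRelativeDimension 2 (W.toSpecC h₃ h₆) := by
  let P : MorphismProperty Scheme.{0} := @SmoothOfRelativeDimension 2
  have : IsZariskiLocalAtSource P :=
    HasRingHomProperty.instIsZariskiLocalAtSource (P := @SmoothOfRelativeDimension 2)
  refine of_charts P 𝔄.d 𝔄.cover _ fun k ↦ ?_
  rw [𝔄.toSpecC]
  obtain ⟨z, hz, -⟩ := 𝔄.exists_isPresented k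
  exact hz.flat.smoothOfRelativeDimension fun _ _ χ hχ ↦
    exists_pderiv_flat_chartRel_ne_zero (squarefree_dehom_mul h₃ h₆ hF k.1) χ _ hχ

end SurfaceAtlas

lemma isProper_toSpecC (h : IsProper (W.toR h₃ h₆)) :
    IsProper (W.toSpecC h₃ h₆) := by
  have := isProper_PP 2
  have := isProper_toPlane F₃ F₆
  rw [W.toSpecC, W.toPlane]
  infer_instance

/-! ### Gradings as homomorphisms to a polynomial ring -/

section Grading

variable {A : Type} [CommRing A] [Algebra ℂ A] (𝒜 : ℕ → Submodule ℂ A) [GradedAlgebra 𝒜]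

/-- The homomorphism `∑ aₙ ↦ ∑ aₙ Xⁿ`. -/
def gradingHom : A →+* Polynomial A :=
  (DirectSum.toSemiring (A := fun n ↦ 𝒜 n)
    (fun n ↦ (Polynomial.monomial n).toAddMonoidHom.comp (𝒜 n).subtype.toAddMonoidHom)
    rfl (fun _ _ ↦ (Polynomial.monomial_mul_monomial _ _ _ _).symm)).comp
    (DirectSum.decomposeRingEquiv 𝒜 : A →+* DirectSum ℕ fun n ↦ 𝒜 n)

lemma gradingHom_of_mem {n : ℕ} {a : A} (ha : a ∈ 𝒜 n) :
    gradingHom 𝒜 a = Polynomial.monomial n a := by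
  rw [gradingHom, RingHom.comp_apply]
  refine (congrArg (DirectSum.toSemiring _ _ _) (DirectSum.decompose_of_mem 𝒜 ha)).trans ?_
  exact DirectSum.toSemiring_of (A := fun n ↦ 𝒜 n) _ _ _ n (⟨a, ha⟩ : 𝒜 n)

/-- Homogeneity becomes an equation between values of ring homomorphisms, so that gradedness can be
checked on generators. -/
lemma mem_of_gradingHom_eq {n : ℕ} {a : A} (h : gradingHom 𝒜 a = Polynomial.monomial n a) :
    a ∈ 𝒜 n := by
  have key (a : A) : (gradingHom 𝒜 a).coeff n ∈ 𝒜 n := by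
    induction a using DirectSum.Decomposition.inductionOn 𝒜 with
    | zero => simp
    | homogeneous a =>
      rw [gradingHom_of_mem 𝒜 a.2, Polynomial.coeff_monomial]
      split_ifs with h
      · exact h ▸ a.2
      · exact zero_mem _
    | add a b ha hb => rw [map_add, Polynomial.coeff_add]; exact add_mem ha hb
  have := key a
  rwa [h, Polynomial.coeff_monomial_same] at this

end Grading

/-! ### The plane cubic `x w² = a z³ + b x³` and its charts -/

section Equation

open MvPolynomial

variable {R S E : Type} [CommRing R] [CommRing S] [CommRing E]

/-- The equation `x w² = a z³ + b x³` of a plane cubic in the coordinates `x, z, w`. -/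
def cubicRel (a b : R) : MvPolynomial (Fin 3) R := X 0 * X 2 ^ 2 - C a * X 1 ^ 3 - C b * X 0 ^ 3

/-- The equations of the plane cubic in the three standard charts. -/
def cubicChart (a b : R) : Fin 3 → MvPolynomial (Fin 2) R :=
  ![chartRel a b none, chartRel a b (some false), X 0 - C a * X 1 ^ 3 - C b * X 0 ^ 3]

/-- The homogeneous coordinates of a point of the `i`-th standard chart. -/
def coneCoord (i : Fin 3) (z : Fin 2 → E) : Fin 3 → E :=
  ![![1, z 0, z 1], ![z 0, 1, z 1], ![z 0, z 1, 1]] i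

lemma coneCoord_self (i : Fin 3) (z : Fin 2 → E) : coneCoord i z i = 1 := by
  fin_cases i <;> rfl

lemma coneCoord_succAbove (i : Fin 3) (z : Fin 2 → E) (l : Fin 2) :
    coneCoord i z (i.succAbove l) = z l := by
  fin_cases i <;> fin_cases l <;> rfl

lemma eval₂_cubicRel (ρ : R →+* E) (y : Fin 3 → E) (a b : R) :
    eval₂ ρ y (cubicRel a b) = y 0 * y 2 ^ 2 - ρ a * y 1 ^ 3 - ρ b * y 0 ^ 3 := by
  simp [cubicRel]

lemma eval₂_cubicChart (ρ : R →+* E) (z : Fin 2 → E) (a b : R) (i : Fin 3) :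
    eval₂ ρ z (cubicChart a b i) = eval₂ ρ (coneCoord i z) (cubicRel a b) := by
  rw [eval₂_cubicRel]
  fin_cases i <;> simp [cubicChart, chartRel, coneCoord]

lemma map_cubicChart (χ : R →+* S) (a b : R) (i : Fin 3) :
    map χ (cubicChart a b i) = cubicChart (χ a) (χ b) i := by
  fin_cases i
  · exact map_chartRel χ a b none
  · exact map_chartRel χ a b (some false)
  · simp [cubicChart]

end Equation

/-! ### Homogeneous coordinate rings of plane cubics -/

section Cone

open HomogeneousLocalization

variable {R A E : Type} [CommRing R] [CommRing A] [Algebra ℂ A] [CommRing E]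
  (𝒜 : ℕ → Submodule ℂ A) [GradedAlgebra 𝒜]

/-- The graded ring `A` is the homogeneous coordinate ring of the plane cubic
`x w² = a z³ + b x³` over `R`. -/
structure IsCubicCone (ρ : R →+* A) (y : Fin 3 → A) (a b : R) : Prop where
  presented : IsPresented ρ y (cubicRel a b)
  mem_zero r : ρ r ∈ 𝒜 0
  mem_one i : y i ∈ 𝒜 1

/-- The homomorphism to the degree zero part. -/
def zeroHom (ρ : R →+* A) (h : ∀ r, ρ r ∈ 𝒜 0) : R →+* 𝒜 0 where
  toFun r := ⟨ρ r, h r⟩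
  map_one' := Subtype.ext (map_one ρ)
  map_mul' _ _ := Subtype.ext (map_mul ρ _ _)
  map_zero' := Subtype.ext (map_zero ρ)
  map_add' _ _ := Subtype.ext (map_add ρ _ _)

/-- The structure morphism of `Proj` over a ring mapping to the degree zero part. -/
def projToSpec (ρ : R →+* A) (h : ∀ r, ρ r ∈ 𝒜 0) : Proj 𝒜 ⟶ Spec (.of R) :=
  Proj.toSpecZero 𝒜 ≫ Spec.map (CommRingCat.ofHom (zeroHom 𝒜 ρ h))

lemma projPoint_projToSpec (ρ : R →+* A) (h : ∀ r, ρ r ∈ 𝒜 0) (θ : A →+* E) {d : ℕ} {f : A}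
    (hf : f ∈ 𝒜 d) (hd : 0 < d) (hu : IsUnit (θ f)) :
    projPoint 𝒜 θ hf hd hu ≫ projToSpec 𝒜 ρ h = Spec.map (CommRingCat.ofHom (θ.comp ρ)) := by
  rw [projPoint, projToSpec, Category.assoc, Proj.awayι_toSpecZero_assoc, ← Spec.map_comp,
    ← Spec.map_comp, ← CommRingCat.ofHom_comp, ← CommRingCat.ofHom_comp]
  congr 2
  refine RingHom.ext fun r ↦ ?_
  change (IsLocalization.Away.lift f hu : Localization.Away f →+* E)
    (algebraMap A (Localization.Away f) (ρ r)) = _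
  rw [IsLocalization.Away.lift_eq]
  rfl

lemma projPoint_map {B : Type} [CommRing B] [Algebra ℂ B] {ℬ : ℕ → Submodule ℂ B} [GradedAlgebra ℬ]
    (g : 𝒜 →+*ᵍ ℬ)
    (hg : HomogeneousIdeal.irrelevant ℬ ≤ (HomogeneousIdeal.irrelevant 𝒜).map g) {θ : B →+* E}
    {θ' : A →+* E} (hθ : θ.comp (g : A →+* B) = θ') {d : ℕ} {f : A} (hf : f ∈ 𝒜 d)
    (hgf : g f ∈ ℬ d) (hd : 0 < d) (hu : IsUnit (θ (g f))) (hu' : IsUnit (θ' f)) :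
    projPoint ℬ θ hgf hd hu ≫ Proj.map g hg = projPoint 𝒜 θ' hf hd hu' := by
  subst hθ
  have h1 : Spec.map (CommRingCat.ofHom (awayLift ℬ θ (g f) hu)) ≫
      Spec.map (CommRingCat.ofHom (Away.map g f)) =
        Spec.map (CommRingCat.ofHom (awayLift 𝒜 (θ.comp (g : A →+* B)) f hu')) := by
    rw [← Spec.map_comp, ← CommRingCat.ofHom_comp, awayLift_comp_map g θ hf hu]
  have h2 := Proj.awayι_comp_map g hg hd f hf
  refine (Category.assoc _ _ _).trans ((congrArg (_ ≫ ·) h2).trans ?_)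
  exact (Category.assoc _ _ _).symm.trans (congrArg (· ≫ Proj.awayι 𝒜 f hf hd) h1)

namespace IsCubicCone

variable {𝒜} {ρ : R →+* A} {y : Fin 3 → A} {a b : R}

/-- Modulo an ideal containing the coordinates, projection to degree zero agrees with the identity
on generators. On elements of positive degree that projection is zero. -/
lemma mem_of_mem_pos (h : IsCubicCone 𝒜 ρ y a b) (I : Ideal A) (hI : ∀ i, y i ∈ I) {n : ℕ}
    (hn : 0 < n) {x : A} (hx : x ∈ 𝒜 n) : x ∈ I := by
  have h1 := h.presented.gen (((Ideal.Quotient.mk I).comp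
    (GradedRing.projZeroRingHom 𝒜)).eqLocus (Ideal.Quotient.mk I)) (fun r ↦ ?_) fun i ↦ ?_
  · have h2 : x ∈ ((Ideal.Quotient.mk I).comp
      (GradedRing.projZeroRingHom 𝒜)).eqLocus (Ideal.Quotient.mk I) := h1 ▸ Subring.mem_top x
    change Ideal.Quotient.mk I (DirectSum.decompose 𝒜 x 0 : A) = Ideal.Quotient.mk I x at h2
    rw [DirectSum.decompose_of_mem_ne 𝒜 hx hn.ne', map_zero] at h2
    exact Ideal.Quotient.eq_zero_iff_mem.mp h2.symm
  · change Ideal.Quotient.mk I (DirectSum.decompose 𝒜 (ρ r) 0 : A) = _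
    rw [DirectSum.decompose_of_mem_same 𝒜 (h.mem_zero r)]
  · change Ideal.Quotient.mk I (DirectSum.decompose 𝒜 (y i) 0 : A) = _
    rw [DirectSum.decompose_of_mem_ne 𝒜 (h.mem_one i) one_ne_zero, map_zero]
    exact (Ideal.Quotient.eq_zero_iff_mem.mpr (hI i)).symm

lemma exists_mem_basicOpen (h : IsCubicCone 𝒜 ρ y a b) (p : Proj 𝒜) :
    ∃ i, p ∈ Proj.basicOpen 𝒜 (y i) := by
  have h1 : ⨆ i, Proj.basicOpen 𝒜 (y i) = ⊤ := by
    refine Proj.iSup_basicOpen_eq_top _ _ ?_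
    rw [HomogeneousIdeal.toIdeal_irrelevant_le]
    intro m hm x hx
    exact h.mem_of_mem_pos (Ideal.span (Set.range y)) (fun i ↦ Ideal.subset_span ⟨i, rfl⟩) hm hx
  have : p ∈ ⨆ i, Proj.basicOpen 𝒜 (y i) := h1 ▸ trivial
  exact Opens.mem_iSup.mp this

/-- The ring is generated over its degree-zero part by the three coordinates, and `R` maps onto that
part, so `Proj` is proper over a closed subscheme of `Spec R`. -/
lemma isProper (h : IsCubicCone 𝒜 ρ y a b) : IsProper (projToSpec 𝒜 ρ h.mem_zero) := by
  classical
  have : Algebra.FiniteType (𝒜 0) A := by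
    refine ⟨⟨Finset.univ.image y, ?_⟩⟩
    have h1 := h.presented.gen (Algebra.adjoin (𝒜 0) (Finset.univ.image y : Set A)).toSubring
      (fun r ↦ (Algebra.adjoin (𝒜 0) _).algebraMap_mem ⟨ρ r, h.mem_zero r⟩)
      fun i ↦ Algebra.subset_adjoin (by simp)
    rw [eq_top_iff]
    rintro x -
    exact (h1 ▸ Subring.mem_top x : x ∈ (Algebra.adjoin (𝒜 0) _).toSubring)
  have : IsClosedImmersion (Spec.map (CommRingCat.ofHom (zeroHom 𝒜 ρ h.mem_zero))) := by
    refine IsClosedImmersion.spec_of_surjective _ fun z ↦ ?_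
    have h1 := h.presented.gen ((ρ.range).comap (GradedRing.projZeroRingHom 𝒜)) (fun r ↦ ?_) fun i ↦ ?_
    · obtain ⟨r, hr⟩ := (h1 ▸ Subring.mem_top z.1 : z.1 ∈ (ρ.range).comap _)
      refine ⟨r, Subtype.ext (hr.trans ?_)⟩
      exact DirectSum.decompose_of_mem_same 𝒜 z.2
    · exact ⟨r, (DirectSum.decompose_of_mem_same 𝒜 (h.mem_zero r)).symm⟩
    · exact ⟨0, (map_zero ρ).trans
        (DirectSum.decompose_of_mem_ne 𝒜 (h.mem_one i) one_ne_zero).symm⟩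
  rw [projToSpec]
  infer_instance

/-- The homomorphism of the homogeneous coordinate ring to the ring of a chart. -/
def chartHom (h : IsCubicCone 𝒜 ρ y a b) {i : Fin 3} {σ : R →+* E} {z : Fin 2 → E}
    (hE : IsPresented σ z (cubicChart a b i)) : A →+* E :=
  (h.presented.lift E σ (coneCoord i z) (by rw [← eval₂_cubicChart, hE.rel])).choose

section Chart

variable (h : IsCubicCone 𝒜 ρ y a b) {i : Fin 3} {σ : R →+* E} {z : Fin 2 → E}
    (hE : IsPresented σ z (cubicChart a b i))

lemma chartHom_comp : (h.chartHom hE).comp ρ = σ :=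
  (h.presented.lift E σ (coneCoord i z) (by rw [← eval₂_cubicChart, hE.rel])).choose_spec.1

lemma chartHom_apply (j : Fin 3) : h.chartHom hE (y j) = coneCoord i z j :=
  (h.presented.lift E σ (coneCoord i z) (by rw [← eval₂_cubicChart, hE.rel])).choose_spec.2 j

lemma chartHom_self : h.chartHom hE (y i) = 1 := by
  rw [chartHom_apply, coneCoord_self]

lemma chartHom_surjective : Function.Surjective (h.chartHom hE) := by
  have h1 := hE.gen (h.chartHom hE).range
    (fun r ↦ ⟨ρ r, RingHom.congr_fun (h.chartHom_comp hE) r⟩)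
    fun l ↦ ⟨y (i.succAbove l), by rw [chartHom_apply, coneCoord_succAbove]⟩
  exact RingHom.range_eq_top.mp h1

lemma isUnit_chartHom : IsUnit (h.chartHom hE (y i)) := (h.chartHom_self hE) ▸ isUnit_one

lemma chartHom_bijective :
    Function.Bijective (awayLift 𝒜 (h.chartHom hE) (y i) (h.isUnit_chartHom hE)) := by
  let α := algebraMap A (Localization.Away (y i))
  let u : Localization.Away (y i) := IsLocalization.Away.invSelf (y i)
  have hu : α (y i) * u = 1 := IsLocalization.Away.mul_invSelf (y i)
  have hz : coneCoord i (fun l ↦ α (y (i.succAbove l)) * u) = fun j ↦ α (y j) * u := by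
    funext j
    obtain rfl | ⟨l, rfl⟩ := Fin.eq_self_or_eq_succAbove i j
    · rw [coneCoord_self, hu]
    · rw [coneCoord_succAbove]
  -- The inverse on the chart: the affine coordinates go to `y_j / y_i`, which satisfy the
  -- dehomogenized equation.
  obtain ⟨H, hH, hHz⟩ := hE.lift _ (α.comp ρ) (fun l ↦ α (y (i.succAbove l)) * u) (by
    rw [eval₂_cubicChart, hz, eval₂_cubicRel]
    have h1 := h.presented.rel
    rw [eval₂_cubicRel] at h1
    have h2 := congrArg α h1
    simp only [map_sub, map_mul, map_pow, map_zero] at h2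
    simp only [RingHom.comp_apply]
    linear_combination u ^ 3 * h2)
  refine awayLift_bijective 𝒜 (h.mem_one i) (h.chartHom_self hE) (h.chartHom_surjective hE) H ?_
  intro n x hx
  -- The required identity depends on the degree. With a grading variable it becomes an equality of
  -- ring homomorphisms, which is checked on generators and then read off in degree `n`.
  have h3 : (Polynomial.mapRingHom α).comp (gradingHom 𝒜) =
      (Polynomial.eval₂RingHom (Polynomial.C.comp (H.comp (h.chartHom hE)))
        (Polynomial.C (α (y i)) * Polynomial.X)).comp (gradingHom 𝒜) := by
    refine h.presented.hom_ext (RingHom.ext fun r ↦ ?_) fun j ↦ ?_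
    · have h4 := RingHom.congr_fun (h.chartHom_comp hE) r
      have h5 := RingHom.congr_fun hH r
      simp only [RingHom.comp_apply] at h4 h5
      simp only [RingHom.comp_apply, gradingHom_of_mem 𝒜 (h.mem_zero r)]
      simp [h4, h5]
    · have h4 : H (coneCoord i z j) = α (y j) * u := by
        rw [← congrFun hz j]
        obtain rfl | ⟨l, rfl⟩ := Fin.eq_self_or_eq_succAbove i j
        · rw [coneCoord_self, coneCoord_self, map_one]
        · rw [coneCoord_succAbove, coneCoord_succAbove, hHz]
      simp only [RingHom.comp_apply, gradingHom_of_mem 𝒜 (h.mem_one j)]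
      simp only [Polynomial.coe_mapRingHom, Polynomial.map_monomial,
        Polynomial.coe_eval₂RingHom, Polynomial.eval₂_monomial, pow_one, RingHom.comp_apply,
        chartHom_apply, h4]
      rw [← mul_assoc, ← map_mul, mul_assoc, mul_comm u, hu, mul_one, Polynomial.C_mul_X_eq_monomial]
  have h6 := RingHom.congr_fun h3 x
  simp only [RingHom.comp_apply, gradingHom_of_mem 𝒜 hx, Polynomial.coe_mapRingHom,
    Polynomial.map_monomial, Polynomial.coe_eval₂RingHom, Polynomial.eval₂_monomial, mul_pow] at h6
  rw [← mul_assoc, ← Polynomial.C_pow, ← map_mul, Polynomial.C_mul_X_pow_eq_monomial] at h6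
  exact (Polynomial.monomial_injective n h6).symm

/-- A standard chart of a plane cubic. -/
def chart : Spec (.of E) ⟶ Proj 𝒜 :=
  projPoint 𝒜 (h.chartHom hE) (h.mem_one i) one_pos (h.isUnit_chartHom hE)

lemma isOpenImmersion_chart : IsOpenImmersion (h.chart hE) :=
  isOpenImmersion_projPoint _ _ _ _ _ (h.chartHom_bijective hE)

lemma range_chart : Set.range (h.chart hE) = Proj.basicOpen 𝒜 (y i) :=
  opensRange_projPoint _ _ _ _ _ (h.chartHom_bijective hE)

lemma chart_projToSpec :
    h.chart hE ≫ projToSpec 𝒜 ρ h.mem_zero = Spec.map (CommRingCat.ofHom σ) := by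
  rw [chart, projPoint_projToSpec, chartHom_comp]

end Chart

end IsCubicCone

end Cone

/-! ### Base change of families of cubics -/

namespace IsCubicCone

variable {R A S B : Type} [CommRing R] [CommRing A] [Algebra ℂ A] [CommRing S] [CommRing B]
  [Algebra ℂ B] {𝒜 : ℕ → Submodule ℂ A} [GradedAlgebra 𝒜] {ℬ : ℕ → Submodule ℂ B}
  [GradedAlgebra ℬ] {ρ : R →+* A} {y : Fin 3 → A} {a b : R} {χ : R →+* S} {ρ' : S →+* B}
  {y' : Fin 3 → B}

lemma exists_gradedHom (h : IsCubicCone 𝒜 ρ y a b) (h' : IsCubicCone ℬ ρ' y' (χ a) (χ b)) :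
    ∃ g : 𝒜 →+*ᵍ ℬ, (g : A →+* B).comp ρ = ρ'.comp χ ∧ ∀ i, g (y i) = y' i := by
  obtain ⟨g, hg, hgy⟩ := h.presented.lift B (ρ'.comp χ) y' (by
    have := h'.presented.rel
    rw [eval₂_cubicRel] at this
    rw [eval₂_cubicRel]
    exact this)
  -- The homomorphism given by the presentation respects the gradings because it does so on
  -- generators.
  have key : (Polynomial.mapRingHom g).comp (gradingHom 𝒜) = (gradingHom ℬ).comp g := by
    refine h.presented.hom_ext (RingHom.ext fun r ↦ ?_) fun j ↦ ?_
    · have h1 := RingHom.congr_fun hg r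
      simp only [RingHom.comp_apply] at h1
      simp only [RingHom.comp_apply, gradingHom_of_mem 𝒜 (h.mem_zero r), h1,
        gradingHom_of_mem ℬ (h'.mem_zero _)]
      simp [h1]
    · simp only [RingHom.comp_apply, gradingHom_of_mem 𝒜 (h.mem_one j), hgy,
        gradingHom_of_mem ℬ (h'.mem_one _)]
      simp [hgy]
  refine ⟨⟨g, fun {n x} hx ↦ mem_of_gradingHom_eq ℬ ?_⟩, hg, hgy⟩
  have h1 := RingHom.congr_fun key x
  simp only [RingHom.comp_apply, gradingHom_of_mem 𝒜 hx] at h1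
  exact h1.symm.trans (Polynomial.map_monomial g)

/-- The charts are presented by one equation, whose coefficients are simply mapped along `χ`. So the
square is cartesian chart by chart. In particular the fibers of the family are plane cubics. -/
lemma exists_isPullback (h : IsCubicCone 𝒜 ρ y a b) (h' : IsCubicCone ℬ ρ' y' (χ a) (χ b)) :
    ∃ m : Proj ℬ ⟶ Proj 𝒜, IsPullback m (projToSpec ℬ ρ' h'.mem_zero)
      (projToSpec 𝒜 ρ h.mem_zero) (Spec.map (CommRingCat.ofHom χ)) := by
  obtain ⟨g, hg, hgy⟩ := h.exists_gradedHom h'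
  have hirr : HomogeneousIdeal.irrelevant ℬ ≤ (HomogeneousIdeal.irrelevant 𝒜).map g := by
    suffices H : (HomogeneousIdeal.irrelevant ℬ).toIdeal ≤
        Ideal.map g (HomogeneousIdeal.irrelevant 𝒜).toIdeal from H
    rw [HomogeneousIdeal.toIdeal_irrelevant_le]
    intro n hn x hx
    refine h'.mem_of_mem_pos _ (fun i ↦ ?_) hn hx
    rw [← hgy]
    exact Ideal.mem_map_of_mem _ (HomogeneousIdeal.mem_irrelevant_of_mem _ one_pos (h.mem_one i))
  let m : Proj ℬ ⟶ Proj 𝒜 := Proj.map g hirr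
  let c i := h.chart (isPresented_hyp (cubicChart a b i))
  let c' i := h'.chart (isPresented_hyp (cubicChart (χ a) (χ b) i))
  have hc i : IsOpenImmersion (c i) := h.isOpenImmersion_chart _
  have hc' i : IsOpenImmersion (c' i) := h'.isOpenImmersion_chart _
  let 𝒰 : (Proj 𝒜).OpenCover :=
    { I₀ := Fin 3
      X i := Spec (.of (Hyp (cubicChart a b i)))
      f := c
      mem₀ := by
        rw [Scheme.ofArrows_mem_precoverage_iff]
        refine ⟨fun x ↦ ?_, hc⟩
        obtain ⟨i, hi⟩ := h.exists_mem_basicOpen x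
        exact ⟨i, (h.range_chart (isPresented_hyp (cubicChart a b i))).symm ▸ hi⟩ }
  refine ⟨m, Scheme.isPullback_of_openCover _ _ _ _ 𝒰 fun i ↦ ?_⟩
  have hp : IsPresented (algebraMap S (Hyp (cubicChart (χ a) (χ b) i)))
      (fun l ↦ Ideal.Quotient.mk _ (MvPolynomial.X l)) (MvPolynomial.map χ (cubicChart a b i)) := by
    rw [map_cubicChart]
    exact isPresented_hyp _
  obtain ⟨q, hq, hqy⟩ := (isPresented_hyp (cubicChart a b i)).lift _
    ((algebraMap S (Hyp (cubicChart (χ a) (χ b) i))).comp χ)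
    (fun l ↦ Ideal.Quotient.mk _ (MvPolynomial.X l)) (by
      rw [← hp.rel, MvPolynomial.eval₂_map])
  have hθ : (h'.chartHom (isPresented_hyp (cubicChart (χ a) (χ b) i))).comp (g : A →+* B) =
      q.comp (h.chartHom (isPresented_hyp (cubicChart a b i))) := by
    refine h.presented.hom_ext ?_ fun j ↦ ?_
    · rw [RingHom.comp_assoc, hg, ← RingHom.comp_assoc, chartHom_comp, RingHom.comp_assoc,
        chartHom_comp, hq]
    · change h'.chartHom _ (g (y j)) = q (h.chartHom _ (y j))
      rw [hgy, chartHom_apply, chartHom_apply]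
      obtain rfl | ⟨l, rfl⟩ := Fin.eq_self_or_eq_succAbove i j
      · rw [coneCoord_self, coneCoord_self, map_one]
      · rw [coneCoord_succAbove, coneCoord_succAbove, hqy]
  have hcomm : Spec.map (CommRingCat.ofHom q) ≫ c i = c' i ≫ m := by
    have h1 : g (y i) ∈ ℬ 1 := g.2 (h.mem_one i)
    have h2 : IsUnit (h'.chartHom (isPresented_hyp (cubicChart (χ a) (χ b) i)) (g (y i))) := by
      rw [hgy]; exact h'.isUnit_chartHom _
    have h3 : c' i = projPoint ℬ (h'.chartHom (isPresented_hyp (cubicChart (χ a) (χ b) i))) h1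
        one_pos h2 := projPoint_congr _ 1 (fun n a _ ↦ by rw [one_pow, one_mul]) _ _ _ _ _ _
    rw [h3]
    refine (specMap_projPoint _ _ _ _ _ _).trans ?_
    exact (projPoint_map 𝒜 g hirr hθ (h.mem_one i) h1 one_pos h2 _).symm
  have sq1 : IsPullback (Spec.map (CommRingCat.ofHom q)) (c' i) (c i) m := by
    refine IsOpenImmersion.isPullback _ _ _ _ hcomm.symm ?_
    apply Opens.ext
    have h4 : ((c i).opensRange : Set (Proj 𝒜)) = Proj.basicOpen 𝒜 (y i) := h.range_chart _
    have h5 : ((c' i).opensRange : Set (Proj ℬ)) = Proj.basicOpen ℬ (y' i) := h'.range_chart _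
    rw [h5, ← hgy]
    change m ⁻¹' ((c i).opensRange : Set (Proj 𝒜)) = _
    rw [h4]
    rfl
  have sq2 : IsPullback (Spec.map (CommRingCat.ofHom q))
      (Spec.map (CommRingCat.ofHom (algebraMap S (Hyp (cubicChart (χ a) (χ b) i)))))
      (Spec.map (CommRingCat.ofHom (algebraMap R (Hyp (cubicChart a b i)))))
      (Spec.map (CommRingCat.ofHom χ)) :=
    isPullback_SpecMap_of_isPushout _ _ _ _
      ((isPresented_hyp (cubicChart a b i)).isPushout hp hq hqy)
  refine sq2.of_iso sq1.flip.isoPullback (Iso.refl _) (Iso.refl _) (Iso.refl _) ?_ ?_ ?_ ?_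
  · rw [Iso.refl_hom, Category.comp_id]
    exact (IsPullback.isoPullback_hom_snd sq1.flip).symm
  · rw [Iso.refl_hom, Category.comp_id, ← h'.chart_projToSpec]
    exact ((IsPullback.isoPullback_hom_fst_assoc sq1.flip _)).symm
  · rw [Iso.refl_hom, Category.comp_id, Iso.refl_hom, Category.id_comp, ← h.chart_projToSpec]
  · simp

end IsCubicCone

/-! ### Normal forms of the fibers -/

section PlaneCubic

open MvPolynomial

/-- The linear forms `l` and `m` are mutually inverse changes of coordinates under which the cubic
becomes `c` times `f`. So `ℂ[X, Y, Z] / (f)` has the universal property of the cone. -/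
lemma isCubicCone_planeCurve (f : MvPolynomial (Fin 3) ℂ) (hf : f.IsHomogeneous 3) {α β c : ℂ}
    (hc : c ≠ 0) (l m : Fin 3 → MvPolynomial (Fin 3) ℂ) (hl : ∀ i, (l i).IsHomogeneous 1)
    (hlm : ∀ i, eval₂ C l (m i) = X i) (hml : ∀ i, eval₂ C m (l i) = X i)
    (h : l 0 * l 2 ^ 2 - C α * l 1 ^ 3 - C β * l 0 ^ 3 = C c * f) :
    IsCubicCone (quotientGrading (principalIdeal f hf))
      (algebraMap ℂ (MvPolynomial (Fin 3) ℂ ⧸ (principalIdeal f hf).toIdeal))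
      (fun i ↦ Ideal.Quotient.mk _ (l i)) α β where
  presented :=
    { rel := by
        rw [eval₂_cubicRel]
        change Ideal.Quotient.mk _ (l 0 * l 2 ^ 2 - C α * l 1 ^ 3 - C β * l 0 ^ 3) = _
        rw [h]
        exact Ideal.Quotient.eq_zero_iff_mem.mpr
          (Ideal.mul_mem_left _ _ (Ideal.subset_span rfl))
      gen := fun S hσ hy ↦ by
        have h1 := subring_mvPolynomial_eq_top
          ((S.comap (Ideal.Quotient.mk (principalIdeal f hf).toIdeal)).comap (eval₂Hom C l))
          (fun a ↦ by
            change Ideal.Quotient.mk _ (eval₂Hom C l (C a)) ∈ S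
            rw [eval₂Hom_C]
            exact hσ a)
          (fun i ↦ by
            change Ideal.Quotient.mk _ (eval₂Hom C l (X i)) ∈ S
            rw [eval₂Hom_X']
            exact hy i)
        have h2 := subring_mvPolynomial_eq_top
          (S.comap (Ideal.Quotient.mk (principalIdeal f hf).toIdeal)) hσ fun i ↦ by
            have h3 := (h1 ▸ Subring.mem_top (m i) : m i ∈ Subring.comap (eval₂Hom C l) _)
            change eval₂ C l (m i) ∈ S.comap (Ideal.Quotient.mk (principalIdeal f hf).toIdeal) at h3
            rwa [hlm] at h3
        rw [eq_top_iff]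
        rintro p -
        obtain ⟨p, rfl⟩ := Ideal.Quotient.mk_surjective p
        exact (h2 ▸ Subring.mem_top p : p ∈ S.comap _)
      lift := fun E _ ρ z hz ↦ by
        let q : MvPolynomial (Fin 3) ℂ →+* E := eval₂Hom ρ fun i ↦ eval₂ ρ z (m i)
        have hql i : q (l i) = z i := by
          have h1 : q = (eval₂Hom ρ z).comp (eval₂Hom C m) := by
            ext <;> simp [q]
          rw [h1]
          change eval₂Hom ρ z (eval₂ C m (l i)) = _
          rw [hml, eval₂Hom_X']
        have hqC r : q (C r) = ρ r := eval₂Hom_C _ _ _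
        rw [eval₂_cubicRel] at hz
        have hqf : q f = 0 := by
          have h1 := congrArg q h
          simp only [map_sub, map_mul, map_pow, hql, hqC] at h1
          rw [hz] at h1
          exact ((IsUnit.mk0 c hc).map ρ).mul_right_eq_zero.mp h1.symm
        have h0 : ∀ a ∈ (principalIdeal f hf).toIdeal, q a = 0 := by
          intro a ha
          have : (principalIdeal f hf).toIdeal ≤ RingHom.ker q :=
            (Ideal.span_singleton_le_iff_mem _).mpr hqf
          exact this ha
        refine ⟨Ideal.Quotient.lift _ q h0, RingHom.ext fun a ↦ ?_, fun i ↦ ?_⟩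
        · exact (Ideal.Quotient.lift_mk _ _ h0).trans (hqC a)
        · exact (Ideal.Quotient.lift_mk _ _ h0).trans (hql i) }
  mem_zero r := ⟨C r, isHomogeneous_C _ _, rfl⟩
  mem_one i := ⟨l i, hl i, rfl⟩

lemma exists_isCubicCone_scale (f : MvPolynomial (Fin 3) ℂ) (hf : f.IsHomogeneous 3) {α β : ℂ}
    {r s t : ℂ} (hr : r ≠ 0) (hs : s ≠ 0) (ht : t ≠ 0)
    (h : C (r * t ^ 2) * (X 1 ^ 2 * X 2) - C (α * s ^ 3) * X 0 ^ 3 - C (β * r ^ 3) * X 2 ^ 3 = f) :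
    ∃ y, IsCubicCone (quotientGrading (principalIdeal f hf))
      (algebraMap ℂ (MvPolynomial (Fin 3) ℂ ⧸ (principalIdeal f hf).toIdeal)) y α β := by
  -- The substitution is `x = r Z`, `z = s X`, `w = t Y`.
  refine ⟨_, isCubicCone_planeCurve f hf one_ne_zero ![C r * X 2, C s * X 0, C t * X 1]
    ![C s⁻¹ * X 1, C t⁻¹ * X 2, C r⁻¹ * X 0] (fun i ↦ ?_) (fun i ↦ ?_) (fun i ↦ ?_) ?_⟩
  · fin_cases i <;> exact (isHomogeneous_C_mul_X _ _)
  · fin_cases i <;> simp [← mul_assoc, ← C_mul, hr, hs, ht]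
  · fin_cases i <;> simp [← mul_assoc, ← C_mul, hr, hs, ht]
  · rw [← h]
    simp
    ring

/-- The elliptic curve `Y²Z = X³ + Z³`. -/
def curveZero : WeierstrassCurve ℂ := ⟨0, 0, 0, 0, 1⟩

instance : curveZero.IsElliptic := by
  refine ⟨?_⟩
  simp [curveZero, WeierstrassCurve.Δ, WeierstrassCurve.b₂, WeierstrassCurve.b₄,
    WeierstrassCurve.b₆, WeierstrassCurve.b₈]

lemma curveZero_j : curveZero.j = 0 := by
  rw [WeierstrassCurve.j_eq_zero_iff]
  simp [curveZero, WeierstrassCurve.c₄, WeierstrassCurve.b₂, WeierstrassCurve.b₄]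

lemma exists_isCubicCone_curveZero {α β : ℂ} (hα : α ≠ 0) (hβ : β ≠ 0) :
    ∃ y, IsCubicCone (quotientGrading (principalIdeal _ (isHomogeneous_weierstrass curveZero)))
      (algebraMap ℂ (MvPolynomial (Fin 3) ℂ ⧸ (principalIdeal _
        (isHomogeneous_weierstrass curveZero)).toIdeal)) y α β := by
  -- With `β r³ = 1`, `α s³ = 1` and `r t² = 1` all coefficients of the rescaled equation are `±1`.
  obtain ⟨r, hr⟩ := IsAlgClosed.exists_pow_nat_eq β⁻¹ (n := 3) (by norm_num)
  obtain ⟨s, hs⟩ := IsAlgClosed.exists_pow_nat_eq α⁻¹ (n := 3) (by norm_num)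
  have hr0 : r ≠ 0 := by
    rintro rfl
    exact hβ (by simpa using hr.symm)
  have hs0 : s ≠ 0 := by
    rintro rfl
    exact hα (by simpa using hs.symm)
  obtain ⟨t, ht⟩ := IsAlgClosed.exists_pow_nat_eq r⁻¹ (n := 2) (by norm_num)
  have ht0 : t ≠ 0 := by
    rintro rfl
    exact hr0 (by simpa using ht.symm)
  refine exists_isCubicCone_scale _ _ hr0 hs0 ht0 ?_
  rw [hr, hs, ht, mul_inv_cancel₀ hα, mul_inv_cancel₀ hβ, mul_inv_cancel₀ hr0,
    WeierstrassCurve.Projective.polynomial]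
  simp [curveZero]
  ring

lemma exists_isCubicCone_cuspidalCubic {α : ℂ} (hα : α ≠ 0) :
    ∃ y, IsCubicCone (quotientGrading (principalIdeal _ isHomogeneous_cuspidalCubic))
      (algebraMap ℂ (MvPolynomial (Fin 3) ℂ ⧸ (principalIdeal _
        isHomogeneous_cuspidalCubic).toIdeal)) y α 0 := by
  obtain ⟨s, hs⟩ := IsAlgClosed.exists_pow_nat_eq α⁻¹ (n := 3) (by norm_num)
  have hs0 : s ≠ 0 := by
    rintro rfl
    exact hα (by simpa using hs.symm)
  refine exists_isCubicCone_scale _ _ one_ne_zero hs0 one_ne_zero ?_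
  rw [hs, mul_inv_cancel₀ hα, cuspidalCubic]
  simp

lemma exists_isCubicCone_concurrentLines {β : ℂ} (hβ : β ≠ 0) :
    ∃ y, IsCubicCone (quotientGrading (principalIdeal _ isHomogeneous_concurrentLines))
      (algebraMap ℂ (MvPolynomial (Fin 3) ℂ ⧸ (principalIdeal _
        isHomogeneous_concurrentLines).toIdeal)) y 0 β := by
  obtain ⟨s, rfl⟩ := IsAlgClosed.exists_pow_nat_eq β (n := 2) (by norm_num)
  have hs0 : s ≠ 0 := by
    rintro rfl
    exact hβ (by simp)
  have hs1 : (C s : MvPolynomial (Fin 3) ℂ) * C s⁻¹ = 1 := by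
    rw [← C_mul, mul_inv_cancel₀ hs0, C_1]
  have h2 : (C 2⁻¹ : MvPolynomial (Fin 3) ℂ) * 2 = 1 := by
    have : (2 : MvPolynomial (Fin 3) ℂ) = C 2 := rfl
    rw [this, ← C_mul, inv_mul_cancel₀ two_ne_zero, C_1]
  have hX (i : Fin 3) : (X i : MvPolynomial (Fin 3) ℂ).IsHomogeneous 1 := isHomogeneous_X _ _
  -- For `β = s²`, setting `x = X + Y` and `w = s (Y - X)` gives `x (w² - β x²) = -4 s² X Y (X +
  -- Y)`.
  refine ⟨_, isCubicCone_planeCurve _ _ (c := -(4 * s ^ 2)) (by simp [hs0])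
    ![X 0 + X 1, X 2, C s * (X 1 - X 0)]
    ![C 2⁻¹ * (X 0 - C s⁻¹ * X 2), C 2⁻¹ * (X 0 + C s⁻¹ * X 2), X 1] (fun i ↦ ?_) (fun i ↦ ?_)
    (fun i ↦ ?_) ?_⟩
  · fin_cases i
    · exact (hX 0).add (hX 1)
    · exact hX 2
    · exact ((hX 1).sub (hX 0)).C_mul s
  · fin_cases i
    · simp
      linear_combination (X 0) * h2 - C 2⁻¹ * (X 1 - X 0) * hs1
    · simp
      linear_combination (X 1) * h2 + C 2⁻¹ * (X 1 - X 0) * hs1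
    · simp
  · fin_cases i
    · simp
      linear_combination (X 0) * h2
    · simp
    · simp
      linear_combination (X 2) * h2 + C 2⁻¹ * 2 * (X 2) * hs1
  · have h4 : (C 4 : MvPolynomial (Fin 3) ℂ) = 4 := map_ofNat C 4
    simp [concurrentLines, h4]
    ring

end PlaneCubic

/-! ### Construction of the family of cubics over `ℂ[t]` -/

section UniversalCubic

open MvPolynomial

attribute [local instance] MvPolynomial.weightedGradedAlgebra

/-- The degrees of the coordinates `t, x, z, w` of a family of plane cubics. -/
def cubicWeight : Fin 4 → ℕ := Fin.cons 0 fun _ ↦ 1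

/-- Every plane cubic `x w² = a z³ + b x³` over `ℂ[t]` has a homogeneous coordinate ring. -/
lemma exists_isCubicCone (a b : Polynomial ℂ) : ∃ (A : Type) (_ : CommRing A) (_ : Algebra ℂ A)
    (𝒜 : ℕ → Submodule ℂ A) (_ : GradedAlgebra 𝒜) (ρ : Polynomial ℂ →+* A) (y : Fin 3 → A),
    IsCubicCone 𝒜 ρ y a b := by
  let j : Polynomial ℂ →+* MvPolynomial (Fin 4) ℂ := Polynomial.eval₂RingHom C (X 0)
  have hj (r : Polynomial ℂ) : (j r).IsWeightedHomogeneous cubicWeight 0 := by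
    induction r using Polynomial.induction_on' with
    | add p q hp hq => rw [map_add]; exact hp.add hq
    | monomial n c =>
      have h1 : (X 0 : MvPolynomial (Fin 4) ℂ).IsWeightedHomogeneous cubicWeight 0 :=
        isWeightedHomogeneous_X ℂ cubicWeight 0
      have h2 := (isWeightedHomogeneous_C cubicWeight c).mul (h1.pow n)
      have h3 : j (Polynomial.monomial n c) = C c * X 0 ^ n := Polynomial.eval₂_monomial _ _
      rw [h3]
      simpa using h2
  have hX (i : Fin 3) : (X i.succ : MvPolynomial (Fin 4) ℂ).IsWeightedHomogeneous cubicWeight 1 :=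
    isWeightedHomogeneous_X ℂ cubicWeight i.succ
  let f : MvPolynomial (Fin 4) ℂ := eval₂ j (fun i : Fin 3 ↦ X i.succ) (cubicRel a b)
  have hf : f.IsWeightedHomogeneous cubicWeight 3 := by
    simp only [f, eval₂_cubicRel]
    refine (IsWeightedHomogeneous.sub ?_ ?_).sub ?_
    · exact (hX 0).mul ((hX 2).pow 2)
    · exact (hj a).mul ((hX 1).pow 3)
    · exact (hj b).mul ((hX 0).pow 3)
  let I : HomogeneousIdeal (weightedHomogeneousSubmodule ℂ cubicWeight) :=
    { toSubmodule := Ideal.span {f}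
      is_homogeneous' := Ideal.homogeneous_span _ _ (by
        rintro _ rfl
        exact ⟨3, hf⟩) }
  suffices H : IsCubicCone (quotientGrading I) ((Ideal.Quotient.mk I.toIdeal).comp j)
    (fun i ↦ Ideal.Quotient.mk I.toIdeal (X i.succ)) a b from
    ⟨_, _, _, _, quotientGrading.instGradedAlgebraNatComplexQuotientIdealToIdealSubmodule I, _, _, H⟩
  refine ⟨⟨?_, ?_, ?_⟩, fun r ↦ ⟨j r, hj r, rfl⟩, fun i ↦ ⟨X i.succ, hX i, rfl⟩⟩
  · have := MvPolynomial.eval₂_comp_left (Ideal.Quotient.mk I.toIdeal) j (fun i : Fin 3 ↦ X i.succ)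
      (cubicRel a b)
    exact this.symm.trans (Ideal.Quotient.eq_zero_iff_mem.mpr (Ideal.subset_span rfl))
  · intro S hσ hy
    have h2 := subring_mvPolynomial_eq_top (S.comap (Ideal.Quotient.mk I.toIdeal))
      (fun c ↦ by
        have := hσ (Polynomial.C c)
        rwa [RingHom.comp_apply, Polynomial.coe_eval₂RingHom, Polynomial.eval₂_C] at this)
      (Fin.cases (by
        have := hσ Polynomial.X
        rwa [RingHom.comp_apply, Polynomial.coe_eval₂RingHom, Polynomial.eval₂_X] at this) hy)
    rw [eq_top_iff]
    rintro p -
    obtain ⟨p, rfl⟩ := Ideal.Quotient.mk_surjective p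
    exact (h2 ▸ Subring.mem_top p : p ∈ S.comap _)
  · intro E _ ρ z hz
    let q : MvPolynomial (Fin 4) ℂ →+* E :=
      eval₂Hom (ρ.comp Polynomial.C) (Fin.cons (ρ Polynomial.X) z : Fin 4 → E)
    have hqj : q.comp j = ρ := by
      ext <;> simp [q, j]
    have hqX i : q (X i.succ) = z i := by simp [q]
    have hqf : q f = 0 := by
      rw [← hz]
      refine (MvPolynomial.eval₂_comp_left q j _ _).trans ?_
      rw [hqj]
      congr 1
      exact funext hqX
    have h0 : ∀ a ∈ I.toIdeal, q a = 0 := by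
      intro a ha
      have : I.toIdeal ≤ RingHom.ker q := (Ideal.span_singleton_le_iff_mem _).mpr hqf
      exact this ha
    refine ⟨Ideal.Quotient.lift _ q h0, RingHom.ext fun r ↦ ?_, fun i ↦ ?_⟩
    · exact (Ideal.Quotient.lift_mk _ _ h0).trans (RingHom.congr_fun hqj r)
    · exact (Ideal.Quotient.lift_mk _ _ h0).trans (hqX i)

end UniversalCubic

/-! ### Open immersions of proper families -/

section Immersion

/-- The induced map to the preimage of `B` is an open immersion and, by cancellation, proper. Its
image is open, closed and nonempty in an irreducible scheme, so the map is an isomorphism. -/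
lemma isPullback_of_isOpenImmersion_of_isProper {X Y B P : Scheme.{0}} (m : X ⟶ Y) (p : X ⟶ B)
    (π : Y ⟶ P) (l : B ⟶ P) [IsOpenImmersion m] [IsProper p] [IsSeparated π] [IsOpenImmersion l]
    [IsIntegral Y] [Nonempty X] (h : m ≫ π = p ≫ l) : IsPullback m p π l := by
  let n : X ⟶ pullback π l := pullback.lift m p h
  have h1 : n ≫ pullback.fst π l = m := pullback.lift_fst _ _ _
  have h2 : n ≫ pullback.snd π l = p := pullback.lift_snd _ _ _
  have : IsOpenImmersion (n ≫ pullback.fst π l) := h1 ▸ inferInstance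
  have : IsOpenImmersion n := IsOpenImmersion.of_comp n (pullback.fst π l)
  have : IsProper (n ≫ pullback.snd π l) := h2 ▸ inferInstance
  have : IsProper n := IsProper.of_comp n (pullback.snd π l)
  have : Nonempty ((pullback π l : Scheme.{0}) : Type) := ⟨n (Classical.arbitrary X)⟩
  have : IsIntegral (pullback π l) := isIntegral_of_isOpenImmersion (pullback.fst π l)
  have h3 : Set.range n = Set.univ := by
    refine IsClopen.eq_univ ⟨n.isClosedMap.isClosed_range, n.isOpenEmbedding.isOpen_range⟩ ?_
    exact Set.range_nonempty n
  have : Surjective n := ⟨Set.range_eq_univ.mp h3⟩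
  have : IsIso n := by
    exact IsOpenImmersion.isIso n
  exact IsPullback.of_iso_pullback ⟨h⟩ (asIso n) h1 h2

/-- The common charts glue to an isomorphism of `X` with the open union of their images in `Y`, to
which the preceding lemma applies. -/
lemma exists_isPullback_of_charts {ι : Type} {U : ι → Scheme.{0}} {X Y B P E : Scheme.{0}}
    (c : ∀ k, U k ⟶ X) [∀ k, IsOpenImmersion (c k)] (hc : ∀ x : X, ∃ k, x ∈ Set.range (c k))
    (d : ∀ k, U k ⟶ Y) [∀ k, IsOpenImmersion (d k)] [∀ k, IsReduced (U k)] (e : ∀ k, E ⟶ U k)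
    [∀ k, IsDominant (e k)] (η : E ⟶ X) (he : ∀ k, e k ≫ c k = η) (η' : E ⟶ Y)
    (he' : ∀ k, e k ≫ d k = η') [X.IsSeparated] [Y.IsSeparated] [IsIntegral Y] [Nonempty E]
    (p : X ⟶ B) [IsProper p] (π : Y ⟶ P) [IsSeparated π] (l : B ⟶ P) [IsOpenImmersion l]
    (h : ∀ k, d k ≫ π = c k ≫ p ≫ l) : ∃ m : X ⟶ Y, IsPullback m p π l := by
  let V : Y.Opens := ⨆ k, (d k).opensRange
  have hV (k) : Set.range (d k) ⊆ Set.range V.ι := by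
    rw [Scheme.Opens.range_ι]
    exact SetLike.coe_subset_coe.mpr (le_iSup (fun k ↦ (d k).opensRange) k)
  let d' k : U k ⟶ V := IsOpenImmersion.lift V.ι (d k) (hV k)
  have hd' k : d' k ≫ V.ι = d k := IsOpenImmersion.lift_fac _ _ _
  have k₀ : Nonempty ι := by
    obtain ⟨k, -⟩ := hc (η (Classical.arbitrary E))
    exact ⟨k⟩
  have hη : Set.range η' ⊆ Set.range V.ι := by
    rintro _ ⟨z, rfl⟩
    refine hV k₀.some ⟨e k₀.some z, ?_⟩
    rw [← Scheme.Hom.comp_apply, he']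
  let η'' : E ⟶ V := IsOpenImmersion.lift V.ι η' hη
  have hη'' : η'' ≫ V.ι = η' := IsOpenImmersion.lift_fac _ _ _
  have hd'' (k) : IsOpenImmersion (d' k) := by
    have : IsOpenImmersion (d' k ≫ V.ι) := by rw [hd']; infer_instance
    exact IsOpenImmersion.of_comp (d' k) V.ι
  have : V.toScheme.IsSeparated := ⟨by
    rw [← terminal.comp_from V.ι]
    infer_instance⟩
  obtain ⟨F, hF⟩ := exists_iso_of_charts c hc d' (fun ⟨y, hy⟩ ↦ by
    obtain ⟨k, z, hz⟩ := Opens.mem_iSup.mp hy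
    refine ⟨k, z, Subtype.ext ?_⟩
    change V.ι (d' k z) = y
    rw [← Scheme.Hom.comp_apply, hd']
    exact hz) e η he η'' fun k ↦ by
      rw [← cancel_mono V.ι, Category.assoc, hd', he', hη'']
  have : Nonempty X := ⟨η (Classical.arbitrary E)⟩
  refine ⟨F.hom ≫ V.ι, isPullback_of_isOpenImmersion_of_isProper _ _ _ _ ?_⟩
  refine hom_ext_of_charts c hc fun k ↦ ?_
  rw [Category.assoc, ← Category.assoc, hF, ← Category.assoc, hd', h]

end Immersion

/-! ### The neighbourhood of the point at infinity of the cubics -/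

section ThirdChart

variable {R D G : Type} [CommRing R] [CommRing D] [CommRing G] {σ : R →+* D} {σ' : R →+* G}
  {y : Fin 2 → D} {z : Fin 2 → G} {a b : R}

lemma eval₂_cubicChart_two {E : Type} [CommRing E] (ρ : R →+* E) (z : Fin 2 → E) :
    MvPolynomial.eval₂ ρ z (cubicChart a b 2) = z 0 - ρ a * z 1 ^ 3 - ρ b * z 0 ^ 3 := by
  rw [eval₂_cubicChart, eval₂_cubicRel]
  simp [coneCoord]

lemma eval₂_chartRel_true {E : Type} [CommRing E] (ρ : R →+* E) (z : Fin 2 → E) :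
    MvPolynomial.eval₂ ρ z (chartRel a b (some true)) =
      z 1 ^ 2 - z 0 - ρ a ^ 2 * ρ b * z 0 ^ 4 := by
  simp [chartRel]

/-- The chart `w² = s + a² b s⁴` of the elliptic surface and the chart `w ≠ 0` of the plane cubic
share an open subscheme. -/
lemma exists_openImmersion_chart (hD : IsPresented σ y (chartRel a b (some true)))
    (hG : IsPresented σ' z (cubicChart a b 2)) (v : D) (hv : v = 1 + σ a ^ 2 * σ b * y 0 ^ 3) :
    ∃ φ : G →+* Localization.Away v, φ.comp σ' = (algebraMap D _).comp σ ∧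
      φ (z 0) * algebraMap D _ v = algebraMap D _ (σ a * y 0 * y 1) ∧
      φ (z 1) * algebraMap D _ v = algebraMap D _ (y 1) ∧
      IsOpenImmersion (Spec.map (CommRingCat.ofHom φ)) ∧
      ∀ P : Spec (.of G), 1 - σ' b * z 0 ^ 2 ∉ P.asIdeal →
        P ∈ Set.range (Spec.map (CommRingCat.ofHom φ)) := by
  set q : G := 1 - σ' b * z 0 ^ 2 with hq
  let α := algebraMap D (Localization.Away v)
  let u : Localization.Away v := IsLocalization.Away.invSelf v
  have hu : α v * u = 1 := IsLocalization.Away.mul_invSelf v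
  let β := algebraMap G (Localization.Away q)
  let t : Localization.Away q := IsLocalization.Away.invSelf q
  have ht : β q * t = 1 := IsLocalization.Away.mul_invSelf q
  have hαv : α v = 1 + α (σ a) ^ 2 * α (σ b) * α (y 0) ^ 3 :=
    (congrArg α hv).trans (by simp)
  have hβq : β q = 1 - β (σ' b) * β (z 0) ^ 2 :=
    (congrArg β hq).trans (by simp)
  have hy := hD.rel
  have hz := hG.rel
  rw [eval₂_chartRel_true] at hy
  rw [eval₂_cubicChart_two] at hz
  have hyα : α (y 1) ^ 2 = α (y 0) * α v := by
    have := congrArg α hy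
    simp only [map_sub, map_mul, map_pow, map_zero] at this
    rw [hαv]
    linear_combination this
  have hzβ : β (σ' a) * β (z 1) ^ 3 = β (z 0) * β q := by
    have := congrArg β hz
    simp only [map_sub, map_mul, map_pow, map_zero] at this
    rw [hβq]
    linear_combination -this
  -- With `v = 1 + a² b s³`, the affine coordinates `x / w` and `z / w` of the cubic are `a s w / v`
  -- and `w / v` in terms of `s` and the root `w` of the chart.
  obtain ⟨φ, hφ, hφz⟩ := hG.lift _ (α.comp σ) ![α (σ a * y 0 * y 1) * u, α (y 1) * u] (by
    rw [eval₂_cubicChart_two]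
    simp only [RingHom.comp_apply, Matrix.cons_val_zero, Matrix.cons_val_one, map_mul]
    have h1 := hu
    rw [hαv] at h1
    have h2 := hyα
    rw [hαv] at h2
    linear_combination (-α (σ a) * α (y 1) * u * u ^ 2 *
      (1 + α (σ a) ^ 2 * α (σ b) * α (y 0) ^ 3)) * h2 -
      (α (σ a) * α (y 1) * u * α (y 0)) *
        (u * (1 + α (σ a) ^ 2 * α (σ b) * α (y 0) ^ 3) + 1) * h1)
  -- Conversely `s` and the root are `z₁² / q` and `z₁ / q`. The denominators `v` and `q` correspond
  -- to inverses of each other.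
  obtain ⟨ψ, hψ, hψy⟩ := hD.lift _ (β.comp σ') ![β (z 1) ^ 2 * t, β (z 1) * t] (by
    rw [eval₂_chartRel_true]
    simp only [RingHom.comp_apply, Matrix.cons_val_zero, Matrix.cons_val_one]
    have h1 := ht
    rw [hβq] at h1
    have h2 := hzβ
    rw [hβq] at h2
    set Q := 1 - β (σ' b) * β (z 0) ^ 2 with hQ
    linear_combination (-β (z 1) ^ 2 * t ^ 4 * β (σ' b) *
      (β (σ' a) * β (z 1) ^ 3 + β (z 0) * Q)) * h2 +
      (β (z 1) ^ 2 * t * (-t * (Q * t + 1) + (Q * t) ^ 2 + Q * t + 1)) * h1 +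
      (-β (z 1) ^ 2 * t ^ 4 * Q ^ 2) * hQ)
  have hφ' r : φ (σ' r) = α (σ r) := RingHom.congr_fun hφ r
  have hψ' r : ψ (σ r) = β (σ' r) := RingHom.congr_fun hψ r
  have hφ0 : φ (z 0) = α (σ a) * α (y 0) * α (y 1) * u := by
    rw [hφz, Matrix.cons_val_zero, map_mul, map_mul]
  have hφ1 : φ (z 1) = α (y 1) * u := by rw [hφz, Matrix.cons_val_one]; rfl
  have hψ0 : ψ (y 0) = β (z 1) ^ 2 * t := by rw [hψy, Matrix.cons_val_zero]
  have hψ1 : ψ (y 1) = β (z 1) * t := by rw [hψy, Matrix.cons_val_one]; rfl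
  have hφq : φ q = u := by
    rw [hq]
    simp only [map_sub, map_one, map_mul, map_pow, hφ', hφ0]
    have h1 := hu
    set V := α v
    linear_combination (-α (σ b) * α (σ a) ^ 2 * α (y 0) ^ 2 * u ^ 2) * hyα +
      (V * u ^ 2) * hαv + (u - 1 - V * u) * h1
  have hψv : ψ v = t := by
    rw [hv]
    simp only [map_add, map_one, map_mul, map_pow, hψ', hψ0]
    have h1 := ht
    set Q := β q
    linear_combination (β (σ' b) * t ^ 3 * (β (σ' a) * β (z 1) ^ 3 + β (z 0) * Q)) * hzβ -
      (-Q ^ 2 * t ^ 3) * hβq + (t * (Q * t + 1) - ((Q * t) ^ 2 + Q * t + 1)) * h1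
  have huφ : IsUnit (φ q) := by
    rw [hφq]
    exact IsUnit.of_mul_eq_one _ ((mul_comm _ _).trans hu)
  have huψ : IsUnit (ψ v) := by
    rw [hψv]
    exact IsUnit.of_mul_eq_one _ ((mul_comm _ _).trans ht)
  let Φ : Localization.Away q →+* Localization.Away v := IsLocalization.Away.lift q huφ
  let Ψ : Localization.Away v →+* Localization.Away q := IsLocalization.Away.lift v huψ
  have hΦ x : Φ (β x) = φ x := IsLocalization.Away.lift_eq q huφ x
  have hΨ x : Ψ (α x) = ψ x := IsLocalization.Away.lift_eq v huψ x
  have hΦt : Φ t = α v := by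
    have h1 := congrArg Φ ht
    rw [map_mul, hΦ, hφq, map_one] at h1
    linear_combination α v * h1 - Φ t * hu
  have hΨu : Ψ u = β q := by
    have h1 := congrArg Ψ hu
    rw [map_mul, hΨ, hψv, map_one] at h1
    linear_combination β q * h1 - Ψ u * ht
  have h1 : Φ.comp Ψ = RingHom.id _ := by
    refine IsLocalization.ringHom_ext (.powers v) (hD.hom_ext (RingHom.ext fun r ↦ ?_) fun i ↦ ?_)
    · change Φ (Ψ (α (σ r))) = α (σ r)
      rw [hΨ, hψ', hΦ, hφ']
    · change Φ (Ψ (α (y i))) = α (y i)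
      rw [hΨ]
      fin_cases i
      · change Φ (ψ (y 0)) = α (y 0)
        rw [hψ0, map_mul, map_pow, hΦ, hΦt, hφ1]
        linear_combination (u ^ 2 * α v) * hyα + α (y 0) * (α v * u + 1) * hu
      · change Φ (ψ (y 1)) = α (y 1)
        rw [hψ1, map_mul, hΦ, hΦt, hφ1]
        linear_combination α (y 1) * hu
  have h2 : Ψ.comp Φ = RingHom.id _ := by
    refine IsLocalization.ringHom_ext (.powers q) (hG.hom_ext (RingHom.ext fun r ↦ ?_) fun i ↦ ?_)
    · change Ψ (Φ (β (σ' r))) = β (σ' r)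
      rw [hΦ, hφ', hΨ, hψ']
    · change Ψ (Φ (β (z i))) = β (z i)
      rw [hΦ]
      fin_cases i
      · change Ψ (φ (z 0)) = β (z 0)
        rw [hφ0, map_mul, map_mul, map_mul, hΨ, hΨ, hΨ, hΨu, hψ', hψ0, hψ1]
        linear_combination (t ^ 2 * β q) * hzβ + β (z 0) * (β q * t + 1) * ht
      · change Ψ (φ (z 1)) = β (z 1)
        rw [hφ1, map_mul, hΨ, hΨu, hψ1]
        linear_combination β (z 1) * ht
  have hbij : Function.Bijective Φ := by
    refine ⟨fun x x' hx ↦ ?_, fun x ↦ ⟨Ψ x, RingHom.congr_fun h1 x⟩⟩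
    have h3 := congrArg Ψ hx
    exact (RingHom.congr_fun h2 x).symm.trans (h3.trans (RingHom.congr_fun h2 x'))
  have hiso := isIso_specMap_of_bijective hbij
  have hcomp : Spec.map (CommRingCat.ofHom φ) =
      Spec.map (CommRingCat.ofHom Φ) ≫ Spec.map (CommRingCat.ofHom β) := by
    rw [← Spec.map_comp, ← CommRingCat.ofHom_comp]
    congr 2
    exact RingHom.ext fun x ↦ (hΦ x).symm
  refine ⟨φ, hφ, ?_, ?_, ?_, fun P hP ↦ ?_⟩
  · change φ (z 0) * α v = α (σ a * y 0 * y 1)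
    rw [hφ0, map_mul, map_mul]
    linear_combination (α (σ a) * α (y 0) * α (y 1)) * hu
  · change φ (z 1) * α v = α (y 1)
    rw [hφ1]
    linear_combination α (y 1) * hu
  · rw [hcomp]
    infer_instance
  · have h3 : P ∈ Set.range (Spec.map (CommRingCat.ofHom β)) :=
      (PrimeSpectrum.localization_away_comap_range (Localization.Away q) q).ge hP
    obtain ⟨P', rfl⟩ := h3
    refine ⟨(inv (Spec.map (CommRingCat.ofHom Φ))) P', ?_⟩
    rw [hcomp, ← Scheme.Hom.comp_apply, IsIso.inv_hom_id_assoc]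

end ThirdChart

/-! ### Identification of the surface with the family of cubics over a chart of the line -/

namespace IsCubicCone

variable {R A E : Type} [CommRing R] [CommRing A] [Algebra ℂ A] [CommRing E]
  {𝒜 : ℕ → Submodule ℂ A} [GradedAlgebra 𝒜] {ρ : R →+* A} {y : Fin 3 → A} {a b : R}

/-- Allows the coordinates of one generic point in different charts of the cubic to be compared by a
scale factor on the three generators. -/
lemma map_eq_of_scale (h : IsCubicCone 𝒜 ρ y a b) {θ θ' : A →+* E} {c : E}
    (hρ : θ'.comp ρ = θ.comp ρ) (hy : ∀ i, θ' (y i) = c * θ (y i)) {n : ℕ} {x : A}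
    (hx : x ∈ 𝒜 n) : θ' x = c ^ n * θ x := by
  have key : θ' = (Polynomial.eval₂RingHom θ c).comp (gradingHom 𝒜) := by
    refine h.presented.hom_ext (RingHom.ext fun r ↦ ?_) fun i ↦ ?_
    · rw [hρ, RingHom.comp_apply, RingHom.comp_apply, RingHom.comp_apply,
        gradingHom_of_mem 𝒜 (h.mem_zero r)]
      simp
    · rw [hy, RingHom.comp_apply, gradingHom_of_mem 𝒜 (h.mem_one i)]
      simp [mul_comm]
  rw [key, RingHom.comp_apply, gradingHom_of_mem 𝒜 hx]
  simp [mul_comm]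

end IsCubicCone

lemma lift_away_injective {D L : Type} [CommRing D] [Field L] {Δ : D →+* L}
    (h : Function.Injective Δ) (v : D) (hv : IsUnit (Δ v)) :
    Function.Injective (IsLocalization.Away.lift v hv : Localization.Away v →+* L) := by
  rw [injective_iff_map_eq_zero]
  intro z hz
  obtain ⟨n, x, hx⟩ := IsLocalization.Away.surj v z
  have h1 := congrArg (IsLocalization.Away.lift v hv : Localization.Away v →+* L) hx
  rw [map_mul, hz, zero_mul, IsLocalization.Away.lift_eq] at h1
  have h2 : x = 0 := h (by rw [map_zero, ← h1])
  rw [h2, map_zero] at hx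
  exact ((IsLocalization.Away.algebraMap_isUnit v).pow n).mul_left_eq_zero.mp hx

/-- A chart of both `X` and `Y`, compatible with morphisms to `P` and with a common generic point. -/
structure CommonChart {E X Y P : Scheme.{0}} (η : E ⟶ X) (η' : E ⟶ Y) (p : X ⟶ P) (π : Y ⟶ P) where
  U : Scheme.{0}
  c : U ⟶ X
  d : U ⟶ Y
  e : E ⟶ U
  isReduced : IsReduced U
  isOpenImmersion_c : IsOpenImmersion c
  isOpenImmersion_d : IsOpenImmersion d
  isDominant : IsDominant e
  comp_c : e ≫ c = η
  comp_d : e ≫ d = η'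
  comp_eq : d ≫ π = c ≫ p

attribute [instance] CommonChart.isReduced CommonChart.isOpenImmersion_c
  CommonChart.isOpenImmersion_d CommonChart.isDominant

variable {F₃ F₆ : MvPolynomial (Fin 2) ℂ} {h₃ : F₃.IsHomogeneous 3} {h₆ : F₆.IsHomogeneous 6}
  {hF : Squarefree (F₃ * F₆)}

namespace SurfaceAtlas

variable (𝔄 : SurfaceAtlas h₃ h₆ hF)

/-- A common chart of the elliptic surface and a plane cubic. -/
def commonChart {π : W h₃ h₆ ⟶ PP 1} (hπ : ∀ k, 𝔄.d k ≫ π = 𝔄.proj k)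
    {A : Type} [CommRing A] [Algebra ℂ A] {𝒜 : ℕ → Submodule ℂ A} [GradedAlgebra 𝒜]
    {ρ : Polynomial ℂ →+* A} {y : Fin 3 → A} (k : Fin 2 × Option Bool)
    (h : IsCubicCone 𝒜 ρ y (dehom k.1 F₃) (dehom k.1 F₆))
    {i₀ : Fin 3} {Θ : A →+* 𝔄.L} (hΘ : IsUnit (Θ (y i₀))) (hΘρ : Θ.comp ρ = 𝔄.τ k.1)
    {T G : Type} [CommRing T] [CommRing G] (δ : 𝔄.D k →+* T)
    (hδ : IsOpenImmersion (Spec.map (CommRingCat.ofHom δ))) (γ : G →+* T)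
    (hγ : IsOpenImmersion (Spec.map (CommRingCat.ofHom γ))) {i : Fin 3} {σ : Polynomial ℂ →+* G}
    {z : Fin 2 → G} (hG : IsPresented σ z (cubicChart (dehom k.1 F₃) (dehom k.1 F₆) i))
    (hσ : γ.comp σ = δ.comp (𝔄.σ k)) (Δ : T →+* 𝔄.L) (hΔ : Function.Injective Δ)
    (hΔδ : Δ.comp δ = 𝔄.Δ k) (s : 𝔄.L)
    (hs : ∀ j, Δ (γ (coneCoord i z j)) = s * Θ (y j)) :
    CommonChart (projPoint 𝒜 Θ (h.mem_one i₀) one_pos hΘ) 𝔄.η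
      (projToSpec 𝒜 ρ h.mem_zero ≫ lineChart k.1) π where
  U := Spec (.of T)
  c := Spec.map (CommRingCat.ofHom γ) ≫ h.chart hG
  d := Spec.map (CommRingCat.ofHom δ) ≫ 𝔄.d k
  e := Spec.map (CommRingCat.ofHom Δ)
  isReduced := by
    have := hΔ.isDomain
    infer_instance
  isOpenImmersion_c := by
    have := h.isOpenImmersion_chart hG
    infer_instance
  isOpenImmersion_d := inferInstance
  isDominant := isDominant_specMap hΔ
  comp_c := by
    have hu : IsUnit ((γ.comp (h.chartHom hG)) (y i)) := (h.isUnit_chartHom hG).map γ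
    have h1 : Spec.map (CommRingCat.ofHom γ) ≫ h.chart hG =
        projPoint 𝒜 (γ.comp (h.chartHom hG)) (h.mem_one i) one_pos hu :=
      specMap_projPoint _ _ _ _ _ _
    rw [h1]
    refine (specMap_projPoint _ _ _ _ _ _).trans (projPoint_congr 𝒜 s (fun n x hx ↦ ?_) _ _ _ _ _ _).symm
    refine h.map_eq_of_scale ?_ (fun j ↦ ?_) hx
    · rw [hΘρ, RingHom.comp_assoc, RingHom.comp_assoc, h.chartHom_comp, hσ, ← RingHom.comp_assoc,
        hΔδ, 𝔄.Δ_comp_σ]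
    · rw [← hs, ← h.chartHom_apply hG]
      rfl
  comp_d := by
    rw [← Category.assoc, ← Spec.map_comp, ← CommRingCat.ofHom_comp, hΔδ, 𝔄.Δ_comp]
  comp_eq := by
    rw [Category.assoc, hπ, proj, Category.assoc, ← Category.assoc (h.chart hG),
      h.chart_projToSpec, ← Category.assoc, ← Category.assoc, ← Spec.map_comp, ← Spec.map_comp,
      ← CommRingCat.ofHom_comp, ← CommRingCat.ofHom_comp, hσ]

/-- Three open sets of the cubic are charts of the surface: `x ≠ 0`, `z ≠ 0` and part of `w ≠ 0`.
They cover the cubic and share its generic point, so the cubic embeds openly. Properness over the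
chart of the line makes it the whole preimage. -/
theorem exists_isPullback {π : W h₃ h₆ ⟶ PP 1} (hπ : ∀ k, 𝔄.d k ≫ π = 𝔄.proj k)
    {A : Type} [CommRing A] [Algebra ℂ A] {𝒜 : ℕ → Submodule ℂ A} [GradedAlgebra 𝒜]
    {ρ : Polynomial ℂ →+* A} {y : Fin 3 → A} (i : Fin 2)
    (h : IsCubicCone 𝒜 ρ y (dehom i F₃) (dehom i F₆)) :
    ∃ m : Proj 𝒜 ⟶ W h₃ h₆, IsPullback m (projToSpec 𝒜 ρ h.mem_zero) π (lineChart i) := by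
  obtain ⟨z₀, hz₀, hz₀0, hz₀1⟩ := 𝔄.exists_isPresented (i, none)
  obtain ⟨z₁, hz₁, hz₁0, hz₁1⟩ := 𝔄.exists_isPresented (i, some false)
  obtain ⟨z₂, hz₂, hz₂0, hz₂1⟩ := 𝔄.exists_isPresented (i, some true)
  have hF₃ : dehom i F₃ ≠ 0 := left_ne_zero_of_mul (squarefree_dehom_mul h₃ h₆ hF i).ne_zero
  set 𝔽 := 𝔄.𝔓.frame h₃ h₆ i with h𝔽
  set κ := algebraMap 𝔄.K 𝔄.L with hκ
  have hx : κ 𝔽.x ≠ 0 := (map_ne_zero κ).mpr 𝔽.x_ne_zero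
  have hf : κ (𝔽.τ (dehom i F₃)) ≠ 0 := (map_ne_zero κ).mpr (𝔽.τ_ne_zero hF₃)
  have hτ (r) : κ (𝔽.τ r) = 𝔄.τ i r := rfl
  have hw : 𝔽.w ≠ 0 := fun h0 ↦ 𝔽.w_notMem (squarefree_dehom_mul h₃ h₆ hF i) 0 (by
    rw [map_zero, h0])
  have hw2 : 𝔽.w ^ 2 * κ 𝔽.x ^ 3 =
      κ (𝔽.τ (dehom i F₃)) + κ (𝔽.τ (dehom i F₆)) * κ 𝔽.x ^ 3 := by
    rw [𝔽.sq_eq, map_add, map_mul, map_pow, map_inv₀, ← hκ]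
    field_simp
  have e0 : 𝔄.Δ (i, none) (z₀ 0) = (κ 𝔽.x)⁻¹ := hz₀0.trans (map_inv₀ κ _)
  have e1 : 𝔄.Δ (i, none) (z₀ 1) = 𝔽.w := hz₀1
  have e2 : 𝔄.Δ (i, some false) (z₁ 0) = κ 𝔽.x := hz₁0
  have e3 : 𝔄.Δ (i, some false) (z₁ 1) = κ 𝔽.x * 𝔽.w := hz₁1
  have e4 : 𝔄.Δ (i, some true) (z₂ 0) = κ 𝔽.x / κ (𝔽.τ (dehom i F₃)) :=
    hz₂0.trans (map_div₀ κ _ _)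
  have e5 : 𝔄.Δ (i, some true) (z₂ 1) = κ 𝔽.x ^ 2 / κ (𝔽.τ (dehom i F₃)) * 𝔽.w :=
    hz₂1.trans (congrArg (· * 𝔽.w) (by rw [map_div₀, map_pow]))
  have hσ (r) : 𝔄.Δ (i, some true) (𝔄.σ (i, some true) r) = κ (𝔽.τ r) :=
    RingHom.congr_fun (𝔄.Δ_comp_σ (i, some true)) r
  have hz₀' : IsPresented (𝔄.σ (i, none)) z₀ (cubicChart (dehom i F₃) (dehom i F₆) 0) := hz₀
  have hz₁' : IsPresented (𝔄.σ (i, some false)) z₁ (cubicChart (dehom i F₃) (dehom i F₆) 1) := hz₁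
  let G := Hyp (cubicChart (dehom i F₃) (dehom i F₆) 2)
  have hG := isPresented_hyp (cubicChart (dehom i F₃) (dehom i F₆) 2)
  set z : Fin 2 → G := fun l ↦ Ideal.Quotient.mk _ (MvPolynomial.X l) with hz
  -- In the function field `v = (x³ / f₃) w²`, which is nonzero, so the localized chart still embeds
  -- there.
  let v := 1 + 𝔄.σ (i, some true) (dehom i F₃) ^ 2 * 𝔄.σ (i, some true) (dehom i F₆) * z₂ 0 ^ 3
  obtain ⟨φ, hφ, hφ0, hφ1, hφo, hφr⟩ := exists_openImmersion_chart hz₂ hG v rfl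
  have hv : 𝔄.Δ (i, some true) v = κ 𝔽.x ^ 3 / κ (𝔽.τ (dehom i F₃)) * 𝔽.w ^ 2 := by
    simp only [v, map_add, map_one, map_mul, map_pow, hσ, e4]
    field_simp
    linear_combination -hw2
  have hv0 : IsUnit (𝔄.Δ (i, some true) v) := by
    rw [hv, isUnit_iff_ne_zero]
    positivity
  let Λ : Localization.Away v →+* 𝔄.L := IsLocalization.Away.lift v hv0
  have hΛ (x) : Λ (algebraMap _ _ x) = 𝔄.Δ (i, some true) x := IsLocalization.Away.lift_eq v hv0 x
  have g1 : Λ (φ (z 1)) = (κ 𝔽.x * 𝔽.w)⁻¹ := by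
    have := congrArg Λ hφ1
    rw [map_mul, hΛ, hΛ, hv, e5] at this
    have h2 : κ 𝔽.x ^ 3 / κ (𝔽.τ (dehom i F₃)) * 𝔽.w ^ 2 ≠ 0 := by positivity
    refine mul_right_cancel₀ h2 (this.trans ?_)
    field_simp
  have g0 : Λ (φ (z 0)) = 𝔽.w⁻¹ := by
    have := congrArg Λ hφ0
    rw [map_mul, hΛ, hΛ, hv, map_mul, map_mul, hσ, e4, e5] at this
    have h2 : κ 𝔽.x ^ 3 / κ (𝔽.τ (dehom i F₃)) * 𝔽.w ^ 2 ≠ 0 := by positivity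
    refine mul_right_cancel₀ h2 (this.trans ?_)
    field_simp
  let Θ := (𝔄.Δ (i, none)).comp (h.chartHom hz₀')
  have hΘ : IsUnit (Θ (y 0)) := (h.isUnit_chartHom hz₀').map (𝔄.Δ (i, none))
  have hΘρ : Θ.comp ρ = 𝔄.τ i := by
    rw [RingHom.comp_assoc, h.chartHom_comp, 𝔄.Δ_comp_σ]
  have hΘy (j) : Θ (y j) = 𝔄.Δ (i, none) (coneCoord 0 z₀ j) :=
    congrArg (𝔄.Δ (i, none)) (h.chartHom_apply hz₀' j)
  have hid (D : Type) [CommRing D] : IsOpenImmersion (Spec.map (CommRingCat.ofHom (RingHom.id D))) := by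
    rw [CommRingCat.ofHom_id, Spec.map_id]
    infer_instance
  -- The generic point is normalized by first coordinate `1`. The three charts then differ from it
  -- by the scale factors `1`, `x` and `1 / w`.
  let P₀ := 𝔄.commonChart hπ (i, none) h hΘ hΘρ (RingHom.id _) (hid _) (RingHom.id _) (hid _)
    hz₀' rfl (𝔄.Δ (i, none)) (𝔄.Δ_injective _) rfl 1 fun j ↦ by
      rw [one_mul, hΘy]
      rfl
  let P₁ := 𝔄.commonChart hπ (i, some false) h hΘ hΘρ (RingHom.id _) (hid _) (RingHom.id _) (hid _)
    hz₁' rfl (𝔄.Δ (i, some false)) (𝔄.Δ_injective _) rfl (κ 𝔽.x) fun j ↦ by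
      rw [hΘy, RingHom.id_apply]
      fin_cases j <;> simp [coneCoord, e0, e1, e2, e3, hx]
  let P₂ := 𝔄.commonChart hπ (i, some true) h hΘ hΘρ (algebraMap _ (Localization.Away v))
    inferInstance φ hφo hG hφ Λ (lift_away_injective (𝔄.Δ_injective _) v hv0)
    (RingHom.ext hΛ) (𝔽.w⁻¹) fun j ↦ by
      rw [hΘy]
      fin_cases j <;> simp [coneCoord, e0, e1, g0, g1, hw, mul_comm]
  have hr₀ (x) (hx : x ∈ Proj.basicOpen 𝒜 (y 0)) : x ∈ Set.range P₀.c := by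
    obtain ⟨w, rfl⟩ := (h.range_chart hz₀').ge hx
    refine ⟨w, ?_⟩
    change (Spec.map (CommRingCat.ofHom (RingHom.id _)) ≫ h.chart hz₀') w = _
    rw [CommRingCat.ofHom_id, Spec.map_id, Category.id_comp]
  have hr₁ (x) (hx : x ∈ Proj.basicOpen 𝒜 (y 1)) : x ∈ Set.range P₁.c := by
    obtain ⟨w, rfl⟩ := (h.range_chart hz₁').ge hx
    refine ⟨w, ?_⟩
    change (Spec.map (CommRingCat.ofHom (RingHom.id _)) ≫ h.chart hz₁') w = _
    rw [CommRingCat.ofHom_id, Spec.map_id, Category.id_comp]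
  have hcov (x : Proj 𝒜) : ∃ k, x ∈ Set.range ((![P₀, P₁, P₂] k).c) := by
    by_cases h0 : x ∈ Proj.basicOpen 𝒜 (y 0)
    · exact ⟨0, hr₀ x h0⟩
    by_cases h1 : x ∈ Proj.basicOpen 𝒜 (y 1)
    · exact ⟨1, hr₁ x h1⟩
    obtain ⟨j, hj⟩ := h.exists_mem_basicOpen x
    have hj2 : j = 2 := by
      fin_cases j
      · exact absurd hj h0
      · exact absurd hj h1
      · rfl
    subst hj2
    obtain ⟨w, rfl⟩ := (h.range_chart hG).ge hj
    -- A point outside the first two charts has `x = 0`, so `1 - b x²` is nonzero there and the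
    -- point lies in the shared open set.
    have h2 : z 0 ∈ w.asIdeal := by
      by_contra h3
      refine h0 ?_
      have h4 := projPoint_preimage_basicOpen 𝒜 (h.chartHom hG) (h.mem_one 2) one_pos
        (h.isUnit_chartHom hG) (h.mem_one 0) one_pos
      have h5 : w ∈ PrimeSpectrum.basicOpen (h.chartHom hG (y 0)) := by
        rw [h.chartHom_apply hG]
        exact h3
      rw [← h4] at h5
      exact h5
    obtain ⟨w', rfl⟩ := hφr w fun h3 ↦ by
      refine w.2.ne_top ((Ideal.eq_top_iff_one _).mpr ?_)
      have h4 := add_mem h3 (w.asIdeal.mul_mem_left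
        (algebraMap (Polynomial ℂ) G (dehom i F₆) * z 0) h2)
      convert h4 using 1
      ring
    exact ⟨2, w', rfl⟩
  obtain ⟨-, hW, hWR, -⟩ := exists_surfaceAtlas h₃ h₆ hF
  have := isProper_toSpecC hWR
  have : (W h₃ h₆).IsSeparated := ⟨by
    rw [← terminal.comp_from (W.toSpecC h₃ h₆)]
    infer_instance⟩
  have hsep : IsSeparated (π ≫ projToSpecC (coordGrading 1)) := by
    rw [𝔄.comp_toSpecC hπ]
    infer_instance
  have : IsSeparated π := IsSeparated.of_comp π (projToSpecC (coordGrading 1))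
  have := h.isProper
  exact exists_isPullback_of_charts (fun k ↦ (![P₀, P₁, P₂] k).c) hcov
    (fun k ↦ (![P₀, P₁, P₂] k).d) (fun k ↦ (![P₀, P₁, P₂] k).e) _
    (fun k ↦ (![P₀, P₁, P₂] k).comp_c) _ (fun k ↦ (![P₀, P₁, P₂] k).comp_d)
    (projToSpec 𝒜 ρ h.mem_zero) π (lineChart i) fun k ↦ (![P₀, P₁, P₂] k).comp_eq

end SurfaceAtlas

/-! ### Singular fibers detected by arcs that do not lift -/

section FormallySmooth

variable {K : Type} [Field K] {ι : Type}

/-- Formal points of a formally smooth hypersurface lift to the next order. -/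
lemma exists_lift_of_formallySmooth (G : MvPolynomial ι K) [Algebra.FormallySmooth K (Hyp G)]
    (n : ℕ) (hn : 1 ≤ n) (Y : ι → Polynomial K)
    (hY : Polynomial.X ^ n ∣ MvPolynomial.eval₂ Polynomial.C Y G) :
    ∃ Y' : ι → Polynomial K, (∀ i, Polynomial.X ^ n ∣ Y' i - Y i) ∧
      Polynomial.X ^ (n + 1) ∣ MvPolynomial.eval₂ Polynomial.C Y' G := by
  let J : Ideal (Polynomial K) := Ideal.span {Polynomial.X ^ (n + 1)}
  let μ : Polynomial K →ₐ[K] Polynomial K ⧸ J := Ideal.Quotient.mkₐ K J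
  let I : Ideal (Polynomial K ⧸ J) := (Ideal.span {Polynomial.X ^ n}).map μ
  have hI : IsNilpotent I := by
    refine ⟨2, ?_⟩
    rw [← Ideal.map_pow, Ideal.span_singleton_pow, Ideal.zero_eq_bot, Ideal.map_eq_bot_iff_le_ker,
      Ideal.span_singleton_le_iff_mem]
    -- The square of the ideal of `X ^ n` vanishes modulo `X ^ (n + 1)` because `2 n ≥ n + 1`, which
    -- is where `1 ≤ n` enters.
    refine Ideal.Quotient.eq_zero_iff_mem.mpr (Ideal.mem_span_singleton.mpr ?_)
    rw [← pow_mul]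
    exact pow_dvd_pow _ (by omega)
  have hev (Z : ι → Polynomial K) (p : MvPolynomial ι K) : μ (MvPolynomial.eval₂ Polynomial.C Z p) =
      MvPolynomial.aeval (fun i ↦ μ (Z i)) p := by
    exact MvPolynomial.eval₂_comp_left μ.toRingHom Polynomial.C Z p
  let ν : (Polynomial K ⧸ J) →ₐ[K] (Polynomial K ⧸ J) ⧸ I := Ideal.Quotient.mkₐ K I
  have h0 : ∀ a ∈ Ideal.span (Set.range fun _ : Unit ↦ G),
      MvPolynomial.aeval (fun i ↦ ν (μ (Y i))) a = 0 := by
    intro a ha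
    have : Ideal.span (Set.range fun _ : Unit ↦ G) ≤
        RingHom.ker (MvPolynomial.aeval (R := K) fun i ↦ ν (μ (Y i))) := by
      rw [Ideal.span_le]
      rintro _ ⟨-, rfl⟩
      have h1 : MvPolynomial.aeval (fun i ↦ ν (μ (Y i))) G =
          ν (μ (MvPolynomial.eval₂ Polynomial.C Y G)) := by
        rw [hev]
        exact (MvPolynomial.map_aeval _ _ _).symm
      refine h1.trans (Ideal.Quotient.eq_zero_iff_mem.mpr (Ideal.mem_map_of_mem _ ?_))
      exact Ideal.mem_span_singleton.mpr hY
    exact this ha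
  let g : Hyp G →ₐ[K] (Polynomial K ⧸ J) ⧸ I := Ideal.Quotient.liftₐ _
    (MvPolynomial.aeval fun i ↦ ν (μ (Y i))) h0
  obtain ⟨f, hf⟩ := Algebra.FormallySmooth.exists_lift I hI g
  have hs := Ideal.Quotient.mkₐ_surjective K J
  choose Y' hY' using fun i ↦ hs (f (Ideal.Quotient.mk _ (MvPolynomial.X i)))
  refine ⟨Y', fun i ↦ ?_, ?_⟩
  · have h1 := DFunLike.congr_fun hf (Ideal.Quotient.mk _ (MvPolynomial.X i))
    have h2 : ν (f (Ideal.Quotient.mk _ (MvPolynomial.X i))) = ν (μ (Y i)) := by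
      refine h1.trans ((Ideal.Quotient.lift_mk _ _ h0).trans ?_)
      exact MvPolynomial.aeval_X _ _
    rw [← hY'] at h2
    have h3 : μ (Y' i - Y i) ∈ I := by
      rw [map_sub]
      exact Ideal.Quotient.eq.mp h2
    have h4 : Y' i - Y i ∈ I.comap μ := h3
    rw [Ideal.comap_map_of_surjective μ hs] at h4
    have h5 : (Ideal.span {Polynomial.X ^ n} : Ideal (Polynomial K)) ⊔ Ideal.comap μ ⊥ ≤
        Ideal.span {Polynomial.X ^ n} := by
      refine sup_le le_rfl fun p hp ↦ ?_
      have h6 : p ∈ J := Ideal.Quotient.eq_zero_iff_mem.mp hp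
      exact Ideal.mem_span_singleton.mpr
        ((pow_dvd_pow _ (Nat.le_succ n)).trans (Ideal.mem_span_singleton.mp h6))
    exact Ideal.mem_span_singleton.mp (h5 h4)
  · refine Ideal.mem_span_singleton.mp (Ideal.Quotient.eq_zero_iff_mem.mp ?_)
    refine (hev Y' G).trans ?_
    have h1 : (MvPolynomial.aeval fun i ↦ μ (Y' i)) =
        f.comp (Ideal.Quotient.mkₐ K (Ideal.span (Set.range fun _ : Unit ↦ G))) := by
      refine MvPolynomial.algHom_ext fun i ↦ ?_
      rw [MvPolynomial.aeval_X]
      exact hY' i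
    rw [h1]
    exact (congrArg f hyp_mk_eq_zero).trans (map_zero f)

/-- On `w² = α z³` the arc `(0, X)` solves the equation modulo `X²`, but for every correction of
order two the coefficient of `X²` stays `1`. -/
lemma not_formallySmooth_cubicChart_zero (α : K) :
    ¬ Algebra.FormallySmooth K (Hyp (cubicChart α 0 0)) := by
  intro h
  obtain ⟨Y, hY, hY'⟩ := exists_lift_of_formallySmooth (cubicChart α 0 0) 2 one_le_two
    ![0, Polynomial.X] (by simp [cubicChart, chartRel])
  obtain ⟨u, hu⟩ := hY 0
  obtain ⟨v, hv⟩ := hY 1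
  obtain ⟨r, hr⟩ := hY'
  simp only [Matrix.cons_val_zero, Matrix.cons_val_one, sub_zero] at hu hv
  rw [sub_eq_iff_eq_add] at hv
  rw [eval₂_cubicChart, eval₂_cubicRel] at hr
  simp only [coneCoord, Matrix.cons_val_zero, Matrix.cons_val_one, Matrix.cons_val, hu, hv,
    map_zero] at hr
  have h1 : (1 + Polynomial.X * v) ^ 2 - Polynomial.C α * Polynomial.X ^ 4 * u ^ 3 =
      Polynomial.X * r := by
    refine mul_left_cancel₀ (pow_ne_zero 2 (Polynomial.X_ne_zero (R := K))) ?_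
    linear_combination hr
  simpa using congrArg (Polynomial.eval 0) h1

/-- On `x w² = β x³` the arc `(X, 0)` solves the equation modulo `X³`, but for every correction of
order three the coefficient of `X³` stays `-β`. -/
lemma not_formallySmooth_cubicChart_one {β : K} (hβ : β ≠ 0) :
    ¬ Algebra.FormallySmooth K (Hyp (cubicChart 0 β 1)) := by
  intro h
  obtain ⟨Y, hY, hY'⟩ := exists_lift_of_formallySmooth (cubicChart 0 β 1) 3 (by norm_num)
    ![Polynomial.X, 0] (by simp [cubicChart, chartRel])
  obtain ⟨u, hu⟩ := hY 0
  obtain ⟨v, hv⟩ := hY 1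
  obtain ⟨r, hr⟩ := hY'
  simp only [Matrix.cons_val_zero, Matrix.cons_val_one, sub_zero] at hu hv
  rw [sub_eq_iff_eq_add] at hu
  rw [eval₂_cubicChart, eval₂_cubicRel] at hr
  simp only [coneCoord, Matrix.cons_val_zero, Matrix.cons_val_one, Matrix.cons_val, hu, hv,
    map_zero] at hr
  have h1 : (Polynomial.X + Polynomial.X ^ 3 * u) * Polynomial.X ^ 3 * v ^ 2 -
      Polynomial.C β * (1 + Polynomial.X ^ 2 * u) ^ 3 = Polynomial.X * r := by
    refine mul_left_cancel₀ (pow_ne_zero 3 (Polynomial.X_ne_zero (R := K))) ?_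
    linear_combination hr
  exact hβ (by simpa using congrArg (Polynomial.eval 0) h1)

end FormallySmooth

/-! ### Smooth plane cubics -/

section Smooth

variable {K : Type} [Field K]

open MvPolynomial in
lemma exists_pderiv_cubicChart_ne_zero {α β : K} (h2 : (2 : K) ≠ 0) (h3 : (3 : K) ≠ 0) (hα : α ≠ 0)
    (hβ : β ≠ 0) (i : Fin 3) {k : Type} [Field k] (χ : MvPolynomial (Fin 2) K →+* k)
    (hχ : χ (cubicChart α β i) = 0) : ∃ j, χ (pderiv j (cubicChart α β i)) ≠ 0 := by
  have hα' : χ (C α) ≠ 0 := (map_ne_zero (χ.comp C)).mpr hα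
  have hβ' : χ (C β) ≠ 0 := (map_ne_zero (χ.comp C)).mpr hβ
  have h2' : (2 : k) ≠ 0 := by
    have := (map_ne_zero (χ.comp C)).mpr h2
    rwa [map_ofNat] at this
  have h3' : (3 : k) ≠ 0 := by
    have := (map_ne_zero (χ.comp C)).mpr h3
    rwa [map_ofNat] at this
  by_contra! h
  fin_cases i
  · obtain h1 | h1 := singular_point_chartRel h2' h3' none hχ h
    · exact hβ' h1.2.1
    · exact absurd h1.1 (by simp)
  · obtain h1 | h1 := singular_point_chartRel h2' h3' (some false) hχ h
    · exact absurd h1.1 (by simp)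
    · exact hα' h1.2.1
  -- In the chart `w = 1` the derivative in `z` forces `z = 0`. The equation and the derivative in
  -- `x` then give `2 x = 0`, at which point the latter equals `1`.
  · have e1 : (pderiv 0 (X 1 : MvPolynomial (Fin 2) K)) = 0 := pderiv_X_of_ne one_ne_zero
    have e2 : (pderiv 1 (X 0 : MvPolynomial (Fin 2) K)) = 0 := pderiv_X_of_ne zero_ne_one
    replace hχ : χ (X 0 - C α * X 1 ^ 3 - C β * X 0 ^ 3) = 0 := hχ
    have d0 : χ (pderiv 0 (X 0 - C α * X 1 ^ 3 - C β * X 0 ^ 3)) = 0 := h 0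
    have d1 : χ (pderiv 1 (X 0 - C α * X 1 ^ 3 - C β * X 0 ^ 3)) = 0 := h 1
    simp only [map_sub, map_mul, map_pow, pderiv_mul, pderiv_pow,
      pderiv_C, pderiv_X_self, e1, e2, map_natCast, map_zero, map_one, map_add] at d0 d1 hχ
    push_cast at d0 d1
    have h1 : χ (X 1) = 0 := by
      have : 3 * χ (C α) * χ (X 1) ^ 2 = 0 := by linear_combination -d1
      simpa [h3', hα'] using this
    rw [h1] at hχ
    have h4 : χ (X 0) * 2 = 0 := by linear_combination 3 * hχ - χ (X 0) * d0
    have h5 : χ (X 0) = 0 := by simpa [h2'] using h4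
    rw [h5] at d0
    simp at d0

lemma smooth_cubicChart {α β : K} (h2 : (2 : K) ≠ 0) (h3 : (3 : K) ≠ 0) (hα : α ≠ 0) (hβ : β ≠ 0)
    (i : Fin 3) :
    SmoothOfRelativeDimension 1
      (Spec.map (CommRingCat.ofHom (algebraMap K (Hyp (cubicChart α β i))))) :=
  smoothOfRelativeDimension_of_pderiv _ fun _ _ χ hχ ↦
    exists_pderiv_cubicChart_ne_zero h2 h3 hα hβ i χ hχ

end Smooth

/-! ### Smoothness of the fibers of a family of cubics -/

namespace IsCubicCone

variable {R S A : Type} [CommRing R] [CommRing S] [CommRing A] [Algebra ℂ A]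
  {𝒜 : ℕ → Submodule ℂ A} [GradedAlgebra 𝒜] {ρ : R →+* A} {y : Fin 3 → A} {a b : R} {Z : Scheme.{0}}

lemma exists_charts_of_isPullback (h : IsCubicCone 𝒜 ρ y a b) (χ : R →+* S) {f : Z ⟶ Proj 𝒜}
    {q : Z ⟶ Spec (.of S)}
    (hZ : IsPullback f q (projToSpec 𝒜 ρ h.mem_zero) (Spec.map (CommRingCat.ofHom χ))) :
    ∃ d : ∀ j, Spec (.of (Hyp (cubicChart (χ a) (χ b) j))) ⟶ Z, (∀ j, IsOpenImmersion (d j)) ∧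
      (∀ x, ∃ j, x ∈ Set.range (d j)) ∧
      ∀ j, d j ≫ q = Spec.map (CommRingCat.ofHom (algebraMap S _)) := by
  have key (j : Fin 3) : ∃ d : Spec (.of (Hyp (cubicChart (χ a) (χ b) j))) ⟶ Z,
      IsOpenImmersion d ∧ (∀ x, f x ∈ Proj.basicOpen 𝒜 (y j) → x ∈ Set.range d) ∧
      d ≫ q = Spec.map (CommRingCat.ofHom (algebraMap S _)) := by
    have hp : IsPresented (algebraMap S (Hyp (cubicChart (χ a) (χ b) j)))
        (fun l ↦ Ideal.Quotient.mk _ (MvPolynomial.X l))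
        (MvPolynomial.map χ (cubicChart a b j)) := by
      rw [map_cubicChart]
      exact isPresented_hyp _
    obtain ⟨g, hg, hgy⟩ := (isPresented_hyp (cubicChart a b j)).lift _
      ((algebraMap S (Hyp (cubicChart (χ a) (χ b) j))).comp χ)
      (fun l ↦ Ideal.Quotient.mk _ (MvPolynomial.X l)) (by
        rw [← hp.rel, MvPolynomial.eval₂_map])
    have sq : IsPullback (Spec.map (CommRingCat.ofHom g))
        (Spec.map (CommRingCat.ofHom (algebraMap S (Hyp (cubicChart (χ a) (χ b) j)))))
        (Spec.map (CommRingCat.ofHom (algebraMap R (Hyp (cubicChart a b j)))))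
        (Spec.map (CommRingCat.ofHom χ)) :=
      isPullback_SpecMap_of_isPushout _ _ _ _
        ((isPresented_hyp (cubicChart a b j)).isPushout hp hg hgy)
    rw [← h.chart_projToSpec (isPresented_hyp (cubicChart a b j))] at sq
    let c := h.chart (isPresented_hyp (cubicChart a b j))
    have hc : IsOpenImmersion c := h.isOpenImmersion_chart _
    let d := hZ.lift (Spec.map (CommRingCat.ofHom g) ≫ c) (Spec.map (CommRingCat.ofHom
      (algebraMap S (Hyp (cubicChart (χ a) (χ b) j))))) (by rw [Category.assoc, sq.w])
    have hd : d ≫ f = Spec.map (CommRingCat.ofHom g) ≫ c := hZ.lift_fst _ _ _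
    have hd' : d ≫ q = _ := hZ.lift_snd _ _ _
    have sq' : IsPullback d (Spec.map (CommRingCat.ofHom g)) f c :=
      IsPullback.of_right (by rw [hd']; exact sq.flip) hd hZ.flip
    refine ⟨d, MorphismProperty.of_isPullback (P := @IsOpenImmersion) sq'.flip hc, fun x hx ↦ ?_,
      hd'⟩
    rw [← SetLike.mem_coe, ← h.range_chart (isPresented_hyp (cubicChart a b j))] at hx
    exact exists_mem_range_of_isPullback (U := fun _ : Unit ↦ Spec (.of (Hyp (cubicChart a b j))))
      (i := ()) sq' hx
  choose d h1 h2 h3 using key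
  refine ⟨d, h1, fun x ↦ ?_, h3⟩
  obtain ⟨j, hj⟩ := h.exists_mem_basicOpen (f x)
  exact ⟨j, h2 j x hj⟩

/-- The fiber is covered by the charts of the cubic with coefficients `χ a`, `χ b`. For nonzero
coefficients the Jacobian criterion applies. Otherwise an arc through the cusp or the triple point
obstructs smoothness. -/
lemma smooth_iff {K : Type} [Field K] (h : IsCubicCone 𝒜 ρ y a b) (χ : R →+* K) {f : Z ⟶ Proj 𝒜}
    {q : Z ⟶ Spec (.of K)}
    (hZ : IsPullback f q (projToSpec 𝒜 ρ h.mem_zero) (Spec.map (CommRingCat.ofHom χ)))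
    (h2 : (2 : K) ≠ 0) (h3 : (3 : K) ≠ 0) : Smooth q ↔ χ a ≠ 0 ∧ χ b ≠ 0 := by
  obtain ⟨d, hd, hcov, hq⟩ := h.exists_charts_of_isPullback χ hZ
  let P : MorphismProperty Scheme.{0} := @Smooth
  have hP : IsZariskiLocalAtSource P :=
    HasRingHomProperty.instIsZariskiLocalAtSource (P := @Smooth)
  constructor
  · intro hs
    have key (j) : Algebra.FormallySmooth K (Hyp (cubicChart (χ a) (χ b) j)) := by
      have h4 : Smooth (d j ≫ q) := inferInstance
      rw [hq, HasRingHomProperty.Spec_iff (P := @Smooth)] at h4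
      exact (RingHom.smooth_algebraMap.mp h4).formallySmooth
    have hb : χ b ≠ 0 := by
      intro hb
      have := key 0
      rw [hb] at this
      exact not_formallySmooth_cubicChart_zero _ this
    refine ⟨fun ha ↦ ?_, hb⟩
    have := key 1
    rw [ha] at this
    exact not_formallySmooth_cubicChart_one hb this
  · rintro ⟨ha, hb⟩
    refine of_charts P d hcov q fun j ↦ ?_
    rw [hq]
    have := smooth_cubicChart h2 h3 ha hb j
    exact SmoothOfRelativeDimension.smooth 1 _

end IsCubicCone

/-! ### Field-valued points of the line -/

lemma preimage_zeroSet_lineChart (i : Fin 2) {g : MvPolynomial (Fin 2) ℂ} {e : ℕ}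
    (hg : g.IsHomogeneous e) (he : 0 < e) :
    lineChart i ⁻¹' (zeroSet g : Set (PP 1)) = PrimeSpectrum.zeroLocus {dehom i g} :=
  projPoint_preimage_zeroSet _ _ _ _ hg he

section Field

variable {K : Type} [Field K]

/-- The spectrum of a field has one point, so the morphism factors through any chart containing its
image. -/
lemma exists_comp_lineChart_eq (α : Spec (.of K) ⟶ PP 1) :
    ∃ (i : Fin 2) (χ : Polynomial ℂ →+* K), α = Spec.map (CommRingCat.ofHom χ) ≫ lineChart i := by
  obtain ⟨i, hi⟩ := SurfaceAtlas.exists_mem_range_lineChart (α (Classical.arbitrary _))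
  have hr : Set.range α ⊆ Set.range (lineChart i) := by
    rintro _ ⟨z, rfl⟩
    rwa [Subsingleton.elim (α := PrimeSpectrum K) z (Classical.arbitrary _)]
  obtain ⟨φ, hφ⟩ := Spec.map_surjective (IsOpenImmersion.lift (lineChart i) α hr)
  refine ⟨i, φ.hom, ?_⟩
  rw [CommRingCat.ofHom_hom, hφ, IsOpenImmersion.lift_fac]

lemma forall_mem_zeroSet_iff (i : Fin 2) (χ : Polynomial ℂ →+* K) {g : MvPolynomial (Fin 2) ℂ}
    {e : ℕ} (hg : g.IsHomogeneous e) (he : 0 < e) :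
    (∀ z, (Spec.map (CommRingCat.ofHom χ) ≫ lineChart i) z ∈ zeroSet g) ↔ χ (dehom i g) = 0 := by
  have key (z : Spec (.of K)) : (Spec.map (CommRingCat.ofHom χ) ≫ lineChart i) z ∈ zeroSet g ↔
      χ (dehom i g) = 0 := by
    rw [Scheme.Hom.comp_apply]
    refine (Set.ext_iff.mp (preimage_zeroSet_lineChart i hg he) _).trans ?_
    refine Set.singleton_subset_iff.trans ?_
    change χ (dehom i g) ∈ z.asIdeal ↔ _
    rw [(Ideal.eq_bot_or_top z.asIdeal).resolve_right z.2.ne_top, Ideal.mem_bot]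
  exact ⟨fun h ↦ (key (Classical.arbitrary _)).mp (h _), fun h z ↦ (key z).mpr h⟩

lemma ofNat_ne_zero_of_ringHom (χ : Polynomial ℂ →+* K) (n : ℕ) [n.AtLeastTwo] :
    (OfNat.ofNat n : K) ≠ 0 := by
  have := (map_ne_zero (χ.comp Polynomial.C)).mpr (OfNat.ofNat_ne_zero (R := ℂ) n)
  rwa [map_ofNat] at this

end Field

/-! ### The fibers of `π_F` and the discriminant -/

variable {F₃ F₆ : MvPolynomial (Fin 2) ℂ} {h₃ : F₃.IsHomogeneous 3} {h₆ : F₆.IsHomogeneous 6}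
  {hF : Squarefree (F₃ * F₆)}

namespace SurfaceAtlas

/-- Stated over an arbitrary field so that it covers both `ℂ`-points and the residue fields of all
points, including the generic one. -/
lemma smooth_fiber_iff (𝔄 : SurfaceAtlas h₃ h₆ hF) {π : W h₃ h₆ ⟶ PP 1}
    (hπ : ∀ k, 𝔄.d k ≫ π = 𝔄.proj k) {K : Type} [Field K] (i : Fin 2) (χ : Polynomial ℂ →+* K)
    {α : Spec (.of K) ⟶ PP 1} (hα : α = Spec.map (CommRingCat.ofHom χ) ≫ lineChart i) :
    Smooth (pullback.snd π α) ↔ χ (dehom i F₃) ≠ 0 ∧ χ (dehom i F₆) ≠ 0 := by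
  subst hα
  obtain ⟨A, _, _, 𝒜, _, ρ, y, h⟩ := exists_isCubicCone (dehom i F₃) (dehom i F₆)
  obtain ⟨m, hm⟩ := 𝔄.exists_isPullback hπ i h
  let α := Spec.map (CommRingCat.ofHom χ) ≫ lineChart i
  let f := hm.lift (pullback.fst π α) (pullback.snd π α ≫ Spec.map (CommRingCat.ofHom χ)) (by
    rw [Category.assoc]
    exact pullback.condition)
  have hf : f ≫ m = pullback.fst π α := hm.lift_fst _ _ _
  have hZ : IsPullback f (pullback.snd π α) (projToSpec 𝒜 ρ h.mem_zero)
      (Spec.map (CommRingCat.ofHom χ)) :=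
    IsPullback.of_right (by rw [hf]; exact .of_hasPullback _ _) (hm.lift_snd _ _ _) hm
  exact h.smooth_iff χ hZ (ofNat_ne_zero_of_ringHom χ 2) (ofNat_ne_zero_of_ringHom χ 3)

/-- Pasting the base change square of cones with the square identifying the surface over a chart
exhibits the fiber as `Proj` of any cone with the specialized coefficients. -/
lemma isoOver_fiberAt (𝔄 : SurfaceAtlas h₃ h₆ hF) {π : W h₃ h₆ ⟶ PP 1}
    (hπ : ∀ k, 𝔄.d k ≫ π = 𝔄.proj k) (a : CPoint) (i : Fin 2) (χ : Polynomial ℂ →+* ℂ)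
    (ha : a.1 = Spec.map (CommRingCat.ofHom χ) ≫ lineChart i) {B : Type} [CommRing B] [Algebra ℂ B]
    {ℬ : ℕ → Submodule ℂ B} [GradedAlgebra ℬ] {y' : Fin 3 → B}
    (h' : IsCubicCone ℬ (algebraMap ℂ B) y' (χ (dehom i F₃)) (χ (dehom i F₆))) :
    IsoOver (fiberAt π a) (projToSpecC ℬ) := by
  obtain ⟨A, _, _, 𝒜, _, ρ, y, h⟩ := exists_isCubicCone (dehom i F₃) (dehom i F₆)
  obtain ⟨m, hm⟩ := 𝔄.exists_isPullback hπ i h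
  obtain ⟨n, hn⟩ := h.exists_isPullback h'
  have := hn.paste_horiz hm
  rw [← ha] at this
  exact ⟨this.isoPullback.symm, this.isoPullback_inv_snd⟩

/-- The residue field point has a single image, so vanishing of the dehomogenized product under `χ`
is membership in the zero set. -/
lemma discriminant_eq (𝔄 : SurfaceAtlas h₃ h₆ hF) {π : W h₃ h₆ ⟶ PP 1}
    (hπ : ∀ k, 𝔄.d k ≫ π = 𝔄.proj k) : discriminant π = zeroSet (F₃ * F₆) := by
  ext x
  obtain ⟨i, χ, hχ⟩ := exists_comp_lineChart_eq (K := (PP 1).residueField x)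
    ((PP 1).fromSpecResidueField x)
  have h1 : Smooth (π.fiberToSpecResidueField x) ↔ χ (dehom i F₃) ≠ 0 ∧ χ (dehom i F₆) ≠ 0 :=
    𝔄.smooth_fiber_iff hπ i χ hχ
  have h2 := forall_mem_zeroSet_iff i χ (h₃.mul h₆) (by norm_num)
  rw [← hχ, map_mul, map_mul, mul_eq_zero] at h2
  have h4 : (∀ z, (PP 1).fromSpecResidueField x z ∈ zeroSet (F₃ * F₆)) ↔
      x ∈ zeroSet (F₃ * F₆) := by
    have h5 := (PP 1).range_fromSpecResidueField x
    constructor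
    · intro h
      obtain ⟨z, hz⟩ := h5.ge (Set.mem_singleton x)
      exact hz ▸ h z
    · intro h z
      rwa [Set.mem_singleton_iff.mp (h5.le ⟨z, rfl⟩)]
  have h6 : x ∈ zeroSet (F₃ * F₆) ↔ χ (dehom i F₃) = 0 ∨ χ (dehom i F₆) = 0 := h4.symm.trans h2
  change ¬ Smooth (π.fiberToSpecResidueField x) ↔ x ∈ zeroSet (F₃ * F₆)
  rw [h1, h6]
  tauto

end SurfaceAtlas

lemma not_both_eq_zero {f g : Polynomial ℂ} (h : Squarefree (f * g)) {K : Type} [Field K]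
    (χ : Polynomial ℂ →+* K) (hf : χ f = 0) (hg : χ g = 0) : False := by
  obtain ⟨u, v, huv⟩ := (squarefree_mul_iff.mp h).1.isCoprime
  simpa [hf, hg] using congrArg χ huv

lemma CPoint.liesOn_iff (a : CPoint) (i : Fin 2) (χ : Polynomial ℂ →+* ℂ)
    (ha : a.1 = Spec.map (CommRingCat.ofHom χ) ≫ lineChart i) {g : MvPolynomial (Fin 2) ℂ} {e : ℕ}
    (hg : g.IsHomogeneous e) (he : 0 < e) : a.LiesOn (zeroSet g) ↔ χ (dehom i g) = 0 := by
  rw [← forall_mem_zeroSet_iff i χ hg he, ← ha]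
  exact Set.eq_univ_iff_forall

lemma IsoOver.trans_symm {X Y Z S : Scheme.{0}} {f : X ⟶ S} {g : Y ⟶ S} {k : Z ⟶ S}
    (h : IsoOver f k) (h' : IsoOver g k) : IsoOver f g := by
  obtain ⟨e, rfl⟩ := h
  obtain ⟨e', rfl⟩ := h'
  exact ⟨e ≪≫ e'.symm, by simp⟩

lemma zeroSet_mul_ne_top (h₃ : F₃.IsHomogeneous 3) (h₆ : F₆.IsHomogeneous 6)
    (hF : Squarefree (F₃ * F₆)) : zeroSet (F₃ * F₆) ≠ ⊤ := by
  intro h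
  have h1 := preimage_zeroSet_lineChart 0 (h₃.mul h₆) (by norm_num)
  rw [h, map_mul] at h1
  have h2 : (⟨⊥, Ideal.isPrime_bot⟩ : PrimeSpectrum (Polynomial ℂ)) ∈
      PrimeSpectrum.zeroLocus {dehom 0 F₃ * dehom 0 F₆} := h1 ▸ Set.mem_univ _
  exact (squarefree_dehom_mul h₃ h₆ hF 0).ne_zero (Ideal.mem_bot.mp (Set.singleton_subset_iff.mp h2))

end

end PlaneSextic

/-! ### Assembly of the theorem -/

theorem proposition2p3 (F₃ F₆ : MvPolynomial (Fin 2) ℂ)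
    (h₃ : F₃.IsHomogeneous 3) (h₆ : F₆.IsHomogeneous 6) (hF : Squarefree (F₃ * F₆)) :
    IsDoubleCover (W.toR h₃ h₆) ((KHat F₃ F₆ : Set (R F₃ F₆)) ∪ EpHat F₃ F₆) ∧
    (∃! π : W h₃ h₆ ⟶ PP 1, ExtendsProjection h₃ h₆ π) ∧
    ∀ π : W h₃ h₆ ⟶ PP 1, ExtendsProjection h₃ h₆ π →
      IsEllipticFibration (W.toSpecC h₃ h₆) π ∧
      (∀ a : CPoint, Smooth (fiberAt π a) → IsEllipticCurveWithJ 0 (fiberAt π a)) ∧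
      IsIsotrivial π ∧
      discriminant π = zeroSet (F₃ * F₆) ∧
      (∀ a : CPoint, a.LiesOn (zeroSet F₃) → IsKodairaTypeIV (fiberAt π a)) ∧
      (∀ a : CPoint, a.LiesOn (zeroSet F₆) → IsKodairaTypeII (fiberAt π a)) := by
  obtain ⟨⟨𝔄⟩, hW, hR, hdc⟩ := exists_surfaceAtlas h₃ h₆ hF
  refine ⟨hdc, 𝔄.existsUnique_extendsProjection, fun π hπ ↦ ?_⟩
  rw [𝔄.extendsProjection_iff] at hπ
  have hsm (a : CPoint) (i χ) (ha : a.1 = Spec.map (CommRingCat.ofHom χ) ≫ lineChart i)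
      (h : χ (dehom i F₃) ≠ 0 ∧ χ (dehom i F₆) ≠ 0) : IsoOver (fiberAt π a)
        (planeCurve.toSpecC _ (isHomogeneous_weierstrass curveZero)) := by
    obtain ⟨y, hy⟩ := exists_isCubicCone_curveZero h.1 h.2
    exact 𝔄.isoOver_fiberAt hπ a i χ ha hy
  have hell (a : CPoint) (hs : Smooth (fiberAt π a)) : IsoOver (fiberAt π a)
      (planeCurve.toSpecC _ (isHomogeneous_weierstrass curveZero)) := by
    obtain ⟨i, χ, ha⟩ := exists_comp_lineChart_eq a.1
    exact hsm a i χ ha ((𝔄.smooth_fiber_iff hπ i χ ha).mp hs)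
  refine ⟨⟨hW, isProper_toSpecC hR, 𝔄.smooth, 𝔄.comp_toSpecC hπ, 𝔄.surjective hπ,
    zeroSet (F₃ * F₆), zeroSet_mul_ne_top h₃ h₆ hF, fun a ha ↦ ?_⟩, fun a hs ↦ ?_, fun a b hs hs' ↦ ?_,
    𝔄.discriminant_eq hπ, fun a ha ↦ ?_, fun a ha ↦ ?_⟩
  · obtain ⟨i, χ, hχ⟩ := exists_comp_lineChart_eq a.1
    rw [a.liesOn_iff i χ hχ (h₃.mul h₆) (by norm_num), map_mul, map_mul, mul_eq_zero, not_or] at ha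
    exact ⟨curveZero, inferInstance, hsm a i χ hχ ha⟩
  · exact ⟨curveZero, inferInstance, curveZero_j, hell a hs⟩
  · exact (hell a hs).trans_symm (hell b hs')
  · obtain ⟨i, χ, hχ⟩ := exists_comp_lineChart_eq a.1
    rw [a.liesOn_iff i χ hχ h₃ (by norm_num)] at ha
    -- At a zero of `f₃` the coefficient `f₆` is nonzero by coprimality, so the fiber is the cubic
    -- with `α = 0`, `β ≠ 0`. The other case is symmetric.
    have hb : χ (dehom i F₆) ≠ 0 := not_both_eq_zero (squarefree_dehom_mul h₃ h₆ hF i) χ ha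
    obtain ⟨y, hy⟩ := exists_isCubicCone_concurrentLines hb
    rw [← ha] at hy
    exact 𝔄.isoOver_fiberAt hπ a i χ hχ hy
  · obtain ⟨i, χ, hχ⟩ := exists_comp_lineChart_eq a.1
    rw [a.liesOn_iff i χ hχ h₆ (by norm_num)] at ha
    have hb : χ (dehom i F₃) ≠ 0 := fun h ↦
      not_both_eq_zero (squarefree_dehom_mul h₃ h₆ hF i) χ h ha
    obtain ⟨y, hy⟩ := exists_isCubicCone_cuspidalCubic hb
    rw [← ha] at hy
    exact 𝔄.isoOver_fiberAt hπ a i χ hχ hy
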